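/- Let $d\in\{2,3\}$, $k\ge 0$ an integer and $\gamma>0$. Then there is a constant $C>0$, depending only on $d$, $k$ and $\gamma$, such that the following holds. **Mesh.** Let $\Omega\subset\mathbb R^d$ be a polygonal ($d=2$) or polyhedral ($d=3$) domain with a partition $\mathcal T_h$ into finitely many closed polygons/polyhedra $T$ with connected, pairwise disjoint interiors, so that $\Omega$ is the interior of $\bigcup_{T\in\mathcal T_h} T$. Let $\mathcal E_h$ be the finite set of its edges/flat faces: each $e\in\mathcal E_h$ is contained in a hyperplane, different $e$ overlap only in sets of zero $(d-1)$-dimensional measure, the boundary $\partial T$ of each $T$ is the union of the $e\in\mathcal E_h$ with $e\subset\partial T$, and the outward unit normal $\mathbf n$ of $T$ is constant on each such $e$. Each $T$ is divided into finitely many closed simplices $T_i$ (triangles/tetrahedra) that meet face to face and induce a division of each $e\subset\partial T$ into $(d-1)$-simplices. With $h_T=\operatorname{diam} T$ and $h=\max_T h_T$, the mesh is shape regular in the sense that each $T_i\subset T$ contains a ball of radius $\gamma h_T$. **Method.** Let $P_m(S)$ be the space of restrictions to $S$ of polynomials of degree at most $m$, and $$V_h=\{v=\{v_0,v_b\}:\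 v_0|_T\in P_k(T),\ v_b|_e\in P_{k+1}(e),\ T\in\mathcal T_h,\ e\in\mathcal E_h\},\qquad V_h^0=\{v\in V_h:\ v_b|_e=0 \text{ for } e\subset\partial\Omega\},$$ $$\Lambda_k(T)=\{\mathbf q\in H(\mathrm{div};T):\ \mathbf q|_{T_i}\in[P_{k+1}(T_i)]^d,\ \nabla\cdot\mathbf q\in P_k(T),\ \mathbf q\cdot\mathbf n|_e\in P_{k+1}(e)\ \text{for } e\subset\partial T\}.$$ For $v\in V_h$ the weak gradient $\nabla_w v$ is given on each $T$ by $\nabla_w v|_T\in\Lambda_k(T)$ and $$(\nabla_w v,\mathbf q)_T=-(v_0,\nabla\cdot\mathbf q)_T+\langle v_b,\mathbf q\cdot\mathbf n\rangle_{\partial T}\qquad\forall\,\mathbf q\in\Lambda_k(T),$$ and $|||v|||=\big(\sum_{T}\|\nabla_w v\|_{L^2(T)}^2\big)^{1/2}$. Let $Q_hu=\{Q_0u,Q_bu\}$, where $Q_0$ is the $L^2$-projection onto $P_k(T)$ on each $T$ and $Q_b$ the $L^2$-projection of the trace onto $P_{k+1}(e)$ on each $e$. **Claim.** Let $f\in L^2(\Omega)$,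 let $u\in H_0^1(\Omega)\cap H^{k+3}(\Omega)$ be the weak solution of $-\Delta u=f$ in $\Omega$, $u=0$ on $\partial\Omega$, and let $u_h=\{u_0,u_b\}\in V_h^0$ satisfy $$\sum_{T}(\nabla_w u_h,\nabla_w v)_T=(f,v_0)\qquad\forall\, v=\{v_0,v_b\}\in V_h^0 .$$ Then $$|||Q_hu-u_h|||\le C\,h^{k+2}\,|u|_{k+3},$$ where $|u|_{k+3}=\big(\sum_{|\alpha|=k+3}\|\partial^\alpha u\|_{L^2(\Omega)}^2\big)^{1/2}$. -/

import Mathlib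

open MeasureTheory Filter Topology
open scoped ContDiff

noncomputable section

namespace SFWG

/-- The Euclidean space `ℝ^d`. -/
abbrev Space (d : ℕ) := EuclideanSpace ℝ (Fin d)

/-- Polynomials in `d` real variables. -/
abbrev Poly (d : ℕ) := MvPolynomial (Fin d) ℝ

/-- The value of a polynomial at a point. -/
def pval {d : ℕ} (p : Poly d) (x : Space d) : ℝ := MvPolynomial.eval (fun i => x i) p

/-! ### Sobolev spaces -/

/-- Classical partial derivative in the `i`-th coordinate direction. -/
def partialD {d : ℕ} (i : Fin d) (φ : Space d → ℝ) (x : Space d) : ℝ :=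
  fderiv ℝ φ x (EuclideanSpace.single i 1)

/-- `φ ∈ C_c^∞(U)`. -/
def IsTest {d : ℕ} (U : Set (Space d)) (φ : Space d → ℝ) : Prop :=
  ContDiff ℝ ∞ φ ∧ HasCompactSupport φ ∧ tsupport φ ⊆ U

/-- `g` is the weak partial derivative `∂_i u` in the open set `U`. -/
def HasWeakPartial {d : ℕ} (U : Set (Space d)) (i : Fin d) (u g : Space d → ℝ) : Prop :=
  ∀ φ, IsTest U φ → ∫ x in U, u x * partialD i φ x = -∫ x in U, g x * φ x

/-- `D α`, for the multi-indices `α` with `|α| ≤ m`, are the weak derivatives of `u` in `U`,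
and all of them are in `L²(U)`. -/
def HasWeakDerivs {d : ℕ} (U : Set (Space d)) (m : ℕ) (u : Space d → ℝ)
    (D : (Fin d → ℕ) → Space d → ℝ) : Prop :=
  D 0 =ᵐ[volume.restrict U] u ∧
  (∀ α, ∑ i, α i ≤ m → MemLp (D α) 2 (volume.restrict U)) ∧
  (∀ α, ∑ i, α i < m → ∀ i, HasWeakPartial U i (D α) (D (α + Pi.single i 1)))

/-- `u ∈ H^m(U)`. -/
def MemSobolev {d : ℕ} (U : Set (Space d)) (m : ℕ) (u : Space d → ℝ) : Prop :=
  ∃ D, HasWeakDerivs U m u D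

/-- The Sobolev semi-norm `|u|_{m,U} = (∑_{|α| = m} ‖∂^α u‖²_{L²(U)})^{1/2}` of `u ∈ H^m(U)`. -/
def sobolevSeminorm {d : ℕ} (U : Set (Space d)) (m : ℕ) (u : Space d → ℝ) : ℝ :=
  Real.sqrt (∑ α ∈ Finset.piAntidiag (Finset.univ : Finset (Fin d)) m,
    ∫ x in U, (Classical.epsilon (HasWeakDerivs U m u) α x) ^ 2)

/-- `φ n → u` and `∂_i (φ n) → G i` in `L²(U)`, that is, `φ n → u` in `H¹(U)` and `G = ∇u`. -/
def TendstoH1 {d : ℕ} (U : Set (Space d)) (φ : ℕ → Space d → ℝ) (u : Space d → ℝ)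
    (G : Fin d → Space d → ℝ) : Prop :=
  MemLp u 2 (volume.restrict U) ∧
  (∀ i, MemLp (G i) 2 (volume.restrict U)) ∧
  Tendsto (fun n => eLpNorm (fun x => φ n x - u x) 2 (volume.restrict U)) atTop (𝓝 0) ∧
  ∀ i, Tendsto (fun n => eLpNorm (fun x => partialD i (φ n) x - G i x) 2 (volume.restrict U))
    atTop (𝓝 0)

/-- `u` is the solution of `-Δu = f` in `Ω`, `u = 0` on `∂Ω`: it lies in `H¹₀(Ω)`, the closure of
`C_c^∞(Ω)` in `H¹(Ω)`, and `(∇u, ∇φ) = (f, φ)` for all `φ ∈ C_c^∞(Ω)`. -/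
def IsPoissonSolution {d : ℕ} (Ω : Set (Space d)) (f u : Space d → ℝ) : Prop :=
  ∃ G : Fin d → Space d → ℝ,
    (∃ φ : ℕ → Space d → ℝ, (∀ n, IsTest Ω (φ n)) ∧ TendstoH1 Ω φ u G) ∧
    ∀ φ, IsTest Ω φ → ∫ x in Ω, ∑ i, G i x * partialD i φ x = ∫ x in Ω, f x * φ x

/-- Surface measure: the `(d-1)`-dimensional Hausdorff measure, normalized so that it is
Lebesgue measure on hyperplanes. -/
def surf (d : ℕ) : Measure (Space d) := Measure.euclideanHausdorffMeasure (d - 1)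

/-- `g ∈ L²(e)` is the trace on `e` of `u ∈ H¹(Ω)`: the limit in `L²(e)` of the restrictions of
smooth functions that converge to `u` in `H¹(Ω)`. -/
def IsTrace {d : ℕ} (Ω : Set (Space d)) (u : Space d → ℝ) (e : Set (Space d))
    (g : Space d → ℝ) : Prop :=
  MemLp g 2 ((surf d).restrict e) ∧
  ∃ (φ : ℕ → Space d → ℝ) (G : Fin d → Space d → ℝ),
    (∀ n, ContDiff ℝ ∞ (φ n)) ∧ TendstoH1 Ω φ u G ∧
    Tendsto (fun n => eLpNorm (fun x => φ n x - g x) 2 ((surf d).restrict e)) atTop (𝓝 0)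

/-- The trace of `u` on `e`. -/
def trace {d : ℕ} (Ω : Set (Space d)) (u : Space d → ℝ) (e : Set (Space d)) : Space d → ℝ :=
  Classical.epsilon (IsTrace Ω u e)

/-- The outward unit normal of a simplex on its face opposite to the vertex `l`. -/
def outwardNormal {d : ℕ} (S : Affine.Simplex ℝ (Space d) d) (l : Fin (d + 1)) : Space d :=
  Classical.epsilon fun n : Space d => ‖n‖ = 1 ∧
    (∀ i j, i ≠ l → j ≠ l → inner ℝ n (S.points i - S.points j) = 0) ∧
    ∀ i, i ≠ l → inner ℝ n (S.points l - S.points i) < 0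

/-! ### Polytopal meshes -/

/-- The data of a polytopal mesh: `nT` elements, each given with its division into `nS T`
simplices, and `nE` faces. -/
structure Mesh (d : ℕ) where
  /-- number of elements -/
  nT : ℕ
  /-- number of edges / flat faces -/
  nE : ℕ
  /-- number of sub-simplices of an element -/
  nS : Fin nT → ℕ
  /-- the sub-simplices of an element -/
  sub : (T : Fin nT) → Fin (nS T) → Affine.Simplex ℝ (Space d) d
  /-- the edges / flat faces -/
  face : Fin nE → Set (Space d)

namespace Mesh

variable {d : ℕ} (M : Mesh d)

/-- The `i`-th closed sub-simplex of the element `T`. -/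
def cell (T : Fin M.nT) (i : Fin (M.nS T)) : Set (Space d) :=
  convexHull ℝ (Set.range (M.sub T i).points)

/-- The closed face opposite to the vertex `l` of the `i`-th sub-simplex of `T`. -/
def subface (T : Fin M.nT) (i : Fin (M.nS T)) (l : Fin (d + 1)) : Set (Space d) :=
  convexHull ℝ ((M.sub T i).points '' {l}ᶜ)

/-- The closed polytope `T`, the union of its sub-simplices. -/
def elt (T : Fin M.nT) : Set (Space d) := ⋃ i, M.cell T i

/-- `e ⊂ ∂T`. -/
def IsFaceOf (e : Fin M.nE) (T : Fin M.nT) : Prop := M.face e ⊆ frontier (M.elt T)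

/-- `M` is a polytopal mesh of the polytopal domain `Ω`. -/
structure IsMeshOf (Ω : Set (Space d)) : Prop where
  /-- the elements cover the domain -/
  domain_eq : interior (⋃ T, M.elt T) = Ω
  /-- different elements do not overlap -/
  disjoint_interior : ∀ T T', T ≠ T' → Disjoint (interior (M.elt T)) (interior (M.elt T'))
  nS_pos : ∀ T, 0 < M.nS T
  /-- the sub-simplices of an element are different from each other … -/
  sub_injective : ∀ T i j,
    Set.range (M.sub T i).points = Set.range (M.sub T j).points → i = j
  /-- … and meet face to face … -/
  sub_conforming : ∀ T i j, M.cell T i ∩ M.cell T j =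
    convexHull ℝ (Set.range (M.sub T i).points ∩ Set.range (M.sub T j).points)
  /-- … and the interior of the element is connected: one gets from any sub-simplex to any other
  through common `(d-1)`-faces. -/
  sub_connected : ∀ T i j,
    Relation.ReflTransGen (fun i j => ∃ l m, M.subface T i l = M.subface T j m) i j
  face_nonempty : ∀ e, (M.face e).Nonempty
  /-- faces are flat -/
  face_flat : ∀ e, ∃ (n : Space d) (c : ℝ), ‖n‖ = 1 ∧ ∀ x ∈ M.face e, inner ℝ n x = c
  /-- different faces do not overlap -/
  face_inter : ∀ e e', e ≠ e' → surf d (M.face e ∩ M.face e') = 0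
  /-- every face is a face of some element -/
  exists_isFaceOf : ∀ e, ∃ T, M.IsFaceOf e T
  /-- the division of `T` induces a division of each face of `T` -/
  face_eq : ∀ T e, M.IsFaceOf e T →
    M.face e = ⋃ (i) (l) (_ : M.subface T i l ⊆ M.face e), M.subface T i l
  /-- `∂T` is the union of the faces of `T` -/
  subface_subset : ∀ T i l, M.subface T i l ⊆ frontier (M.elt T) →
    ∃ e, M.IsFaceOf e T ∧ M.subface T i l ⊆ M.face e
  /-- the outward normal of `T` is constant on each face of `T` -/
  face_normal : ∀ T e, M.IsFaceOf e T →
    ∃ n, ∀ i l, M.subface T i l ⊆ M.face e → outwardNormal (M.sub T i) l = n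

/-- Shape regularity with parameter `γ`: each sub-simplex of each element `T` contains a ball of
radius `γ h_T`. -/
def ShapeRegular (γ : ℝ) : Prop :=
  ∀ T i, ∃ c, Metric.closedBall c (γ * Metric.diam (M.elt T)) ⊆ M.cell T i

/-- The mesh size `h = max_T h_T`. -/
def meshSize : ℝ := ⨆ T, Metric.diam (M.elt T)

/-! ### The weak Galerkin method -/

/-- Pairs `v = {v₀, v_b}`: a polynomial `v₀` on each element and a polynomial `v_b` on each face.
Of the second, only its restriction to the face is ever used. -/
abbrev WGFun := (Fin M.nT → Poly d) × (Fin M.nE → Poly d)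

/-- `v ∈ V_h`. -/
def MemVh (k : ℕ) (v : M.WGFun) : Prop :=
  (∀ T, (v.1 T).totalDegree ≤ k) ∧ ∀ e, (v.2 e).totalDegree ≤ k + 1

/-- `v ∈ V_h⁰`. -/
def MemVh0 (Ω : Set (Space d)) (k : ℕ) (v : M.WGFun) : Prop :=
  M.MemVh k v ∧ ∀ e, M.face e ⊆ frontier Ω → ∀ x ∈ M.face e, pval (v.2 e) x = 0

/-- Vector fields on `T` that are polynomial on each sub-simplex of `T`. -/
abbrev PwField (T : Fin M.nT) := Fin (M.nS T) → Fin d → Poly d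

/-- The normal component on the face opposite to the vertex `l` of the `i`-th sub-simplex. -/
def normalComp {T : Fin M.nT} (q : M.PwField T) (i : Fin (M.nS T)) (l : Fin (d + 1))
    (x : Space d) : ℝ :=
  ∑ j, pval (q i j) x * outwardNormal (M.sub T i) l j

/-- `(p, q)_T`. -/
def innerT {T : Fin M.nT} (p q : M.PwField T) : ℝ :=
  ∑ i, ∫ x in M.cell T i, ∑ j, pval (p i j) x * pval (q i j) x

/-- `q ∈ Λ_k(T)`: `q` is polynomial of degree `≤ k + 1` on each sub-simplex, its weak divergence
in the interior of `T` is one polynomial of degree `≤ k`, and on each face of `T` its normal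
component is one polynomial of degree `≤ k + 1`. -/
def MemLambda (k : ℕ) (T : Fin M.nT) (q : M.PwField T) : Prop :=
  (∀ i j, (q i j).totalDegree ≤ k + 1) ∧
  (∃ p : Poly d, p.totalDegree ≤ k ∧ ∀ φ, IsTest (interior (M.elt T)) φ →
    ∑ i, ∫ x in M.cell T i, ∑ j, pval (q i j) x * partialD j φ x =
      -∫ x in M.elt T, pval p x * φ x) ∧
  ∀ e, M.IsFaceOf e T → ∃ r : Poly d, r.totalDegree ≤ k + 1 ∧
    ∀ i l, M.subface T i l ⊆ M.face e → ∀ x ∈ M.subface T i l, M.normalComp q i l x = pval r x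

open scoped Classical in
/-- `⟨v_b, q · n⟩_{∂T}`, where `∂T` consists of the faces of `T` and these of faces of
sub-simplices. -/
def boundaryT (v : M.WGFun) {T : Fin M.nT} (q : M.PwField T) : ℝ :=
  ∑ e with M.IsFaceOf e T, ∑ i, ∑ l with M.subface T i l ⊆ M.face e,
    ∫ x in M.subface T i l, pval (v.2 e) x * M.normalComp q i l x ∂(surf d)

/-- `g` is the weak gradient of `v` on `T`. -/
def IsWeakGrad (k : ℕ) (v : M.WGFun) (T : Fin M.nT) (g : M.PwField T) : Prop :=
  M.MemLambda k T g ∧ ∀ q, M.MemLambda k T q →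
    M.innerT g q =
      -(∑ i, ∫ x in M.cell T i, pval (v.1 T) x * pval (∑ j, MvPolynomial.pderiv j (q i j)) x) +
        M.boundaryT v q

/-- The weak gradient `∇_w v` on `T`. -/
def weakGrad (k : ℕ) (v : M.WGFun) (T : Fin M.nT) : M.PwField T :=
  Classical.epsilon (M.IsWeakGrad k v T)

/-- `u_h` is a solution of the stabilizer-free weak Galerkin scheme. -/
def IsWGSolution (Ω : Set (Space d)) (k : ℕ) (f : Space d → ℝ) (uh : M.WGFun) : Prop :=
  M.MemVh0 Ω k uh ∧ ∀ v, M.MemVh0 Ω k v →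
    ∑ T, M.innerT (M.weakGrad k uh T) (M.weakGrad k v T) =
      ∑ T, ∫ x in M.elt T, f x * pval (v.1 T) x

/-- `p` is the `L²(s, μ)`-projection of `w` onto the polynomials of degree `≤ m`. -/
def IsL2Proj (μ : Measure (Space d)) (s : Set (Space d)) (m : ℕ) (w : Space d → ℝ)
    (p : Poly d) : Prop :=
  p.totalDegree ≤ m ∧ ∀ r : Poly d, r.totalDegree ≤ m →
    ∫ x in s, pval p x * pval r x ∂μ = ∫ x in s, w x * pval r x ∂μ

/-- `Q_h u = {Q_0 u, Q_b u}`. -/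
def Qh (Ω : Set (Space d)) (k : ℕ) (u : Space d → ℝ) : M.WGFun :=
  (fun T => Classical.epsilon (IsL2Proj volume (M.elt T) k u),
   fun e => Classical.epsilon (IsL2Proj (surf d) (M.face e) (k + 1) (trace Ω u (M.face e))))

/-- The energy norm `|||v||| = (∇_w v, ∇_w v)^{1/2}`. -/
def energyNorm (k : ℕ) (v : M.WGFun) : ℝ :=
  Real.sqrt (∑ T, M.innerT (M.weakGrad k v T) (M.weakGrad k v T))

end Mesh

end SFWG

end

/-! Put `E = Q_h u - u_h`, an element of `V_h^0`. The degrees in `Λ_k(T)` match those of `Q_0` and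
`Q_b`, so integration by parts shows that `∇_w (Q_h u)` is the `L²`-projection of `∇u` onto `Λ_k(T)`
(`weakRhs_Qh`). The second ingredient is a field `σ` with `σ|_T ∈ Λ_k(T)` whose divergence is `Q_0
(Δu)`, whose normal component on each face is the projection of the flux `∂u/∂n`, and for which `‖∇u
- σ‖_T ≤ C h_T^(k+2) |u|_{k+3,T}` (`exists_sigma`). Then `(f, E_0) = -(div σ, E_0) = Σ_T ((σ, ∇_w
E)_T - ⟨E_b, σ·n⟩_{∂T})`, and the boundary terms sum to zero: the fluxes of `∇u` from the two sides
of an inner face are opposite, and `E_b = 0` on `∂Ω`. The scheme now gives `Σ (∇_w u_h, ∇_w E)_T = Σ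
(σ, ∇_w E)_T`, hence `|||E|||² = Σ (∇u - σ, ∇_w E)_T`, and Young's inequality finishes the proof
(`exists_energy_bound`).

The field is `σ = ∇q + τ`. Here `q` is a polynomial of degree `k + 2` close to `u` with all its
derivatives (`exists_bramble_hilbert`), and `τ` lifts the projected Laplacian and fluxes of `u - q`
with `‖τ‖² ≤ C (h ‖flux‖²_{∂T} + h² ‖div‖²_T)` (`exists_element_lift`). On one simplex such liftings
are combinations of the fields `(p_a - p_b) λ^α`, which are tangential to all faces but two
(`exists_simplex_lift`); their bounds are uniform because norms of polynomials in barycentric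
coordinates can be compared on a single reference simplex (`exists_coeff_sq_le`). On an element each
simplex must satisfy its own compatibility condition. This is arranged by constant fluxes through
the inner sides, found as a flow on the connected adjacency graph of the simplices
(`exists_unit_flow`).

Elements need not be convex. Shape regularity bounds the number of simplices in an element, so only
finitely many adjacency graphs occur. The Poincaré inequality on an element follows from the one on
its simplices by comparing means through common faces (`exists_poincare`), and its iteration gives
the polynomial approximation.

Traces of derivatives of `u` are constructed on each simplex, from the density of smooth functions
in `H¹` of a convex body (`exists_tendstoH1_of_convex`) and a trace inequality obtained by viewing
the simplex as a cone over a face (`lintegral_body_eq_cone`). That traces or fluxes from both sides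
of a face fit together is read off from the vanishing of a surface distribution
(`ae_sum_indicator_eq_zero`). -/

noncomputable section

namespace SFWG

/-! ### Convergence in `L²` -/

section L2

variable {α : Type*} [MeasurableSpace α] {μ : Measure α}

lemma eLpNorm_two_eq {f : α → ℝ} (hf : MemLp f 2 μ) :
    eLpNorm f 2 μ = ENNReal.ofReal (Real.sqrt (∫ x, f x ^ 2 ∂μ)) := by
  rw [hf.eLpNorm_eq_integral_rpow_norm two_ne_zero ENNReal.ofNat_ne_top, Real.sqrt_eq_rpow]
  simp

lemma integrable_mul_of_memLp {f g : α → ℝ} (hf : MemLp f 2 μ) (hg : MemLp g 2 μ) :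
    Integrable (fun x => f x * g x) μ := hf.integrable_mul hg

/-- The definitions measure convergence by `eLpNorm`, the estimates below by integrals of squares;
this passes between the two. -/
lemma tendsto_eLpNorm_zero_iff {f : ℕ → α → ℝ} (hf : ∀ n, MemLp (f n) 2 μ) :
    Tendsto (fun n => eLpNorm (f n) 2 μ) atTop (𝓝 0) ↔
      Tendsto (fun n => ∫ x, f n x ^ 2 ∂μ) atTop (𝓝 0) := by
  have h0 : ∀ n, 0 ≤ ∫ x, f n x ^ 2 ∂μ := fun n => integral_nonneg fun x => sq_nonneg _
  constructor
  · intro h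
    have h1 : Tendsto (fun n => (eLpNorm (f n) 2 μ).toReal ^ 2) atTop (𝓝 0) := by
      have := ((ENNReal.tendsto_toReal ENNReal.zero_ne_top).comp h).pow 2
      simpa using this
    refine h1.congr fun n => ?_
    rw [eLpNorm_two_eq (hf n), ENNReal.toReal_ofReal (Real.sqrt_nonneg _), Real.sq_sqrt (h0 n)]
  · intro h
    have h1 := (ENNReal.continuous_ofReal.tendsto _).comp
      ((Real.continuous_sqrt.tendsto _).comp h)
    simp only [Real.sqrt_zero, ENNReal.ofReal_zero] at h1
    refine h1.congr fun n => ?_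
    simp [eLpNorm_two_eq (hf n)]

lemma abs_integral_mul_le {f g : α → ℝ} (hf : MemLp f 2 μ) (hg : MemLp g 2 μ) :
    |∫ x, f x * g x ∂μ| ≤ Real.sqrt (∫ x, f x ^ 2 ∂μ) * Real.sqrt (∫ x, g x ^ 2 ∂μ) := by
  have h := integral_mul_norm_le_Lp_mul_Lq (μ := μ) (f := f) (g := g)
    (p := 2) (q := 2) Real.HolderConjugate.two_two (by simpa using hf) (by simpa using hg)
  simp only [Real.norm_eq_abs, ← Real.sqrt_eq_rpow, Real.rpow_two, sq_abs] at h
  calc |∫ x, f x * g x ∂μ| ≤ ∫ x, |f x * g x| ∂μ := abs_integral_le_integral_abs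
    _ = ∫ x, |f x| * |g x| ∂μ := by simp only [abs_mul]
    _ ≤ _ := h

lemma sq_integral_mul_le {f g : α → ℝ} (hf : MemLp f 2 μ) (hg : MemLp g 2 μ) :
    (∫ x, f x * g x ∂μ) ^ 2 ≤ (∫ x, f x ^ 2 ∂μ) * (∫ x, g x ^ 2 ∂μ) := by
  have h := abs_integral_mul_le hf hg
  have h2 := pow_le_pow_left₀ (abs_nonneg _) h 2
  rwa [sq_abs, mul_pow, Real.sq_sqrt (integral_nonneg fun x => sq_nonneg _),
    Real.sq_sqrt (integral_nonneg fun x => sq_nonneg _)] at h2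

lemma integral_add_sq_le {f g : α → ℝ} (hf : MemLp f 2 μ) (hg : MemLp g 2 μ) :
    ∫ x, (f x + g x) ^ 2 ∂μ ≤ 2 * (∫ x, f x ^ 2 ∂μ) + 2 * ∫ x, g x ^ 2 ∂μ := by
  rw [← integral_const_mul, ← integral_const_mul, ← integral_add
    (hf.integrable_sq.const_mul _) (hg.integrable_sq.const_mul _)]
  refine integral_mono (hf.add hg).integrable_sq
    ((hf.integrable_sq.const_mul _).add (hg.integrable_sq.const_mul _)) fun x => ?_
  simp only
  nlinarith [sq_nonneg (f x - g x)]

lemma tendsto_integral_mul {φ ψ : ℕ → α → ℝ} {w z : α → ℝ} (hφ : ∀ n, MemLp (φ n) 2 μ)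
    (hψ : ∀ n, MemLp (ψ n) 2 μ) (hw : MemLp w 2 μ) (hz : MemLp z 2 μ)
    (h1 : Tendsto (fun n => ∫ x, (φ n x - w x) ^ 2 ∂μ) atTop (𝓝 0))
    (h2 : Tendsto (fun n => ∫ x, (ψ n x - z x) ^ 2 ∂μ) atTop (𝓝 0)) :
    Tendsto (fun n => ∫ x, φ n x * ψ n x ∂μ) atTop (𝓝 (∫ x, w x * z x ∂μ)) := by
  have hφw : ∀ n, MemLp (fun x => φ n x - w x) 2 μ := fun n => (hφ n).sub hw
  have hψz : ∀ n, MemLp (fun x => ψ n x - z x) 2 μ := fun n => (hψ n).sub hz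
  rw [tendsto_iff_norm_sub_tendsto_zero]
  have hb : ∀ n, ‖(∫ x, φ n x * ψ n x ∂μ) - ∫ x, w x * z x ∂μ‖ ≤
      Real.sqrt (∫ x, (φ n x - w x) ^ 2 ∂μ) * Real.sqrt (∫ x, (ψ n x - z x) ^ 2 ∂μ) +
      Real.sqrt (∫ x, (φ n x - w x) ^ 2 ∂μ) * Real.sqrt (∫ x, z x ^ 2 ∂μ) +
      Real.sqrt (∫ x, w x ^ 2 ∂μ) * Real.sqrt (∫ x, (ψ n x - z x) ^ 2 ∂μ) := by
    intro n
    -- The product of the two errors is split off, so that no uniform bound on the norms of `φ n`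
    -- and `ψ n` is needed.
    have e : (∫ x, φ n x * ψ n x ∂μ) - ∫ x, w x * z x ∂μ =
        (∫ x, (φ n x - w x) * (ψ n x - z x) ∂μ) + (∫ x, (φ n x - w x) * z x ∂μ) +
          ∫ x, w x * (ψ n x - z x) ∂μ := by
      have i1 : Integrable (fun x => (φ n x - w x) * (ψ n x - z x) + (φ n x - w x) * z x) μ :=
        (integrable_mul_of_memLp (hφw n) (hψz n)).add (integrable_mul_of_memLp (hφw n) hz)
      rw [← integral_add (integrable_mul_of_memLp (hφw n) (hψz n))
        (integrable_mul_of_memLp (hφw n) hz), ← integral_add i1 (integrable_mul_of_memLp hw (hψz n)),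
        ← integral_sub (integrable_mul_of_memLp (hφ n) (hψ n)) (integrable_mul_of_memLp hw hz)]
      congr 1
      ext x
      ring
    rw [e, Real.norm_eq_abs]
    refine (abs_add_three _ _ _).trans ?_
    gcongr
    · exact abs_integral_mul_le (hφw n) (hψz n)
    · exact abs_integral_mul_le (hφw n) hz
    · exact abs_integral_mul_le hw (hψz n)
  refine squeeze_zero (fun n => norm_nonneg _) hb ?_
  have s1 := (Real.continuous_sqrt.tendsto _).comp h1
  have s2 := (Real.continuous_sqrt.tendsto _).comp h2
  simp only [Real.sqrt_zero] at s1 s2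
  have := ((s1.mul s2).add (s1.mul_const (Real.sqrt (∫ x, z x ^ 2 ∂μ)))).add
    (s2.const_mul (Real.sqrt (∫ x, w x ^ 2 ∂μ)))
  simpa using this

lemma tendsto_integral_mul_const {φ : ℕ → α → ℝ} {w z : α → ℝ} (hφ : ∀ n, MemLp (φ n) 2 μ)
    (hw : MemLp w 2 μ) (hz : MemLp z 2 μ)
    (h1 : Tendsto (fun n => ∫ x, (φ n x - w x) ^ 2 ∂μ) atTop (𝓝 0)) :
    Tendsto (fun n => ∫ x, φ n x * z x ∂μ) atTop (𝓝 (∫ x, w x * z x ∂μ)) :=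
  tendsto_integral_mul hφ (fun _ => hz) hw hz h1 (by simp)

lemma tendsto_integral_sq {φ : ℕ → α → ℝ} {w : α → ℝ} (hφ : ∀ n, MemLp (φ n) 2 μ)
    (hw : MemLp w 2 μ)
    (h1 : Tendsto (fun n => ∫ x, (φ n x - w x) ^ 2 ∂μ) atTop (𝓝 0)) :
    Tendsto (fun n => ∫ x, φ n x ^ 2 ∂μ) atTop (𝓝 (∫ x, w x ^ 2 ∂μ)) := by
  simpa only [sq] using tendsto_integral_mul hφ hφ hw hw h1 h1

/-- A Cauchy sequence in `L²` has a limit. -/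
lemma exists_tendsto_integral_sq {φ : ℕ → α → ℝ} (hφ : ∀ n, MemLp (φ n) 2 μ)
    (h : Tendsto (fun p : ℕ × ℕ => ∫ x, (φ p.1 x - φ p.2 x) ^ 2 ∂μ) atTop (𝓝 0)) :
    ∃ g : α → ℝ, MemLp g 2 μ ∧
      Tendsto (fun n => ∫ x, (φ n x - g x) ^ 2 ∂μ) atTop (𝓝 0) := by
  have hc : CauchySeq fun n => (hφ n).toLp (φ n) := by
    rw [cauchySeq_iff_tendsto_dist_atTop_0]
    have h1 := (Real.continuous_sqrt.tendsto _).comp h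
    simp only [Real.sqrt_zero] at h1
    refine h1.congr fun p => ?_
    have hm : MemLp (fun x => φ p.1 x - φ p.2 x) 2 μ := (hφ p.1).sub (hφ p.2)
    rw [dist_eq_norm, ← MemLp.toLp_sub, Lp.norm_toLp]
    change _ = (eLpNorm (fun x => φ p.1 x - φ p.2 x) 2 μ).toReal
    rw [eLpNorm_two_eq hm, ENNReal.toReal_ofReal (Real.sqrt_nonneg _)]
    rfl
  obtain ⟨g, hg⟩ := cauchySeq_tendsto_of_complete hc
  refine ⟨g, Lp.memLp g, ?_⟩
  have hm : ∀ n, MemLp (fun x => φ n x - g x) 2 μ := fun n => (hφ n).sub (Lp.memLp g)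
  rw [← tendsto_eLpNorm_zero_iff hm]
  rw [Lp.tendsto_Lp_iff_tendsto_eLpNorm'] at hg
  refine hg.congr fun n => eLpNorm_congr_ae ?_
  filter_upwards [(hφ n).coeFn_toLp] with x hx
  simp [hx]

end L2

/-! ### Representation of functionals by a semidefinite form -/

/-- The form may be degenerate, as it is for polynomials restricted to a face. The range of the dual
map of `B` is the annihilator of the kernel of `B`, which is where `ℓ` lies; reflexivity in finite
dimension turns the bidual element into a vector. -/
lemma exists_representative {V : Type*} [AddCommGroup V] [Module ℝ V] [FiniteDimensional ℝ V]
    (B : V →ₗ[ℝ] V →ₗ[ℝ] ℝ) (hsymm : ∀ v w, B v w = B w v) (ℓ : V →ₗ[ℝ] ℝ)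
    (hℓ : ∀ v, (∀ w, B v w = 0) → ℓ v = 0) : ∃ g, ∀ v, B g v = ℓ v := by
  have h1 : ℓ ∈ LinearMap.range (LinearMap.dualMap B) := by
    rw [LinearMap.range_dualMap_eq_dualAnnihilator_ker, Submodule.mem_dualAnnihilator]
    intro v hv
    refine hℓ v fun w => ?_
    rw [LinearMap.mem_ker.1 hv]
    rfl
  obtain ⟨F, hF⟩ := h1
  obtain ⟨g, rfl⟩ := (Module.evalEquiv ℝ V).surjective F
  refine ⟨g, fun v => ?_⟩
  rw [← hF]
  simp [hsymm g v]

/-! ### Affine contractions -/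

/-- Change of variables with Jacobian `t⁻ᵈ`. It is only an inequality, since the contraction maps
`K` into, not onto, itself. For `t ≥ 1/2` the factor is at most `2 ^ d`, which is how it enters both
the smoothing and the Poincaré inequality. -/
lemma setLIntegral_comp_affine_le {d : ℕ} {K : Set (Space d)} (hK : MeasurableSet K)
    {t : ℝ} (ht : 0 < t) {b : Space d} (hb : ∀ x ∈ K, t • x + b ∈ K)
    {f : Space d → ENNReal} (hf : Measurable f) :
    ∫⁻ x in K, f (t • x + b) ≤ ENNReal.ofReal ((t ^ d)⁻¹) * ∫⁻ x in K, f x := by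
  have hmap : Measure.map (fun x : Space d => t • x + b) volume =
      ENNReal.ofReal ((t ^ d)⁻¹) • volume := by
    have h1 := Measure.map_addHaar_smul (volume : Measure (Space d)) ht.ne'
    rw [finrank_euclideanSpace_fin, abs_of_pos (by positivity)] at h1
    have h2 : (fun x : Space d => t • x + b) = (fun y => y + b) ∘ (fun x => t • x) := rfl
    rw [h2, ← Measure.map_map (by fun_prop) (by fun_prop), h1, Measure.map_smul,
      map_add_right_eq_self]
  have hm : Measurable fun x : Space d => t • x + b := by fun_prop
  calc ∫⁻ x in K, f (t • x + b)
      = ∫⁻ x in K, K.indicator f (t • x + b) := by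
        refine setLIntegral_congr_fun hK fun x hx => ?_
        simp [hb x hx]
    _ ≤ ∫⁻ x, K.indicator f (t • x + b) := setLIntegral_le_lintegral _ _
    _ = ∫⁻ y, K.indicator f y ∂(Measure.map (fun x : Space d => t • x + b) volume) :=
        (lintegral_map (hf.indicator hK) hm).symm
    _ = _ := by rw [hmap, lintegral_smul_measure, lintegral_indicator hK, smul_eq_mul]

end SFWG

end

noncomputable section

namespace SFWG

/-! ### Smooth functions are dense in `H¹` of a convex body -/

section Density

variable {d : ℕ}

/-- The smoothed function `x ↦ (f ⋆ ρ) ((1 - s) x + s c)`. -/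
def smoothed (ρ : Space d → ℝ) (s : ℝ) (c : Space d) (f : Space d → ℝ) (x : Space d) : ℝ :=
  convolution f ρ (ContinuousLinearMap.lsmul ℝ ℝ) volume ((1 - s) • x + s • c)

lemma contDiff_smoothed {ρ : Space d → ℝ} (hρ : ContDiff ℝ ∞ ρ) (hc : HasCompactSupport ρ)
    (s : ℝ) (c : Space d) {f : Space d → ℝ} (hf : LocallyIntegrable f) :
    ContDiff ℝ ∞ (smoothed ρ s c f) := by
  have h1 : ContDiff ℝ ∞ (convolution f ρ (ContinuousLinearMap.lsmul ℝ ℝ) volume) :=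
    hc.contDiff_convolution_right _ hf hρ
  exact h1.comp (by fun_prop : ContDiff ℝ ∞ fun x : Space d => (1 - s) • x + s • c)

lemma partialD_comp_affine {F : Space d → ℝ} (s : ℝ) (b : Space d) (i : Fin d) (x : Space d)
    (hF : DifferentiableAt ℝ F (s • x + b)) :
    partialD i (fun x => F (s • x + b)) x = s * partialD i F (s • x + b) := by
  have h2 : HasFDerivAt (fun x : Space d => s • x + b)
      (s • ContinuousLinearMap.id ℝ (Space d)) x :=
    ((hasFDerivAt_id x).const_smul s).add_const _
  have h3 : HasFDerivAt (fun x => F (s • x + b)) _ x := hF.hasFDerivAt.comp x h2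
  rw [partialD, h3.fderiv]
  simp [partialD]

lemma fderiv_convolution_apply {E : Type*} [NormedAddCommGroup E] [NormedSpace ℝ E]
    [MeasurableSpace E] [BorelSpace E] {μ : Measure E} [SFinite μ] [μ.IsAddLeftInvariant]
    [μ.IsNegInvariant] {ρ : E → ℝ} (hρ : ContDiff ℝ 1 ρ)
    (hc : HasCompactSupport ρ) {f : E → ℝ} (hf : LocallyIntegrable f μ) (x v : E) :
    fderiv ℝ (convolution f ρ (ContinuousLinearMap.lsmul ℝ ℝ) μ) x v =
      ∫ t, f t * fderiv ℝ ρ (x - t) v ∂μ := by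
  have h1 := hc.hasFDerivAt_convolution_right (ContinuousLinearMap.lsmul ℝ ℝ) hf hρ x
  rw [h1.fderiv, convolution_precompR_apply (ContinuousLinearMap.lsmul ℝ ℝ) hf (hc.fderiv ℝ)
    (hρ.continuous_fderiv one_ne_zero)]
  rfl

lemma partialD_convolution {ρ : Space d → ℝ} (hρ : ContDiff ℝ ∞ ρ) (hc : HasCompactSupport ρ)
    {f : Space d → ℝ} (hf : LocallyIntegrable f) (i : Fin d) (x : Space d) :
    partialD i (convolution f ρ (ContinuousLinearMap.lsmul ℝ ℝ) volume) x =
      ∫ t, f t * fderiv ℝ ρ (x - t) (EuclideanSpace.single i 1) :=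
  fderiv_convolution_apply (hρ.of_le (by exact_mod_cast le_top)) hc hf x _

lemma partialD_smoothed {ρ : Space d → ℝ} (hρ : ContDiff ℝ ∞ ρ) (hc : HasCompactSupport ρ)
    (s : ℝ) (c : Space d) {f : Space d → ℝ} (hf : LocallyIntegrable f) (i : Fin d)
    (x : Space d) :
    partialD i (smoothed ρ s c f) x = (1 - s) *
      ∫ t, f t * fderiv ℝ ρ ((1 - s) • x + s • c - t) (EuclideanSpace.single i 1) := by
  have h1 : ContDiff ℝ ∞ (convolution f ρ (ContinuousLinearMap.lsmul ℝ ℝ) volume) :=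
    hc.contDiff_convolution_right _ hf hρ
  rw [← partialD_convolution hρ hc hf]
  exact partialD_comp_affine (1 - s) (s • c) i x ((h1.differentiable (by simp)) _)

/-- Jensen's inequality for the probability measure with density `ρ`. -/
lemma enorm_sq_integral_mul_le {ρ : Space d → ℝ} (hρ0 : ∀ z, 0 ≤ ρ z) (hρ : Continuous ρ)
    (hρ1 : ∫ z, ρ z = 1) (hint : Integrable ρ) {g : Space d → ℝ} (hg : Measurable g) :
    ‖∫ z, ρ z * g z‖ₑ ^ 2 ≤ ∫⁻ z, ENNReal.ofReal (ρ z) * ‖g z‖ₑ ^ 2 := by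
  set ν : Measure (Space d) := volume.withDensity fun z => ENNReal.ofReal (ρ z) with hν
  have hm : Measurable fun z => ENNReal.ofReal (ρ z) := by fun_prop
  have h1 : ‖∫ z, ρ z * g z‖ₑ ≤ ∫⁻ z, ‖g z‖ₑ ∂ν := by
    refine (enorm_integral_le_lintegral_enorm _).trans_eq ?_
    rw [hν, lintegral_withDensity_eq_lintegral_mul _ hm (by fun_prop)]
    refine lintegral_congr fun z => ?_
    simp only [Pi.mul_apply, enorm_mul]
    rw [Real.enorm_of_nonneg (hρ0 z)]
  have h2 : ν Set.univ = 1 := by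
    rw [hν, withDensity_apply _ MeasurableSet.univ, Measure.restrict_univ,
      ← ofReal_integral_eq_lintegral_ofReal hint (Eventually.of_forall hρ0), hρ1,
      ENNReal.ofReal_one]
  have h3 : ∫⁻ z, ‖g z‖ₑ ∂ν ≤ (∫⁻ z, ‖g z‖ₑ ^ (2 : ℝ) ∂ν) ^ (1 / 2 : ℝ) := by
    have := ENNReal.lintegral_mul_le_Lp_mul_Lq ν Real.HolderConjugate.two_two
      (f := fun z => ‖g z‖ₑ) (g := fun _ => 1) (by fun_prop) (by fun_prop)
    simpa [h2] using this
  calc ‖∫ z, ρ z * g z‖ₑ ^ 2 ≤ ((∫⁻ z, ‖g z‖ₑ ^ (2 : ℝ) ∂ν) ^ (1 / 2 : ℝ)) ^ 2 := by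
        gcongr; exact h1.trans h3
    _ = ∫⁻ z, ‖g z‖ₑ ^ (2 : ℝ) ∂ν := by
        rw [← ENNReal.rpow_natCast, ← ENNReal.rpow_mul]; simp
    _ = _ := by
        rw [hν, lintegral_withDensity_eq_lintegral_mul _ hm (by fun_prop)]
        simp

lemma enorm_sub_sq_le_three (a b p q : ℝ) :
    ‖a - b‖ₑ ^ 2 ≤ 3 * (‖a - p‖ₑ ^ 2 + ‖p - q‖ₑ ^ 2 + ‖b - q‖ₑ ^ 2) := by
  have h3 : (3 : ENNReal) = ENNReal.ofReal 3 := by simp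
  simp only [← ofReal_norm, Real.norm_eq_abs]
  rw [← ENNReal.ofReal_pow (abs_nonneg _), ← ENNReal.ofReal_pow (abs_nonneg _),
    ← ENNReal.ofReal_pow (abs_nonneg _), ← ENNReal.ofReal_pow (abs_nonneg _),
    ← ENNReal.ofReal_add (by positivity) (by positivity),
    ← ENNReal.ofReal_add (by positivity) (by positivity), h3,
    ← ENNReal.ofReal_mul (by norm_num)]
  refine ENNReal.ofReal_le_ofReal ?_
  simp only [sq_abs]
  nlinarith [sq_nonneg (a - p - (p - q)), sq_nonneg (p - q - (q - b)), sq_nonneg (a - p - (q - b))]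

/-- Smoothing with parameter `s → 0` converges in `L²(K)`. -/
lemma lintegral_smoothed_sub_le {K : Set (Space d)} (hK : IsCompact K) (hconv : Convex ℝ K)
    {c : Space d} {r : ℝ} (hr : 0 < r) (hc : Metric.closedBall c r ⊆ K)
    {f : Space d → ℝ} (hf : Measurable f) (hfL : MemLp f 2 (volume.restrict K))
    (hint : LocallyIntegrable f) {ε : ℝ} (hε : 0 < ε) :
    ∃ s₀ > 0, ∀ s, 0 < s → s < s₀ → ∀ ρ : Space d → ℝ, (∀ z, 0 ≤ ρ z) → Continuous ρ →
      HasCompactSupport ρ → ∫ z, ρ z = 1 → (∀ z, ρ z ≠ 0 → ‖z‖ ≤ s * r) →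
      ∫⁻ x in K, ‖smoothed ρ s c f x - f x‖ₑ ^ 2 ≤ ENNReal.ofReal ε := by
  have hKm := hK.measurableSet
  have hKfin : volume K < ⊤ := hK.measure_lt_top
  set V : ℝ := (volume K).toReal with hV
  have hV0 : 0 ≤ V := ENNReal.toReal_nonneg
  -- The constants make `3 * (2 ^ d * ε₁ + ε₂ * V + ε₁) ≤ ε`, the bound reached at the end; `V + 1`
  -- replaces `V` to avoid a division by zero.
  set A : ℝ := 2 ^ d + 1 with hA
  have hA0 : 0 < A := by positivity
  set ε₁ : ℝ := ε / (6 * A) with hε₁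
  have hε₁0 : 0 < ε₁ := by positivity
  set ε₂ : ℝ := ε / (6 * (V + 1)) with hε₂
  have hε₂0 : 0 < ε₂ := by positivity
  obtain ⟨g, hgc, hgd, hg⟩ := hfL.exist_eLpNorm_sub_le (by simp) (by norm_num)
    (Real.sqrt_pos.2 hε₁0)
  have hgcont : Continuous g := hgd.continuous
  have hgK : ∫⁻ x in K, ‖f x - g x‖ₑ ^ 2 ≤ ENNReal.ofReal ε₁ := by
    have h := pow_le_pow_left₀ (zero_le) hg 2
    rw [← ENNReal.ofReal_pow (Real.sqrt_nonneg _), Real.sq_sqrt hε₁0.le] at h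
    refine le_trans (le_of_eq ?_) h
    rw [eLpNorm_eq_lintegral_rpow_enorm_toReal (by simp) (by simp), ← ENNReal.rpow_natCast,
      ← ENNReal.rpow_mul]
    simp
  obtain ⟨R, hR⟩ := hK.isBounded.subset_closedBall c
  have hgu : UniformContinuous g := hgcont.uniformContinuous_of_tendsto_cocompact
    (by simpa using hgc.is_zero_at_infty) 
  rw [Metric.uniformContinuous_iff] at hgu
  obtain ⟨δ, hδ, hgu⟩ := hgu (Real.sqrt ε₂) (Real.sqrt_pos.2 hε₂0)
  have hR0 : 0 ≤ |R| + r := by positivity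
  -- The bound `s < 1/2` keeps the Jacobian of the contraction below `2 ^ d`; the other one keeps
  -- every point used in the average at `x` within distance `δ` of `x`.
  refine ⟨min (1 / 2) (δ / (|R| + r + 1)), by positivity, ?_⟩
  intro s hs hs0 ρ hρ0 hρ hρc hρ1 hρs
  have hs1 : s < 1 / 2 := hs0.trans_le (min_le_left _ _)
  have hsδ : s * (|R| + r + 1) < δ := by
    have := hs0.trans_le (min_le_right _ _)
    rwa [lt_div_iff₀ (by positivity)] at this
  have hρint : Integrable ρ := hρ.integrable_of_hasCompactSupport hρc
  set y : Space d → Space d → Space d := fun x z => (1 - s) • x + (s • c - z) with hy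
  -- The point is `(1 - s) x + s (c - z / s)`, a convex combination of `x` and a point of the ball
  -- about `c`. Hence the average only sees values of `f` in `K`, and no extension of `f` beyond `K`
  -- is required.
  have hyK : ∀ z, ρ z ≠ 0 → ∀ x ∈ K, y x z ∈ K := by
    intro z hz x hx
    have h1 : c - s⁻¹ • z ∈ K := by
      apply hc
      rw [Metric.mem_closedBall, dist_eq_norm]
      simp only [sub_sub_cancel_left, norm_neg, norm_smul, norm_inv, Real.norm_eq_abs,
        abs_of_pos hs]
      rw [inv_mul_le_iff₀ hs]
      exact hρs z hz
    have := hconv hx h1 (by linarith : 0 ≤ 1 - s) hs.le (by ring)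
    rwa [smul_sub, smul_smul, mul_inv_cancel₀ hs.ne', one_smul] at this
  have key : ∀ x, ‖smoothed ρ s c f x - f x‖ₑ ^ 2 ≤
      ∫⁻ z, ENNReal.ofReal (ρ z) * ‖f (y x z) - f x‖ₑ ^ 2 := by
    intro x
    have e1 : smoothed ρ s c f x = ∫ z, ρ z * f (y x z) := by
      rw [smoothed, convolution_eq_swap]
      refine integral_congr_ae (Eventually.of_forall fun z => ?_)
      simp only [ContinuousLinearMap.lsmul_apply, smul_eq_mul, hy]
      rw [mul_comm, add_sub_assoc]
    have i1 : Integrable fun z => ρ z * f (y x z) := by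
      have := hρc.convolutionExists_right (ContinuousLinearMap.lsmul ℝ ℝ) hint hρ
        ((1 - s) • x + s • c)
      have h2 := this.integrable_swap
      refine h2.congr (Eventually.of_forall fun z => ?_)
      simp only [ContinuousLinearMap.lsmul_apply, smul_eq_mul, hy]
      rw [mul_comm, add_sub_assoc]
    have e2 : smoothed ρ s c f x - f x = ∫ z, ρ z * (f (y x z) - f x) := by
      simp only [mul_sub]
      rw [integral_sub i1 (hρint.mul_const _), integral_mul_const, hρ1, one_mul, e1]
    rw [e2]
    exact enorm_sq_integral_mul_le hρ0 hρ hρ1 hρint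
      ((hf.comp (by fun_prop)).sub measurable_const)
  have hρl : ∫⁻ z, ENNReal.ofReal (ρ z) = 1 := by
    rw [← ofReal_integral_eq_lintegral_ofReal hρint (Eventually.of_forall hρ0), hρ1,
      ENNReal.ofReal_one]
  have hym : Measurable fun p : Space d × Space d => y p.1 p.2 := by fun_prop
  calc ∫⁻ x in K, ‖smoothed ρ s c f x - f x‖ₑ ^ 2
      ≤ ∫⁻ x in K, ∫⁻ z, ENNReal.ofReal (ρ z) * ‖f (y x z) - f x‖ₑ ^ 2 :=
        lintegral_mono fun x => key x
    _ = ∫⁻ z, ∫⁻ x in K, ENNReal.ofReal (ρ z) * ‖f (y x z) - f x‖ₑ ^ 2 := by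
        refine lintegral_lintegral_swap ?_
        refine Measurable.aemeasurable ?_
        have h1 : Measurable fun p : Space d × Space d => f (y p.1 p.2) - f p.1 :=
          (hf.comp hym).sub (hf.comp measurable_fst)
        exact (ENNReal.measurable_ofReal.comp (hρ.measurable.comp measurable_snd)).mul
          (h1.enorm.pow_const 2)
    _ ≤ ∫⁻ z, ENNReal.ofReal (ρ z) * ENNReal.ofReal ε := by
        refine lintegral_mono fun z => ?_
        rw [lintegral_const_mul' _ _ ENNReal.ofReal_ne_top]
        by_cases hz : ρ z = 0
        · simp [hz]
        gcongr
        have b1 : ∫⁻ x in K, ‖f (y x z) - g (y x z)‖ₑ ^ 2 ≤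
            ENNReal.ofReal (2 ^ d) * ENNReal.ofReal ε₁ := by
          have hm : Measurable fun x => ‖f x - g x‖ₑ ^ 2 :=
            (hf.sub hgcont.measurable).enorm.pow_const 2
          refine (setLIntegral_comp_affine_le hKm (by linarith : 0 < 1 - s)
            (b := s • c - z) (fun x hx => hyK z hz x hx) hm).trans ?_
          gcongr
          rw [← inv_pow]
          refine pow_le_pow_left₀ (inv_nonneg.2 (by linarith)) ?_ d
          rw [inv_le_comm₀ (by linarith) (by norm_num)]
          linarith
        have b2 : ∫⁻ x in K, ‖g (y x z) - g x‖ₑ ^ 2 ≤ ENNReal.ofReal (ε₂ * V) := by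
          have : ∀ x ∈ K, ‖g (y x z) - g x‖ₑ ^ 2 ≤ ENNReal.ofReal ε₂ := by
            intro x hx
            have hd : dist (y x z) x < δ := by
              have e : y x z - x = s • (c - x) - z := by
                simp only [hy, sub_smul, one_smul, smul_sub]; abel
              rw [dist_eq_norm, e]
              have h1 : ‖c - x‖ ≤ |R| := by
                have := hR hx
                rw [Metric.mem_closedBall, dist_comm, dist_eq_norm] at this
                exact this.trans (le_abs_self R)
              have h2 := hρs z hz
              calc ‖s • (c - x) - z‖ ≤ s * ‖c - x‖ + ‖z‖ := by
                    refine (norm_sub_le _ _).trans_eq ?_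
                    rw [norm_smul, Real.norm_eq_abs, abs_of_pos hs]
                _ ≤ s * |R| + s * r := by gcongr
                _ < δ := by nlinarith
            have := hgu hd
            rw [dist_eq_norm] at this
            rw [← ofReal_norm, ← ENNReal.ofReal_pow (norm_nonneg _)]
            refine ENNReal.ofReal_le_ofReal ?_
            have h2 := pow_le_pow_left₀ (norm_nonneg _) this.le 2
            rwa [Real.sq_sqrt hε₂0.le] at h2
          calc ∫⁻ x in K, ‖g (y x z) - g x‖ₑ ^ 2 ≤ ∫⁻ x in K, ENNReal.ofReal ε₂ :=
                setLIntegral_mono measurable_const this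
            _ = ENNReal.ofReal (ε₂ * V) := by
                rw [setLIntegral_const, ENNReal.ofReal_mul hε₂0.le, hV,
                  ENNReal.ofReal_toReal hKfin.ne]
        calc ∫⁻ x in K, ‖f (y x z) - f x‖ₑ ^ 2
            ≤ ∫⁻ x in K, 3 * (‖f (y x z) - g (y x z)‖ₑ ^ 2 + ‖g (y x z) - g x‖ₑ ^ 2 +
                ‖f x - g x‖ₑ ^ 2) := lintegral_mono fun x => enorm_sub_sq_le_three _ _ _ _
          _ = 3 * ((∫⁻ x in K, ‖f (y x z) - g (y x z)‖ₑ ^ 2) +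
                (∫⁻ x in K, ‖g (y x z) - g x‖ₑ ^ 2) + ∫⁻ x in K, ‖f x - g x‖ₑ ^ 2) := by
              have hyz : Measurable fun x => y x z := by fun_prop
              have m1 : Measurable fun x => ‖f (y x z) - g (y x z)‖ₑ ^ 2 :=
                ((hf.comp hyz).sub (hgcont.measurable.comp hyz)).enorm.pow_const 2
              have m2 : Measurable fun x => ‖g (y x z) - g x‖ₑ ^ 2 :=
                ((hgcont.measurable.comp hyz).sub hgcont.measurable).enorm.pow_const 2
              have m12 : Measurable fun x => ‖f (y x z) - g (y x z)‖ₑ ^ 2 +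
                  ‖g (y x z) - g x‖ₑ ^ 2 := m1.add m2
              rw [lintegral_const_mul' _ _ (by simp), lintegral_add_left m12,
                lintegral_add_left m1]
          _ ≤ 3 * (ENNReal.ofReal (2 ^ d) * ENNReal.ofReal ε₁ + ENNReal.ofReal (ε₂ * V) +
                ENNReal.ofReal ε₁) := by gcongr
          _ ≤ ENNReal.ofReal ε := by
              have h3 : (3 : ENNReal) = ENNReal.ofReal 3 := by simp
              rw [← ENNReal.ofReal_mul (by positivity), ← ENNReal.ofReal_add (by positivity)
                (by positivity), ← ENNReal.ofReal_add (by positivity) (by positivity), h3,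
                ← ENNReal.ofReal_mul (by norm_num)]
              refine ENNReal.ofReal_le_ofReal ?_
              have e1 : ε₁ * A = ε / 6 := by rw [hε₁]; field_simp
              have e2 : ε₂ * (V + 1) = ε / 6 := by rw [hε₂]; field_simp
              have e3 : 2 ^ d * ε₁ + ε₁ = ε / 6 := by rw [← e1, hA]; ring
              nlinarith
    _ = ENNReal.ofReal ε := by
        rw [lintegral_mul_const' _ _ ENNReal.ofReal_ne_top, hρl, one_mul]

end Density

end SFWG

end

noncomputable section

namespace SFWG

/-! ### Convergence of the smoothed functions and their gradients -/

section Density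

variable {d : ℕ}

lemma eLpNorm_two_le_of_lintegral_le {α : Type*} [MeasurableSpace α] {μ : Measure α} {f : α → ℝ}
    {a : ENNReal} (h : ∫⁻ x, ‖f x‖ₑ ^ 2 ∂μ ≤ a) : eLpNorm f 2 μ ≤ a ^ (1 / 2 : ℝ) := by
  rw [eLpNorm_eq_lintegral_rpow_enorm_toReal (by simp) (by simp)]
  simp only [ENNReal.toReal_ofNat, ENNReal.rpow_ofNat]
  gcongr

lemma interior_ae_eq_of_convex {K : Set (Space d)} (hconv : Convex ℝ K) :
    interior K =ᵐ[volume] K := by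
  refine LE.le.eventuallyLE interior_subset |>.antisymm ?_
  rw [ae_le_set]
  refine measure_mono_null ?_ (hconv.addHaar_frontier volume)
  exact fun x hx => ⟨subset_closure hx.1, hx.2⟩

/-- Smoothing commutes with weak differentiation, up to a factor. -/
lemma partialD_smoothed_eq {K : Set (Space d)} (hK : IsCompact K) (hconv : Convex ℝ K)
    {c : Space d} {r : ℝ} (hc : Metric.closedBall c r ⊆ K) {w g : Space d → ℝ}
    (hw : LocallyIntegrable (K.indicator w)) (i : Fin d)
    (hD : HasWeakPartial (interior K) i w g) {s : ℝ} (hs : 0 < s) (hs1 : s < 1)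
    {ρ : Space d → ℝ} (hρ : ContDiff ℝ ∞ ρ) {r' : ℝ} (hr' : r' < r)
    (hρs : ∀ z, ρ z ≠ 0 → ‖z‖ ≤ s * r') {x : Space d} (hx : x ∈ K) :
    partialD i (smoothed ρ s c (K.indicator w)) x =
      (1 - s) * smoothed ρ s c (K.indicator g) x := by
  have hKm := hK.measurableSet
  have hρc : HasCompactSupport ρ :=
    HasCompactSupport.intro (isCompact_closedBall 0 (s * r')) fun z hz => by
      by_contra h
      exact hz (by simpa using hρs z h)
  rw [partialD_smoothed hρ hρc s c hw]
  congr 1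
  set y : Space d := (1 - s) • x + s • c with hy
  -- The shifted kernel `t ↦ ρ (y - t)`. Moving `x` towards `c` by the fraction `s` leaves room for
  -- a ball of radius `s * r` about `y`, and `r' < r` puts the support of the kernel into the
  -- interior of `K`, so it may be used in the definition of the weak derivative.
  set φ : Space d → ℝ := fun t => ρ ((-1 : ℝ) • t + y) with hφ
  have hsup : Function.support φ ⊆ Metric.closedBall y (s * r') := by
    intro t ht
    have := hρs _ ht
    rw [Metric.mem_closedBall, dist_comm, dist_eq_norm]
    simpa [neg_add_eq_sub] using this
  have hts : tsupport φ ⊆ Metric.closedBall y (s * r') :=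
    closure_minimal hsup Metric.isClosed_closedBall
  have hsub : Metric.closedBall y (s * r') ⊆ interior K := by
    intro t ht
    rw [Metric.mem_closedBall, dist_eq_norm] at ht
    have h1 : c + s⁻¹ • (t - y) ∈ interior K := by
      refine interior_mono hc ?_
      refine Metric.ball_subset_interior_closedBall ?_
      rw [Metric.mem_ball, dist_eq_norm, add_sub_cancel_left, norm_smul, norm_inv,
        Real.norm_eq_abs, abs_of_pos hs]
      refine lt_of_le_of_lt ?_ hr'
      rwa [inv_mul_le_iff₀ hs]
    have := hconv.combo_self_interior_mem_interior hx h1 (by linarith : 0 ≤ 1 - s) hs (by ring)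
    convert this using 1
    rw [smul_add, smul_smul, mul_inv_cancel₀ hs.ne', one_smul, ← add_assoc, ← hy]
    abel
  have htest : IsTest (interior K) φ := by
    refine ⟨hρ.comp (by fun_prop), ?_, hts.trans hsub⟩
    exact HasCompactSupport.intro (isCompact_closedBall y (s * r')) fun z hz => by
      by_contra h
      exact hz (hsup h)
  have h := hD φ htest
  have hp : ∀ t, partialD i φ t = -fderiv ℝ ρ (y - t) (EuclideanSpace.single i 1) := by
    intro t
    have hdiff : Differentiable ℝ ρ := hρ.differentiable (by simp)
    have := partialD_comp_affine (-1) y i t (hdiff _)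
    rw [hφ, this, partialD]
    simp [neg_add_eq_sub]
  have hae : (volume.restrict (interior K)) = volume.restrict K :=
    Measure.restrict_congr_set (interior_ae_eq_of_convex hconv)
  rw [hae] at h
  simp only [hp, mul_neg, integral_neg, neg_inj] at h
  have e1 : ∫ t, K.indicator w t * fderiv ℝ ρ (y - t) (EuclideanSpace.single i 1) =
      ∫ t in K, w t * fderiv ℝ ρ (y - t) (EuclideanSpace.single i 1) := by
    rw [← integral_indicator hKm]
    congr 1
    ext t
    by_cases ht : t ∈ K <;> simp [ht]
  rw [e1, h, smoothed, convolution, ← integral_indicator hKm, ← hy]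
  congr 1
  ext t
  by_cases ht : t ∈ K
  · simp [ht, hφ, neg_add_eq_sub]
  · simp [ht]

/-- Smooth functions are dense in `H¹(K)` for a convex body `K`. -/
theorem exists_tendstoH1_of_convex {K : Set (Space d)} (hK : IsCompact K) (hconv : Convex ℝ K)
    {c : Space d} {r : ℝ} (hr : 0 < r) (hc : Metric.closedBall c r ⊆ K)
    {w : Space d → ℝ} {G : Fin d → Space d → ℝ} (hw : MemLp w 2 (volume.restrict K))
    (hG : ∀ i, MemLp (G i) 2 (volume.restrict K))
    (hD : ∀ i, HasWeakPartial (interior K) i w (G i)) :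
    ∃ φ : ℕ → Space d → ℝ, (∀ n, ContDiff ℝ ∞ (φ n)) ∧ TendstoH1 K φ w G := by
  have hKm := hK.measurableSet
  have : IsFiniteMeasure (volume.restrict K) := ⟨by simpa using hK.measure_lt_top⟩
  -- The estimate for the smoothing uses Tonelli's theorem and asks for measurable functions, not
  -- merely a.e. measurable ones.
  have hrep : ∀ f : Space d → ℝ, MemLp f 2 (volume.restrict K) → ∃ g : Space d → ℝ,
      Measurable g ∧ g =ᵐ[volume.restrict K] f := fun f hf =>
    ⟨hf.1.mk f, hf.1.stronglyMeasurable_mk.measurable, hf.1.ae_eq_mk.symm⟩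
  obtain ⟨w', hw'm, hw'⟩ := hrep w hw
  choose G' hG'm hG' using fun i => hrep (G i) (hG i)
  have hL : ∀ f g : Space d → ℝ, MemLp f 2 (volume.restrict K) → g =ᵐ[volume.restrict K] f →
      MemLp (K.indicator g) 2 (volume.restrict K) ∧ LocallyIntegrable (K.indicator g) := by
    intro f g hf hfg
    have h1 : MemLp g 2 (volume.restrict K) := (memLp_congr_ae hfg).2 hf
    refine ⟨h1.indicator hKm, ?_⟩
    have h2 : IntegrableOn g K := h1.integrable (by norm_num)
    exact ((integrable_indicator_iff hKm).2 h2).locallyIntegrable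
  have hind : ∀ g : Space d → ℝ, K.indicator g =ᵐ[volume.restrict K] g := by
    intro g
    filter_upwards [ae_restrict_mem hKm] with x hx
    simp [hx]
  have hae : (volume.restrict (interior K)) = volume.restrict K :=
    Measure.restrict_congr_set (interior_ae_eq_of_convex hconv)
  have hD' : ∀ i, HasWeakPartial (interior K) i w' (G' i) := by
    intro i φ hφ
    have h := hD i φ hφ
    rw [hae] at h ⊢
    rw [integral_congr_ae (g := fun x => w x * partialD i φ x)
        (by filter_upwards [hw'] with x hx; rw [hx]),
      integral_congr_ae (f := fun x => G' i x * φ x) (g := fun x => G i x * φ x)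
        (by filter_upwards [hG' i] with x hx; rw [hx])]
    exact h
  -- The second term in the bound for the derivatives is the price of the factor `1 - s` that
  -- differentiation of the smoothed function produces.
  have hstep : ∀ n : ℕ, ∃ φ : Space d → ℝ, ContDiff ℝ ∞ φ ∧
      eLpNorm (fun x => φ x - w x) 2 (volume.restrict K) ≤
        (ENNReal.ofReal (1 / ((n : ℝ) + 1))) ^ (1 / 2 : ℝ) ∧
      ∀ i, eLpNorm (fun x => partialD i φ x - G i x) 2 (volume.restrict K) ≤
        (ENNReal.ofReal (1 / ((n : ℝ) + 1))) ^ (1 / 2 : ℝ) +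
          ENNReal.ofReal (1 / ((n : ℝ) + 1)) * eLpNorm (G i) 2 (volume.restrict K) := by
    intro n
    have hε : 0 < 1 / ((n : ℝ) + 1) := by positivity
    obtain ⟨s₀, hs₀, h0⟩ := lintegral_smoothed_sub_le hK hconv hr hc
      (hw'm.indicator hKm) (hL w w' hw hw').1 (hL w w' hw hw').2 hε
    choose s₁ hs₁ h1 using fun i => lintegral_smoothed_sub_le hK hconv hr hc
      ((hG'm i).indicator hKm) (hL _ _ (hG i) (hG' i)).1 (hL _ _ (hG i) (hG' i)).2 hε
    obtain ⟨s, hs, hss₀, hss₁, hsn, hs1⟩ : ∃ s : ℝ, 0 < s ∧ s < s₀ ∧ (∀ i, s < s₁ i) ∧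
        s < 1 / ((n : ℝ) + 1) ∧ s < 1 := by
      have : ∀ᶠ s in 𝓝[>] (0 : ℝ), 0 < s ∧ s < s₀ ∧ (∀ i, s < s₁ i) ∧
          s < 1 / ((n : ℝ) + 1) ∧ s < 1 := by
        have hlt : ∀ a : ℝ, 0 < a → ∀ᶠ s in 𝓝[>] (0 : ℝ), s < a := fun a ha =>
          nhdsWithin_le_nhds (gt_mem_nhds ha)
        exact (eventually_mem_nhdsWithin).and ((hlt _ hs₀).and ((eventually_all.2 fun i =>
          hlt _ (hs₁ i)).and ((hlt _ hε).and (hlt _ one_pos))))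
      exact this.exists
    -- Support radius `s * (r / 2)`, strictly less than `s * r` as the commutation with weak
    -- derivatives requires.
    let b : ContDiffBump (0 : Space d) := ⟨s * (r / 4), s * (r / 2), by positivity, by nlinarith⟩
    set ρ : Space d → ℝ := b.normed volume with hρ
    have hρs : ∀ z, ρ z ≠ 0 → ‖z‖ ≤ s * (r / 2) := by
      intro z hz
      have : z ∈ Function.support ρ := hz
      rw [hρ, b.support_normed_eq] at this
      simpa using (Metric.mem_ball.1 this).le
    have hρs' : ∀ z, ρ z ≠ 0 → ‖z‖ ≤ s * r := fun z hz =>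
      (hρs z hz).trans (by nlinarith)
    have hρd : ContDiff ℝ ∞ ρ := b.contDiff_normed
    have hρ0 : ∀ z, 0 ≤ ρ z := fun z => b.nonneg_normed z
    have hρ1 : ∫ z, ρ z = 1 := b.integral_normed
    have hρc : HasCompactSupport ρ := b.hasCompactSupport_normed
    refine ⟨smoothed ρ s c (K.indicator w'),
      contDiff_smoothed hρd hρc s c (hL w w' hw hw').2, ?_, fun i => ?_⟩
    · refine le_trans (le_of_eq (eLpNorm_congr_ae ?_))
        (eLpNorm_two_le_of_lintegral_le (h0 s hs hss₀ ρ hρ0 hρd.continuous hρc hρ1 hρs'))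
      filter_upwards [hw', hind w'] with x hx hx'
      rw [hx', hx]
    · have e1 : eLpNorm (fun x => partialD i (smoothed ρ s c (K.indicator w')) x - G i x) 2
          (volume.restrict K) = eLpNorm ((fun x => (1 - s) *
            (smoothed ρ s c (K.indicator (G' i)) x - K.indicator (G' i) x)) -
              fun x => s * G i x) 2 (volume.restrict K) := by
        refine eLpNorm_congr_ae ?_
        filter_upwards [hG' i, hind (G' i), ae_restrict_mem hKm] with x hx hx' hxK
        rw [partialD_smoothed_eq hK hconv hc (hL w w' hw hw').2 i (hD' i) hs hs1 hρd
          (by linarith : r / 2 < r) hρs hxK]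
        simp only [Pi.sub_apply]
        rw [hx', hx]
        ring
      have hsm : ContDiff ℝ ∞ (smoothed ρ s c (K.indicator (G' i))) :=
        contDiff_smoothed hρd hρc s c (hL _ _ (hG i) (hG' i)).2
      rw [e1]
      refine (eLpNorm_sub_le ?_ ((hG i).1.const_mul s) (by norm_num)).trans (add_le_add ?_ ?_)
      · exact (hsm.continuous.aestronglyMeasurable.sub
          (hL _ _ (hG i) (hG' i)).1.1).const_mul _
      · refine le_trans (eLpNorm_mono_real (g := fun x => ‖smoothed ρ s c (K.indicator (G' i)) x -
          K.indicator (G' i) x‖) fun x => ?_) ?_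
        · rw [norm_mul, Real.norm_eq_abs, abs_of_pos (by linarith)]
          exact mul_le_of_le_one_left (norm_nonneg _) (by linarith)
        · rw [eLpNorm_norm]
          exact eLpNorm_two_le_of_lintegral_le
            (h1 i s hs (hss₁ i) ρ hρ0 hρd.continuous hρc hρ1 hρs')
      · have : eLpNorm (fun x => s * G i x) 2 (volume.restrict K) =
            ‖s‖ₑ * eLpNorm (G i) 2 (volume.restrict K) :=
          eLpNorm_const_smul s (G i) 2 (volume.restrict K)
        rw [this]
        gcongr
        rw [Real.enorm_of_nonneg hs.le]
        exact ENNReal.ofReal_le_ofReal hsn.le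
  choose φ hφ h1 h2 using hstep
  have hlim : Tendsto (fun n : ℕ => ENNReal.ofReal (1 / ((n : ℝ) + 1))) atTop (𝓝 0) := by
    have := (ENNReal.continuous_ofReal.tendsto 0).comp
      (tendsto_one_div_add_atTop_nhds_zero_nat (𝕜 := ℝ))
    simpa [Function.comp_def] using this
  have hlim2 : Tendsto (fun n : ℕ => (ENNReal.ofReal (1 / ((n : ℝ) + 1))) ^ (1 / 2 : ℝ))
      atTop (𝓝 0) := by
    have := (ENNReal.continuous_rpow_const (y := (1 / 2 : ℝ))).tendsto 0 |>.comp hlim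
    simpa [Function.comp_def] using this
  refine ⟨φ, hφ, hw, hG, ?_, fun i => ?_⟩
  · exact tendsto_of_tendsto_of_tendsto_of_le_of_le tendsto_const_nhds hlim2
      (fun _ => zero_le) h1
  · have h3 := hlim2.add (ENNReal.Tendsto.mul_const (b := eLpNorm (G i) 2 (volume.restrict K))
      hlim (Or.inr (hG i).2.ne))
    rw [zero_mul, add_zero] at h3
    exact tendsto_of_tendsto_of_tendsto_of_le_of_le tendsto_const_nhds h3
      (fun _ => zero_le) (fun n => h2 n i)

end Density

end SFWG

end

noncomputable section

namespace SFWG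

/-! ### The Poincaré inequality on convex bodies -/

section Poincare

variable {d : ℕ}

/-- The squared length of the gradient. -/
def gradSq (φ : Space d → ℝ) (x : Space d) : ℝ := ∑ i, partialD i φ x ^ 2

lemma fderiv_apply_eq_sum (φ : Space d → ℝ) (x v : Space d) :
    fderiv ℝ φ x v = ∑ i, v i * partialD i φ x := by
  have hv : v = ∑ i, v i • EuclideanSpace.single i (1 : ℝ) := by
    ext j
    simp [Pi.single_apply]
  conv_lhs => rw [hv]
  simp [partialD]

lemma sq_fderiv_apply_le (φ : Space d → ℝ) (x v : Space d) :
    (fderiv ℝ φ x v) ^ 2 ≤ ‖v‖ ^ 2 * gradSq φ x := by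
  rw [fderiv_apply_eq_sum, EuclideanSpace.norm_sq_eq]
  simpa [gradSq] using Finset.sum_mul_sq_le_sq_mul_sq Finset.univ (fun i => v i)
    (fun i => partialD i φ x)

lemma continuous_partialD {φ : Space d → ℝ} (hφ : ContDiff ℝ ∞ φ) (i : Fin d) :
    Continuous (partialD i φ) :=
  (hφ.continuous_fderiv (by simp)).clm_apply continuous_const

lemma continuous_gradSq {φ : Space d → ℝ} (hφ : ContDiff ℝ ∞ φ) : Continuous (gradSq φ) :=
  continuous_finsetSum _ fun i _ => (continuous_partialD hφ i).pow 2

lemma gradSq_nonneg (φ : Space d → ℝ) (x : Space d) : 0 ≤ gradSq φ x :=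
  Finset.sum_nonneg fun _ _ => sq_nonneg _

/-- The fundamental theorem of calculus on the segment from `y` to `x`, followed by the
Cauchy–Schwarz inequality in the parameter. -/
lemma enorm_sub_sq_le_lintegral {φ : Space d → ℝ} (hφ : ContDiff ℝ ∞ φ) {h : ℝ}
    {x y : Space d} (hxy : ‖x - y‖ ≤ h) :
    ‖φ x - φ y‖ₑ ^ 2 ≤
      ∫⁻ t in Set.Ioc (0 : ℝ) 1, ENNReal.ofReal (h ^ 2 * gradSq φ (t • x + (1 - t) • y)) := by
  have hd : Differentiable ℝ φ := hφ.differentiable (by simp)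
  set γ : ℝ → Space d := fun t => t • x + (1 - t) • y with hγ
  have hγd : ∀ t, HasDerivAt γ (x - y) t := by
    intro t
    have h1 : HasDerivAt (fun t : ℝ => t • x) ((1 : ℝ) • x) t := (hasDerivAt_id t).smul_const x
    have h2 : HasDerivAt (fun t : ℝ => (1 - t) • y) ((-1 : ℝ) • y) t :=
      ((hasDerivAt_id t).const_sub 1).smul_const y
    have h3 : HasDerivAt γ ((1 : ℝ) • x + (-1 : ℝ) • y) t := h1.add h2
    rwa [one_smul, neg_one_smul, ← sub_eq_add_neg] at h3
  have hder : ∀ t, HasDerivAt (fun t => φ (γ t)) (fderiv ℝ φ (γ t) (x - y)) t := fun t =>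
    (hd (γ t)).hasFDerivAt.comp_hasDerivAt t (hγd t)
  have hγc : Continuous γ := by fun_prop
  have hcont : Continuous fun t => fderiv ℝ φ (γ t) (x - y) :=
    ((hφ.continuous_fderiv (by simp)).comp hγc).clm_apply continuous_const
  have hftc : ∫ t in (0 : ℝ)..1, fderiv ℝ φ (γ t) (x - y) = φ x - φ y := by
    rw [intervalIntegral.integral_eq_sub_of_hasDerivAt (fun t _ => hder t)
      (hcont.intervalIntegrable _ _)]
    simp [hγ]
  have hgc : Continuous fun t => h ^ 2 * gradSq φ (γ t) :=
    continuous_const.mul ((continuous_gradSq hφ).comp hγc)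
  have hint : IntegrableOn (fun t => h ^ 2 * gradSq φ (γ t)) (Set.Ioc (0 : ℝ) 1) :=
    hgc.integrableOn_Ioc
  have hsq : (φ x - φ y) ^ 2 ≤ ∫ t in Set.Ioc (0 : ℝ) 1, h ^ 2 * gradSq φ (γ t) := by
    rw [← hftc, intervalIntegral.integral_of_le zero_le_one]
    have hfin : IsFiniteMeasure (volume.restrict (Set.Ioc (0 : ℝ) 1)) := inferInstance
    have hm : MemLp (fun t => fderiv ℝ φ (γ t) (x - y)) 2
        (volume.restrict (Set.Ioc (0 : ℝ) 1)) := by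
      rw [memLp_two_iff_integrable_sq hcont.aestronglyMeasurable]
      exact (hcont.pow 2).integrableOn_Ioc
    have := sq_integral_mul_le hm (memLp_const (1 : ℝ))
    have e1 : ∫ _ in Set.Ioc (0 : ℝ) 1, (1 : ℝ) ^ 2 = 1 := by simp
    rw [e1, mul_one] at this
    simp only [mul_one] at this
    have i1 : IntegrableOn (fun t => fderiv ℝ φ (γ t) (x - y) ^ 2) (Set.Ioc (0 : ℝ) 1) :=
      (hcont.pow 2).integrableOn_Ioc
    refine this.trans (integral_mono i1 hint fun t => ?_)
    refine (sq_fderiv_apply_le φ _ _).trans ?_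
    exact mul_le_mul_of_nonneg_right (pow_le_pow_left₀ (norm_nonneg _) hxy 2)
      (gradSq_nonneg _ _)
  rw [← ofReal_norm, ← ENNReal.ofReal_pow (norm_nonneg _), Real.norm_eq_abs, sq_abs,
    ← ofReal_integral_eq_lintegral_ofReal hint
      (Eventually.of_forall fun t => mul_nonneg (sq_nonneg _) (gradSq_nonneg _ _))]
  exact ENNReal.ofReal_le_ofReal hsq

/-- The segment estimate is integrated over `K × K`. For `t ≥ 1/2` the point `t x + (1 - t) y` is
substituted for `x`, for `t ≤ 1/2` for `y`; the contraction ratio is then at least `1/2`, so the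
Jacobian stays below `2 ^ d` and the singular factor `t⁻ᵈ` never appears. -/
lemma lintegral_lintegral_sub_sq_le {K : Set (Space d)} (hK : IsCompact K) (hconv : Convex ℝ K)
    {h : ℝ} (hh : ∀ x ∈ K, ∀ y ∈ K, ‖x - y‖ ≤ h) {φ : Space d → ℝ} (hφ : ContDiff ℝ ∞ φ) :
    ∫⁻ x in K, ∫⁻ y in K, ‖φ x - φ y‖ₑ ^ 2 ≤
      ENNReal.ofReal (2 ^ d) * (∫⁻ x in K, ENNReal.ofReal (h ^ 2 * gradSq φ x)) * volume K := by
  have hKm := hK.measurableSet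
  set f : Space d → ENNReal := fun x => ENNReal.ofReal (h ^ 2 * gradSq φ x) with hf
  have hfm : Measurable f :=
    ENNReal.measurable_ofReal.comp (measurable_const.mul (continuous_gradSq hφ).measurable)
  set I := ∫⁻ x in K, f x with hI
  have half : ∀ t : ℝ, 1 / 2 ≤ t → t ≤ 1 → ∀ y ∈ K,
      ∫⁻ x in K, f (t • x + (1 - t) • y) ≤ ENNReal.ofReal (2 ^ d) * I := by
    intro t ht ht1 y hy
    have ht0 : 0 < t := by linarith
    refine (setLIntegral_comp_affine_le hKm ht0 (fun x hx => ?_) hfm).trans ?_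
    · exact hconv hx hy ht0.le (by linarith) (by ring)
    · gcongr
      rw [← inv_pow]
      refine pow_le_pow_left₀ (inv_nonneg.2 ht0.le) ?_ d
      rw [inv_le_comm₀ ht0 (by norm_num)]
      linarith
  have hm3 : Measurable fun p : (Space d × ℝ) × Space d =>
      f (p.1.2 • p.1.1 + (1 - p.1.2) • p.2) := hfm.comp (by fun_prop)
  calc ∫⁻ x in K, ∫⁻ y in K, ‖φ x - φ y‖ₑ ^ 2
      ≤ ∫⁻ x in K, ∫⁻ y in K, ∫⁻ t in Set.Ioc (0 : ℝ) 1, f (t • x + (1 - t) • y) := by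
        refine setLIntegral_mono' hKm fun x hx => setLIntegral_mono' hKm fun y hy => ?_
        exact enorm_sub_sq_le_lintegral hφ (hh x hx y hy)
    _ = ∫⁻ x in K, ∫⁻ t in Set.Ioc (0 : ℝ) 1, ∫⁻ y in K, f (t • x + (1 - t) • y) := by
        refine lintegral_congr fun x => lintegral_lintegral_swap ?_
        exact (hfm.comp (by fun_prop : Measurable fun p : Space d × ℝ =>
          p.2 • x + (1 - p.2) • p.1)).aemeasurable
    _ = ∫⁻ t in Set.Ioc (0 : ℝ) 1, ∫⁻ x in K, ∫⁻ y in K, f (t • x + (1 - t) • y) := by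
        refine lintegral_lintegral_swap ?_
        exact (hm3.lintegral_prod_right' (ν := volume.restrict K)).aemeasurable
    _ ≤ ∫⁻ t in Set.Ioc (0 : ℝ) 1, ENNReal.ofReal (2 ^ d) * I * volume K := by
        refine setLIntegral_mono' measurableSet_Ioc fun t ht => ?_
        rcases le_total (1 / 2) t with h2 | h2
        · calc ∫⁻ x in K, ∫⁻ y in K, f (t • x + (1 - t) • y)
              = ∫⁻ y in K, ∫⁻ x in K, f (t • x + (1 - t) • y) := by
                refine lintegral_lintegral_swap ?_
                exact (hfm.comp (by fun_prop : Measurable fun p : Space d × Space d =>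
                  t • p.1 + (1 - t) • p.2)).aemeasurable
            _ ≤ ∫⁻ y in K, ENNReal.ofReal (2 ^ d) * I :=
                setLIntegral_mono' hKm fun y hy => half t h2 ht.2 y hy
            _ = _ := by rw [setLIntegral_const]
        · calc ∫⁻ x in K, ∫⁻ y in K, f (t • x + (1 - t) • y)
              ≤ ∫⁻ x in K, ENNReal.ofReal (2 ^ d) * I := by
                refine setLIntegral_mono' hKm fun x hx => ?_
                have := half (1 - t) (by linarith) (by linarith [ht.1]) x hx
                simpa [add_comm] using this
            _ = _ := by rw [setLIntegral_const]
    _ = _ := by rw [setLIntegral_const]; simp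

lemma memLp_of_continuous_of_isCompact {α : Type*} [MeasurableSpace α] [TopologicalSpace α]
    [T2Space α] [OpensMeasurableSpace α] {μ : Measure α} {K : Set α} (hK : IsCompact K)
    (hμ : μ K ≠ ⊤) {φ : α → ℝ} (hφ : Continuous φ) : MemLp φ 2 (μ.restrict K) := by
  have : IsFiniteMeasure (μ.restrict K) := ⟨by simpa using hμ.lt_top⟩
  obtain ⟨C, hC⟩ := hK.exists_bound_of_continuousOn hφ.continuousOn
  refine MemLp.of_bound hφ.measurable.aestronglyMeasurable C ?_
  exact (ae_restrict_iff' hK.measurableSet).2 (Eventually.of_forall hC)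

/-- The left side is the integral of the squared deviation from the mean, hence at most the integral
of `(φ x - φ y)²` over `y` for every fixed `x`. Integrating over `x` and dividing by the volume
reduces the claim to the double integral above. -/
lemma poincare_smooth {K : Set (Space d)} (hK : IsCompact K) (hconv : Convex ℝ K)
    {h : ℝ} (hh : ∀ x ∈ K, ∀ y ∈ K, ‖x - y‖ ≤ h) (hpos : 0 < volume.real K)
    {φ : Space d → ℝ} (hφ : ContDiff ℝ ∞ φ) :
    (∫ x in K, φ x ^ 2) - (∫ x in K, φ x) ^ 2 / volume.real K ≤
      2 ^ d * h ^ 2 * ∑ i, ∫ x in K, partialD i φ x ^ 2 := by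
  have hKm := hK.measurableSet
  have hKfin : volume K ≠ ⊤ := hK.measure_lt_top.ne
  have hfin : IsFiniteMeasure (volume.restrict K) := ⟨by simpa using hKfin.lt_top⟩
  set V := volume.real K with hV
  have hL : MemLp φ 2 (volume.restrict K) := memLp_of_continuous_of_isCompact hK hKfin
    hφ.continuous
  have hI1 : IntegrableOn φ K := hL.integrable (by norm_num)
  have hI2 : IntegrableOn (fun x => φ x ^ 2) K := hL.integrable_sq
  have hgi : IntegrableOn (fun x => h ^ 2 * gradSq φ x) K :=
    (continuous_const.mul (continuous_gradSq hφ)).continuousOn.integrableOn_compact hK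
  set A := (∫ x in K, φ x ^ 2) - (∫ x in K, φ x) ^ 2 / V with hA
  have hexp : ∀ c : ℝ, ∫ y in K, (c - φ y) ^ 2 =
      c ^ 2 * V - 2 * c * (∫ y in K, φ y) + ∫ y in K, φ y ^ 2 := by
    intro c
    have e : ∀ y, (c - φ y) ^ 2 = (c ^ 2 - 2 * c * φ y) + φ y ^ 2 := fun y => by ring
    simp only [e]
    have i1 : IntegrableOn (fun y => 2 * c * φ y) K := hI1.const_mul _
    have i0 : IntegrableOn (fun _ : Space d => c ^ 2) K := integrable_const _
    have i01 : IntegrableOn (fun y : Space d => c ^ 2 - 2 * c * φ y) K := i0.sub i1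
    rw [integral_add i01 hI2, integral_sub i0 i1,
      integral_const_mul, setIntegral_const, smul_eq_mul, mul_comm V]
  have hlow : ∀ x, ENNReal.ofReal A ≤ ∫⁻ y in K, ‖φ x - φ y‖ₑ ^ 2 := by
    intro x
    have e : ∀ y, ‖φ x - φ y‖ₑ ^ 2 = ENNReal.ofReal ((φ x - φ y) ^ 2) := by
      intro y
      rw [← ofReal_norm, ← ENNReal.ofReal_pow (norm_nonneg _), Real.norm_eq_abs, sq_abs]
    simp only [e]
    have i3 : IntegrableOn (fun y => (φ x - φ y) ^ 2) K :=
      ((continuous_const.sub hφ.continuous).pow 2).continuousOn.integrableOn_compact hK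
    rw [← ofReal_integral_eq_lintegral_ofReal i3 (Eventually.of_forall fun y => sq_nonneg _)]
    refine ENNReal.ofReal_le_ofReal ?_
    rw [hexp, hA]
    have : 0 ≤ V * (φ x - (∫ y in K, φ y) / V) ^ 2 := by positivity
    have e2 : V * (φ x - (∫ y in K, φ y) / V) ^ 2 =
        φ x ^ 2 * V - 2 * φ x * (∫ y in K, φ y) + (∫ y in K, φ y) ^ 2 / V := by
      field_simp
      ring
    linarith
  have h1 : ENNReal.ofReal A * volume K ≤ ENNReal.ofReal (2 ^ d) *
      (∫⁻ x in K, ENNReal.ofReal (h ^ 2 * gradSq φ x)) * volume K := by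
    refine le_trans ?_ (lintegral_lintegral_sub_sq_le hK hconv hh hφ)
    rw [← setLIntegral_const]
    exact lintegral_mono fun x => hlow x
  have hV0 : volume K ≠ 0 := fun h0 => by simp [hV, Measure.real, h0] at hpos
  rw [ENNReal.mul_le_mul_iff_left hV0 hKfin, ← ofReal_integral_eq_lintegral_ofReal hgi
    (Eventually.of_forall fun x => mul_nonneg (sq_nonneg _) (gradSq_nonneg _ _)),
    ← ENNReal.ofReal_mul (by positivity)] at h1
  have hnn : 0 ≤ ∫ x in K, h ^ 2 * gradSq φ x :=
    integral_nonneg fun x => mul_nonneg (sq_nonneg _) (gradSq_nonneg _ _)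
  have h2 := (ENNReal.ofReal_le_ofReal_iff (by positivity)).1 h1
  rw [integral_const_mul] at h2
  have e3 : ∫ x in K, gradSq φ x = ∑ i, ∫ x in K, partialD i φ x ^ 2 :=
    integral_finsetSum _ fun i _ =>
      ((continuous_partialD hφ i).pow 2).continuousOn.integrableOn_compact hK
  rw [e3] at h2
  linarith

lemma TendstoH1.tendsto_sq {K : Set (Space d)} (hK : IsCompact K) {φ : ℕ → Space d → ℝ}
    {w : Space d → ℝ} {G : Fin d → Space d → ℝ} (hφ : ∀ n, ContDiff ℝ ∞ (φ n))
    (h : TendstoH1 K φ w G) :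
    Tendsto (fun n => ∫ x in K, (φ n x - w x) ^ 2) atTop (𝓝 0) ∧
    ∀ i, Tendsto (fun n => ∫ x in K, (partialD i (φ n) x - G i x) ^ 2) atTop (𝓝 0) := by
  have hKfin : volume K ≠ ⊤ := hK.measure_lt_top.ne
  refine ⟨(tendsto_eLpNorm_zero_iff fun n => ?_).1 h.2.2.1,
    fun i => (tendsto_eLpNorm_zero_iff fun n => ?_).1 (h.2.2.2 i)⟩
  · exact (memLp_of_continuous_of_isCompact hK hKfin (hφ n).continuous).sub h.1
  · exact (memLp_of_continuous_of_isCompact hK hKfin (continuous_partialD (hφ n) i)).sub (h.2.1 i)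

/-- The Poincaré inequality for `H¹` functions on a convex body. -/
theorem poincare_convex {K : Set (Space d)} (hK : IsCompact K) (hconv : Convex ℝ K)
    {h : ℝ} (hh : ∀ x ∈ K, ∀ y ∈ K, ‖x - y‖ ≤ h) (hpos : 0 < volume.real K)
    {φ : ℕ → Space d → ℝ} {w : Space d → ℝ} {G : Fin d → Space d → ℝ}
    (hφ : ∀ n, ContDiff ℝ ∞ (φ n)) (hw : TendstoH1 K φ w G) :
    (∫ x in K, w x ^ 2) - (∫ x in K, w x) ^ 2 / volume.real K ≤
      2 ^ d * h ^ 2 * ∑ i, ∫ x in K, G i x ^ 2 := by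
  have hKfin : volume K ≠ ⊤ := hK.measure_lt_top.ne
  have hfin : IsFiniteMeasure (volume.restrict K) := ⟨by simpa using hKfin.lt_top⟩
  obtain ⟨h1, h2⟩ := hw.tendsto_sq hK hφ
  have hm : ∀ n, MemLp (φ n) 2 (volume.restrict K) := fun n =>
    memLp_of_continuous_of_isCompact hK hKfin (hφ n).continuous
  have hmd : ∀ i n, MemLp (partialD i (φ n)) 2 (volume.restrict K) := fun i n =>
    memLp_of_continuous_of_isCompact hK hKfin (continuous_partialD (hφ n) i)
  have t1 := tendsto_integral_sq hm hw.1 h1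
  have t2 := tendsto_integral_mul_const hm hw.1 (memLp_const (1 : ℝ)) h1
  simp only [mul_one] at t2
  have t3 := tendsto_finsetSum Finset.univ fun i _ =>
    tendsto_integral_sq (hmd i) (hw.2.1 i) (h2 i)
  exact le_of_tendsto_of_tendsto' (t1.sub ((t2.pow 2).div_const _)) (t3.const_mul _)
    fun n => poincare_smooth hK hconv hh hpos (hφ n)

end Poincare

end SFWG

end

noncomputable section

namespace SFWG

/-! ### Barycentric coordinates of a simplex -/

section Simplex

variable {d : ℕ} (S : Affine.Simplex ℝ (Space d) d)

/-- The vertices of a simplex of full dimension as an affine basis. -/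
def sbasis : AffineBasis (Fin (d + 1)) ℝ (Space d) :=
  ⟨S.points, S.independent, by
    rw [S.independent.affineSpan_eq_top_iff_card_eq_finrank_add_one]
    simp⟩

/-- Barycentric coordinates. -/
def lam (i : Fin (d + 1)) : Space d →ᵃ[ℝ] ℝ := (sbasis S).coord i

/-- The closed simplex. -/
def body : Set (Space d) := convexHull ℝ (Set.range S.points)

/-- The closed face opposite to the vertex `l`. -/
def facet (l : Fin (d + 1)) : Set (Space d) := convexHull ℝ (S.points '' {l}ᶜ)

lemma lam_points (i j : Fin (d + 1)) : lam S i (S.points j) = if i = j then 1 else 0 :=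
  (sbasis S).coord_apply i j

@[simp] lemma lam_points_self (i : Fin (d + 1)) : lam S i (S.points i) = 1 := by
  simp [lam_points]

lemma lam_points_of_ne {i j : Fin (d + 1)} (h : i ≠ j) : lam S i (S.points j) = 0 := by
  simp [lam_points, h]

lemma sum_lam (x : Space d) : ∑ i, lam S i x = 1 := (sbasis S).sum_coord_apply_eq_one x

lemma sum_lam_smul (x : Space d) : ∑ i, lam S i x • S.points i = x :=
  (sbasis S).linear_combination_coord_eq_self x

lemma lam_continuous (i : Fin (d + 1)) : Continuous (lam S i) :=
  (lam S i).continuous_of_finiteDimensional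

lemma mem_body {x : Space d} : x ∈ body S ↔ ∀ i, 0 ≤ lam S i x := by
  have := (sbasis S).convexHull_eq_nonneg_coord
  change x ∈ convexHull ℝ (Set.range (sbasis S)) ↔ _
  rw [this]
  rfl

lemma mem_interior_body {x : Space d} : x ∈ interior (body S) ↔ ∀ i, 0 < lam S i x := by
  have := (sbasis S).interior_convexHull
  change x ∈ interior (convexHull ℝ (Set.range (sbasis S))) ↔ _
  rw [this]
  rfl

lemma lam_le_one {x : Space d} (hx : x ∈ body S) (i : Fin (d + 1)) : lam S i x ≤ 1 := by
  rw [← sum_lam S x]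
  exact Finset.single_le_sum (fun j _ => (mem_body S).1 hx j) (Finset.mem_univ i)

lemma facet_subset_body (l : Fin (d + 1)) : facet S l ⊆ body S :=
  convexHull_mono (Set.image_subset_range _ _)

/-- Faces of a simplex in barycentric coordinates. -/
lemma mem_convexHull_image {s : Set (Fin (d + 1))} {x : Space d} :
    x ∈ convexHull ℝ (S.points '' s) ↔ (∀ i, 0 ≤ lam S i x) ∧ ∀ i ∉ s, lam S i x = 0 := by
  constructor
  · intro hx
    have hconv : Convex ℝ {x | (∀ i, 0 ≤ lam S i x) ∧ ∀ i ∉ s, lam S i x = 0} := by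
      intro x hx y hy a b ha hb hab
      have e : ∀ i, lam S i (a • x + b • y) = a * lam S i x + b * lam S i y := fun i =>
        Convex.combo_affine_apply hab
      refine ⟨fun i => ?_, fun i hi => ?_⟩
      · rw [e]
        exact add_nonneg (mul_nonneg ha (hx.1 i)) (mul_nonneg hb (hy.1 i))
      · rw [e, hx.2 i hi, hy.2 i hi]; simp
    refine convexHull_min ?_ hconv hx
    rintro _ ⟨j, hj, rfl⟩
    refine ⟨fun i => ?_, fun i hi => ?_⟩
    · rw [lam_points]; split_ifs <;> norm_num
    · exact lam_points_of_ne S fun h => hi (h ▸ hj)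
  · rintro ⟨h0, hz⟩
    classical
    rw [← sum_lam_smul S x, ← Finset.sum_subset (Finset.subset_univ (Finset.univ.filter (· ∈ s)))
      (fun i _ hi => by rw [hz i (by simpa using hi), zero_smul])]
    refine (convex_convexHull ℝ _).sum_mem (fun i _ => h0 i) ?_ fun i hi =>
      subset_convexHull ℝ _ ⟨i, by simpa using hi, rfl⟩
    rw [Finset.sum_subset (Finset.subset_univ _)
      (fun i _ hi => by rw [hz i (by simpa using hi)]), sum_lam]

lemma mem_facet {l : Fin (d + 1)} {x : Space d} :
    x ∈ facet S l ↔ (∀ i, 0 ≤ lam S i x) ∧ lam S l x = 0 := by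
  rw [facet, mem_convexHull_image]
  simp

lemma isCompact_body : IsCompact (body S) :=
  (Set.finite_range _).isCompact_convexHull ℝ

lemma isCompact_facet (l : Fin (d + 1)) : IsCompact (facet S l) :=
  ((Set.toFinite _).image _).isCompact_convexHull ℝ

lemma convex_body : Convex ℝ (body S) := convex_convexHull ℝ _

lemma points_mem_body (i : Fin (d + 1)) : S.points i ∈ body S :=
  subset_convexHull ℝ _ ⟨i, rfl⟩

lemma points_mem_facet {i l : Fin (d + 1)} (h : i ≠ l) : S.points i ∈ facet S l :=
  subset_convexHull ℝ _ ⟨i, h, rfl⟩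

lemma interior_body_nonempty : (interior (body S)).Nonempty :=
  ⟨_, (sbasis S).centroid_mem_interior_convexHull⟩

/-! ### Normals and heights -/

/-- The gradient of a barycentric coordinate. -/
def glam (i : Fin (d + 1)) : Space d :=
  (InnerProductSpace.toDual ℝ (Space d)).symm (LinearMap.toContinuousLinearMap (lam S i).linear)

lemma inner_glam (i : Fin (d + 1)) (v : Space d) :
    inner ℝ (glam S i) v = (lam S i).linear v := by
  rw [glam, InnerProductSpace.toDual_symm_apply]
  rfl

lemma inner_glam_sub (i : Fin (d + 1)) (x y : Space d) :
    inner ℝ (glam S i) (x - y) = lam S i x - lam S i y := by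
  rw [inner_glam]
  exact (lam S i).linearMap_vsub x y

lemma glam_ne_zero (hd : 0 < d) (l : Fin (d + 1)) : glam S l ≠ 0 := by
  intro h
  have : Nontrivial (Fin (d + 1)) := Fin.nontrivial_iff_two_le.2 (by omega)
  obtain ⟨i, hi⟩ := exists_ne l
  have h1 := inner_glam_sub S l (S.points l) (S.points i)
  rw [h, inner_zero_left, lam_points_self, lam_points_of_ne S hi.symm] at h1
  norm_num at h1

/-- The height of a simplex over the face opposite to the vertex `l`. -/
def height (l : Fin (d + 1)) : ℝ := ‖glam S l‖⁻¹

lemma height_pos (hd : 0 < d) (l : Fin (d + 1)) : 0 < height S l :=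
  inv_pos.2 (norm_pos_iff.2 (glam_ne_zero S hd l))

/-- The normalized negative gradient of the barycentric coordinate `λ_l` has the required
properties. -/
lemma outwardNormal_spec (hd : 0 < d) (l : Fin (d + 1)) :
    ‖outwardNormal S l‖ = 1 ∧
    (∀ i j, i ≠ l → j ≠ l → inner ℝ (outwardNormal S l) (S.points i - S.points j) = 0) ∧
    ∀ i, i ≠ l → inner ℝ (outwardNormal S l) (S.points l - S.points i) < 0 := by
  refine Classical.epsilon_spec (p := fun n : Space d => ‖n‖ = 1 ∧
    (∀ i j, i ≠ l → j ≠ l → inner ℝ n (S.points i - S.points j) = 0) ∧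
    ∀ i, i ≠ l → inner ℝ n (S.points l - S.points i) < 0) ⟨-(height S l • glam S l), ?_, ?_, ?_⟩
  · rw [norm_neg, norm_smul, Real.norm_eq_abs, abs_of_pos (height_pos S hd l), height,
      inv_mul_cancel₀ (norm_ne_zero_iff.2 (glam_ne_zero S hd l))]
  · intro i j hi hj
    rw [inner_neg_left, inner_smul_left, inner_glam_sub, lam_points_of_ne S hi.symm,
      lam_points_of_ne S hj.symm]
    simp
  · intro i hi
    rw [inner_neg_left, inner_smul_left, inner_glam_sub, lam_points_of_ne S hi.symm,
      lam_points_self]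
    simpa using height_pos S hd l

/-- The defining properties leave no choice: expanding `x - p_o` in the vertices, only the vertex
`l` contributes to the product with the normal, so the normal is a negative multiple of the gradient
of `λ_l`, and its length fixes the multiple. -/
lemma outwardNormal_eq (hd : 0 < d) (l : Fin (d + 1)) :
    outwardNormal S l = -(height S l • glam S l) := by
  obtain ⟨h1, h2, h3⟩ := outwardNormal_spec S hd l
  set n := outwardNormal S l
  have : Nontrivial (Fin (d + 1)) := Fin.nontrivial_iff_two_le.2 (by omega)
  obtain ⟨o, ho⟩ := exists_ne l
  set a := inner ℝ n (S.points l - S.points o) with ha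
  have ha0 : a < 0 := h3 o ho
  have key : ∀ x, inner ℝ n (x - S.points o) = a * lam S l x := by
    intro x
    have e : x - S.points o = ∑ i, lam S i x • (S.points i - S.points o) := by
      simp only [smul_sub, Finset.sum_sub_distrib, sum_lam_smul, ← Finset.sum_smul, sum_lam,
        one_smul]
    rw [e, inner_sum, Finset.sum_eq_single l]
    · rw [inner_smul_right, mul_comm]
    · intro i _ hi
      rw [inner_smul_right, h2 i o hi ho, mul_zero]
    · simp
  have hn : n = a • glam S l := by
    refine ext_inner_right ℝ fun v => ?_
    have h4 := key (v + S.points o)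
    rw [add_sub_cancel_right] at h4
    rw [h4, inner_smul_left]
    have h5 := inner_glam_sub S l (v + S.points o) (S.points o)
    rw [add_sub_cancel_right, lam_points_of_ne S ho.symm, sub_zero] at h5
    rw [h5]
    simp
  have hg := glam_ne_zero S hd l
  have : -a = height S l := by
    rw [hn, norm_smul, Real.norm_eq_abs, abs_of_neg ha0] at h1
    rw [height, eq_inv_of_mul_eq_one_left h1]
  rw [hn, ← this, neg_smul, neg_neg]

lemma norm_outwardNormal (hd : 0 < d) (l : Fin (d + 1)) : ‖outwardNormal S l‖ = 1 :=
  (outwardNormal_spec S hd l).1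

lemma inner_outwardNormal (hd : 0 < d) (l : Fin (d + 1)) (x y : Space d) :
    inner ℝ (outwardNormal S l) (x - y) = -(height S l * (lam S l x - lam S l y)) := by
  rw [outwardNormal_eq S hd, inner_neg_left, inner_smul_left, inner_glam_sub]
  rfl

/-! ### The cone formula -/

/-- Fubini's theorem for the orthogonal decomposition of the space into the line of `n` and its
complement. -/
lemma lintegral_eq_slices {n : Space d} (hn : ‖n‖ = 1) (p : Space d) {f : Space d → ENNReal}
    (hf : Measurable f) :
    ∫⁻ x, f x = ∫⁻ s : ℝ, ∫⁻ y : (ℝ ∙ n)ᗮ, f (p + (s • n + (y : Space d))) := by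
  have h1 := (ℝ ∙ n).measurePreserving_measurableEquivProd p
  rw [finrank_euclideanSpace_fin, EuclideanSpace.euclideanHausdorffMeasure_eq_volume] at h1
  have h2 := h1.symm
  rw [← h2.lintegral_comp hf, Measure.volume_eq_prod,
    lintegral_prod _ (by exact (hf.comp h2.measurable).aemeasurable)]
  have h3 := (LinearIsometryEquiv.toSpanUnitSingleton n hn).measurePreserving
  have hm : Measurable fun x : (ℝ ∙ n) => ∫⁻ y : (ℝ ∙ n)ᗮ,
      f (((ℝ ∙ n).measurableEquivProd p).symm (x, y)) :=
    (hf.comp h2.measurable).lintegral_prod_right'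
  rw [← h3.lintegral_comp hm]
  refine lintegral_congr fun s => lintegral_congr fun y => ?_
  congr 1
  rw [Submodule.measurableEquivProd_symm_apply]
  simp [add_comm]

lemma finrank_orthogonal_singleton {n : Space d} (hn : ‖n‖ = 1) :
    Module.finrank ℝ (ℝ ∙ n)ᗮ = d - 1 := by
  have h := (ℝ ∙ n).finrank_add_finrank_orthogonal
  rw [finrank_span_singleton (by rintro rfl; simp at hn), finrank_euclideanSpace_fin] at h
  omega

/-- The hyperplane is the image of the orthogonal complement of `n` under an isometry. Hausdorff
measure is invariant under isometries, and on the `(d-1)`-dimensional complement it is Lebesgue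
measure. -/
lemma lintegral_surf_hyperplane {n : Space d} (hn : ‖n‖ = 1) (p : Space d)
    {f : Space d → ENNReal} (hf : Measurable f) :
    ∫⁻ z in {z | inner ℝ n (z - p) = 0}, f z ∂(surf d) =
      ∫⁻ y : (ℝ ∙ n)ᗮ, f (p + (y : Space d)) := by
  set ι : (ℝ ∙ n)ᗮ → Space d := fun y => p + (y : Space d) with hι
  have hiso : Isometry ι := by
    refine Isometry.of_dist_eq fun a b => ?_
    simp [hι, Subtype.dist_eq]
  have hmap := hiso.map_euclideanHausdorffMeasure (d := d - 1)
  have hvol : (Measure.euclideanHausdorffMeasure (d - 1) : Measure (ℝ ∙ n)ᗮ) = volume := by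
    rw [← finrank_orthogonal_singleton hn, InnerProductSpace.euclideanHausdorffMeasure_eq_volume]
  rw [hvol] at hmap
  have hrange : Set.range ι = {z | inner ℝ n (z - p) = 0} := by
    ext z
    constructor
    · rintro ⟨y, rfl⟩
      simp only [hι, Set.mem_ofPred_eq, add_sub_cancel_left]
      exact Submodule.mem_orthogonal_singleton_iff_inner_right.1 y.2
    · intro hz
      exact ⟨⟨z - p, Submodule.mem_orthogonal_singleton_iff_inner_right.2 hz⟩, by simp [hι]⟩
  rw [hrange] at hmap
  rw [surf, ← hmap, lintegral_map hf hiso.continuous.measurable]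

lemma lintegral_comp_smul_orthogonal {n : Space d} (hn : ‖n‖ = 1) {t : ℝ} (ht : 0 < t)
    {g : (ℝ ∙ n)ᗮ → ENNReal} (hg : Measurable g) :
    ∫⁻ y, g y = ENNReal.ofReal (t ^ (d - 1)) * ∫⁻ y, g (t • y) := by
  have h1 := Measure.map_addHaar_smul (volume : Measure (ℝ ∙ n)ᗮ) ht.ne'
  rw [finrank_orthogonal_singleton hn, abs_of_pos (by positivity)] at h1
  rw [← lintegral_map hg (measurable_const_smul t), h1, lintegral_smul_measure, smul_eq_mul,
    ← mul_assoc, ← ENNReal.ofReal_mul (by positivity), mul_inv_cancel₀ (by positivity)]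
  simp

lemma lam_cone (i l : Fin (d + 1)) (t : ℝ) (z : Space d) :
    lam S i (S.points l + t • (z - S.points l)) =
      (1 - t) * (if i = l then 1 else 0) + t * lam S i z := by
  have e : S.points l + t • (z - S.points l) = AffineMap.lineMap (S.points l) z t := by
    rw [AffineMap.lineMap_apply]
    simp [add_comm]
  rw [e, AffineMap.apply_lineMap, AffineMap.lineMap_apply_ring', lam_points]
  ring

lemma cone_mem_body_iff {l : Fin (d + 1)} {t : ℝ} (ht : 0 < t) (ht1 : t ≤ 1) {z : Space d}
    (hz : lam S l z = 0) :
    S.points l + t • (z - S.points l) ∈ body S ↔ z ∈ facet S l := by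
  rw [mem_body, mem_facet]
  constructor
  · intro h
    refine ⟨fun i => ?_, hz⟩
    by_cases hi : i = l
    · rw [hi, hz]
    · have := h i
      rw [lam_cone, if_neg hi, mul_zero, zero_add] at this
      exact nonneg_of_mul_nonneg_right this ht
  · rintro ⟨h, -⟩ i
    rw [lam_cone]
    have := mul_nonneg ht.le (h i)
    split_ifs
    · linarith
    · linarith

/-- Integration over a simplex as the cone over one of its faces. -/
theorem lintegral_body_eq_cone (hd : 0 < d) (l : Fin (d + 1)) {f : Space d → ENNReal}
    (hf : Measurable f) :
    ∫⁻ x in body S, f x = ∫⁻ t in Set.Ioo (0 : ℝ) 1, ENNReal.ofReal (height S l * t ^ (d - 1)) *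
      ∫⁻ z in facet S l, f (S.points l + t • (z - S.points l)) ∂(surf d) := by
  set n := outwardNormal S l with hn'
  have hn : ‖n‖ = 1 := norm_outwardNormal S hd l
  set p := S.points l with hp
  set H := height S l with hH
  have hH0 : 0 < H := height_pos S hd l
  have hBm : MeasurableSet (body S) := (isCompact_body S).measurableSet
  have hFm : MeasurableSet (facet S l) := (isCompact_facet S l).measurableSet
  set g : Space d → ENNReal := (body S).indicator f with hg
  have hgm : Measurable g := hf.indicator hBm
  have hin : ∀ (s : ℝ) (y : (ℝ ∙ n)ᗮ), lam S l (p + (s • n + (y : Space d))) = 1 - s / H := by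
    intro s y
    have h1 := inner_outwardNormal S hd l (p + (s • n + (y : Space d))) p
    rw [add_sub_cancel_left, ← hn', inner_add_right, inner_smul_right,
      real_inner_self_eq_norm_sq, hn, Submodule.mem_orthogonal_singleton_iff_inner_right.1 y.2,
      ← hH, hp, lam_points_self] at h1
    rw [← hp] at h1
    field_simp
    linarith
  have hmapH : ∀ G : ℝ → ENNReal, Measurable G →
      ∫⁻ s, G s = ENNReal.ofReal H * ∫⁻ t, G (t * H) := by
    intro G hG
    have h1 := Real.map_volume_mul_right hH0.ne'
    rw [← lintegral_map (g := fun t : ℝ => t * H) hG (by fun_prop), h1, lintegral_smul_measure, smul_eq_mul, ← mul_assoc,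
      abs_of_pos (by positivity), ← ENNReal.ofReal_mul hH0.le, mul_inv_cancel₀ hH0.ne']
    simp
  -- The slice at distance `t * H` from the vertex is the copy of the face scaled by `t` about the
  -- vertex, whence the factor `t ^ (d - 1)`.
  have hinner : ∀ t ∈ Set.Ioo (0 : ℝ) 1, ∫⁻ y : (ℝ ∙ n)ᗮ, g (p + ((t * H) • n + (y : Space d))) =
      ENNReal.ofReal (t ^ (d - 1)) * ∫⁻ z in facet S l, f (p + t • (z - p)) ∂(surf d) := by
    intro t ht
    rw [lintegral_comp_smul_orthogonal hn ht.1 (g := fun y : (ℝ ∙ n)ᗮ =>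
      g (p + ((t * H) • n + (y : Space d)))) (hgm.comp (by fun_prop))]
    congr 1
    have hplane : facet S l ⊆ {z | inner ℝ n (z - (p + H • n)) = 0} := by
      intro z hz
      have h1 := inner_outwardNormal S hd l z p
      rw [((mem_facet S).1 hz).2, hp, lam_points_self, ← hp, ← hn', ← hH] at h1
      simp only [Set.mem_ofPred_eq]
      rw [← sub_sub, inner_sub_right, h1, inner_smul_right, real_inner_self_eq_norm_sq, hn]
      ring
    have h2 : ∫⁻ z in facet S l, f (p + t • (z - p)) ∂(surf d) =
        ∫⁻ z in {z | inner ℝ n (z - (p + H • n)) = 0},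
          (facet S l).indicator (fun z => f (p + t • (z - p))) z ∂(surf d) := by
      rw [lintegral_indicator hFm, Measure.restrict_restrict hFm,
        Set.inter_eq_left.2 hplane]
    have hm : Measurable fun z : Space d => f (p + t • (z - p)) := hf.comp (by fun_prop)
    rw [h2, lintegral_surf_hyperplane hn _ (hm.indicator hFm)]
    refine lintegral_congr fun y => ?_
    have e1 : p + ((t * H) • n + ((t • y : (ℝ ∙ n)ᗮ) : Space d)) =
        p + t • ((p + H • n + (y : Space d)) - p) := by
      rw [Submodule.coe_smul, add_assoc p, add_sub_cancel_left, smul_add, smul_smul]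
    have hz : lam S l (p + H • n + (y : Space d)) = 0 := by
      rw [add_assoc, hin H y, div_self hH0.ne', sub_self]
    have hiff := cone_mem_body_iff S ht.1 ht.2.le hz
    rw [e1, hg]
    by_cases hy : p + H • n + (y : Space d) ∈ facet S l
    · rw [Set.indicator_of_mem (hiff.2 hy), Set.indicator_of_mem hy]
    · rw [Set.indicator_of_notMem (fun h => hy (hiff.1 h)), Set.indicator_of_notMem hy]
  rw [← lintegral_indicator hBm, lintegral_eq_slices hn p hgm,
    hmapH (fun s => ∫⁻ y : (ℝ ∙ n)ᗮ, g (p + (s • n + (y : Space d))))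
      ((hgm.comp (by fun_prop : Measurable fun q : ℝ × (ℝ ∙ n)ᗮ =>
        p + (q.1 • n + (q.2 : Space d)))).lintegral_prod_right')]
  have hout : ∀ t ∉ Set.Icc (0 : ℝ) 1, ∫⁻ y : (ℝ ∙ n)ᗮ, g (p + ((t * H) • n + (y : Space d))) =
      0 := by
    intro t ht
    have : ∀ y : (ℝ ∙ n)ᗮ, g (p + ((t * H) • n + (y : Space d))) = 0 := by
      intro y
      refine Set.indicator_of_notMem (fun hmem => ht ?_) _
      have h1 := (mem_body S).1 hmem l
      have h2 := lam_le_one S hmem l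
      rw [hin, mul_div_assoc, div_self hH0.ne', mul_one] at h1 h2
      exact ⟨by linarith, by linarith⟩
    simp [this]
  have hrestr : ∫⁻ t, ∫⁻ y : (ℝ ∙ n)ᗮ, g (p + ((t * H) • n + (y : Space d))) =
      ∫⁻ t in Set.Ioo (0 : ℝ) 1, ∫⁻ y : (ℝ ∙ n)ᗮ, g (p + ((t * H) • n + (y : Space d))) := by
    rw [← setLIntegral_congr (Ioo_ae_eq_Icc (a := (0 : ℝ)) (b := 1)).symm]
    rw [← lintegral_indicator measurableSet_Icc]
    refine lintegral_congr fun t => ?_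
    by_cases ht : t ∈ Set.Icc (0 : ℝ) 1
    · rw [Set.indicator_of_mem ht]
    · rw [Set.indicator_of_notMem ht, hout t ht]
  rw [hrestr, setLIntegral_congr_fun measurableSet_Ioo hinner,
    ← lintegral_const_mul' _ _ ENNReal.ofReal_ne_top]
  refine lintegral_congr fun t => ?_
  rw [← mul_assoc, ENNReal.ofReal_mul hH0.le]

end Simplex

end SFWG

end

noncomputable section

namespace SFWG

/-! ### Surface measure and relative interior of the faces of a simplex -/

section Simplex

variable {d : ℕ} (S : Affine.Simplex ℝ (Space d) d)

lemma lintegral_height_pow (hd : 0 < d) (l : Fin (d + 1)) :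
    ∫⁻ t in Set.Ioo (0 : ℝ) 1, ENNReal.ofReal (height S l * t ^ (d - 1)) =
      ENNReal.ofReal (height S l / d) := by
  have hH := height_pos S hd l
  have hint : IntegrableOn (fun t : ℝ => height S l * t ^ (d - 1)) (Set.Ioo 0 1) :=
    ((by fun_prop : Continuous fun t : ℝ => height S l * t ^ (d - 1)).integrableOn_Icc).mono_set
      Set.Ioo_subset_Icc_self
  rw [← ofReal_integral_eq_lintegral_ofReal hint]
  · congr 1
    rw [integral_const_mul, ← integral_Ioc_eq_integral_Ioo,
      ← intervalIntegral.integral_of_le zero_le_one, integral_pow]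
    have : d - 1 + 1 = d := by omega
    rw [this]
    have h2 : ((d - 1 : ℕ) : ℝ) + 1 = d := by exact_mod_cast this
    rw [h2]
    simp [hd.ne', div_eq_mul_inv]
  · refine (ae_restrict_iff' measurableSet_Ioo).2 (Eventually.of_forall fun t ht => ?_)
    exact mul_nonneg hH.le (pow_nonneg ht.1.le _)

lemma volume_body_eq (hd : 0 < d) (l : Fin (d + 1)) :
    volume (body S) = ENNReal.ofReal (height S l / d) * surf d (facet S l) := by
  have h := lintegral_body_eq_cone S hd l (f := fun _ => 1) measurable_const
  simp only [lintegral_one, Measure.restrict_apply_univ] at h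
  have hm : Measurable fun t : ℝ => ENNReal.ofReal (height S l * t ^ (d - 1)) := by fun_prop
  rw [h, lintegral_mul_const _ hm, lintegral_height_pow S hd]

lemma surf_facet_ne_top (hd : 0 < d) (l : Fin (d + 1)) : surf d (facet S l) ≠ ⊤ := by
  intro h
  have h1 := volume_body_eq S hd l
  have hH : ENNReal.ofReal (height S l / d) ≠ 0 := by
    have := height_pos S hd l
    simpa using by positivity
  rw [h, ENNReal.mul_top hH] at h1
  exact (isCompact_body S).measure_lt_top.ne h1

lemma volume_real_body (hd : 0 < d) (l : Fin (d + 1)) :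
    volume.real (body S) = height S l / d * (surf d).real (facet S l) := by
  have := height_pos S hd l
  rw [Measure.real, volume_body_eq S hd l, ENNReal.toReal_mul, ENNReal.toReal_ofReal (by positivity)]
  rfl

lemma volume_real_body_pos : 0 < volume.real (body S) := by
  refine ENNReal.toReal_pos ?_ (isCompact_body S).measure_lt_top.ne
  exact (Measure.measure_pos_of_nonempty_interior _ (interior_body_nonempty S)).ne'

lemma isFiniteMeasure_facet (hd : 0 < d) (l : Fin (d + 1)) :
    IsFiniteMeasure ((surf d).restrict (facet S l)) :=
  ⟨by simpa using (surf_facet_ne_top S hd l).lt_top⟩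

/-- Points of a face with a vanishing further barycentric coordinate form a null set. -/
lemma surf_facet_inter_lam_eq_zero (hd : 0 < d) {i l : Fin (d + 1)} (hi : i ≠ l) :
    surf d (facet S l ∩ {x | lam S i x = 0}) = 0 := by
  set Z : Set (Space d) := {x | lam S i x = 0} with hZ
  have hZm : MeasurableSet Z := (isClosed_eq (lam_continuous S i) continuous_const).measurableSet
  have hFm := (isCompact_facet S l).measurableSet
  -- The set `λ_i = 0` is a cone with apex `p_l`, as `i ≠ l`. Its part in the simplex lies in the
  -- frontier and is null, so by the cone formula its trace on the face is null as well.
  have h := lintegral_body_eq_cone S hd l (f := Z.indicator fun _ => 1)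
    (measurable_const.indicator hZm)
  have hz : ∫⁻ x in body S, Z.indicator (fun _ => (1 : ENNReal)) x = 0 := by
    rw [lintegral_indicator hZm, Measure.restrict_restrict hZm]
    simp only [lintegral_one, Measure.restrict_apply_univ]
    refine measure_mono_null ?_ ((convex_body S).addHaar_frontier volume)
    rintro x ⟨hx, hxb⟩
    refine ⟨subset_closure hxb, fun hxi => ?_⟩
    have := (mem_interior_body S).1 hxi i
    rw [hZ, Set.mem_ofPred_eq] at hx
    linarith
  rw [hz] at h
  have e : ∀ t ∈ Set.Ioo (0 : ℝ) 1, ENNReal.ofReal (height S l * t ^ (d - 1)) *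
      ∫⁻ z in facet S l, Z.indicator (fun _ => (1 : ENNReal)) (S.points l + t • (z - S.points l))
        ∂(surf d) = ENNReal.ofReal (height S l * t ^ (d - 1)) * surf d (facet S l ∩ Z) := by
    intro t ht
    congr 1
    have : ∀ z, Z.indicator (fun _ => (1 : ENNReal)) (S.points l + t • (z - S.points l)) =
        Z.indicator (fun _ => (1 : ENNReal)) z := by
      intro z
      have hiff : S.points l + t • (z - S.points l) ∈ Z ↔ z ∈ Z := by
        simp only [hZ, Set.mem_ofPred_eq]
        rw [lam_cone, if_neg hi]
        simp [ht.1.ne']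
      by_cases hzZ : z ∈ Z
      · rw [Set.indicator_of_mem hzZ, Set.indicator_of_mem (hiff.2 hzZ)]
      · rw [Set.indicator_of_notMem hzZ, Set.indicator_of_notMem fun h => hzZ (hiff.1 h)]
    simp only [this]
    rw [lintegral_indicator hZm, Measure.restrict_restrict hZm]
    simp [Set.inter_comm]
  have hm : Measurable fun t : ℝ => ENNReal.ofReal (height S l * t ^ (d - 1)) := by fun_prop
  rw [setLIntegral_congr_fun measurableSet_Ioo e, lintegral_mul_const _ hm,
    lintegral_height_pow S hd, eq_comm, mul_eq_zero] at h
  refine h.resolve_left ?_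
  have := height_pos S hd l
  simpa using by positivity

/-- The relative interior of a face. -/
def relFacet (l : Fin (d + 1)) : Set (Space d) :=
  {x | lam S l x = 0 ∧ ∀ i, i ≠ l → 0 < lam S i x}

lemma relFacet_subset (l : Fin (d + 1)) : relFacet S l ⊆ facet S l := by
  rintro x ⟨h1, h2⟩
  refine (mem_facet S).2 ⟨fun i => ?_, h1⟩
  by_cases hi : i = l
  · rw [hi, h1]
  · exact (h2 i hi).le

lemma surf_facet_diff_relFacet (hd : 0 < d) (l : Fin (d + 1)) :
    surf d (facet S l \ relFacet S l) = 0 := by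
  have hsub : facet S l \ relFacet S l ⊆
      ⋃ i ∈ {i : Fin (d + 1) | i ≠ l}, facet S l ∩ {x | lam S i x = 0} := by
    rintro x ⟨hx, hx2⟩
    obtain ⟨h1, h2⟩ := (mem_facet S).1 hx
    by_contra hcon
    refine hx2 ⟨h2, fun i hi => lt_of_le_of_ne (h1 i) fun h => hcon ?_⟩
    simp only [Set.mem_iUnion]
    exact ⟨i, hi, hx, h.symm⟩
  refine measure_mono_null hsub ((measure_biUnion_null_iff (Set.to_countable _)).2 fun i hi => ?_)
  exact surf_facet_inter_lam_eq_zero S hd hi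

/-- The simplex has positive volume, a multiple of the area of the face. Since the rest of the face
is null, the relative interior cannot be empty. -/
lemma relFacet_nonempty (hd : 0 < d) (l : Fin (d + 1)) : (relFacet S l).Nonempty := by
  have hv := volume_body_eq S hd l
  have hpos : 0 < volume (body S) :=
    Measure.measure_pos_of_nonempty_interior _ (interior_body_nonempty S)
  by_contra hcon
  rw [Set.not_nonempty_iff_eq_empty] at hcon
  have := surf_facet_diff_relFacet S hd l
  rw [hcon, Set.sdiff_empty] at this
  rw [this, mul_zero] at hv
  exact hpos.ne' hv

lemma lam_combo (i : Fin (d + 1)) (x y : Space d) (t : ℝ) :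
    lam S i ((1 - t) • x + t • y) = (1 - t) * lam S i x + t * lam S i y :=
  Convex.combo_affine_apply (by ring)

/-- Relatively open parts of a face have positive measure. -/
lemma surf_inter_facet_pos (hd : 0 < d) (l : Fin (d + 1)) {U : Set (Space d)} (hU : IsOpen U)
    (hne : (U ∩ facet S l).Nonempty) : 0 < surf d (U ∩ facet S l) := by
  obtain ⟨z, hzU, hz⟩ := hne
  obtain ⟨c, hc1, hc2⟩ := relFacet_nonempty S hd l
  obtain ⟨hz1, hz2⟩ := (mem_facet S).1 hz
  -- Moving `z` slightly towards a relative interior point stays in `U` and makes all other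
  -- barycentric coordinates positive; near the new point the face fills the hyperplane.
  obtain ⟨t, ht0, ht1, htU⟩ : ∃ t : ℝ, 0 < t ∧ t < 1 ∧ (1 - t) • z + t • c ∈ U := by
    have hcont : Continuous fun t : ℝ => (1 - t) • z + t • c := by fun_prop
    have h0 : (fun t : ℝ => (1 - t) • z + t • c) 0 ∈ U := by simpa using hzU
    have h1 : ∀ᶠ t in 𝓝[>] (0 : ℝ), (1 - t) • z + t • c ∈ U :=
      nhdsWithin_le_nhds (hcont.continuousAt.eventually (hU.mem_nhds h0))
    have h2 : ∀ᶠ t in 𝓝[>] (0 : ℝ), t < 1 := nhdsWithin_le_nhds (gt_mem_nhds one_pos)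
    obtain ⟨t, h3, h4, h5⟩ := (eventually_mem_nhdsWithin.and (h2.and h1)).exists
    exact ⟨t, h3, h4, h5⟩
  set x := (1 - t) • z + t • c with hx
  have hxl : lam S l x = 0 := by rw [hx, lam_combo, hz2, hc1]; simp
  have hxi : ∀ i, i ≠ l → 0 < lam S i x := fun i hi => by
    rw [hx, lam_combo]
    exact add_pos_of_nonneg_of_pos (mul_nonneg (by linarith) (hz1 i)) (mul_pos ht0 (hc2 i hi))
  set n := outwardNormal S l with hn'
  have hn : ‖n‖ = 1 := norm_outwardNormal S hd l
  set O : Set (Space d) := U ∩ {y | ∀ i, i ≠ l → 0 < lam S i y} with hO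
  have hOo : IsOpen O := by
    refine hU.inter ?_
    have : {y | ∀ i, i ≠ l → 0 < lam S i y} = ⋂ i, {y | i ≠ l → 0 < lam S i y} := by
      ext y; simp
    rw [this]
    refine isOpen_iInter_of_finite fun i => ?_
    by_cases hi : i = l
    · simp [hi]
    · simpa [hi] using isOpen_lt continuous_const (lam_continuous S i)
  have hsub : O ∩ {y | inner ℝ n (y - x) = 0} ⊆ U ∩ facet S l := by
    rintro y ⟨⟨hyU, hy⟩, hyn⟩
    refine ⟨hyU, relFacet_subset S l ⟨?_, hy⟩⟩
    have h1 := inner_outwardNormal S hd l y x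
    rw [Set.mem_ofPred_eq] at hyn
    rw [← hn', hyn, hxl, sub_zero, eq_comm, neg_eq_zero, mul_eq_zero] at h1
    exact h1.resolve_left (height_pos S hd l).ne'
  refine lt_of_lt_of_le ?_ (measure_mono hsub)
  have h1 := lintegral_surf_hyperplane hn x (f := O.indicator fun _ => 1)
    (measurable_const.indicator hOo.measurableSet)
  rw [lintegral_indicator hOo.measurableSet, Measure.restrict_restrict hOo.measurableSet] at h1
  simp only [lintegral_one, Measure.restrict_apply_univ] at h1
  rw [h1]
  have hpre : IsOpen ((fun y : (ℝ ∙ n)ᗮ => x + (y : Space d)) ⁻¹' O) :=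
    hOo.preimage (by fun_prop)
  have e : ∀ y : (ℝ ∙ n)ᗮ, O.indicator (fun _ => (1 : ENNReal)) (x + (y : Space d)) =
      ((fun y : (ℝ ∙ n)ᗮ => x + (y : Space d)) ⁻¹' O).indicator 1 y := fun y => rfl
  simp only [e]
  rw [lintegral_indicator_one hpre.measurableSet]
  refine hpre.measure_pos volume ⟨0, ?_⟩
  simpa [hO] using ⟨htU, hxi⟩

lemma eq_zero_of_ae_eq_zero_facet (hd : 0 < d) (l : Fin (d + 1)) {φ : Space d → ℝ}
    (hφ : Continuous φ) (h : ∀ᵐ x ∂((surf d).restrict (facet S l)), φ x = 0) :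
    ∀ x ∈ facet S l, φ x = 0 := by
  by_contra! hcon
  obtain ⟨x, hx, hx0⟩ := hcon
  have hU : IsOpen {x | φ x ≠ 0} := isOpen_ne_fun hφ continuous_const
  have := surf_inter_facet_pos S hd l hU ⟨x, hx0, hx⟩
  rw [ae_iff, Measure.restrict_apply hU.measurableSet] at h
  exact this.ne h.symm

/-- Near a relatively interior point of a face, the simplex is a half space. -/
lemma exists_halfBall_subset (hd : 0 < d) {l : Fin (d + 1)} {x : Space d}
    (hx : x ∈ relFacet S l) : ∃ ε > 0, ∀ y ∈ Metric.ball x ε,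
      inner ℝ (outwardNormal S l) (y - x) ≤ 0 → y ∈ body S := by
  have hev : ∀ᶠ y in 𝓝 x, ∀ i, i ≠ l → 0 < lam S i y := by
    refine eventually_all.2 fun i => ?_
    by_cases hi : i = l
    · simp [hi]
    · filter_upwards [(lam_continuous S i).continuousAt.eventually (lt_mem_nhds (hx.2 i hi))]
        with y hy _ using hy
  obtain ⟨ε, hε, h⟩ := Metric.eventually_nhds_iff_ball.1 hev
  refine ⟨ε, hε, fun y hy hyn => (mem_body S).2 fun i => ?_⟩
  by_cases hi : i = l
  · rw [inner_outwardNormal S hd, hx.1, sub_zero] at hyn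
    rw [hi]
    have := height_pos S hd l
    by_contra hneg
    push Not at hneg
    nlinarith
  · exact (h y hy i hi).le

/-- The diameter of the ball along the normal changes `λ_l` by `2 * ρ / height`, and `λ_l` only
takes values between `0` and `1` on the simplex. -/
lemma two_mul_le_height (hd : 0 < d) (l : Fin (d + 1)) {c : Space d} {ρ : ℝ} (hρ : 0 ≤ ρ)
    (hc : Metric.closedBall c ρ ⊆ body S) : 2 * ρ ≤ height S l := by
  set n := outwardNormal S l with hn'
  have hn : ‖n‖ = 1 := norm_outwardNormal S hd l
  have h1 : c + ρ • n ∈ body S := hc (by simp [norm_smul, hn, abs_of_nonneg hρ])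
  have h2 : c - ρ • n ∈ body S := hc (by simp [norm_smul, hn, abs_of_nonneg hρ])
  have h3 := inner_outwardNormal S hd l (c + ρ • n) (c - ρ • n)
  have e : c + ρ • n - (c - ρ • n) = (2 * ρ) • n := by rw [two_mul, add_smul]; abel
  rw [e, ← hn', inner_smul_right, real_inner_self_eq_norm_sq, hn] at h3
  have h4 := (mem_body S).1 h1 l
  have h5 := lam_le_one S h2 l
  have := height_pos S hd l
  nlinarith

lemma height_le (hd : 0 < d) (l : Fin (d + 1)) {h : ℝ}
    (hh : ∀ x ∈ body S, ∀ y ∈ body S, ‖x - y‖ ≤ h) : height S l ≤ h := by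
  have : Nontrivial (Fin (d + 1)) := Fin.nontrivial_iff_two_le.2 (by omega)
  obtain ⟨i, hi⟩ := exists_ne l
  have h1 := inner_outwardNormal S hd l (S.points i) (S.points l)
  rw [lam_points_self, lam_points_of_ne S hi.symm] at h1
  have h2 := real_inner_le_norm (outwardNormal S l) (S.points i - S.points l)
  rw [norm_outwardNormal S hd, one_mul] at h2
  have h3 := hh _ (points_mem_body S i) _ (points_mem_body S l)
  linarith

/-! ### The divergence theorem on a simplex -/

/-- The cone formula for integrals of continuous functions. -/
lemma integral_body_eq_cone (hd : 0 < d) (l : Fin (d + 1)) {f : Space d → ℝ}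
    (hf : Continuous f) :
    ∫ x in body S, f x = ∫ z in facet S l, (∫ t in (0 : ℝ)..1, height S l * t ^ (d - 1) *
      f (S.points l + t • (z - S.points l))) ∂(surf d) := by
  have hH := height_pos S hd l
  have hfinF := isFiniteMeasure_facet S hd l
  set dens : ℝ → ENNReal := fun t => ENNReal.ofReal (height S l * t ^ (d - 1)) with hdens
  have hdm : Measurable dens := by fun_prop
  set ν : Measure ℝ := (volume.restrict (Set.Ioo (0 : ℝ) 1)).withDensity dens with hν
  have hνfin : IsFiniteMeasure ν := by
    refine ⟨?_⟩
    rw [hν, withDensity_apply _ MeasurableSet.univ, Measure.restrict_univ, hdens,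
      lintegral_height_pow S hd]
    exact ENNReal.ofReal_lt_top
  -- The cone formula says that Lebesgue measure on the simplex is the image under `Ψ` of a finite
  -- product measure; this carries it over from nonnegative to signed functions.
  set Ψ : ℝ × Space d → Space d := fun q => S.points l + q.1 • (q.2 - S.points l) with hΨ
  have hΨm : Measurable Ψ := by fun_prop
  have hmeas : Measure.map Ψ (ν.prod ((surf d).restrict (facet S l))) =
      volume.restrict (body S) := by
    refine Measure.ext_of_lintegral _ fun g hg => ?_
    have hgΨ : Measurable fun q => g (Ψ q) := hg.comp hΨm
    rw [lintegral_map hg hΨm, lintegral_prod _ hgΨ.aemeasurable,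
      lintegral_body_eq_cone S hd l hg, hν,
      lintegral_withDensity_eq_lintegral_mul _ hdm hgΨ.lintegral_prod_right']
    rfl
  have hint : Integrable f (Measure.map Ψ (ν.prod ((surf d).restrict (facet S l)))) := by
    rw [hmeas]
    exact hf.continuousOn.integrableOn_compact (isCompact_body S)
  have hint2 : Integrable (fun q => f (Ψ q)) (ν.prod ((surf d).restrict (facet S l))) :=
    (integrable_map_measure hf.aestronglyMeasurable hΨm.aemeasurable).1 hint
  rw [← hmeas, integral_map hΨm.aemeasurable hf.aestronglyMeasurable,
    integral_prod_symm _ hint2]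
  refine integral_congr_ae (Eventually.of_forall fun z => ?_)
  simp only [hΨ, hν]
  rw [integral_withDensity_eq_integral_toReal_smul hdm
    (Eventually.of_forall fun t => ENNReal.ofReal_lt_top),
    intervalIntegral.integral_of_le zero_le_one, integral_Ioc_eq_integral_Ioo]
  refine setIntegral_congr_fun measurableSet_Ioo fun t ht => ?_
  simp only [hdens, smul_eq_mul]
  rw [ENNReal.toReal_ofReal (mul_nonneg hH.le (pow_nonneg ht.1.le _))]

/-- The divergence theorem for the field `(x - p_l) φ`. -/
lemma integral_cone_divergence (hd : 0 < d) (l : Fin (d + 1)) {φ : Space d → ℝ}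
    (hφ : ContDiff ℝ ∞ φ) :
    ∫ x in body S, (d * φ x + fderiv ℝ φ x (x - S.points l)) =
      height S l * ∫ z in facet S l, φ z ∂(surf d) := by
  have hdφ : Continuous (fderiv ℝ φ) := hφ.continuous_fderiv (by simp)
  have hc : Continuous fun x => d * φ x + fderiv ℝ φ x (x - S.points l) :=
    (continuous_const.mul hφ.continuous).add
      (hdφ.clm_apply (continuous_id.sub continuous_const))
  rw [integral_body_eq_cone S hd l hc, ← integral_const_mul]
  refine integral_congr_ae (Eventually.of_forall fun z => ?_)
  simp only
  set p := S.points l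
  set γ : ℝ → Space d := fun t => p + t • (z - p) with hγ
  have hγd : ∀ t, HasDerivAt γ (z - p) t := fun t => by
    have h1 : HasDerivAt (fun t : ℝ => t • (z - p)) ((1 : ℝ) • (z - p)) t :=
      (hasDerivAt_id t).smul_const _
    rw [one_smul] at h1
    exact h1.const_add p
  have hγc : Continuous γ := by fun_prop
  -- On each ray from the vertex the integrand is the derivative of `H * t ^ d * φ`, so the inner
  -- integral is the value at the face.
  have hder : ∀ t, HasDerivAt (fun t => height S l * (t ^ d * φ (γ t)))
      (height S l * t ^ (d - 1) * (d * φ (γ t) + fderiv ℝ φ (γ t) (γ t - p))) t := by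
    intro t
    have h1 : HasDerivAt (fun t => φ (γ t)) (fderiv ℝ φ (γ t) (z - p)) t :=
      ((hφ.differentiable (by simp)) (γ t)).hasFDerivAt.comp_hasDerivAt t (hγd t)
    have h2 : HasDerivAt (fun t => height S l * (t ^ d * φ (γ t))) (height S l *
        (↑d * t ^ (d - 1) * φ (γ t) + t ^ d * (fderiv ℝ φ (γ t)) (z - p))) t :=
      ((hasDerivAt_pow d t).mul h1).const_mul (height S l)
    refine h2.congr_deriv ?_
    have e1 : γ t - p = t • (z - p) := by simp [hγ]
    have e2 : t ^ d = t ^ (d - 1) * t := by rw [← pow_succ]; congr 1; omega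
    rw [e1, map_smul, smul_eq_mul, e2]
    ring
  rw [intervalIntegral.integral_eq_sub_of_hasDerivAt (fun t _ => hder t)]
  · simp [hγ, hd.ne']
  · refine Continuous.intervalIntegrable ?_ _ _
    exact (continuous_const.mul (continuous_pow _)).mul ((continuous_const.mul
      (hφ.continuous.comp hγc)).add ((hdφ.comp hγc).clm_apply (hγc.sub continuous_const)))

lemma sum_inner_glam_smul (v : Space d) : ∑ l, inner ℝ (glam S l) v • S.points l = v := by
  have h : ∀ x y : Space d, ∑ l, inner ℝ (glam S l) (x - y) • S.points l = x - y := fun x y => by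
    simp only [inner_glam_sub, sub_smul, Finset.sum_sub_distrib, sum_lam_smul]
  simpa using h v 0

lemma sum_inner_glam (v : Space d) : ∑ l, inner ℝ (glam S l) v = 0 := by
  have h : ∀ x y : Space d, ∑ l, inner ℝ (glam S l) (x - y) = 0 := fun x y => by
    simp only [inner_glam_sub, Finset.sum_sub_distrib, sum_lam, sub_self]
  simpa using h v 0

/-- The divergence theorem on a simplex. -/
theorem integral_fderiv_body (hd : 0 < d) {φ : Space d → ℝ} (hφ : ContDiff ℝ ∞ φ)
    (v : Space d) :
    ∫ x in body S, fderiv ℝ φ x v =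
      ∑ l, inner ℝ (outwardNormal S l) v * ∫ z in facet S l, φ z ∂(surf d) := by
  have hdφ : Continuous (fderiv ℝ φ) := hφ.continuous_fderiv (by simp)
  have hK := isCompact_body S
  -- The constant field `v` is a combination, with coefficients independent of `x`, of the radial
  -- fields `x - p_l` treated before. The coefficients add up to zero, so the zero-order terms `d *
  -- φ` cancel.
  have hv : ∀ x : Space d, v = ∑ l, (-inner ℝ (glam S l) v) • (x - S.points l) := by
    intro x
    simp only [smul_sub, Finset.sum_sub_distrib, neg_smul, Finset.sum_neg_distrib,
      sum_inner_glam_smul, ← Finset.sum_smul, sum_inner_glam]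
    simp
  have h1 : ∀ x, fderiv ℝ φ x v =
      ∑ l, (-inner ℝ (glam S l) v) * (d * φ x + fderiv ℝ φ x (x - S.points l)) := by
    intro x
    conv_lhs => rw [hv x]
    simp only [map_sum, map_smul, smul_eq_mul, mul_add, Finset.sum_add_distrib]
    rw [← Finset.sum_mul, Finset.sum_neg_distrib, sum_inner_glam]
    simp
  simp only [h1]
  rw [integral_finsetSum]
  · refine Finset.sum_congr rfl fun l _ => ?_
    rw [integral_const_mul, integral_cone_divergence S hd l hφ, ← mul_assoc]
    congr 1
    rw [outwardNormal_eq S hd, inner_neg_left, inner_smul_left]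
    simp
    ring
  · intro l _
    refine ((continuous_const.mul ((continuous_const.mul hφ.continuous).add
      (hdφ.clm_apply (continuous_id.sub continuous_const)))).continuousOn).integrableOn_compact hK

lemma integral_partialD_body (hd : 0 < d) {φ : Space d → ℝ} (hφ : ContDiff ℝ ∞ φ)
    (j : Fin d) :
    ∫ x in body S, partialD j φ x =
      ∑ l, outwardNormal S l j * ∫ z in facet S l, φ z ∂(surf d) := by
  have := integral_fderiv_body S hd hφ (EuclideanSpace.single j 1)
  simpa [partialD, EuclideanSpace.inner_single_right] using this

/-- The trace inequality on a simplex, for smooth functions. -/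
lemma integral_facet_sq_le (hd : 0 < d) (l : Fin (d + 1)) {h : ℝ}
    (hh : ∀ x ∈ body S, ∀ y ∈ body S, ‖x - y‖ ≤ h) {φ : Space d → ℝ} (hφ : ContDiff ℝ ∞ φ) :
    height S l * ∫ z in facet S l, φ z ^ 2 ∂(surf d) ≤
      (d + 1) * (∫ x in body S, φ x ^ 2) + h ^ 2 * ∑ i, ∫ x in body S, partialD i φ x ^ 2 := by
  have hK := isCompact_body S
  have hdφ : Continuous (fderiv ℝ φ) := hφ.continuous_fderiv (by simp)
  have hφ2 : ContDiff ℝ ∞ fun x => φ x ^ 2 := hφ.pow 2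
  rw [← integral_cone_divergence S hd l hφ2]
  have e3 : ∫ x in body S, gradSq φ x = ∑ i, ∫ x in body S, partialD i φ x ^ 2 :=
    integral_finsetSum _ fun i _ =>
      ((continuous_partialD hφ i).pow 2).continuousOn.integrableOn_compact hK
  have i1 : IntegrableOn (fun x => φ x ^ 2) (body S) :=
    hφ2.continuous.continuousOn.integrableOn_compact hK
  have i2 : IntegrableOn (gradSq φ) (body S) :=
    (continuous_gradSq hφ).continuousOn.integrableOn_compact hK
  rw [← e3, ← integral_const_mul, ← integral_const_mul,
    ← integral_add (i1.const_mul _) (i2.const_mul _)]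
  refine setIntegral_mono_on ?_ ((i1.const_mul _).add (i2.const_mul _)) hK.measurableSet ?_
  · refine ((continuous_const.mul hφ2.continuous).add
      ((hφ2.continuous_fderiv (by simp)).clm_apply
        (continuous_id.sub continuous_const))).continuousOn.integrableOn_compact hK
  · intro x hx
    have h1 : fderiv ℝ (fun x => φ x ^ 2) x (x - S.points l) =
        2 * φ x * fderiv ℝ φ x (x - S.points l) := by
      have := (((hφ.differentiable (by simp)) x).hasFDerivAt.pow 2).fderiv
      have h2 : fderiv ℝ (fun x => φ x ^ 2) x = _ := this
      rw [h2]
      simp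
    rw [h1]
    -- Young's inequality for the mixed term `2 * φ * Dφ` turns the coefficient `d` into `d + 1` and
    -- leaves the squared gradient.
    have h2 := sq_fderiv_apply_le φ x (x - S.points l)
    have h3 : ‖x - S.points l‖ ^ 2 * gradSq φ x ≤ h ^ 2 * gradSq φ x :=
      mul_le_mul_of_nonneg_right (pow_le_pow_left₀ (norm_nonneg _)
        (hh x hx _ (points_mem_body S l)) 2) (gradSq_nonneg _ _)
    nlinarith [sq_nonneg (φ x - fderiv ℝ φ x (x - S.points l))]

end Simplex

end SFWG

end

noncomputable section

namespace SFWG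

/-! ### Polynomials as functions -/

section PolyFun

variable {d : ℕ}

@[simp] lemma pval_add (p q : Poly d) (x : Space d) : pval (p + q) x = pval p x + pval q x := by
  simp [pval]
@[simp] lemma pval_sub (p q : Poly d) (x : Space d) : pval (p - q) x = pval p x - pval q x := by
  simp [pval]
@[simp] lemma pval_mul (p q : Poly d) (x : Space d) : pval (p * q) x = pval p x * pval q x := by
  simp [pval]
@[simp] lemma pval_C (a : ℝ) (x : Space d) : pval (MvPolynomial.C a : Poly d) x = a := by
  simp [pval]
@[simp] lemma pval_X (i : Fin d) (x : Space d) : pval (MvPolynomial.X i : Poly d) x = x i := by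
  simp [pval]
@[simp] lemma pval_zero (x : Space d) : pval (0 : Poly d) x = 0 := by simp [pval]
@[simp] lemma pval_one (x : Space d) : pval (1 : Poly d) x = 1 := by simp [pval]
@[simp] lemma pval_smul (a : ℝ) (p : Poly d) (x : Space d) : pval (a • p) x = a * pval p x := by
  simp [pval, MvPolynomial.smul_eval]
@[simp] lemma pval_sum {ι : Type*} (s : Finset ι) (p : ι → Poly d) (x : Space d) :
    pval (∑ i ∈ s, p i) x = ∑ i ∈ s, pval (p i) x := by
  simp [pval]

lemma contDiff_pval (p : Poly d) : ContDiff ℝ ∞ (pval p) := by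
  induction p using MvPolynomial.induction_on with
  | C a =>
    have : pval (MvPolynomial.C a : Poly d) = fun _ => a := by ext; simp
    rw [this]
    exact contDiff_const
  | add p q hp hq =>
    have : pval (p + q) = fun x => pval p x + pval q x := by ext; simp
    rw [this]
    exact hp.add hq
  | mul_X p i hp =>
    have : pval (p * MvPolynomial.X i) = fun x => pval p x * x i := by ext; simp
    rw [this]
    exact hp.mul (by fun_prop)

lemma continuous_pval (p : Poly d) : Continuous (pval p) := (contDiff_pval p).continuous

lemma partialD_add {φ ψ : Space d → ℝ} (hφ : ContDiff ℝ ∞ φ) (hψ : ContDiff ℝ ∞ ψ) (i : Fin d)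
    (x : Space d) : partialD i (fun x => φ x + ψ x) x = partialD i φ x + partialD i ψ x := by
  have h : HasFDerivAt (fun x => φ x + ψ x) _ x :=
    ((hφ.differentiable (by simp)) x).hasFDerivAt.add ((hψ.differentiable (by simp)) x).hasFDerivAt
  rw [partialD, h.fderiv]
  rfl

lemma partialD_sub {φ ψ : Space d → ℝ} (hφ : ContDiff ℝ ∞ φ) (hψ : ContDiff ℝ ∞ ψ) (i : Fin d)
    (x : Space d) : partialD i (fun x => φ x - ψ x) x = partialD i φ x - partialD i ψ x := by
  have h : HasFDerivAt (fun x => φ x - ψ x) _ x :=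
    ((hφ.differentiable (by simp)) x).hasFDerivAt.sub ((hψ.differentiable (by simp)) x).hasFDerivAt
  rw [partialD, h.fderiv]
  rfl

lemma partialD_mul {φ ψ : Space d → ℝ} (hφ : ContDiff ℝ ∞ φ) (hψ : ContDiff ℝ ∞ ψ) (i : Fin d)
    (x : Space d) :
    partialD i (fun x => φ x * ψ x) x = partialD i φ x * ψ x + φ x * partialD i ψ x := by
  have h : HasFDerivAt (fun x => φ x * ψ x) _ x :=
    ((hφ.differentiable (by simp)) x).hasFDerivAt.mul ((hψ.differentiable (by simp)) x).hasFDerivAt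
  rw [partialD, h.fderiv]
  simp only [add_apply, smul_apply, smul_eq_mul, partialD]
  ring

lemma partialD_const (c : ℝ) (i : Fin d) (x : Space d) : partialD i (fun _ => c) x = 0 := by
  simp [partialD]

lemma partialD_coord (i j : Fin d) (x : Space d) :
    partialD i (fun x : Space d => x j) x = if i = j then 1 else 0 := by
  have h : HasFDerivAt (fun x : Space d => x j) (EuclideanSpace.proj j : Space d →L[ℝ] ℝ) x :=
    (EuclideanSpace.proj j : Space d →L[ℝ] ℝ).hasFDerivAt
  rw [partialD, h.fderiv]
  simp [eq_comm]

lemma partialD_pval (p : Poly d) (i : Fin d) (x : Space d) :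
    partialD i (pval p) x = pval (MvPolynomial.pderiv i p) x := by
  induction p using MvPolynomial.induction_on with
  | C a =>
    have : pval (MvPolynomial.C a : Poly d) = fun _ => a := by ext; simp
    rw [this, partialD_const]
    simp
  | add p q hp hq =>
    have : pval (p + q) = fun x => pval p x + pval q x := by ext; simp
    rw [this, partialD_add (contDiff_pval p) (contDiff_pval q), hp, hq]
    simp
  | mul_X p j hp =>
    have : pval (p * MvPolynomial.X j) = fun x => pval p x * x j := by ext; simp
    rw [this, partialD_mul (contDiff_pval p) (by fun_prop), hp, partialD_coord]
    rw [Derivation.leibniz, MvPolynomial.pderiv_X]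
    simp only [smul_eq_mul, pval_add, pval_mul, pval_X]
    by_cases h : i = j
    · subst h; simp; ring
    · simp [h, Ne.symm h]; ring

end PolyFun

/-! ### Traces of `H¹` functions on the faces of a simplex -/

section Trace

variable {d : ℕ} {S : Affine.Simplex ℝ (Space d) d}

/-- Inclusion up to a null set is the useful form, since the closed elements and simplices may reach
the boundary of the open domain. -/
lemma TendstoH1.mono {U K : Set (Space d)} {φ : ℕ → Space d → ℝ} {w : Space d → ℝ}
    {G : Fin d → Space d → ℝ} (h : TendstoH1 U φ w G) (hK : K ≤ᵐ[volume] U) :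
    TendstoH1 K φ w G := by
  have hm : volume.restrict K ≤ volume.restrict U := Measure.restrict_mono' hK le_rfl
  refine ⟨h.1.mono_measure hm, fun i => (h.2.1 i).mono_measure hm, ?_, fun i => ?_⟩
  · exact tendsto_of_tendsto_of_tendsto_of_le_of_le tendsto_const_nhds h.2.2.1
      (fun _ => zero_le) fun n => eLpNorm_mono_measure _ hm
  · exact tendsto_of_tendsto_of_tendsto_of_le_of_le tendsto_const_nhds (h.2.2.2 i)
      (fun _ => zero_le) fun n => eLpNorm_mono_measure _ hm

lemma memLp_body {φ : Space d → ℝ} (hφ : Continuous φ) : MemLp φ 2 (volume.restrict (body S)) :=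
  memLp_of_continuous_of_isCompact (isCompact_body S) (isCompact_body S).measure_lt_top.ne hφ

lemma memLp_facet (hd : 0 < d) (l : Fin (d + 1)) {φ : Space d → ℝ} (hφ : Continuous φ) :
    MemLp φ 2 ((surf d).restrict (facet S l)) :=
  memLp_of_continuous_of_isCompact (isCompact_facet S l) (surf_facet_ne_top S hd l) hφ

lemma body_norm_sub_le (S : Affine.Simplex ℝ (Space d) d) {x y : Space d} (hx : x ∈ body S)
    (hy : y ∈ body S) : ‖x - y‖ ≤ Metric.diam (body S) := by
  rw [← dist_eq_norm]
  exact Metric.dist_le_diam_of_mem (isCompact_body S).isBounded hx hy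

/-- Two smooth sequences with the same limit in `H¹` have asymptotically equal traces. -/
lemma TendstoH1.tendsto_facet_sub (hd : 0 < d) {φ ψ : ℕ → Space d → ℝ} {w : Space d → ℝ}
    {G : Fin d → Space d → ℝ} (hφ : ∀ n, ContDiff ℝ ∞ (φ n)) (hψ : ∀ n, ContDiff ℝ ∞ (ψ n))
    (h : TendstoH1 (body S) φ w G) (h' : TendstoH1 (body S) ψ w G) (l : Fin (d + 1)) :
    Tendsto (fun p : ℕ × ℕ => ∫ x in facet S l, (φ p.1 x - ψ p.2 x) ^ 2 ∂(surf d))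
      atTop (𝓝 0) := by
  have hK := isCompact_body S
  have hH := height_pos S hd l
  obtain ⟨a1, a2⟩ := h.tendsto_sq hK hφ
  obtain ⟨b1, b2⟩ := h'.tendsto_sq hK hψ
  set D := Metric.diam (body S)
  have hb : ∀ p : ℕ × ℕ, ∫ x in facet S l, (φ p.1 x - ψ p.2 x) ^ 2 ∂(surf d) ≤
      (height S l)⁻¹ * ((d + 1) * (2 * (∫ x in body S, (φ p.1 x - w x) ^ 2) +
        2 * ∫ x in body S, (ψ p.2 x - w x) ^ 2) +
      D ^ 2 * ∑ i, (2 * (∫ x in body S, (partialD i (φ p.1) x - G i x) ^ 2) +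
        2 * ∫ x in body S, (partialD i (ψ p.2) x - G i x) ^ 2)) := by
    intro p
    rw [← div_eq_inv_mul, le_div_iff₀ hH, mul_comm]
    refine (integral_facet_sq_le S hd l (fun x hx y hy => body_norm_sub_le S hx hy)
      ((hφ p.1).sub (hψ p.2))).trans ?_
    have e : ∀ {f g k : Space d → ℝ}, MemLp f 2 (volume.restrict (body S)) →
        MemLp g 2 (volume.restrict (body S)) → MemLp k 2 (volume.restrict (body S)) →
        ∫ x in body S, (f x - g x) ^ 2 ≤ 2 * (∫ x in body S, (f x - k x) ^ 2) +
          2 * ∫ x in body S, (g x - k x) ^ 2 := by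
      intro f g k hf hg hk
      have h1 := integral_add_sq_le (hf.sub hk) (hk.sub hg)
      simp only [Pi.sub_apply, sub_add_sub_cancel] at h1
      refine h1.trans_eq ?_
      congr 2
      refine integral_congr_ae (Eventually.of_forall fun x => ?_)
      simp only
      ring
    gcongr with i
    · exact e (memLp_body (hφ p.1).continuous) (memLp_body (hψ p.2).continuous) h.1
    · have : ∀ x, partialD i (fun x => φ p.1 x - ψ p.2 x) x =
          partialD i (φ p.1) x - partialD i (ψ p.2) x :=
        fun x => partialD_sub (hφ p.1) (hψ p.2) i x
      change ∫ x in body S, partialD i (fun x => φ p.1 x - ψ p.2 x) x ^ 2 ≤ _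
      simp only [this]
      exact e (memLp_body (continuous_partialD (hφ p.1) i))
        (memLp_body (continuous_partialD (hψ p.2) i)) (h.2.1 i)
  refine squeeze_zero (fun p => integral_nonneg fun x => sq_nonneg _) hb ?_
  have hfst : Tendsto (Prod.fst : ℕ × ℕ → ℕ) atTop atTop := by
    rw [← prod_atTop_atTop_eq]; exact tendsto_fst
  have hsnd : Tendsto (Prod.snd : ℕ × ℕ → ℕ) atTop atTop := by
    rw [← prod_atTop_atTop_eq]; exact tendsto_snd
  have t1 := (((a1.comp hfst).const_mul 2).add ((b1.comp hsnd).const_mul 2)).const_mul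
    ((d : ℝ) + 1)
  have t2 := (tendsto_finsetSum Finset.univ fun i _ =>
    (((a2 i).comp hfst).const_mul 2).add (((b2 i).comp hsnd).const_mul 2)).const_mul (D ^ 2)
  have t3 := (t1.add t2).const_mul (height S l)⁻¹
  simpa using t3

/-- The functions `g l` are the traces of `w`, with gradient `G`, on the faces of `S`. -/
def HasTraces (S : Affine.Simplex ℝ (Space d) d) (w : Space d → ℝ) (G : Fin d → Space d → ℝ)
    (g : Fin (d + 1) → Space d → ℝ) : Prop :=
  ∃ φ : ℕ → Space d → ℝ, (∀ n, ContDiff ℝ ∞ (φ n)) ∧ TendstoH1 (body S) φ w G ∧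
    (∀ l, MemLp (g l) 2 ((surf d).restrict (facet S l))) ∧
    ∀ l, Tendsto (fun n => ∫ x in facet S l, (φ n x - g l x) ^ 2 ∂(surf d)) atTop (𝓝 0)

lemma exists_closedBall_subset_body (S : Affine.Simplex ℝ (Space d) d) :
    ∃ c r, 0 < r ∧ Metric.closedBall c r ⊆ body S := by
  obtain ⟨c, hc⟩ := interior_body_nonempty S
  obtain ⟨r, hr, h⟩ := Metric.nhds_basis_closedBall.mem_iff.1 (mem_interior_iff_mem_nhds.1 hc)
  exact ⟨c, r, hr, h⟩

/-- By the trace inequality a smooth sequence that converges in `H¹` is Cauchy in `L²` of each face.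
One sequence serves all faces. -/
theorem exists_hasTraces (hd : 0 < d) {w : Space d → ℝ} {G : Fin d → Space d → ℝ}
    (hw : MemLp w 2 (volume.restrict (body S)))
    (hG : ∀ i, MemLp (G i) 2 (volume.restrict (body S)))
    (hD : ∀ i, HasWeakPartial (interior (body S)) i w (G i)) : ∃ g, HasTraces S w G g := by
  obtain ⟨c, r, hr, hc⟩ := exists_closedBall_subset_body S
  obtain ⟨φ, hφ, h⟩ := exists_tendstoH1_of_convex (isCompact_body S) (convex_body S) hr hc hw hG hD
  choose g hg1 hg2 using fun l => exists_tendsto_integral_sq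
    (fun n => memLp_facet hd l (hφ n).continuous) (h.tendsto_facet_sub hd hφ hφ h l)
  exact ⟨g, φ, hφ, h, hg1, hg2⟩

namespace HasTraces

variable {w : Space d → ℝ} {G : Fin d → Space d → ℝ} {g : Fin (d + 1) → Space d → ℝ}

lemma memLp (h : HasTraces S w G g) : MemLp w 2 (volume.restrict (body S)) := by
  obtain ⟨φ, hφ, h1, -⟩ := h
  exact h1.1

lemma memLp_grad (h : HasTraces S w G g) (i : Fin d) :
    MemLp (G i) 2 (volume.restrict (body S)) := by
  obtain ⟨φ, hφ, h1, -⟩ := h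
  exact h1.2.1 i

lemma memLp_trace (h : HasTraces S w G g) (l : Fin (d + 1)) :
    MemLp (g l) 2 ((surf d).restrict (facet S l)) := by
  obtain ⟨φ, hφ, -, h1, -⟩ := h
  exact h1 l

/-- Green's formula. -/
lemma green (hd : 0 < d) (h : HasTraces S w G g) {χ : Space d → ℝ} (hχ : ContDiff ℝ ∞ χ)
    (j : Fin d) :
    (∫ x in body S, G j x * χ x) + ∫ x in body S, w x * partialD j χ x =
      ∑ l, outwardNormal S l j * ∫ z in facet S l, g l z * χ z ∂(surf d) := by
  obtain ⟨φ, hφ, h1, hg, h2⟩ := h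
  obtain ⟨a1, a2⟩ := h1.tendsto_sq (isCompact_body S) hφ
  have t1 := tendsto_integral_mul_const
    (fun n => memLp_body (continuous_partialD (hφ n) j)) (h1.2.1 j) (memLp_body hχ.continuous)
    (a2 j)
  have t2 := tendsto_integral_mul_const
    (fun n => memLp_body (hφ n).continuous) h1.1 (memLp_body (continuous_partialD hχ j)) a1
  have t3 := tendsto_finsetSum Finset.univ fun l _ => (tendsto_integral_mul_const
    (fun n => memLp_facet hd l (hφ n).continuous) (hg l) (memLp_facet hd l hχ.continuous)
    (h2 l)).const_mul (outwardNormal S l j)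
  refine tendsto_nhds_unique (t1.add t2) (t3.congr fun n => ?_)
  rw [← integral_partialD_body S hd ((hφ n).mul hχ) j, ← integral_add
    (integrable_mul_of_memLp (memLp_body (continuous_partialD (hφ n) j))
      (memLp_body hχ.continuous))
    (integrable_mul_of_memLp (memLp_body (hφ n).continuous)
      (memLp_body (continuous_partialD hχ j)))]
  exact integral_congr_ae (Eventually.of_forall fun x => partialD_mul (hφ n) hχ j x)

/-- The trace inequality. -/
lemma facet_sq_le (hd : 0 < d) (h : HasTraces S w G g) (l : Fin (d + 1)) {D : ℝ}
    (hD : ∀ x ∈ body S, ∀ y ∈ body S, ‖x - y‖ ≤ D) :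
    height S l * ∫ z in facet S l, g l z ^ 2 ∂(surf d) ≤
      (d + 1) * (∫ x in body S, w x ^ 2) + D ^ 2 * ∑ i, ∫ x in body S, G i x ^ 2 := by
  obtain ⟨φ, hφ, h1, hg, h2⟩ := h
  obtain ⟨a1, a2⟩ := h1.tendsto_sq (isCompact_body S) hφ
  have t1 := (tendsto_integral_sq (fun n => memLp_facet hd l (hφ n).continuous) (hg l)
    (h2 l)).const_mul (height S l)
  have t2 := (tendsto_integral_sq (fun n => memLp_body (hφ n).continuous) h1.1 a1).const_mul
    ((d : ℝ) + 1)
  have t3 := (tendsto_finsetSum Finset.univ fun i _ => tendsto_integral_sq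
    (fun n => memLp_body (continuous_partialD (hφ n) i)) (h1.2.1 i) (a2 i)).const_mul (D ^ 2)
  exact le_of_tendsto_of_tendsto' t1 (t2.add t3) fun n => integral_facet_sq_le S hd l hD (hφ n)

lemma sub_smooth (hd : 0 < d) (h : HasTraces S w G g) {χ : Space d → ℝ} (hχ : ContDiff ℝ ∞ χ) :
    HasTraces S (fun x => w x - χ x) (fun i x => G i x - partialD i χ x)
      (fun l x => g l x - χ x) := by
  obtain ⟨φ, hφ, h1, hg, h2⟩ := h
  refine ⟨fun n x => φ n x - χ x, fun n => (hφ n).sub hχ, ⟨h1.1.sub (memLp_body hχ.continuous),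
    fun i => (h1.2.1 i).sub (memLp_body (continuous_partialD hχ i)), ?_, fun i => ?_⟩,
    fun l => (hg l).sub (memLp_facet hd l hχ.continuous), fun l => ?_⟩
  · simpa only [sub_sub_sub_cancel_right] using h1.2.2.1
  · simpa only [partialD_sub (hφ _) hχ, sub_sub_sub_cancel_right] using h1.2.2.2 i
  · simpa only [sub_sub_sub_cancel_right] using h2 l

/-- The Poincaré inequality. -/
lemma poincare (h : HasTraces S w G g) {D : ℝ}
    (hD : ∀ x ∈ body S, ∀ y ∈ body S, ‖x - y‖ ≤ D) :
    (∫ x in body S, w x ^ 2) - (∫ x in body S, w x) ^ 2 / volume.real (body S) ≤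
      2 ^ d * D ^ 2 * ∑ i, ∫ x in body S, G i x ^ 2 := by
  obtain ⟨φ, hφ, h1, hg, h2⟩ := h
  exact poincare_convex (isCompact_body S) (convex_body S) hD (volume_real_body_pos S) hφ h1

/-- The mean over a face differs from the mean over the simplex by a gradient term. -/
lemma cone (hd : 0 < d) (h : HasTraces S w G g) (l : Fin (d + 1)) :
    d * (∫ x in body S, w x) + ∑ j, ∫ x in body S, G j x * (x j - S.points l j) =
      height S l * ∫ z in facet S l, g l z ∂(surf d) := by
  obtain ⟨φ, hφ, h1, hg, h2⟩ := h
  have hfinF := isFiniteMeasure_facet S hd l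
  have hfinB : IsFiniteMeasure (volume.restrict (body S)) :=
    ⟨by simpa using (isCompact_body S).measure_lt_top⟩
  obtain ⟨a1, a2⟩ := h1.tendsto_sq (isCompact_body S) hφ
  have t1 := tendsto_integral_mul_const
    (fun n => memLp_body (hφ n).continuous) h1.1 (memLp_const (1 : ℝ)) a1
  have hc : ∀ j, Continuous fun x : Space d => x j - S.points l j := fun j => by fun_prop
  have t2 := tendsto_finsetSum Finset.univ fun j _ => tendsto_integral_mul_const
    (fun n => memLp_body (continuous_partialD (hφ n) j)) (h1.2.1 j) (memLp_body (hc j)) (a2 j)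
  have t3 := (tendsto_integral_mul_const
    (fun n => memLp_facet hd l (hφ n).continuous) (hg l) (memLp_const (1 : ℝ))
    (h2 l)).const_mul (height S l)
  simp only [mul_one] at t1 t3
  refine tendsto_nhds_unique ((t1.const_mul (d : ℝ)).add t2) (t3.congr fun n => ?_)
  rw [← integral_cone_divergence S hd l (hφ n), ← integral_const_mul, ← integral_finsetSum,
    ← integral_add]
  · refine integral_congr_ae (Eventually.of_forall fun x => ?_)
    simp only [fderiv_apply_eq_sum]
    congr 1
    exact Finset.sum_congr rfl fun j _ => by simp [mul_comm]
  · exact ((memLp_body (hφ n).continuous).integrable (by norm_num)).const_mul _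
  · exact integrable_finsetSum _ fun j _ => integrable_mul_of_memLp
      (memLp_body (continuous_partialD (hφ n) j)) (memLp_body (hc j))
  · exact fun j _ => integrable_mul_of_memLp
      (memLp_body (continuous_partialD (hφ n) j)) (memLp_body (hc j))

end HasTraces

end Trace

end SFWG

end

noncomputable section

namespace SFWG

/-! ### Monomials in the barycentric coordinates -/

section Barycentric

variable {d : ℕ} (S : Affine.Simplex ℝ (Space d) d)

/-- Multi-indices of degree `m` in the barycentric coordinates. -/
abbrev baryIndex (d m : ℕ) : Finset (Fin (d + 1) → ℕ) := Finset.piAntidiag Finset.univ m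

lemma mem_baryIndex {m : ℕ} {α : Fin (d + 1) → ℕ} : α ∈ baryIndex d m ↔ ∑ i, α i = m := by
  simp [baryIndex]

/-- The monomial `λ^α`. -/
def bmon (α : Fin (d + 1) → ℕ) (x : Space d) : ℝ := ∏ i, lam S i x ^ α i

/-- The barycentric coordinate as a polynomial. -/
def lamPoly (i : Fin (d + 1)) : Poly d :=
  MvPolynomial.C (lam S i 0) + ∑ j, MvPolynomial.C (glam S i j) * MvPolynomial.X j

lemma pval_lamPoly (i : Fin (d + 1)) (x : Space d) : pval (lamPoly S i) x = lam S i x := by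
  have h := inner_glam_sub S i x 0
  rw [sub_zero, PiLp.inner_apply] at h
  simp only [lamPoly, pval_add, pval_C, pval_sum, pval_mul, pval_X]
  have : ∑ j, glam S i j * x j = lam S i x - lam S i 0 := by
    rw [← h]; exact Finset.sum_congr rfl fun j _ => by simp [mul_comm]
  linarith

lemma totalDegree_lamPoly (i : Fin (d + 1)) : (lamPoly S i).totalDegree ≤ 1 := by
  refine (MvPolynomial.totalDegree_add _ _).trans (max_le (by simp) ?_)
  refine MvPolynomial.totalDegree_finsetSum_le fun j _ => ?_
  refine (MvPolynomial.totalDegree_mul _ _).trans ?_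
  simp

/-- The monomial `λ^α` as a polynomial. -/
def barPoly (α : Fin (d + 1) → ℕ) : Poly d := ∏ i, lamPoly S i ^ α i

lemma pval_barPoly (α : Fin (d + 1) → ℕ) (x : Space d) : pval (barPoly S α) x = bmon S α x := by
  unfold barPoly bmon
  simp only [pval, map_prod, map_pow]
  exact Finset.prod_congr rfl fun i _ => by rw [← pval_lamPoly]; rfl

lemma totalDegree_barPoly (α : Fin (d + 1) → ℕ) : (barPoly S α).totalDegree ≤ ∑ i, α i := by
  refine (MvPolynomial.totalDegree_finsetProd _ _).trans (Finset.sum_le_sum fun i _ => ?_)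
  refine (MvPolynomial.totalDegree_pow _ _).trans ?_
  have := totalDegree_lamPoly S i
  nlinarith

lemma continuous_bmon (α : Fin (d + 1) → ℕ) : Continuous (bmon S α) :=
  continuous_finsetProd _ fun i _ => (lam_continuous S i).pow _

lemma abs_bmon_le {x : Space d} (hx : x ∈ body S) (α : Fin (d + 1) → ℕ) : |bmon S α x| ≤ 1 := by
  have h0 : 0 ≤ bmon S α x := Finset.prod_nonneg fun i _ => pow_nonneg (mem_body S |>.1 hx i) _
  rw [abs_of_nonneg h0]
  exact Finset.prod_le_one (fun i _ => pow_nonneg (mem_body S |>.1 hx i) _)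
    fun i _ => pow_le_one₀ (mem_body S |>.1 hx i) (lam_le_one S hx i)

lemma bmon_eq_zero {x : Space d} {α : Fin (d + 1) → ℕ} {l : Fin (d + 1)} (hl : α l ≠ 0)
    (hx : lam S l x = 0) : bmon S α x = 0 :=
  Finset.prod_eq_zero (Finset.mem_univ l) (by rw [hx, zero_pow hl])

lemma bmon_cone {α : Fin (d + 1) → ℕ} {l : Fin (d + 1)} (hl : α l = 0) (t : ℝ) (z : Space d) :
    bmon S α (S.points l + t • (z - S.points l)) = t ^ (∑ i, α i) * bmon S α z := by
  unfold bmon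
  rw [← Finset.prod_pow_eq_pow_sum, ← Finset.prod_mul_distrib]
  refine Finset.prod_congr rfl fun i _ => ?_
  rw [lam_cone]
  rcases eq_or_ne i l with rfl | h
  · simp [hl]
  · simp [h, mul_pow]

/-- The directional derivative along the edge from `p_b` to `p_a`: in this direction `λ_a` grows
with slope `1`, `λ_b` falls with slope `1`, and the other coordinates are constant. A vanishing
exponent is harmless, since its factor in front is zero. -/
lemma sum_mul_pderiv_barPoly (a b : Fin (d + 1)) (α : Fin (d + 1) → ℕ)
    (x : Space d) :
    ∑ j, (S.points a - S.points b) j * pval (MvPolynomial.pderiv j (barPoly S α)) x =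
      α a * bmon S (Function.update α a (α a - 1)) x -
        α b * bmon S (Function.update α b (α b - 1)) x := by
  set v := S.points a - S.points b with hv
  have h1 : ∑ j, v j * pval (MvPolynomial.pderiv j (barPoly S α)) x =
      fderiv ℝ (pval (barPoly S α)) x v := by
    rw [fderiv_apply_eq_sum]
    exact Finset.sum_congr rfl fun j _ => by rw [partialD_pval]
  have hlam : ∀ i, ∀ t : ℝ, lam S i (x + t • v) =
      lam S i x + t * ((if i = a then 1 else 0) - (if i = b then 1 else 0)) := by
    intro i t
    have h2 := inner_glam_sub S i (x + t • v) x
    have h3 := inner_glam_sub S i (S.points a) (S.points b)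
    rw [add_sub_cancel_left, inner_smul_right, hv, h3, lam_points, lam_points] at h2
    linarith
  have hline : HasDerivAt (fun t : ℝ => x + t • v) v 0 := by
    simpa using ((hasDerivAt_id (0 : ℝ)).smul_const v).const_add x
  have hd1 : HasDerivAt (fun t : ℝ => pval (barPoly S α) (x + t • v))
      (fderiv ℝ (pval (barPoly S α)) x v) 0 := by
    have hf : HasFDerivAt (pval (barPoly S α)) (fderiv ℝ (pval (barPoly S α)) x)
        (x + (0 : ℝ) • v) := by
      rw [zero_smul, add_zero]
      exact ((contDiff_pval _).differentiable (by simp) x).hasFDerivAt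
    exact hf.comp_hasDerivAt (0 : ℝ) hline
  have hd2 : HasDerivAt (fun t : ℝ => ∏ i, (lam S i x + t *
      ((if i = a then 1 else 0) - (if i = b then 1 else 0))) ^ α i)
      (∑ i, (∏ j ∈ Finset.univ.erase i, lam S j x ^ α j) * ((α i : ℝ) * lam S i x ^ (α i - 1) *
        ((if i = a then 1 else 0) - (if i = b then 1 else 0)))) 0 := by
    have := HasDerivAt.fun_finsetProd (u := (Finset.univ : Finset (Fin (d + 1))))
      (f := fun i t => (lam S i x + t *
        ((if i = a then 1 else 0) - (if i = b then 1 else 0))) ^ α i)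
      (f' := fun i => (α i : ℝ) * lam S i x ^ (α i - 1) *
        ((if i = a then 1 else 0) - (if i = b then 1 else 0))) (x := (0 : ℝ)) (fun i _ => by
          have h := (((hasDerivAt_id (0 : ℝ)).mul_const
            ((if i = a then (1 : ℝ) else 0) - (if i = b then 1 else 0))).const_add
              (lam S i x)).fun_pow (α i)
          exact h.congr_deriv (by simp))
    exact this.congr_deriv (by simp)
  have heq : (fun t : ℝ => pval (barPoly S α) (x + t • v)) = fun t => ∏ i, (lam S i x + t *
      ((if i = a then 1 else 0) - (if i = b then 1 else 0))) ^ α i := by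
    ext t
    rw [pval_barPoly, bmon]
    exact Finset.prod_congr rfl fun i _ => by rw [hlam]
  rw [heq] at hd1
  have hup : ∀ i, (∏ j ∈ Finset.univ.erase i, lam S j x ^ α j) * lam S i x ^ (α i - 1) =
      bmon S (Function.update α i (α i - 1)) x := by
    intro i
    unfold bmon
    rw [← Finset.prod_erase_mul _ _ (Finset.mem_univ i)]
    congr 1
    · refine Finset.prod_congr rfl fun j hj => ?_
      rw [Function.update_of_ne (Finset.ne_of_mem_erase hj)]
    · rw [Function.update_self]
  rw [h1, hd1.unique hd2, ← hup a, ← hup b]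
  have : ∀ i, (∏ j ∈ Finset.univ.erase i, lam S j x ^ α j) * ((α i : ℝ) * lam S i x ^ (α i - 1) *
        ((if i = a then 1 else 0) - (if i = b then 1 else 0))) =
      (if i = a then α i * ((∏ j ∈ Finset.univ.erase i, lam S j x ^ α j) *
        lam S i x ^ (α i - 1)) else 0) - (if i = b then α i *
        ((∏ j ∈ Finset.univ.erase i, lam S j x ^ α j) * lam S i x ^ (α i - 1)) else 0) := by
    intro i
    split_ifs <;> ring
  rw [Finset.sum_congr rfl fun i _ => this i, Finset.sum_sub_distrib]
  simp

/-- The functions that are homogeneous polynomials of degree `m` in the barycentric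
coordinates. -/
def barySpan (m : ℕ) : Submodule ℝ (Space d → ℝ) :=
  Submodule.span ℝ (bmon S '' (baryIndex d m : Set (Fin (d + 1) → ℕ)))

lemma lam_mul_mem_barySpan {m : ℕ} {f : Space d → ℝ} (hf : f ∈ barySpan S m) (i : Fin (d + 1)) :
    (fun x => lam S i x * f x) ∈ barySpan S (m + 1) := by
  unfold barySpan at hf
  induction hf using Submodule.span_induction with
  | mem f hf =>
    obtain ⟨α, hα, rfl⟩ := hf
    refine Submodule.subset_span ⟨α + Pi.single i 1, ?_, ?_⟩
    · have := (mem_baryIndex (d := d)).1 hα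
      simp [Finset.sum_add_distrib, this]
    · ext x
      simp only [bmon, Pi.add_apply, pow_add, Finset.prod_mul_distrib]
      rw [mul_comm]
      congr 1
      rw [Finset.prod_eq_single i]
      · simp
      · intro j _ hj; simp [hj]
      · simp
  | zero =>
    have : (fun x => lam S i x * (0 : Space d → ℝ) x) = 0 := by ext x; simp
    rw [this]
    exact Submodule.zero_mem _
  | add f g _ _ hf hg =>
    have := Submodule.add_mem _ hf hg
    convert this using 1
    ext x; simp [mul_add]
  | smul c f _ hf =>
    have := Submodule.smul_mem _ c hf
    convert this using 1
    ext x; simp only [Pi.smul_apply, smul_eq_mul]; ring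

/-- The degree is raised by multiplying with `1 = ∑ λ_i`; this is why homogeneous polynomials in the
barycentric coordinates also represent polynomials of lower degree. -/
lemma barySpan_succ {m : ℕ} {f : Space d → ℝ} (hf : f ∈ barySpan S m) :
    f ∈ barySpan S (m + 1) := by
  have : f = ∑ i, fun x => lam S i x * f x := by
    ext x
    rw [Finset.sum_apply, ← Finset.sum_mul, sum_lam, one_mul]
  rw [this]
  exact Submodule.sum_mem _ fun i _ => lam_mul_mem_barySpan S hf i

lemma barySpan_mono {m n : ℕ} (h : m ≤ n) {f : Space d → ℝ} (hf : f ∈ barySpan S m) :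
    f ∈ barySpan S n := by
  induction h with
  | refl => exact hf
  | step _ ih => exact barySpan_succ S ih

lemma coord_mul_mem_barySpan {m : ℕ} {f : Space d → ℝ} (hf : f ∈ barySpan S m) (j : Fin d) :
    (fun x : Space d => x j * f x) ∈ barySpan S (m + 1) := by
  have : (fun x : Space d => x j * f x) =
      ∑ i, S.points i j • fun x => lam S i x * f x := by
    ext x
    have hx := congrArg (fun y : Space d => y j) (sum_lam_smul S x)
    simp only [WithLp.ofLp_sum, WithLp.ofLp_smul, Finset.sum_apply, Pi.smul_apply, smul_eq_mul] at hx
    simp only [Finset.sum_apply, Pi.smul_apply, smul_eq_mul]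
    rw [← hx, Finset.sum_mul]
    exact Finset.sum_congr rfl fun i _ => by ring
  rw [this]
  exact Submodule.sum_mem _ fun i _ => Submodule.smul_mem _ _ (lam_mul_mem_barySpan S hf i)

lemma one_mem_barySpan : (fun _ => 1) ∈ barySpan S 0 := by
  refine Submodule.subset_span ⟨0, by simp, ?_⟩
  ext x; simp [bmon]

lemma pval_mem_barySpan (p : Poly d) {m : ℕ} (hp : p.totalDegree ≤ m) :
    pval p ∈ barySpan S m := by
  have hmono : ∀ (n : ℕ) (s : Fin d →₀ ℕ), s.degree = n →
      (fun x : Space d => s.prod fun i e => x i ^ e) ∈ barySpan S n := by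
    intro n
    induction n with
    | zero =>
      intro s hs
      rw [Finsupp.degree_eq_zero_iff] at hs
      subst hs
      simpa using one_mem_barySpan S
    | succ n ih =>
      intro s hs
      obtain ⟨i, hi⟩ : ∃ i, s i ≠ 0 := by
        by_contra! h
        have : s = 0 := by ext i; exact h i
        simp [this] at hs
      have hsum : s = Finsupp.single i 1 + (s - Finsupp.single i 1) := by
        rw [add_tsub_cancel_of_le]
        rw [Finsupp.single_le_iff]; omega
      have h := ih (s - Finsupp.single i 1) (by
        have h2 := congrArg Finsupp.degree hsum
        rw [map_add, Finsupp.degree_single] at h2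
        omega)
      have h3 := coord_mul_mem_barySpan S h i
      convert h3 using 1
      ext x
      conv_lhs => rw [hsum]
      rw [Finsupp.prod_add_index' (by simp) (by intros; rw [pow_add])]
      simp
  have : pval p = ∑ s ∈ p.support, p.coeff s • fun x : Space d => s.prod fun i e => x i ^ e := by
    ext x
    simp only [pval, MvPolynomial.eval_eq, Finset.sum_apply, Pi.smul_apply, smul_eq_mul]
    exact Finset.sum_congr rfl fun s _ => rfl
  rw [this]
  refine Submodule.sum_mem _ fun s hs => Submodule.smul_mem _ _ (barySpan_mono S ?_ (hmono _ s rfl))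
  exact (MvPolynomial.le_totalDegree hs).trans hp

/-- Every polynomial of degree `≤ m` is a homogeneous polynomial of degree `m` in the barycentric
coordinates. -/
theorem exists_bary_coeff (p : Poly d) {m : ℕ} (hp : p.totalDegree ≤ m) :
    ∃ c : (Fin (d + 1) → ℕ) → ℝ, ∀ x, pval p x = ∑ α ∈ baryIndex d m, c α * bmon S α x := by
  have h := pval_mem_barySpan S p hp
  unfold barySpan at h
  rw [Submodule.mem_span_image_finset_iff_exists_fun'] at h
  obtain ⟨c, hc⟩ := h
  refine ⟨c, fun x => ?_⟩
  rw [← hc]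
  simp

lemma exists_lam_eq {y : Fin (d + 1) → ℝ} (hy : ∑ i, y i = 1) : ∃ x, ∀ i, lam S i x = y i := by
  refine ⟨Finset.univ.affineCombination ℝ S.points y, fun i => ?_⟩
  exact (sbasis S).coord_apply_combination_of_mem (Finset.mem_univ i) hy

/-- Every positive vector is a multiple of the barycentric coordinates of an interior point. By
homogeneity the polynomial in `d + 1` independent variables therefore vanishes on the positive
orthant, hence identically. -/
lemma bary_coeff_eq_zero {m : ℕ} {c : (Fin (d + 1) → ℕ) → ℝ}
    (h : ∀ x ∈ interior (body S), ∑ α ∈ baryIndex d m, c α * bmon S α x = 0) :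
    ∀ α ∈ baryIndex d m, c α = 0 := by
  set Q : MvPolynomial (Fin (d + 1)) ℝ :=
    ∑ α ∈ baryIndex d m, MvPolynomial.monomial (Finsupp.equivFunOnFinite.symm α) (c α) with hQ
  have hev : ∀ y, MvPolynomial.eval y Q = ∑ α ∈ baryIndex d m, c α * ∏ i, y i ^ α i := by
    intro y
    simp [hQ, MvPolynomial.eval_monomial, Finsupp.prod_fintype]
  have hQ0 : Q = 0 := by
    refine MvPolynomial.funext_set (fun _ => Set.Ioi (0 : ℝ)) (fun _ => Set.Ioi_infinite 0) ?_
    intro y hy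
    rw [map_zero, hev]
    have hy' : ∀ i, 0 < y i := fun i => hy i (Set.mem_univ i)
    have hs : 0 < ∑ i, y i := Finset.sum_pos (fun i _ => hy' i) Finset.univ_nonempty
    obtain ⟨x, hx⟩ := exists_lam_eq S (y := fun i => y i / ∑ i, y i) (by
      rw [← Finset.sum_div, div_self hs.ne'])
    have hxi : x ∈ interior (body S) := (mem_interior_body S).2 fun i => by
      rw [hx]; exact div_pos (hy' i) hs
    have h2 := h x hxi
    have : ∑ α ∈ baryIndex d m, c α * ∏ i, y i ^ α i =
        (∑ i, y i) ^ m * ∑ α ∈ baryIndex d m, c α * bmon S α x := by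
      rw [Finset.mul_sum]
      refine Finset.sum_congr rfl fun α hα => ?_
      have hb : (∏ i, y i ^ α i) = (∑ i, y i) ^ m * bmon S α x := by
        conv_lhs => rw [show (∏ i, y i ^ α i) = ∏ i, ((∑ i, y i) ^ α i * lam S i x ^ α i) from
          Finset.prod_congr rfl fun i _ => by
            rw [hx, div_pow, mul_div_cancel₀ _ (pow_ne_zero _ hs.ne')]]
        rw [Finset.prod_mul_distrib, Finset.prod_pow_eq_pow_sum, mem_baryIndex.1 hα, bmon]
      rw [hb]; ring
    rw [this, h2, mul_zero]
  intro α hα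
  have := congrArg (MvPolynomial.coeff (Finsupp.equivFunOnFinite.symm α)) hQ0
  rw [hQ, MvPolynomial.coeff_sum] at this
  simp only [MvPolynomial.coeff_monomial, MvPolynomial.coeff_zero] at this
  rw [Finset.sum_eq_single α] at this
  · simpa using this
  · intro β _ hβ
    rw [if_neg]
    exact fun h => hβ (Finsupp.equivFunOnFinite.symm.injective h)
  · exact fun h => absurd hα h

end Barycentric

end SFWG

end

noncomputable section

namespace SFWG

/-! ### Equivalence of norms for polynomials on a simplex -/

section NormEquiv

variable {d : ℕ}

/-- The affine map that takes the vertices of `S` to those of `S'`. -/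
def simplexMap (S S' : Affine.Simplex ℝ (Space d) d) (x : Space d) : Space d :=
  ∑ i, lam S i x • S'.points i

lemma lam_simplexMap (S S' : Affine.Simplex ℝ (Space d) d) (i : Fin (d + 1)) (x : Space d) :
    lam S' i (simplexMap S S' x) = lam S i x := by
  have h : simplexMap S S' x =
      Finset.univ.affineCombination ℝ S'.points (fun i => lam S i x) := by
    rw [Finset.affineCombination_eq_linear_combination _ _ _ (sum_lam S x)]
    rfl
  rw [h]
  exact (sbasis S').coord_apply_combination_of_mem (Finset.mem_univ i) (sum_lam S x)

lemma simplexMap_simplexMap (S S' : Affine.Simplex ℝ (Space d) d) (x : Space d) :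
    simplexMap S S' (simplexMap S' S x) = x := by
  unfold simplexMap
  rw [show (∑ i, lam S i (∑ j, lam S' j x • S.points j) • S'.points i) =
    ∑ i, lam S' i x • S'.points i from
      Finset.sum_congr rfl fun i _ => by rw [← lam_simplexMap S' S i x]; rfl]
  exact sum_lam_smul S' x

lemma simplexMap_image_body (S S' : Affine.Simplex ℝ (Space d) d) :
    simplexMap S S' '' body S = body S' := by
  ext y
  constructor
  · rintro ⟨x, hx, rfl⟩
    rw [mem_body] at hx ⊢
    exact fun i => by rw [lam_simplexMap]; exact hx i
  · intro hy
    refine ⟨simplexMap S' S y, ?_, simplexMap_simplexMap S S' y⟩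
    rw [mem_body] at hy ⊢
    exact fun i => by rw [lam_simplexMap]; exact hy i

lemma exists_integral_body_eq (S S' : Affine.Simplex ℝ (Space d) d) :
    ∃ δ : ℝ, ∀ f : Space d → ℝ,
      ∫ x in body S', f x = δ * ∫ x in body S, f (simplexMap S S' x) := by
  set L : Space d →L[ℝ] Space d :=
    ∑ i, (innerSL ℝ (glam S i)).smulRight (S'.points i) with hL
  have hder : ∀ x, HasFDerivAt (simplexMap S S') L x := by
    intro x
    have : simplexMap S S' = fun y => simplexMap S S' 0 + L y := by
      ext1 y
      have hy : ∀ i, lam S i y = lam S i 0 + inner ℝ (glam S i) y := fun i => by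
        have := inner_glam_sub S i y 0
        rw [sub_zero] at this
        linarith
      simp only [simplexMap, hL, _root_.sum_apply,
        ContinuousLinearMap.smulRight_apply, innerSL_apply_apply, ← Finset.sum_add_distrib,
        ← add_smul]
      exact Finset.sum_congr rfl fun i _ => by rw [hy]
    rw [this]
    exact L.hasFDerivAt.const_add _
  have hinj : Set.InjOn (simplexMap S S') (body S) := fun x _ y _ h => by
    rw [← simplexMap_simplexMap S' S x, h, simplexMap_simplexMap]
  refine ⟨|L.det|, fun f => ?_⟩
  rw [← simplexMap_image_body S S', integral_image_eq_integral_abs_det_fderiv_smul volume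
    (isCompact_body S).measurableSet (fun x _ => (hder x).hasFDerivWithinAt) hinj]
  simp only [smul_eq_mul]
  rw [integral_const_mul]

/-- The affine map between two simplices has a constant Jacobian, which is eliminated by integrating
`1`. So means of functions of the barycentric coordinates do not depend on the simplex. -/
lemma integral_lam_invariant (S S' : Affine.Simplex ℝ (Space d) d)
    (F : (Fin (d + 1) → ℝ) → ℝ) :
    (∫ x in body S', F fun i => lam S' i x) * volume.real (body S) =
      (∫ x in body S, F fun i => lam S i x) * volume.real (body S') := by
  obtain ⟨δ, hδ⟩ := exists_integral_body_eq S S'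
  have h1 := hδ fun _ => 1
  simp only [setIntegral_const, smul_eq_mul, mul_one] at h1
  rw [h1, hδ]
  simp only [lam_simplexMap]
  ring

/-- The right side is a continuous quadratic form in the coefficients, positive on the unit sphere
because the monomials are linearly independent; compactness gives a positive minimum and homogeneity
the rest. -/
lemma exists_coeff_sq_le_of_simplex (S : Affine.Simplex ℝ (Space d) d) (m : ℕ) :
    ∃ a : ℝ, 0 < a ∧ ∀ c : (Fin (d + 1) → ℕ) → ℝ, a * ∑ α ∈ baryIndex d m, c α ^ 2 ≤
      ∫ x in body S, (∑ α ∈ baryIndex d m, c α * bmon S α x) ^ 2 := by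
  let E := ↥(baryIndex d m)
  let q : EuclideanSpace ℝ E → ℝ := fun c => ∫ x in body S, (∑ α : E, c α * bmon S α.1 x) ^ 2
  have hint : ∀ α β : E, IntegrableOn (fun x => bmon S α.1 x * bmon S β.1 x) (body S) :=
    fun α β => ((continuous_bmon S _).mul (continuous_bmon S _)).continuousOn.integrableOn_compact
      (isCompact_body S)
  have hq : ∀ c, q c = ∑ α : E, ∑ β : E, c α * c β *
      ∫ x in body S, bmon S α.1 x * bmon S β.1 x := by
    intro c
    have h1 : ∀ x, (∑ α : E, c α * bmon S α.1 x) ^ 2 =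
        ∑ α : E, ∑ β : E, c α * c β * (bmon S α.1 x * bmon S β.1 x) := by
      intro x
      rw [sq, Finset.sum_mul_sum]
      exact Finset.sum_congr rfl fun α _ => Finset.sum_congr rfl fun β _ => by ring
    simp only [q, h1]
    rw [integral_finsetSum _ fun α _ => integrable_finsetSum _ fun β _ => (hint α β).const_mul _]
    refine Finset.sum_congr rfl fun α _ => ?_
    rw [integral_finsetSum _ fun β _ => (hint α β).const_mul _]
    exact Finset.sum_congr rfl fun β _ => by rw [integral_const_mul]
  have hqc : Continuous q := by
    have : q = fun c => ∑ α : E, ∑ β : E, c α * c β *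
      ∫ x in body S, bmon S α.1 x * bmon S β.1 x := funext hq
    rw [this]
    fun_prop
  have hpos : ∀ c ∈ Metric.sphere (0 : EuclideanSpace ℝ E) 1, 0 < q c := by
    intro c hc
    have hcont : Continuous fun x => (∑ α : E, c α * bmon S α.1 x) ^ 2 :=
      (continuous_finsetSum _ fun α _ => continuous_const.mul (continuous_bmon S _)).pow 2
    refine lt_of_le_of_ne (integral_nonneg fun x => sq_nonneg _) fun h0 => ?_
    have h1 := (integral_eq_zero_iff_of_nonneg (fun x => sq_nonneg _)
      (hcont.continuousOn.integrableOn_compact (isCompact_body S))).1 h0.symm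
    have h2 : Set.EqOn (fun x => (∑ α : E, c α * bmon S α.1 x) ^ 2) 0 (interior (body S)) :=
      Measure.eqOn_open_of_ae_eq (ae_restrict_of_ae_restrict_of_subset interior_subset h1)
        isOpen_interior hcont.continuousOn continuousOn_const
    have h3 := bary_coeff_eq_zero S (m := m)
      (c := fun α => if h : α ∈ baryIndex d m then c ⟨α, h⟩ else 0) (fun x hx => by
        have := pow_eq_zero_iff (two_ne_zero) |>.1 (h2 hx)
        rw [← this, ← Finset.sum_coe_sort]
        refine Finset.sum_congr rfl fun α _ => ?_
        rw [dif_pos α.2])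
    have : c = 0 := by
      ext α
      have := h3 α.1 α.2
      rw [dif_pos α.2] at this
      simpa using this
    rw [this] at hc
    simp at hc
  obtain ⟨a, ha, hle⟩ := (isCompact_sphere (0 : EuclideanSpace ℝ E) 1).exists_forall_le'
    hqc.continuousOn hpos
  refine ⟨a, ha, fun c => ?_⟩
  let c' : EuclideanSpace ℝ E := WithLp.toLp 2 fun α => c α.1
  have hc'n : ‖c'‖ ^ 2 = ∑ α ∈ baryIndex d m, c α ^ 2 := by
    rw [EuclideanSpace.norm_sq_eq, ← Finset.sum_coe_sort (baryIndex d m)]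
    exact Finset.sum_congr rfl fun α _ => by simp [c']
  have hq' : ∫ x in body S, (∑ α ∈ baryIndex d m, c α * bmon S α x) ^ 2 = q c' := by
    simp only [q]
    refine integral_congr_ae (Eventually.of_forall fun x => ?_)
    simp only [c']
    rw [← Finset.sum_coe_sort (baryIndex d m)]
  rw [← hc'n, hq']
  rcases eq_or_ne c' 0 with h0 | h0
  · rw [h0, norm_zero]
    simpa using integral_nonneg (fun x => sq_nonneg _)
  · have hn : 0 < ‖c'‖ := norm_pos_iff.2 h0
    have h1 := hle (‖c'‖⁻¹ • c') (by simp [norm_smul, hn.ne'])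
    have h2 : q c' = ‖c'‖ ^ 2 * q (‖c'‖⁻¹ • c') := by
      rw [hq, hq]
      rw [Finset.mul_sum]
      refine Finset.sum_congr rfl fun α _ => ?_
      rw [Finset.mul_sum]
      refine Finset.sum_congr rfl fun β _ => ?_
      simp only [PiLp.smul_apply, smul_eq_mul]
      field_simp
    rw [h2, mul_comm]
    gcongr

/-- The coefficients of a polynomial in the barycentric coordinates are bounded by its mean square,
uniformly in the simplex. -/
theorem exists_coeff_sq_le (d m : ℕ) : ∃ C : ℝ, 0 < C ∧
    ∀ (S : Affine.Simplex ℝ (Space d) d) (c : (Fin (d + 1) → ℕ) → ℝ),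
      volume.real (body S) * ∑ α ∈ baryIndex d m, c α ^ 2 ≤
        C * ∫ x in body S, (∑ α ∈ baryIndex d m, c α * bmon S α x) ^ 2 := by
  by_cases hne : Nonempty (Affine.Simplex ℝ (Space d) d)
  · obtain ⟨S₀⟩ := hne
    obtain ⟨a, ha, h⟩ := exists_coeff_sq_le_of_simplex S₀ m
    have hV := volume_real_body_pos S₀
    refine ⟨volume.real (body S₀) / a, div_pos hV ha, fun S c => ?_⟩
    have h1 := integral_lam_invariant S₀ S
      (fun y => (∑ α ∈ baryIndex d m, c α * ∏ i, y i ^ α i) ^ 2)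
    change (∫ x in body S, (∑ α ∈ baryIndex d m, c α * bmon S α x) ^ 2) * _ =
      (∫ x in body S₀, (∑ α ∈ baryIndex d m, c α * bmon S₀ α x) ^ 2) * _ at h1
    have h2 := h c
    have hV' := volume_real_body_pos S
    rw [div_mul_eq_mul_div, le_div_iff₀ ha, mul_comm (volume.real (body S₀)), h1]
    nlinarith
  · exact ⟨1, one_pos, fun S => absurd ⟨S⟩ hne⟩

end NormEquiv

end SFWG

end

noncomputable section

namespace SFWG

/-! ### Lifting of normal traces and divergences on a simplex -/

section Lifting

variable {d : ℕ} (S : Affine.Simplex ℝ (Space d) d)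

lemma totalDegree_pderiv_le (j : Fin d) (p : Poly d) :
    (MvPolynomial.pderiv j p).totalDegree ≤ p.totalDegree - 1 := by
  conv_lhs => rw [p.as_sum, map_sum]
  refine MvPolynomial.totalDegree_finsetSum_le fun s hs => ?_
  rw [MvPolynomial.pderiv_monomial]
  rcases eq_or_ne (s j) 0 with h | h
  · simp [h]
  · refine (MvPolynomial.totalDegree_monomial_le _ _).trans ?_
    have h1 : s - Finsupp.single j 1 + Finsupp.single j 1 = s :=
      tsub_add_cancel_of_le (Finsupp.single_le_iff.2 (by omega))
    have h2 := congrArg Finsupp.degree h1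
    rw [map_add, Finsupp.degree_single] at h2
    have h3 : s.degree ≤ p.totalDegree := MvPolynomial.le_totalDegree hs
    change (s - Finsupp.single j 1).degree ≤ _
    omega

/-- The normal component of a polynomial field on the face opposite to the vertex `l`. -/
def normalTr (l : Fin (d + 1)) (τ : Fin d → Poly d) (x : Space d) : ℝ :=
  ∑ j, pval (τ j) x * outwardNormal S l j

/-- The divergence of a polynomial field. -/
def fdiv (τ : Fin d → Poly d) : Poly d := ∑ j, MvPolynomial.pderiv j (τ j)

lemma normalTr_add (l : Fin (d + 1)) (τ τ' : Fin d → Poly d) (x : Space d) :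
    normalTr S l (τ + τ') x = normalTr S l τ x + normalTr S l τ' x := by
  simp [normalTr, add_mul, Finset.sum_add_distrib]

lemma normalTr_smul (l : Fin (d + 1)) (c : ℝ) (τ : Fin d → Poly d) (x : Space d) :
    normalTr S l (c • τ) x = c * normalTr S l τ x := by
  simp [normalTr, Finset.mul_sum, mul_assoc]

lemma normalTr_zero (l : Fin (d + 1)) (x : Space d) :
    normalTr S l (0 : Fin d → Poly d) x = 0 := by
  simp [normalTr]

lemma normalTr_sum {ι : Type*} (s : Finset ι) (l : Fin (d + 1)) (τ : ι → Fin d → Poly d)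
    (x : Space d) : normalTr S l (∑ a ∈ s, τ a) x = ∑ a ∈ s, normalTr S l (τ a) x := by
  induction s using Finset.cons_induction with
  | empty => simp [normalTr_zero]
  | cons a s ha ih => rw [Finset.sum_cons, Finset.sum_cons, normalTr_add, ih]

lemma fdiv_add (τ τ' : Fin d → Poly d) : fdiv (τ + τ') = fdiv τ + fdiv τ' := by
  simp [fdiv, Finset.sum_add_distrib]

lemma fdiv_smul (c : ℝ) (τ : Fin d → Poly d) : fdiv (c • τ) = c • fdiv τ := by
  simp [fdiv, Finset.smul_sum]

lemma fdiv_zero : fdiv (0 : Fin d → Poly d) = 0 := by simp [fdiv]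

lemma fdiv_sum {ι : Type*} (s : Finset ι) (τ : ι → Fin d → Poly d) :
    fdiv (∑ a ∈ s, τ a) = ∑ a ∈ s, fdiv (τ a) := by
  induction s using Finset.cons_induction with
  | empty => simp [fdiv_zero]
  | cons a s ha ih => rw [Finset.sum_cons, Finset.sum_cons, fdiv_add, ih]

lemma totalDegree_fdiv_le {τ : Fin d → Poly d} {m : ℕ} (h : ∀ j, (τ j).totalDegree ≤ m + 1) :
    (fdiv τ).totalDegree ≤ m := by
  refine MvPolynomial.totalDegree_finsetSum_le fun j _ => ?_
  have h1 := totalDegree_pderiv_le j (τ j)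
  have := h j
  omega

lemma continuous_normalTr (l : Fin (d + 1)) (τ : Fin d → Poly d) :
    Continuous (normalTr S l τ) :=
  continuous_finsetSum _ fun _ _ => (continuous_pval _).mul continuous_const

/-- The divergence theorem for a polynomial field. -/
lemma integral_fdiv (hd : 0 < d) (τ : Fin d → Poly d) :
    ∫ x in body S, pval (fdiv τ) x = ∑ l, ∫ z in facet S l, normalTr S l τ z ∂(surf d) := by
  have h1 : ∀ x, pval (fdiv τ) x = ∑ j, partialD j (pval (τ j)) x := fun x => by
    simp only [fdiv, pval_sum, partialD_pval]
  simp only [h1]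
  rw [integral_finsetSum]
  · simp only [fun j => integral_partialD_body S hd (contDiff_pval (τ j)) j]
    rw [Finset.sum_comm]
    refine Finset.sum_congr rfl fun l _ => ?_
    unfold normalTr
    have := isFiniteMeasure_facet S hd l
    rw [integral_finsetSum]
    · exact Finset.sum_congr rfl fun j _ => by rw [integral_mul_const, mul_comm]
    · intro j _
      exact ((memLp_facet hd l (continuous_pval (τ j))).integrable (by norm_num)).mul_const _
  · intro j _
    exact (continuous_partialD (contDiff_pval _) j).continuousOn.integrableOn_compact
      (isCompact_body S)

/-- The field `(p_a - p_b) λ^α`. -/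
def edgeField (a b : Fin (d + 1)) (α : Fin (d + 1) → ℕ) (j : Fin d) : Poly d :=
  MvPolynomial.C ((S.points a - S.points b) j) * barPoly S α

lemma totalDegree_edgeField (a b : Fin (d + 1)) (α : Fin (d + 1) → ℕ) (j : Fin d) :
    (edgeField S a b α j).totalDegree ≤ ∑ i, α i := by
  refine (MvPolynomial.totalDegree_mul _ _).trans ?_
  rw [MvPolynomial.totalDegree_C, zero_add]
  exact totalDegree_barPoly S α

/-- The edge from `p_b` to `p_a` lies in every face that contains both vertices, so only the faces
opposite to `a` and to `b` see a normal component. This makes these fields the building blocks of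
the liftings. -/
lemma normalTr_edgeField (hd : 0 < d) (l a b : Fin (d + 1)) (α : Fin (d + 1) → ℕ)
    (x : Space d) : normalTr S l (edgeField S a b α) x =
      height S l * ((if l = b then 1 else 0) - (if l = a then 1 else 0)) * bmon S α x := by
  have h := inner_outwardNormal S hd l (S.points a) (S.points b)
  rw [lam_points, lam_points, PiLp.inner_apply] at h
  unfold normalTr edgeField
  simp only [pval_mul, pval_C, pval_barPoly]
  rw [show (∑ j, (S.points a - S.points b) j * bmon S α x * outwardNormal S l j) =
    (∑ j, inner ℝ (outwardNormal S l j) ((S.points a - S.points b) j)) * bmon S α x by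
      rw [Finset.sum_mul]
      exact Finset.sum_congr rfl fun j _ => by simp; ring]
  rw [h]; ring

lemma pval_fdiv_edgeField (a b : Fin (d + 1)) (α : Fin (d + 1) → ℕ) (x : Space d) :
    pval (fdiv (edgeField S a b α)) x =
      α a * bmon S (Function.update α a (α a - 1)) x -
        α b * bmon S (Function.update α b (α b - 1)) x := by
  rw [← sum_mul_pderiv_barPoly]
  simp [fdiv, edgeField, Derivation.leibniz]

lemma abs_pval_edgeField_le {h : ℝ} (hh : ∀ x ∈ body S, ∀ y ∈ body S, ‖x - y‖ ≤ h)
    (a b : Fin (d + 1)) (α : Fin (d + 1) → ℕ) (j : Fin d) {x : Space d} (hx : x ∈ body S) :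
    |pval (edgeField S a b α j) x| ≤ h := by
  simp only [edgeField, pval_mul, pval_C, pval_barPoly, abs_mul]
  have h1 : |(S.points a - S.points b) j| ≤ h :=
    (PiLp.norm_apply_le (S.points a - S.points b) j).trans
      (hh _ (points_mem_body S a) _ (points_mem_body S b))
  have h2 := abs_bmon_le S hx α
  calc _ ≤ |(S.points a - S.points b) j| * 1 := by gcongr
    _ ≤ h := by rw [mul_one]; exact h1

lemma integral_body_sq_le {f : Space d → ℝ} {B : ℝ} (hB : ∀ x ∈ body S, |f x| ≤ B) :
    ∫ x in body S, f x ^ 2 ≤ volume.real (body S) * B ^ 2 := by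
  have hfin : volume (body S) ≠ ⊤ := (isCompact_body S).measure_lt_top.ne
  have h1 : ‖∫ x in body S, f x ^ 2‖ ≤ B ^ 2 * volume.real (body S) := by
    refine norm_setIntegral_le_of_norm_le_const hfin.lt_top fun x hx => ?_
    rw [Real.norm_eq_abs, abs_pow]
    exact pow_le_pow_left₀ (abs_nonneg _) (hB x hx) 2
  rw [mul_comm]
  exact (le_abs_self _).trans h1

lemma integral_sq_sum_le {μ : Measure (Space d)} {ι : Type*} (s : Finset ι)
    {f : ι → Space d → ℝ} (hf : ∀ i ∈ s, MemLp (f i) 2 μ) :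
    ∫ x, (∑ i ∈ s, f i x) ^ 2 ∂μ ≤ s.card * ∑ i ∈ s, ∫ x, f i x ^ 2 ∂μ := by
  rw [← integral_finsetSum _ fun i hi => (hf i hi).integrable_sq, ← integral_const_mul]
  refine integral_mono (memLp_finsetSum s hf).integrable_sq
    ((integrable_finsetSum _ fun i hi => (hf i hi).integrable_sq).const_mul _) fun x => ?_
  exact sq_sum_le_card_mul_sum_sq

lemma integral_sub_sq_le {μ : Measure (Space d)} {f g : Space d → ℝ} (hf : MemLp f 2 μ)
    (hg : MemLp g 2 μ) :
    ∫ x, (f x - g x) ^ 2 ∂μ ≤ 2 * (∫ x, f x ^ 2 ∂μ) + 2 * ∫ x, g x ^ 2 ∂μ := by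
  simpa [sub_eq_add_neg] using integral_add_sq_le hf hg.neg

/-- Without the coordinate `λ_l` the polynomial is homogeneous of degree `m` on the rays from `p_l`.
The radial integral in the cone formula is then that of a power of `t`, which is at most `1`. -/
lemma integral_body_sq_le_facet (hd : 0 < d) (l : Fin (d + 1)) {m : ℕ}
    {c : (Fin (d + 1) → ℕ) → ℝ} (hc : ∀ α, α l ≠ 0 → c α = 0) :
    ∫ x in body S, (∑ α ∈ baryIndex d m, c α * bmon S α x) ^ 2 ≤
      height S l * ∫ z in facet S l, (∑ α ∈ baryIndex d m, c α * bmon S α z) ^ 2 ∂(surf d) := by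
  have hcont : Continuous fun x => (∑ α ∈ baryIndex d m, c α * bmon S α x) ^ 2 :=
    (continuous_finsetSum _ fun α _ => continuous_const.mul (continuous_bmon S _)).pow 2
  have hcone : ∀ (t : ℝ) (z : Space d),
      (∑ α ∈ baryIndex d m, c α * bmon S α (S.points l + t • (z - S.points l))) ^ 2 =
        t ^ (2 * m) * (∑ α ∈ baryIndex d m, c α * bmon S α z) ^ 2 := by
    intro t z
    rw [mul_comm 2 m, pow_mul, ← mul_pow, Finset.mul_sum]
    congr 1
    refine Finset.sum_congr rfl fun α hα => ?_
    by_cases h : α l = 0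
    · rw [bmon_cone S h, mem_baryIndex.1 hα]; ring
    · rw [hc α h]; ring
  have hH := height_pos S hd l
  rw [integral_body_eq_cone S hd l hcont, ← integral_const_mul]
  simp only [hcone]
  have hone : ∀ z : Space d, ∫ t in (0 : ℝ)..1, height S l * t ^ (d - 1) *
      (t ^ (2 * m) * (∑ α ∈ baryIndex d m, c α * bmon S α z) ^ 2) =
      (∫ t in (0 : ℝ)..1, t ^ (d - 1) * t ^ (2 * m)) *
        (height S l * (∑ α ∈ baryIndex d m, c α * bmon S α z) ^ 2) := by
    intro z
    rw [← intervalIntegral.integral_mul_const]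
    refine intervalIntegral.integral_congr fun t _ => ?_
    ring
  simp only [hone]
  have h1 : (∫ t in (0 : ℝ)..1, t ^ (d - 1) * t ^ (2 * m)) ≤ 1 := by
    simp only [← pow_add, integral_pow]
    rw [one_pow, zero_pow (by omega), sub_zero, div_le_one (by positivity)]
    linarith [(Nat.cast_nonneg (d - 1 + 2 * m) : (0 : ℝ) ≤ _)]
  rw [integral_const_mul]
  refine mul_le_of_le_one_left (integral_nonneg fun z => ?_) h1
  positivity

/-- Lifting of a normal trace given on one face. -/
theorem exists_trace_lift (d : ℕ) (hd : 0 < d) (k : ℕ) {κ : ℝ} (hκ : 0 < κ) : ∃ C : ℝ, 0 < C ∧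
    ∀ (S : Affine.Simplex ℝ (Space d) d) (h : ℝ), 0 < h →
      (∀ x ∈ body S, ∀ y ∈ body S, ‖x - y‖ ≤ h) →
      ∀ l, κ * h ≤ height S l → ∀ g : Poly d, g.totalDegree ≤ k + 1 →
      ∃ τ : Fin d → Poly d, (∀ j, (τ j).totalDegree ≤ k + 1) ∧
        (∀ x ∈ facet S l, normalTr S l τ x = pval g x) ∧
        (∀ l', l' ≠ l → ∀ x ∈ facet S l', normalTr S l' τ x = 0) ∧
        (∀ j, ∫ x in body S, pval (τ j) x ^ 2 ≤
          C * (h * ∫ z in facet S l, pval g z ^ 2 ∂(surf d))) ∧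
        h ^ 2 * ∫ x in body S, pval (fdiv τ) x ^ 2 ≤
          C * (h * ∫ z in facet S l, pval g z ^ 2 ∂(surf d)) := by
  obtain ⟨C₀, hC₀, hC⟩ := exists_coeff_sq_le d (k + 1)
  set N : ℝ := ((baryIndex d (k + 1)).card : ℝ) with hN
  -- `κ⁻¹` bounds `h / height`, `N` counts the monomials (with `N + 1` for positivity), `C₀`
  -- compares coefficients with the mean square, and `(k + 1) ^ 2` accounts for the exponents
  -- brought down in the divergence.
  refine ⟨((k : ℝ) + 1) ^ 2 * (κ⁻¹ ^ 2 * (N + 1) * C₀), by positivity, fun S h hh hdiam l hl g hg => ?_⟩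
  have hH := height_pos S hd l
  have hHh := height_le S hd l hdiam
  obtain ⟨c₁, hc₁⟩ := exists_bary_coeff S g hg
  -- Monomials that contain `λ_l` vanish on the face and are dropped, so that the mean square over
  -- the face controls the remaining coefficients.
  set c : (Fin (d + 1) → ℕ) → ℝ := fun α => if α l = 0 then c₁ α else 0 with hc
  have hcl : ∀ α, α l ≠ 0 → c α = 0 := fun α hα => by simp [hc, hα]
  have hgF : ∀ x ∈ facet S l, pval g x = ∑ α ∈ baryIndex d (k + 1), c α * bmon S α x := by
    intro x hx
    rw [hc₁]
    refine Finset.sum_congr rfl fun α _ => ?_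
    by_cases hα : α l = 0
    · simp [hc, hα]
    · rw [bmon_eq_zero S hα ((mem_facet S).1 hx).2]; simp
  -- A monomial of degree `k + 1 ≥ 1` contains some coordinate `λ_i`; the value for other
  -- multi-indices is arbitrary.
  have hex : ∀ α : Fin (d + 1) → ℕ, ∃ i, α ∈ baryIndex d (k + 1) → α i ≠ 0 := by
    intro α
    by_cases hα : α ∈ baryIndex d (k + 1)
    · by_contra! hcon
      have := mem_baryIndex.1 hα
      rw [Finset.sum_eq_zero fun i _ => (hcon i).2] at this
      omega
    · exact ⟨0, fun h => absurd h hα⟩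
  choose i hi using hex
  -- On the face `l` the field `(p_i - p_l) λ^α / height` has normal component `λ^α`. On the face
  -- `i` its normal component contains the factor `λ_i`, which vanishes there, and it is tangential
  -- to all others.
  set τ : Fin d → Poly d :=
    ∑ α ∈ baryIndex d (k + 1), (c α / height S l) • edgeField S (i α) l α with hτ
  have hτj : ∀ j x, pval (τ j) x = ∑ α ∈ baryIndex d (k + 1),
      c α / height S l * pval (edgeField S (i α) l α j) x := by
    intro j x
    simp [hτ]
  have hdivx : ∀ x, pval (fdiv τ) x = ∑ α ∈ baryIndex d (k + 1),
      c α / height S l * pval (fdiv (edgeField S (i α) l α)) x := by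
    intro x
    simp [hτ, fdiv_sum, fdiv_smul]
  have hnx : ∀ l' x, normalTr S l' τ x = ∑ α ∈ baryIndex d (k + 1),
      c α / height S l * (height S l' * ((if l' = l then 1 else 0) -
        (if l' = i α then 1 else 0)) * bmon S α x) := by
    intro l' x
    rw [hτ, normalTr_sum]
    exact Finset.sum_congr rfl fun α _ => by rw [normalTr_smul, normalTr_edgeField S hd]
  set A : ℝ := ∑ α ∈ baryIndex d (k + 1), |c α| with hA
  have hA2 : A ^ 2 ≤ N * ∑ α ∈ baryIndex d (k + 1), c α ^ 2 := by
    have := sq_sum_le_card_mul_sum_sq (s := baryIndex d (k + 1)) (f := fun α => |c α|)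
    simpa [sq_abs] using this
  have hint := integral_body_sq_le_facet S hd l (m := k + 1) hcl
  have hFg : ∫ z in facet S l, (∑ α ∈ baryIndex d (k + 1), c α * bmon S α z) ^ 2 ∂(surf d) =
      ∫ z in facet S l, pval g z ^ 2 ∂(surf d) :=
    setIntegral_congr_fun (isCompact_facet S l).measurableSet fun z hz => by
      simp only [hgF z hz]
  rw [hFg] at hint
  set I := ∫ z in facet S l, pval g z ^ 2 ∂(surf d) with hI
  have hI0 : 0 ≤ I := integral_nonneg fun z => sq_nonneg _
  have hV := volume_real_body_pos S
  have hVA : volume.real (body S) * A ^ 2 ≤ N * C₀ * (height S l * I) := by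
    have h1 := hC S c
    have hN0 : 0 ≤ N := Nat.cast_nonneg _
    calc volume.real (body S) * A ^ 2
        ≤ N * (volume.real (body S) * ∑ α ∈ baryIndex d (k + 1), c α ^ 2) := by nlinarith
      _ ≤ N * (C₀ * (height S l * I)) := by
          exact mul_le_mul_of_nonneg_left (h1.trans (mul_le_mul_of_nonneg_left hint hC₀.le)) hN0
      _ = _ := by ring
  have hkh : h / height S l ≤ κ⁻¹ := by
    rw [div_le_iff₀ hH, ← div_eq_inv_mul, le_div_iff₀ hκ]; linarith
  have hkh0 : 0 ≤ h / height S l := by positivity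
  have hN1 : 0 ≤ N := Nat.cast_nonneg _
  have key : volume.real (body S) * A ^ 2 * (h / height S l) ^ 2 ≤
      κ⁻¹ ^ 2 * (N + 1) * C₀ * (h * I) := by
    calc _ ≤ N * C₀ * (height S l * I) * (κ⁻¹) ^ 2 := by gcongr
      _ ≤ (N + 1) * C₀ * (h * I) * (κ⁻¹) ^ 2 := by gcongr; linarith
      _ = _ := by ring
  refine ⟨τ, fun j => ?_, fun x hx => ?_, fun l' hl' x hx => ?_, fun j => ?_, ?_⟩
  · rw [hτ, Finset.sum_apply]
    refine MvPolynomial.totalDegree_finsetSum_le fun α hα => ?_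
    refine (MvPolynomial.totalDegree_smul_le _ _).trans ?_
    exact (totalDegree_edgeField S _ _ _ _).trans (mem_baryIndex.1 hα).le
  · rw [hnx, hgF x hx]
    refine Finset.sum_congr rfl fun α hα => ?_
    by_cases hαl : α l = 0
    · have : l ≠ i α := fun h => hi α hα (h ▸ hαl)
      simp only [if_true, if_neg this]
      field_simp
      ring
    · rw [hcl α hαl]; simp
  · rw [hnx]
    refine Finset.sum_eq_zero fun α hα => ?_
    rw [if_neg hl']
    by_cases hli : l' = i α
    · rw [bmon_eq_zero S (l := l') (hli ▸ hi α hα) ((mem_facet S).1 hx).2]; simp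
    · simp [hli]
  · have hb : ∀ x ∈ body S, |pval (τ j) x| ≤ A * (h / height S l) := by
      intro x hx
      rw [hτj]
      refine (Finset.abs_sum_le_sum_abs _ _).trans ?_
      rw [hA, Finset.sum_mul]
      refine Finset.sum_le_sum fun α _ => ?_
      rw [abs_mul, abs_div, abs_of_pos hH, div_mul_eq_mul_div, mul_div_assoc]
      gcongr
      exact abs_pval_edgeField_le S hdiam _ _ _ _ hx
    refine (integral_body_sq_le S hb).trans ?_
    have hk1 : (1 : ℝ) ≤ ((k : ℝ) + 1) ^ 2 := by
      nlinarith [(Nat.cast_nonneg k : (0 : ℝ) ≤ k)]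
    have hX : 0 ≤ κ⁻¹ ^ 2 * (N + 1) * C₀ * (h * I) := by positivity
    calc volume.real (body S) * (A * (h / height S l)) ^ 2
        = volume.real (body S) * A ^ 2 * (h / height S l) ^ 2 := by ring
      _ ≤ κ⁻¹ ^ 2 * (N + 1) * C₀ * (h * I) := key
      _ ≤ ((k : ℝ) + 1) ^ 2 * (κ⁻¹ ^ 2 * (N + 1) * C₀ * (h * I)) := le_mul_of_one_le_left hX hk1
      _ = _ := by ring
  · have hb : ∀ x ∈ body S, |pval (fdiv τ) x| ≤ A * ((k + 1) / height S l) := by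
      intro x hx
      rw [hdivx]
      refine (Finset.abs_sum_le_sum_abs _ _).trans ?_
      rw [hA, Finset.sum_mul]
      refine Finset.sum_le_sum fun α hα => ?_
      by_cases hαl : α l = 0
      · rw [abs_mul, abs_div, abs_of_pos hH, div_mul_eq_mul_div, mul_div_assoc]
        gcongr
        rw [pval_fdiv_edgeField, hαl]
        simp only [Nat.cast_zero, zero_mul, sub_zero, abs_mul, Nat.abs_cast]
        have h1 := abs_bmon_le S hx (Function.update α (i α) (α (i α) - 1))
        have h2 : (α (i α) : ℝ) ≤ k + 1 := by
          have h3 : α (i α) ≤ ∑ j, α j := Finset.single_le_sum (fun _ _ => Nat.zero_le _)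
            (Finset.mem_univ _)
          rw [mem_baryIndex.1 hα] at h3
          exact_mod_cast h3
        calc _ ≤ (α (i α) : ℝ) * 1 := by gcongr
          _ ≤ k + 1 := by linarith
      · rw [hcl α hαl]; simp
    calc h ^ 2 * ∫ x in body S, pval (fdiv τ) x ^ 2
        ≤ h ^ 2 * (volume.real (body S) * (A * ((k + 1) / height S l)) ^ 2) := by
          gcongr; exact integral_body_sq_le S hb
      _ = ((k : ℝ) + 1) ^ 2 * (volume.real (body S) * A ^ 2 * (h / height S l) ^ 2) := by
          field_simp
      _ ≤ ((k : ℝ) + 1) ^ 2 * (κ⁻¹ ^ 2 * (N + 1) * C₀ * (h * I)) := by gcongr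
      _ = _ := by ring

/-- Up to a multiple of `λ₀^k`, a monomial is the divergence of a field without normal trace. -/
lemma exists_bubble_field (d : ℕ) (hd : 0 < d) (k n : ℕ) : ∃ K : ℝ, 0 ≤ K ∧
    ∀ (S : Affine.Simplex ℝ (Space d) d) (h : ℝ), 0 < h →
      (∀ x ∈ body S, ∀ y ∈ body S, ‖x - y‖ ≤ h) →
      ∀ β : Fin (d + 1) → ℕ, ∑ i, β i = k → k - β 0 = n →
      ∃ (τ : Fin d → Poly d) (s : ℝ), (∀ j, (τ j).totalDegree ≤ k + 1) ∧
        (∀ l, ∀ x ∈ facet S l, normalTr S l τ x = 0) ∧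
        (∀ x, pval (fdiv τ) x = bmon S β x - s * bmon S (Pi.single 0 k) x) ∧
        ∀ x ∈ body S, ∀ j, |pval (τ j) x| ≤ K * h := by
  induction n with
  | zero =>
    refine ⟨0, le_rfl, fun S h _ _ β hβ hn => ⟨0, 1, by simp, fun l x _ => normalTr_zero S l x,
      fun x => ?_, by simp⟩⟩
    have h0 : β 0 + ∑ i ∈ Finset.univ.erase 0, β i = k := by
      rw [Finset.add_sum_erase _ _ (Finset.mem_univ _)]; exact hβ
    have : β = Pi.single 0 k := by
      ext i
      rcases eq_or_ne i 0 with rfl | hi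
      · rw [Pi.single_eq_same]; omega
      · rw [Pi.single_eq_of_ne hi]
        have h1 : β i ≤ ∑ i ∈ Finset.univ.erase 0, β i :=
          Finset.single_le_sum (fun _ _ => Nat.zero_le _) (Finset.mem_erase.2 ⟨hi, Finset.mem_univ i⟩)
        omega
    simp [fdiv_zero, this]
  | succ n ih =>
    obtain ⟨K, hK, H⟩ := ih
    refine ⟨1 + k * K, by positivity, fun S h hh hdiam β hβ hn => ?_⟩
    obtain ⟨i, hi0, hi⟩ : ∃ i, i ≠ 0 ∧ β i ≠ 0 := by
      by_contra! hcon
      rw [Finset.sum_eq_single 0 (fun i _ hi => hcon i hi) (by simp)] at hβ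
      omega
    -- The field `(p_0 - p_i) λ^α` has no normal component on any face, because `α` contains both
    -- `0` and `i`. Its divergence is `(β 0 + 1) λ^β - β i λ^β'`, and `β'` has a larger exponent at
    -- `0`, so the induction hypothesis removes that second term.
    set α : Fin (d + 1) → ℕ := Function.update β 0 (β 0 + 1) with hα
    set β' : Fin (d + 1) → ℕ := Function.update α i (α i - 1) with hβ'
    have hα0 : α 0 = β 0 + 1 := by simp [hα]
    have hαi : α i = β i := by simp [hα, hi0]
    have hαs : ∑ j, α j = k + 1 := by
      rw [hα, Finset.sum_update_of_mem (Finset.mem_univ _)]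
      have := Finset.add_sum_erase Finset.univ β (Finset.mem_univ 0)
      rw [← hβ, ← this, Finset.sdiff_singleton_eq_erase]; ring
    have hβ's : ∑ j, β' j = k := by
      rw [hβ', Finset.sum_update_of_mem (Finset.mem_univ _), Finset.sdiff_singleton_eq_erase]
      have := Finset.add_sum_erase Finset.univ α (Finset.mem_univ i)
      omega
    have hβ'0 : β' 0 = β 0 + 1 := by rw [hβ', Function.update_of_ne (Ne.symm hi0), hα0]
    have hback : Function.update α 0 (α 0 - 1) = β := by
      rw [hα0, hα]; simp
    obtain ⟨τ, s, hdeg, hnor, hdiv, hbd⟩ := H S h hh hdiam β' hβ's (by omega)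
    have hb0 : (0 : ℝ) < (β 0 : ℝ) + 1 := by positivity
    refine ⟨(1 / ((β 0 : ℝ) + 1)) • edgeField S 0 i α + ((β i : ℝ) / (β 0 + 1)) • τ,
      (β i : ℝ) / (β 0 + 1) * s, fun j => ?_, fun l x hx => ?_, fun x => ?_, fun x hx j => ?_⟩
    · refine (MvPolynomial.totalDegree_add _ _).trans (max_le ?_ ?_)
      · exact (MvPolynomial.totalDegree_smul_le _ _).trans
          ((totalDegree_edgeField S _ _ _ _).trans hαs.le)
      · exact (MvPolynomial.totalDegree_smul_le _ _).trans (hdeg j)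
    · rw [normalTr_add, normalTr_smul, normalTr_smul, hnor l x hx, normalTr_edgeField S hd]
      have hl := ((mem_facet S).1 hx).2
      by_cases h1 : l = 0
      · rw [bmon_eq_zero S (l := l) (by rw [h1, hα0]; omega) hl]; simp
      · by_cases h2 : l = i
        · rw [bmon_eq_zero S (l := l) (by rw [h2, hαi]; exact hi) hl]; simp
        · simp [h1, h2]
    · rw [fdiv_add, fdiv_smul, fdiv_smul, pval_add, pval_smul, pval_smul, hdiv,
        pval_fdiv_edgeField, hback, ← hβ', hα0, hαi]
      push_cast
      field_simp
      ring
    · have h1 := abs_pval_edgeField_le S hdiam 0 i α j hx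
      have h2 := hbd x hx j
      have h3 : (β i : ℝ) / (β 0 + 1) ≤ k := by
        rw [div_le_iff₀ hb0]
        have : β i ≤ k := hβ ▸ Finset.single_le_sum (fun _ _ => Nat.zero_le _) (Finset.mem_univ i)
        have : (β i : ℝ) ≤ k := by exact_mod_cast this
        nlinarith [(Nat.cast_nonneg (β 0) : (0 : ℝ) ≤ β 0), (Nat.cast_nonneg k : (0 : ℝ) ≤ k)]
      have h4 : 1 / ((β 0 : ℝ) + 1) ≤ 1 := by
        rw [div_le_one hb0]; linarith [(Nat.cast_nonneg (β 0) : (0 : ℝ) ≤ β 0)]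
      have h5 : (0 : ℝ) ≤ 1 / ((β 0 : ℝ) + 1) := by positivity
      have h6 : (0 : ℝ) ≤ (β i : ℝ) / (β 0 + 1) := by positivity
      rw [Pi.add_apply, Pi.smul_apply, Pi.smul_apply, pval_add, pval_smul, pval_smul]
      refine (abs_add_le _ _).trans ?_
      rw [abs_mul, abs_mul, abs_of_nonneg h5, abs_of_nonneg h6]
      calc _ ≤ 1 * h + k * (K * h) := by gcongr
        _ = _ := by ring

/-- Combining the bubble fields of the monomials of `r` leaves a multiple of `λ_0 ^ k` as error in
the divergence. A field without normal trace has a divergence of mean zero, and so has `r`; as `λ_0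
^ k` has a positive integral, the multiple is zero. -/
lemma exists_bubble_lift (d : ℕ) (hd : 0 < d) (k : ℕ) : ∃ C : ℝ, 0 < C ∧
    ∀ (S : Affine.Simplex ℝ (Space d) d) (h : ℝ), 0 < h →
      (∀ x ∈ body S, ∀ y ∈ body S, ‖x - y‖ ≤ h) →
      ∀ r : Poly d, r.totalDegree ≤ k → ∫ x in body S, pval r x = 0 →
      ∃ τ : Fin d → Poly d, (∀ j, (τ j).totalDegree ≤ k + 1) ∧
        (∀ l, ∀ x ∈ facet S l, normalTr S l τ x = 0) ∧
        (∀ x, pval (fdiv τ) x = pval r x) ∧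
        ∀ j, ∫ x in body S, pval (τ j) x ^ 2 ≤ C * (h ^ 2 * ∫ x in body S, pval r x ^ 2) := by
  obtain ⟨C₀, hC₀, hC⟩ := exists_coeff_sq_le d k
  choose K hK hB using exists_bubble_field d hd k
  set Km : ℝ := ∑ n ∈ Finset.range (k + 1), K n with hKm
  have hKm0 : 0 ≤ Km := Finset.sum_nonneg fun n _ => hK n
  set N : ℝ := ((baryIndex d k).card : ℝ) with hN
  have hN0 : 0 ≤ N := Nat.cast_nonneg _
  refine ⟨(Km + 1) ^ 2 * ((N + 1) * C₀), by positivity, fun S h hh hdiam r hr hr0 => ?_⟩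
  obtain ⟨c, hc⟩ := exists_bary_coeff S r hr
  have hB' : ∀ β : Fin (d + 1) → ℕ, ∃ (τ : Fin d → Poly d) (s : ℝ), β ∈ baryIndex d k →
      (∀ j, (τ j).totalDegree ≤ k + 1) ∧
        (∀ l, ∀ x ∈ facet S l, normalTr S l τ x = 0) ∧
        (∀ x, pval (fdiv τ) x = bmon S β x - s * bmon S (Pi.single 0 k) x) ∧
        ∀ x ∈ body S, ∀ j, |pval (τ j) x| ≤ (Km + 1) * h := by
    intro β
    by_cases hβ : β ∈ baryIndex d k
    · obtain ⟨τ, s, h1, h2, h3, h4⟩ := hB (k - β 0) S h hh hdiam β (mem_baryIndex.1 hβ) rfl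
      refine ⟨τ, s, fun _ => ⟨h1, h2, h3, fun x hx j => (h4 x hx j).trans ?_⟩⟩
      have : K (k - β 0) ≤ Km :=
        Finset.single_le_sum (fun n _ => hK n) (Finset.mem_range.2 (by omega))
      gcongr
      linarith
    · exact ⟨0, 0, fun h => absurd h hβ⟩
  choose t s hts using hB'
  set τ : Fin d → Poly d := ∑ β ∈ baryIndex d k, c β • t β with hτ
  have hnor : ∀ l, ∀ x ∈ facet S l, normalTr S l τ x = 0 := by
    intro l x hx
    rw [hτ, normalTr_sum]
    refine Finset.sum_eq_zero fun β hβ => ?_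
    rw [normalTr_smul, (hts β hβ).2.1 l x hx, mul_zero]
  have hdiv : ∀ x, pval (fdiv τ) x = pval r x -
      (∑ β ∈ baryIndex d k, c β * s β) * bmon S (Pi.single 0 k) x := by
    intro x
    rw [hτ, fdiv_sum, pval_sum, hc, Finset.sum_mul, ← Finset.sum_sub_distrib]
    refine Finset.sum_congr rfl fun β hβ => ?_
    rw [fdiv_smul, pval_smul, (hts β hβ).2.2.1]; ring
  have hint : ∀ f : Space d → ℝ, Continuous f → IntegrableOn f (body S) := fun f hf =>
    hf.continuousOn.integrableOn_compact (isCompact_body S)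
  have hs0 : ∑ β ∈ baryIndex d k, c β * s β = 0 := by
    have h1 := integral_fdiv S hd τ
    rw [Finset.sum_eq_zero] at h1
    · simp only [hdiv] at h1
      rw [integral_sub (hint _ (continuous_pval r))
        ((hint _ (continuous_bmon S _)).const_mul _), hr0, integral_const_mul,
        zero_sub, neg_eq_zero] at h1
      rcases mul_eq_zero.1 h1 with h | h
      · exact h
      · exfalso
        have h2 := (setIntegral_eq_zero_iff_of_nonneg_ae (s := body S)
          (f := bmon S (Pi.single 0 k)) (μ := volume) ((ae_restrict_iff' (isCompact_body S).measurableSet).2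
            (Eventually.of_forall fun x hx => Finset.prod_nonneg fun i _ =>
              pow_nonneg ((mem_body S).1 hx i) _)) (hint _ (continuous_bmon S _))).1 h
        obtain ⟨x, hx⟩ := interior_body_nonempty S
        have h3 : Set.EqOn (bmon S (Pi.single 0 k)) 0 (interior (body S)) :=
          Measure.eqOn_open_of_ae_eq (ae_restrict_of_ae_restrict_of_subset interior_subset h2)
            isOpen_interior (continuous_bmon S _).continuousOn continuousOn_const
        have h4 : 0 < bmon S (Pi.single 0 k) x :=
          Finset.prod_pos fun i _ => pow_pos ((mem_interior_body S).1 hx i) _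
        exact h4.ne' (h3 hx)
    · intro l _
      rw [setIntegral_congr_fun (g := fun _ => 0) (isCompact_facet S l).measurableSet
        fun x hx => hnor l x hx]
      simp
  refine ⟨τ, fun j => ?_, hnor, fun x => by rw [hdiv, hs0]; ring, fun j => ?_⟩
  · rw [hτ, Finset.sum_apply]
    refine MvPolynomial.totalDegree_finsetSum_le fun β hβ => ?_
    exact (MvPolynomial.totalDegree_smul_le _ _).trans ((hts β hβ).1 j)
  · set A : ℝ := ∑ β ∈ baryIndex d k, |c β| with hA
    have hA2 : A ^ 2 ≤ N * ∑ α ∈ baryIndex d k, c α ^ 2 := by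
      have := sq_sum_le_card_mul_sum_sq (s := baryIndex d k) (f := fun α => |c α|)
      simpa [sq_abs] using this
    have hb : ∀ x ∈ body S, |pval (τ j) x| ≤ A * ((Km + 1) * h) := by
      intro x hx
      have : pval (τ j) x = ∑ β ∈ baryIndex d k, c β * pval (t β j) x := by simp [hτ]
      rw [this]
      refine (Finset.abs_sum_le_sum_abs _ _).trans ?_
      rw [hA, Finset.sum_mul]
      refine Finset.sum_le_sum fun β hβ => ?_
      rw [abs_mul]
      exact mul_le_mul_of_nonneg_left ((hts β hβ).2.2.2 x hx j) (abs_nonneg _)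
    refine (integral_body_sq_le S hb).trans ?_
    have h1 := hC S c
    simp only [← hc] at h1
    have hV := volume_real_body_pos S
    set I := ∫ x in body S, pval r x ^ 2 with hI
    have hI0 : 0 ≤ I := integral_nonneg fun z => sq_nonneg _
    have h2 : volume.real (body S) * A ^ 2 ≤ (N + 1) * (C₀ * I) := by
      calc volume.real (body S) * A ^ 2
          ≤ N * (volume.real (body S) * ∑ α ∈ baryIndex d k, c α ^ 2) := by nlinarith
        _ ≤ N * (C₀ * I) := mul_le_mul_of_nonneg_left h1 hN0
        _ ≤ (N + 1) * (C₀ * I) := by gcongr; linarith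
    calc volume.real (body S) * (A * ((Km + 1) * h)) ^ 2
        = volume.real (body S) * A ^ 2 * ((Km + 1) * h) ^ 2 := by ring
      _ ≤ (N + 1) * (C₀ * I) * ((Km + 1) * h) ^ 2 := by gcongr
      _ = _ := by ring

/-- Lifting of normal traces and divergence on a simplex. -/
theorem exists_simplex_lift (d : ℕ) (hd : 0 < d) (k : ℕ) {κ : ℝ} (hκ : 0 < κ) : ∃ C : ℝ, 0 < C ∧
    ∀ (S : Affine.Simplex ℝ (Space d) d) (h : ℝ), 0 < h →
      (∀ x ∈ body S, ∀ y ∈ body S, ‖x - y‖ ≤ h) → (∀ l, κ * h ≤ height S l) →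
      ∀ (g : Fin (d + 1) → Poly d) (r : Poly d), (∀ l, (g l).totalDegree ≤ k + 1) →
      r.totalDegree ≤ k →
      ∫ x in body S, pval r x = ∑ l, ∫ z in facet S l, pval (g l) z ∂(surf d) →
      ∃ τ : Fin d → Poly d, (∀ j, (τ j).totalDegree ≤ k + 1) ∧
        (∀ l, ∀ x ∈ facet S l, normalTr S l τ x = pval (g l) x) ∧
        (∀ x, pval (fdiv τ) x = pval r x) ∧
        ∑ j, ∫ x in body S, pval (τ j) x ^ 2 ≤
          C * (h * ∑ l, ∫ z in facet S l, pval (g l) z ^ 2 ∂(surf d) +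
            h ^ 2 * ∫ x in body S, pval r x ^ 2) := by
  obtain ⟨C₁, hC₁, H₁⟩ := exists_trace_lift d hd k hκ
  obtain ⟨C₂, hC₂, H₂⟩ := exists_bubble_lift d hd k
  refine ⟨d * (2 * ((d + 1) * C₁) + 2 * (C₂ * (2 + 2 * ((d + 1) * C₁)))), by positivity,
    fun S h hh hdiam hκh g r hg hr hcomp => ?_⟩
  choose t ht1 ht2 ht3 ht4 ht5 using fun l => H₁ S h hh hdiam l (hκh l) (g l) (hg l)
  set I := ∑ l, ∫ z in facet S l, pval (g l) z ^ 2 ∂(surf d) with hI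
  have hI0 : 0 ≤ I := Finset.sum_nonneg fun l _ => integral_nonneg fun z => sq_nonneg _
  set J := ∫ x in body S, pval r x ^ 2 with hJ
  have hJ0 : 0 ≤ J := integral_nonneg fun z => sq_nonneg _
  set τ₁ : Fin d → Poly d := ∑ l, t l with hτ₁
  have hτ₁j : ∀ j x, pval (τ₁ j) x = ∑ l, pval (t l j) x := fun j x => by simp [hτ₁]
  have hτ₁n : ∀ l, ∀ x ∈ facet S l, normalTr S l τ₁ x = pval (g l) x := by
    intro l x hx
    rw [hτ₁, normalTr_sum, Finset.sum_eq_single l]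
    · exact ht2 l x hx
    · intro l' _ hl'; exact ht3 l' l hl'.symm x hx
    · simp
  have hτ₁d : ∀ j, (τ₁ j).totalDegree ≤ k + 1 := fun j => by
    rw [hτ₁, Finset.sum_apply]
    exact MvPolynomial.totalDegree_finsetSum_le fun l _ => ht1 l j
  have hb1 : ∀ j, ∫ x in body S, pval (τ₁ j) x ^ 2 ≤ (d + 1) * C₁ * (h * I) := by
    intro j
    simp only [hτ₁j]
    refine (integral_sq_sum_le _ fun l _ => memLp_body (continuous_pval _)).trans ?_
    rw [Finset.card_univ, Fintype.card_fin, mul_assoc]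
    push_cast
    gcongr
    rw [hI, Finset.mul_sum, Finset.mul_sum]
    exact Finset.sum_le_sum fun l _ => ht4 l j
  have hb2 : h ^ 2 * ∫ x in body S, pval (fdiv τ₁) x ^ 2 ≤ (d + 1) * C₁ * (h * I) := by
    simp only [hτ₁, fdiv_sum, pval_sum]
    calc _ ≤ h ^ 2 * (((Finset.univ : Finset (Fin (d + 1))).card : ℝ) *
          ∑ l, ∫ x in body S, pval (fdiv (t l)) x ^ 2) := by
            gcongr
            exact integral_sq_sum_le _ fun l _ => memLp_body (continuous_pval _)
      _ = (d + 1) * ∑ l, h ^ 2 * ∫ x in body S, pval (fdiv (t l)) x ^ 2 := by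
          rw [Finset.card_univ, Fintype.card_fin, ← Finset.mul_sum]; push_cast; ring
      _ ≤ (d + 1) * ∑ l, C₁ * (h * ∫ z in facet S l, pval (g l) z ^ 2 ∂(surf d)) := by
          exact mul_le_mul_of_nonneg_left (Finset.sum_le_sum fun l _ => ht5 l) (by positivity)
      _ = _ := by rw [hI, ← Finset.mul_sum, ← Finset.mul_sum]; ring
  have hint : ∀ f : Space d → ℝ, Continuous f → IntegrableOn f (body S) := fun f hf =>
    hf.continuousOn.integrableOn_compact (isCompact_body S)
  -- The normal traces are already right for `τ₁`. By the compatibility condition the defect of its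
  -- divergence has mean zero, so a field without normal trace corrects it.
  obtain ⟨τ₂, hτ₂d, hτ₂n, hτ₂r, hτ₂b⟩ := H₂ S h hh hdiam (r - fdiv τ₁)
    ((MvPolynomial.totalDegree_sub _ _).trans (max_le hr (totalDegree_fdiv_le hτ₁d))) (by
      simp only [pval_sub]
      rw [integral_sub (hint _ (continuous_pval _)) (hint _ (continuous_pval _)), hcomp,
        integral_fdiv S hd, sub_eq_zero]
      refine Finset.sum_congr rfl fun l _ => ?_
      exact setIntegral_congr_fun (isCompact_facet S l).measurableSet fun x hx =>
        (hτ₁n l x hx).symm)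
  have hb3 : h ^ 2 * ∫ x in body S, pval (r - fdiv τ₁) x ^ 2 ≤
      2 * (h ^ 2 * J) + 2 * ((d + 1) * C₁ * (h * I)) := by
    have h1 := integral_sub_sq_le (memLp_body (S := S) (continuous_pval r))
      (memLp_body (continuous_pval (fdiv τ₁)))
    simp only [← pval_sub] at h1
    have h2 : 0 ≤ h ^ 2 := sq_nonneg h
    nlinarith
  refine ⟨τ₁ + τ₂, fun j => (MvPolynomial.totalDegree_add _ _).trans (max_le (hτ₁d j) (hτ₂d j)),
    fun l x hx => ?_, fun x => ?_, ?_⟩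
  · rw [normalTr_add, hτ₁n l x hx, hτ₂n l x hx, add_zero]
  · rw [fdiv_add, pval_add, hτ₂r, pval_sub]; ring
  · have hj : ∀ j, ∫ x in body S, pval ((τ₁ + τ₂) j) x ^ 2 ≤
        (2 * ((d + 1) * C₁) + 2 * (C₂ * (2 + 2 * ((d + 1) * C₁)))) * (h * I + h ^ 2 * J) := by
      intro j
      change ∫ x in body S, pval (τ₁ j + τ₂ j) x ^ 2 ≤ _
      have h1 := integral_add_sq_le (memLp_body (S := S) (continuous_pval (τ₁ j)))
        (memLp_body (continuous_pval (τ₂ j)))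
      simp only [← pval_add] at h1
      have h2 := hb1 j
      have h3 := (hτ₂b j).trans (mul_le_mul_of_nonneg_left hb3 hC₂.le)
      have hX : 0 ≤ h * I := by positivity
      have hY : 0 ≤ h ^ 2 * J := by positivity
      have h4 : 0 ≤ (d + 1) * C₁ * (h ^ 2 * J) := by positivity
      have h5 : 0 ≤ C₂ * (h * I) := by positivity
      have h6 : 0 ≤ C₂ * ((d + 1) * C₁ * (h ^ 2 * J)) := by positivity
      calc _ ≤ 2 * ((d + 1) * C₁ * (h * I)) +
            2 * (C₂ * (2 * (h ^ 2 * J) + 2 * ((d + 1) * C₁ * (h * I)))) := by linarith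
        _ ≤ 2 * ((d + 1) * C₁ * (h * I)) +
            2 * (C₂ * (2 * (h ^ 2 * J) + 2 * ((d + 1) * C₁ * (h * I)))) +
              (2 * ((d + 1) * C₁ * (h ^ 2 * J)) + 4 * (C₂ * (h * I)) +
                4 * (C₂ * ((d + 1) * C₁ * (h ^ 2 * J)))) := by linarith
        _ = _ := by ring
    calc _ ≤ ∑ _j : Fin d, (2 * ((d + 1) * C₁) + 2 * (C₂ * (2 + 2 * ((d + 1) * C₁)))) *
          (h * I + h ^ 2 * J) := Finset.sum_le_sum fun j _ => hj j
      _ = _ := by rw [Finset.sum_const, Finset.card_univ, Fintype.card_fin, nsmul_eq_mul]; ring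

end Lifting

end SFWG

end

noncomputable section

namespace SFWG

/-! ### Two simplices with faces in one hyperplane -/

section TwoSimplices

variable {d : ℕ} (S : Affine.Simplex ℝ (Space d) d)

/-- Expand `v` in the vertices with the coefficients `⟨∇λ_r, v⟩`. These add up to zero, so `c` may
be subtracted from the products with the vertices, after which only the vertex `l` is left. -/
lemma eq_smul_glam {l : Fin (d + 1)} {w : Space d} {c : ℝ}
    (h : ∀ x ∈ facet S l, inner ℝ w x = c) :
    w = (inner ℝ w (S.points l) - c) • glam S l := by
  refine ext_inner_right ℝ fun v => ?_
  have h1 : inner ℝ w v = ∑ r, inner ℝ (glam S r) v * inner ℝ w (S.points r) := by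
    conv_lhs => rw [← sum_inner_glam_smul S v]
    rw [inner_sum]
    simp only [inner_smul_right]
  have h2 : inner ℝ w v = ∑ r, inner ℝ (glam S r) v * (inner ℝ w (S.points r) - c) := by
    simp only [mul_sub, Finset.sum_sub_distrib, ← Finset.sum_mul, sum_inner_glam, zero_mul,
      sub_zero, h1]
  rw [h2, Finset.sum_eq_single l, inner_smul_left]
  · simp [mul_comm]
  · intro r _ hr
    rw [h _ (points_mem_facet S hr), sub_self, mul_zero]
  · simp

lemma outwardNormal_eq_or_eq_neg (hd : 0 < d) {l : Fin (d + 1)} {n : Space d} (hn : ‖n‖ = 1)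
    {c : ℝ} (h : ∀ x ∈ facet S l, inner ℝ n x = c) :
    outwardNormal S l = n ∨ outwardNormal S l = -n := by
  have h1 := eq_smul_glam S h
  set a := inner ℝ n (S.points l) - c with ha
  have hg : 0 < ‖glam S l‖ := norm_pos_iff.2 (glam_ne_zero S hd l)
  have h2 : |a| * ‖glam S l‖ = 1 := by
    rw [← hn]
    conv_rhs => rw [h1]
    rw [norm_smul, Real.norm_eq_abs]
  have h3 : |a| = height S l := by
    rw [height]; field_simp; exact h2
  rw [outwardNormal_eq S hd l, ← h3]
  rcases abs_choice a with h4 | h4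
  · right; rw [h4]; exact congrArg _ h1.symm
  · left; rw [h4, neg_smul, neg_neg]; exact h1.symm

lemma inner_outwardNormal_const (hd : 0 < d) (l : Fin (d + 1)) :
    ∃ c, ∀ x ∈ facet S l, inner ℝ (outwardNormal S l) x = c := by
  obtain ⟨z, hz⟩ := relFacet_nonempty S hd l
  refine ⟨inner ℝ (outwardNormal S l) z, fun x hx => ?_⟩
  have h := inner_outwardNormal S hd l x z
  rw [((mem_facet S).1 hx).2, ((mem_facet S).1 (relFacet_subset S l hz)).2, inner_sub_right] at h
  linarith

lemma exists_open_halfBall {n x : Space d} (hn : ‖n‖ = 1) {ε : ℝ} (hε : 0 < ε) :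
    (Metric.ball x ε ∩ {y | inner ℝ n (y - x) < 0}).Nonempty := by
  refine ⟨x - (ε / 2) • n, ?_, ?_⟩
  · rw [Metric.mem_ball, dist_eq_norm, sub_sub_cancel_left, norm_neg, norm_smul, hn,
      Real.norm_of_nonneg (by positivity)]
    linarith
  · simp only [Set.mem_ofPred_eq, sub_sub_cancel_left, inner_neg_right, inner_smul_right,
      real_inner_self_eq_norm_sq, hn]
    linarith

lemma isOpen_halfBall (n x : Space d) (ε : ℝ) :
    IsOpen (Metric.ball x ε ∩ {y | inner ℝ n (y - x) < 0}) :=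
  Metric.isOpen_ball.inter (isOpen_lt (by fun_prop) continuous_const)

/-- Simplices without common interior points that touch in relative interior points of faces in
one hyperplane lie on different sides of it. -/
lemma opposite_normals (hd : 0 < d) {S S' : Affine.Simplex ℝ (Space d) d}
    (hdisj : Disjoint (interior (body S)) (interior (body S'))) {l l' : Fin (d + 1)}
    {n : Space d} (hn : ‖n‖ = 1) {c : ℝ} (h : ∀ x ∈ facet S l, inner ℝ n x = c)
    (h' : ∀ x ∈ facet S' l', inner ℝ n x = c) {x : Space d} (hx : x ∈ relFacet S l)
    (hx' : x ∈ relFacet S' l') :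
    outwardNormal S' l' = -outwardNormal S l ∧ x ∈ interior (body S ∪ body S') := by
  obtain ⟨ε, hε, hb⟩ := exists_halfBall_subset S hd hx
  obtain ⟨ε', hε', hb'⟩ := exists_halfBall_subset S' hd hx'
  -- Equal normals would put the same open half ball at `x` into both simplices, against
  -- disjointness of the interiors. With opposite normals the two half balls make up a full ball.
  have hopp : outwardNormal S' l' = -outwardNormal S l := by
    by_contra hne
    have heq : outwardNormal S' l' = outwardNormal S l := by
      rcases outwardNormal_eq_or_eq_neg S hd hn h with h1 | h1 <;>
      rcases outwardNormal_eq_or_eq_neg S' hd hn h' with h2 | h2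
      · rw [h1, h2]
      · exact absurd (by rw [h1, h2]) hne
      · exact absurd (by rw [h1, h2, neg_neg]) hne
      · rw [h1, h2]
    have hn1 := norm_outwardNormal S hd l
    obtain ⟨y, hy⟩ := exists_open_halfBall (x := x) hn1 (lt_min hε hε')
    have hop := isOpen_halfBall (outwardNormal S l) x (min ε ε')
    refine Set.disjoint_left.1 hdisj (interior_maximal ?_ hop hy)
      (interior_maximal ?_ hop hy)
    · rintro z ⟨hz1, hz2⟩
      exact hb z (Metric.ball_subset_ball (min_le_left _ _) hz1) (le_of_lt hz2)
    · rintro z ⟨hz1, hz2⟩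
      exact hb' z (Metric.ball_subset_ball (min_le_right _ _) hz1) (by rw [heq]; exact le_of_lt hz2)
  refine ⟨hopp, mem_interior_iff_mem_nhds.2 (Metric.mem_nhds_iff.2 ⟨min ε ε', lt_min hε hε', ?_⟩)⟩
  intro z hz
  rcases le_total (inner ℝ (outwardNormal S l) (z - x)) 0 with h0 | h0
  · exact Or.inl (hb z (Metric.ball_subset_ball (min_le_left _ _) hz) h0)
  · refine Or.inr (hb' z (Metric.ball_subset_ball (min_le_right _ _) hz) ?_)
    rw [hopp, inner_neg_left]; linarith

/-- The relative interior is dense in the face. -/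
lemma facet_subset_closure_relFacet (hd : 0 < d) (l : Fin (d + 1)) :
    facet S l ⊆ closure (relFacet S l) := by
  intro x hx
  obtain ⟨z, hz⟩ := relFacet_nonempty S hd l
  have hx' := (mem_facet S).1 hx
  have hlim : Tendsto (fun t : ℝ => (1 - t) • x + t • z) (𝓝[>] 0) (𝓝 x) := by
    have : Continuous fun t : ℝ => (1 - t) • x + t • z := by fun_prop
    have h := (this.tendsto 0).mono_left (nhdsWithin_le_nhds (s := Set.Ioi 0))
    simpa using h
  refine mem_closure_of_tendsto hlim ?_
  filter_upwards [Ioo_mem_nhdsGT (zero_lt_one' ℝ)] with t ht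
  refine ⟨by rw [lam_combo, hx'.2, hz.1]; ring, fun i hi => ?_⟩
  · rw [lam_combo]
    have h1 := hz.2 i hi
    have h2 := hx'.1 i
    have h3 := mul_pos ht.1 h1
    have h4 := mul_nonneg (sub_nonneg.2 ht.2.le) h2
    linarith

lemma not_mem_interior_of_lam_eq_zero {x : Space d} {m : Fin (d + 1)} (h : lam S m x = 0) :
    x ∉ interior (body S) := fun hx => ((mem_interior_body S).1 hx m).ne' h

lemma body_subset_closure_interior : body S ⊆ closure (interior (body S)) := by
  rw [(convex_body S).closure_interior_eq_closure_of_nonempty_interior (interior_body_nonempty S)]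
  exact subset_closure

end TwoSimplices

/-! ### Flows on finite graphs -/

section Flow

/-- Potentials whose steps are bounded differ by a bounded amount, uniformly for graphs of bounded
size. -/
lemma exists_potential_bound (N : ℕ) : ∃ K : ℝ, 0 ≤ K ∧ ∀ n, n ≤ N →
    ∀ (R : Fin n → Fin n → Prop) (i j : Fin n), Relation.ReflTransGen R i j →
      ∀ (f : Fin n → ℝ) (δ : ℝ), 0 ≤ δ → (∀ i j, R i j → |f i - f j| ≤ δ) →
        |f i - f j| ≤ K * δ := by
  -- There are only finitely many graphs on at most `N` vertices, so a bound that depends on the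
  -- graph and on its endpoints can be replaced by one that depends on `N` alone.
  have h1 : ∀ x : (Σ n : Fin (N + 1), (Fin n → Fin n → Prop) × Fin n × Fin n), ∃ K : ℝ,
      Relation.ReflTransGen x.2.1 x.2.2.1 x.2.2.2 → ∀ (f : Fin x.1 → ℝ) (δ : ℝ), 0 ≤ δ →
        (∀ i j, x.2.1 i j → |f i - f j| ≤ δ) → |f x.2.2.1 - f x.2.2.2| ≤ K * δ := by
    rintro ⟨n, R, i, j⟩
    by_cases h : Relation.ReflTransGen R i j
    · suffices h' : ∃ K : ℝ, ∀ (f : Fin n → ℝ) (δ : ℝ), 0 ≤ δ →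
          (∀ i j, R i j → |f i - f j| ≤ δ) → |f i - f j| ≤ K * δ from
        h'.imp fun K hK _ => hK
      induction h with
      | refl => exact ⟨0, fun f δ _ _ => by simp⟩
      | tail _ hbc ih =>
        obtain ⟨K, hK⟩ := ih
        refine ⟨K + 1, fun f δ hδ hf => ?_⟩
        have h1 := hK f δ hδ hf
        have h2 := hf _ _ hbc
        calc _ ≤ _ := abs_sub_le _ _ _
          _ ≤ _ := add_le_add h1 h2
          _ = _ := by ring
    · exact ⟨0, fun h' => absurd h' h⟩
  choose K hK using h1
  obtain ⟨B, hB⟩ := (Set.finite_range K).bddAbove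
  refine ⟨max B 0, le_max_right _ _, fun n hn R i j h f δ hδ hf => ?_⟩
  refine (hK ⟨⟨n, by omega⟩, R, i, j⟩ h f δ hδ hf).trans ?_
  gcongr
  exact (hB ⟨_, rfl⟩).trans (le_max_left _ _)

/-- In a family of cells whose sides are matched in pairs by `R`, a unit flow between connected
cells, with a bound that is uniform for families of bounded size. -/
lemma exists_unit_flow (N m : ℕ) : ∃ K : ℝ, 0 ≤ K ∧ ∀ n, n ≤ N →
    ∀ (R : Fin n × Fin m → Fin n × Fin m → Prop), (∀ a b, R a b → R b a) →
      (∀ a b c, R a b → R a c → b = c) → ∀ i j : Fin n,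
      Relation.ReflTransGen (fun i j => ∃ l l', R (i, l) (j, l') ∨ i = j) i j →
      ∃ s : Fin n × Fin m → ℝ, (∀ a, |s a| ≤ K) ∧ (∀ a b, R a b → a ≠ b → s a + s b = 0) ∧
        (∀ a, (∀ b, R a b → a = b) → s a = 0) ∧
        ∀ r, ∑ l, s (r, l) = (if r = i then 1 else 0) - (if r = j then 1 else 0) := by
  classical
  have h1 : ∀ x : (Σ n : Fin (N + 1), (Fin n × Fin m → Fin n × Fin m → Prop) × Fin n × Fin n),
      ∃ K : ℝ, (∀ a b, x.2.1 a b → x.2.1 b a) →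
      (∀ a b c, x.2.1 a b → x.2.1 a c → b = c) →
      Relation.ReflTransGen (fun i j => ∃ l l', x.2.1 (i, l) (j, l') ∨ i = j) x.2.2.1 x.2.2.2 →
      ∃ s : Fin x.1 × Fin m → ℝ, (∀ a, |s a| ≤ K) ∧
        (∀ a b, x.2.1 a b → a ≠ b → s a + s b = 0) ∧
        (∀ a, (∀ b, x.2.1 a b → a = b) → s a = 0) ∧
        ∀ r, ∑ l, s (r, l) = (if r = x.2.2.1 then 1 else 0) - (if r = x.2.2.2 then 1 else 0) := by
    rintro ⟨n, R, i, j⟩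
    by_cases hR : (∀ a b, R a b → R b a) ∧ (∀ a b c, R a b → R a c → b = c) ∧
      Relation.ReflTransGen (fun i j => ∃ l l', R (i, l) (j, l') ∨ i = j) i j
    · obtain ⟨hsymm, huniq, h⟩ := hR
      suffices h' : ∃ s : Fin n × Fin m → ℝ, (∀ a b, R a b → a ≠ b → s a + s b = 0) ∧
          (∀ a, (∀ b, R a b → a = b) → s a = 0) ∧
          ∀ r, ∑ l, s (r, l) = (if r = i then 1 else 0) - (if r = j then 1 else 0) by
        obtain ⟨s, hs⟩ := h'
        refine ⟨∑ a, |s a|, fun _ _ _ => ⟨s, fun a => ?_, hs⟩⟩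
        exact Finset.single_le_sum (f := fun a => |s a|) (fun a _ => abs_nonneg _)
          (Finset.mem_univ a)
      induction h with
      | refl => exact ⟨0, by simp, by simp, by simp⟩
      | @tail b c _ hbc ih =>
        obtain ⟨s, hs1, hs2, hs3⟩ := ih
        obtain ⟨l, l', hll⟩ := hbc
        -- Steps that stay in the same cell carry no flow.
        by_cases hbc' : b = c
        · subst hbc'; exact ⟨s, hs1, hs2, hs3⟩
        have hll : R (b, l) (c, l') := hll.resolve_right hbc'
        have hne : (b, l) ≠ (c, l') := fun h => hbc' (congrArg Prod.fst h)
        -- One more unit is sent out of cell `b` through its side `l` and into cell `c` through the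
        -- matching side `l'`. Uniqueness of the matching keeps the two values on any other pair of
        -- sides unaffected.
        refine ⟨fun a => s a + ((if a = (b, l) then 1 else 0) - (if a = (c, l') then 1 else 0)),
          fun a e hae hne' => ?_, fun a ha => ?_, fun r => ?_⟩
        · have h0 := hs1 a e hae hne'
          have e1 : a = (b, l) ↔ e = (c, l') := by
            constructor
            · rintro rfl; exact huniq _ _ _ hae hll
            · rintro rfl; exact huniq _ _ _ (hsymm _ _ hae) (hsymm _ _ hll)
          have e2 : a = (c, l') ↔ e = (b, l) := by
            constructor
            · rintro rfl; exact huniq _ _ _ hae (hsymm _ _ hll)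
            · rintro rfl; exact huniq _ _ _ (hsymm _ _ hae) hll
          simp only [e1, e2]
          linarith
        · have n1 : a ≠ (b, l) := by rintro rfl; exact hne (ha _ hll)
          have n2 : a ≠ (c, l') := by rintro rfl; exact hne (ha _ (hsymm _ _ hll)).symm
          simp [n1, n2, hs2 a ha]
        · rw [Finset.sum_add_distrib, hs3, Finset.sum_sub_distrib]
          have e3 : ∀ (b : Fin n) (l : Fin m),
              (∑ x, if (r, x) = (b, l) then (1 : ℝ) else 0) = if r = b then 1 else 0 := by
            intro b l
            by_cases h : r = b
            · subst h; simp
            · simp [h]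
          rw [e3, e3]
          ring
    · exact ⟨0, fun h1 h2 h3 => absurd ⟨h1, h2, h3⟩ hR⟩
  choose K hK using h1
  obtain ⟨B, hB⟩ := (Set.finite_range K).bddAbove
  refine ⟨max B 0, le_max_right _ _, fun n hn R h1 h2 i j h => ?_⟩
  obtain ⟨s, hs, hs'⟩ := hK ⟨⟨n, by omega⟩, R, i, j⟩ h1 h2 h
  exact ⟨s, fun a => (hs a).trans ((hB ⟨_, rfl⟩).trans (le_max_left _ _)), hs'⟩

end Flow

end SFWG

end

noncomputable section

namespace SFWG

/-! ### Conforming families of simplices -/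

section Triangulation

variable {d n : ℕ}

/-- A family of different simplices that meet face to face, connected through common faces. -/
structure Triang (S : Fin n → Affine.Simplex ℝ (Space d) d) : Prop where
  inj : ∀ i j, Set.range (S i).points = Set.range (S j).points → i = j
  conf : ∀ i j, body (S i) ∩ body (S j) =
    convexHull ℝ (Set.range (S i).points ∩ Set.range (S j).points)
  conn : ∀ i j, Relation.ReflTransGen (fun i j => ∃ l m, facet (S i) l = facet (S j) m) i j

/-- The union of the simplices. -/
def tunion (S : Fin n → Affine.Simplex ℝ (Space d) d) : Set (Space d) := ⋃ i, body (S i)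

/-- The side `a = (i, l)`: the face of the `i`-th simplex opposite to its vertex `l`. -/
abbrev side (S : Fin n → Affine.Simplex ℝ (Space d) d) (a : Fin n × Fin (d + 1)) :
    Set (Space d) := facet (S a.1) a.2

/-- The outward normal on a side. -/
abbrev sideNormal (S : Fin n → Affine.Simplex ℝ (Space d) d) (a : Fin n × Fin (d + 1)) :
    Space d := outwardNormal (S a.1) a.2

/-- Two different sides coincide. -/
def SideAdj (S : Fin n → Affine.Simplex ℝ (Space d) d) (a b : Fin n × Fin (d + 1)) : Prop :=
  a ≠ b ∧ side S a = side S b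

variable {S : Fin n → Affine.Simplex ℝ (Space d) d}

lemma SideAdj.symm {a b : Fin n × Fin (d + 1)} (h : SideAdj S a b) : SideAdj S b a :=
  ⟨h.1.symm, h.2.symm⟩

lemma isCompact_tunion : IsCompact (tunion S) := isCompact_iUnion fun i => isCompact_body (S i)

lemma body_subset_tunion (i : Fin n) : body (S i) ⊆ tunion S :=
  Set.subset_iUnion (fun i => body (S i)) i

lemma facet_injective (T : Affine.Simplex ℝ (Space d) d) {l m : Fin (d + 1)}
    (h : facet T l = facet T m) : l = m := by
  by_contra hne
  have h1 : T.points m ∈ facet T l := points_mem_facet T (Ne.symm hne)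
  rw [h] at h1
  have := ((mem_facet T).1 h1).2
  rw [lam_points_self] at this
  exact one_ne_zero this

lemma SideAdj.fst_ne {a b : Fin n × Fin (d + 1)} (h : SideAdj S a b) : a.1 ≠ b.1 := by
  intro h1
  obtain ⟨i, l⟩ := a
  obtain ⟨j, m⟩ := b
  simp only at h1
  subst h1
  exact h.1 (congrArg (Prod.mk i) (facet_injective (S i) h.2))

/-- Almost every point of a side is a relative interior point of each side that contains it. -/
lemma ae_mem_relFacet_of_mem (hd : 0 < d) (S : Fin n → Affine.Simplex ℝ (Space d) d) :
    ∀ᵐ x ∂(surf d), ∀ a, x ∈ side S a → x ∈ relFacet (S a.1) a.2 := by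
  rw [ae_all_iff]
  intro a
  have h := surf_facet_diff_relFacet (S a.1) hd a.2
  rw [ae_iff]
  refine measure_mono_null (fun x hx => ?_) h
  simp only [Set.mem_ofPred_eq, Classical.not_imp] at hx
  exact hx

namespace Triang

lemma inter_eq (hT : Triang S) (i j : Fin n) : body (S i) ∩ body (S j) =
    convexHull ℝ ((S i).points '' {r | (S i).points r ∈ Set.range (S j).points}) := by
  rw [hT.conf]
  congr 1
  ext x
  constructor
  · rintro ⟨⟨r, rfl⟩, h⟩; exact ⟨r, h, rfl⟩
  · rintro ⟨r, h, rfl⟩; exact ⟨⟨r, rfl⟩, h⟩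

lemma exists_not_mem_range (hT : Triang S) {i j : Fin n} (hij : i ≠ j) :
    ∃ m, (S i).points m ∉ Set.range (S j).points := by
  by_contra! hcon
  refine hij (hT.inj i j ?_)
  refine Set.eq_of_subset_of_ncard_le ?_ ?_ (Set.finite_range _)
  · rintro _ ⟨m, rfl⟩; exact hcon m
  · rw [← Set.image_univ, ← Set.image_univ, Set.ncard_image_of_injective _ (S i).independent.injective,
      Set.ncard_image_of_injective _ (S j).independent.injective]

/-- Different simplices do not have the same vertices, so their intersection, spanned by the common
vertices, lies in the face opposite to some vertex. -/
lemma exists_lam_eq_zero (hT : Triang S) {i j : Fin n} (hij : i ≠ j) :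
    ∃ m, ∀ x ∈ body (S i) ∩ body (S j), lam (S i) m x = 0 := by
  obtain ⟨m, hm⟩ := hT.exists_not_mem_range hij
  refine ⟨m, fun x hx => ?_⟩
  rw [hT.inter_eq, mem_convexHull_image] at hx
  exact hx.2 m hm

lemma disjoint_interior (hT : Triang S) {i j : Fin n} (hij : i ≠ j) :
    Disjoint (interior (body (S i))) (interior (body (S j))) := by
  obtain ⟨m, hm⟩ := hT.exists_lam_eq_zero hij
  rw [Set.disjoint_left]
  intro x hx hx'
  exact not_mem_interior_of_lam_eq_zero (S i) (hm x ⟨interior_subset hx, interior_subset hx'⟩) hx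

/-- A point in the relative interior of a face can lie in the other simplex only if all vertices of
that face are common to both. The remaining vertex is then not common, and the `d` common vertices
span the face of the other simplex opposite to its own remaining vertex. -/
lemma exists_sideAdj (hT : Triang S) {i j : Fin n} (hij : i ≠ j) {l : Fin (d + 1)} {x : Space d}
    (hx : x ∈ relFacet (S i) l) (hxj : x ∈ body (S j)) : ∃ m, SideAdj S (i, l) (j, m) := by
  have hxi : x ∈ body (S i) := facet_subset_body _ _ (relFacet_subset _ _ hx)
  have hmem : x ∈ body (S i) ∩ body (S j) := ⟨hxi, hxj⟩
  rw [hT.inter_eq, mem_convexHull_image] at hmem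
  have hs : ∀ r, r ≠ l → (S i).points r ∈ Set.range (S j).points := by
    intro r hr
    by_contra hcon
    exact (hx.2 r hr).ne' (hmem.2 r hcon)
  obtain ⟨m₀, hm₀⟩ := hT.exists_not_mem_range hij
  have hl : (S i).points l ∉ Set.range (S j).points := by
    by_cases h : m₀ = l
    · rwa [← h]
    · exact absurd (hs m₀ h) hm₀
  set t : Set (Fin (d + 1)) := (S j).points ⁻¹' ((S i).points '' {l}ᶜ) with ht
  have himg : (S j).points '' t = (S i).points '' {l}ᶜ := by
    rw [ht, Set.image_preimage_eq_iff]
    rintro _ ⟨r, hr, rfl⟩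
    exact hs r hr
  have hcard : t.ncard = d := by
    have h1 := congrArg Set.ncard himg
    rw [Set.ncard_image_of_injective _ (S i).independent.injective,
      Set.ncard_image_of_injective _ (S j).independent.injective] at h1
    rw [h1, Set.ncard_compl, Nat.card_eq_fintype_card, Fintype.card_fin, Set.ncard_singleton]
    rfl
  have hc1 : tᶜ.ncard = 1 := by
    rw [Set.ncard_compl, Nat.card_eq_fintype_card, Fintype.card_fin, hcard]; omega
  obtain ⟨m, hm⟩ := Set.ncard_eq_one.1 hc1
  refine ⟨m, fun h => hij (congrArg Prod.fst h), ?_⟩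
  change convexHull ℝ _ = convexHull ℝ _
  rw [← himg, ← hm, compl_compl]

lemma sideAdj_normal (hT : Triang S)
    (hd : 0 < d) {a b : Fin n × Fin (d + 1)} (h : SideAdj S a b) {x : Space d}
    (hx : x ∈ relFacet (S a.1) a.2) (hx' : x ∈ relFacet (S b.1) b.2) :
    sideNormal S b = -sideNormal S a ∧ x ∈ interior (body (S a.1) ∪ body (S b.1)) := by
  obtain ⟨c, hc⟩ := inner_outwardNormal_const (S a.1) hd a.2
  exact opposite_normals hd (hT.disjoint_interior h.fst_ne) (norm_outwardNormal _ hd _) hc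
    (fun x hx => hc x (by have := h.2; simp only [side] at this; rw [this]; exact hx)) hx hx'

/-- The exceptional points form a null set, whereas a side has positive measure. -/
lemma exists_generic (hd : 0 < d) (a : Fin n × Fin (d + 1)) :
    ∃ x ∈ side S a, ∀ b, x ∈ side S b → x ∈ relFacet (S b.1) b.2 := by
  have h := ae_mem_relFacet_of_mem hd S
  by_contra! hcon
  have h0 : surf d (side S a) = 0 := by
    refine measure_mono_null (fun x hx => ?_) (ae_iff.1 h)
    obtain ⟨b, hb, hb'⟩ := hcon x hx
    exact fun h => hb' (h b hb)
  have hpos := surf_inter_facet_pos (S a.1) hd a.2 isOpen_univ (by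
    obtain ⟨z, hz⟩ := relFacet_nonempty (S a.1) hd a.2
    exact ⟨z, trivial, relFacet_subset _ _ hz⟩)
  rw [Set.univ_inter] at hpos
  exact hpos.ne' h0

lemma neg_sideNormal (hT : Triang S) (hd : 0 < d) {a b : Fin n × Fin (d + 1)} (h : SideAdj S a b) :
    sideNormal S b = -sideNormal S a := by
  obtain ⟨x, hx, hg⟩ := exists_generic (S := S) hd a
  exact (hT.sideAdj_normal hd h (hg a hx) (hg b (h.2 ▸ hx))).1

/-- Matched sides have opposite normals. With three coinciding sides one normal would be its own
negative. -/
lemma sideAdj_unique (hT : Triang S) (hd : 0 < d) {a b c : Fin n × Fin (d + 1)} (h : SideAdj S a b)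
    (h' : SideAdj S a c) : b = c := by
  by_contra hne
  have hbc : SideAdj S b c := ⟨hne, h.2.symm.trans h'.2⟩
  have h1 := hT.neg_sideNormal hd h
  have h2 := hT.neg_sideNormal hd h'
  have h3 := hT.neg_sideNormal hd hbc
  rw [h1, h2, neg_neg] at h3
  have h4 := norm_outwardNormal (S a.1) hd a.2
  have h5 : sideNormal S a = 0 := by
    have : (2 : ℝ) • sideNormal S a = 0 := by
      rw [two_smul]; nth_rewrite 1 [← h3]; simp
    simpa using this
  rw [show outwardNormal (S a.1) a.2 = sideNormal S a from rfl, h5, norm_zero] at h4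
  exact zero_ne_one h4

lemma mem_interior_of_sideAdj (hT : Triang S)
    (hd : 0 < d) {a b : Fin n × Fin (d + 1)} (h : SideAdj S a b)
    {x : Space d} (hx : x ∈ relFacet (S a.1) a.2) (hx' : x ∈ relFacet (S b.1) b.2) :
    x ∈ interior (tunion S) :=
  interior_mono (Set.union_subset (body_subset_tunion _) (body_subset_tunion _))
    (hT.sideAdj_normal hd h hx hx').2

lemma not_mem_body_of_forall_not (hT : Triang S)
    {a : Fin n × Fin (d + 1)} (ha : ∀ b, ¬SideAdj S a b)
    {x : Space d} (hx : x ∈ relFacet (S a.1) a.2) {j : Fin n} (hj : j ≠ a.1) :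
    x ∉ body (S j) := by
  intro hxj
  obtain ⟨m, hm⟩ := hT.exists_sideAdj hj.symm hx hxj
  exact ha _ hm

/-- Near a relative interior point of an unmatched side there is only one simplex. -/
lemma exists_ball_inter_subset (hT : Triang S) {a : Fin n × Fin (d + 1)} (ha : ∀ b, ¬SideAdj S a b)
    {x : Space d} (hx : x ∈ relFacet (S a.1) a.2) :
    ∃ ε > 0, Metric.ball x ε ∩ tunion S ⊆ body (S a.1) := by
  have hcl : IsClosed (⋃ j : {j : Fin n // j ≠ a.1}, body (S j)) :=
    isClosed_iUnion_of_finite fun j => (isCompact_body (S j)).isClosed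
  have hxn : x ∉ ⋃ j : {j : Fin n // j ≠ a.1}, body (S j) := by
    rw [Set.mem_iUnion]
    rintro ⟨⟨j, hj⟩, hxj⟩
    exact hT.not_mem_body_of_forall_not ha hx hj hxj
  obtain ⟨ε, hε, hb⟩ := Metric.mem_nhds_iff.1 (hcl.isOpen_compl.mem_nhds hxn)
  refine ⟨ε, hε, ?_⟩
  rintro y ⟨hy, hyT⟩
  obtain ⟨j, hj⟩ := Set.mem_iUnion.1 hyT
  by_cases h : j = a.1
  · rwa [← h]
  · exact absurd (Set.mem_iUnion.2 ⟨⟨j, h⟩, hj⟩) (hb hy)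

/-- Near a relative interior point of an unmatched side the union consists of one simplex only, and
such a point is not interior to that simplex. The other points of the side follow by taking
closures. -/
lemma side_subset_frontier (hT : Triang S)
    (hd : 0 < d) {a : Fin n × Fin (d + 1)} (ha : ∀ b, ¬SideAdj S a b) :
    side S a ⊆ frontier (tunion S) := by
  refine (facet_subset_closure_relFacet (S a.1) hd a.2).trans
    (closure_minimal (fun x hx => ?_) isClosed_frontier)
  refine ⟨subset_closure (body_subset_tunion a.1
    (facet_subset_body _ _ (relFacet_subset _ _ hx))), fun hint => ?_⟩
  obtain ⟨ε, hε, hb⟩ := hT.exists_ball_inter_subset ha hx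
  refine not_mem_interior_of_lam_eq_zero (S a.1) hx.1 (mem_interior_iff_mem_nhds.2 ?_)
  filter_upwards [Metric.ball_mem_nhds x hε, mem_interior_iff_mem_nhds.1 hint] with y h1 h2
  exact hb ⟨h1, h2⟩

/-- Matched sides are, up to a null set, in the interior. -/
lemma ae_mem_interior_of_sideAdj (hT : Triang S)
    (hd : 0 < d) {a b : Fin n × Fin (d + 1)} (h : SideAdj S a b) :
    ∀ᵐ x ∂(surf d), x ∈ side S a → x ∈ interior (tunion S) := by
  filter_upwards [ae_mem_relFacet_of_mem hd S] with x hx hxa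
  exact hT.mem_interior_of_sideAdj hd h (hx a hxa) (hx b (h.2 ▸ hxa))

lemma forall_not_sideAdj_of_subset_frontier (hT : Triang S) (hd : 0 < d) {a : Fin n × Fin (d + 1)}
    (ha : side S a ⊆ frontier (tunion S)) (b : Fin n × Fin (d + 1)) : ¬SideAdj S a b := by
  intro h
  obtain ⟨x, hx, hg⟩ := exists_generic (S := S) hd a
  exact (ha hx).2 (hT.mem_interior_of_sideAdj hd h (hg a hx) (hg b (h.2 ▸ hx)))

/-- Almost every point of a matched side is on no other sides. -/
lemma ae_eq_or_eq_of_mem (hT : Triang S)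
    (hd : 0 < d) {a b : Fin n × Fin (d + 1)} (h : SideAdj S a b) :
    ∀ᵐ x ∂(surf d), x ∈ side S a → ∀ c, x ∈ side S c → c = a ∨ c = b := by
  filter_upwards [ae_mem_relFacet_of_mem hd S] with x hx hxa c hxc
  by_contra! hcon
  have hr := hx a hxa
  by_cases h1 : c.1 = a.1
  · have h2 : c.2 ≠ a.2 := fun h2 => hcon.1 (Prod.ext h1 h2)
    have h3 := (mem_facet (S c.1)).1 hxc
    rw [h1] at h3
    exact (hr.2 c.2 h2).ne' h3.2
  · obtain ⟨m, hm⟩ := hT.exists_sideAdj (Ne.symm h1) hr (facet_subset_body _ _ hxc)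
    have hb : b = (c.1, m) := hT.sideAdj_unique hd h hm
    have hxb : x ∈ relFacet (S b.1) b.2 := hx b (h.2 ▸ hxa)
    have h2 : c.2 ≠ m := fun h2 => hcon.2 (by rw [hb, ← h2])
    rw [hb] at hxb
    exact (hxb.2 c.2 h2).ne' ((mem_facet (S c.1)).1 hxc).2

/-- Sums over the sides in which matched sides cancel reduce to the unmatched sides. -/
lemma sum_sides_eq (hT : Triang S) (hd : 0 < d) (f : Fin n × Fin (d + 1) → ℝ)
    (hf : ∀ a b, SideAdj S a b → f a + f b = 0) :
    open scoped Classical in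
    ∑ a, f a = ∑ a with (∀ b, ¬SideAdj S a b), f a := by
  classical
  rw [← Finset.sum_filter_add_sum_filter_not Finset.univ (fun a => ∀ b, ¬SideAdj S a b)]
  have : ∑ a with ¬∀ b, ¬SideAdj S a b, f a = 0 := by
    have hex : ∀ a ∈ Finset.univ.filter (fun a => ¬∀ b, ¬SideAdj S a b), ∃ b, SideAdj S a b := by
      intro a ha
      simpa using (Finset.mem_filter.1 ha).2
    choose p hp using hex
    refine Finset.sum_involution p (fun a ha => hf _ _ (hp a ha)) (fun a ha _ => (hp a ha).1.symm)
      (fun a ha => ?_) (fun a ha => ?_)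
    · rw [Finset.mem_filter]
      exact ⟨Finset.mem_univ _, fun hcon => hcon a (hp a ha).symm⟩
    · exact hT.sideAdj_unique hd (hp _ _) (hp a ha).symm
  rw [this, add_zero]

lemma ae_disjoint (hT : Triang S) {i j : Fin n} (hij : i ≠ j) :
    AEDisjoint volume (body (S i)) (body (S j)) := by
  have h1 := (convex_body (S i)).addHaar_frontier (volume : Measure (Space d))
  refine measure_mono_null (fun x hx => ?_) h1
  obtain ⟨m, hm⟩ := hT.exists_lam_eq_zero hij
  exact ⟨subset_closure hx.1, not_mem_interior_of_lam_eq_zero _ (hm x hx)⟩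

lemma integral_tunion (hT : Triang S) {f : Space d → ℝ} (hf : IntegrableOn f (tunion S)) :
    ∫ x in tunion S, f x = ∑ i, ∫ x in body (S i), f x :=
  integral_iUnion_ae (fun i => (isCompact_body (S i)).measurableSet.nullMeasurableSet)
    (fun _ _ hij => hT.ae_disjoint hij) hf |>.trans (tsum_fintype _)

lemma volume_frontier_tunion : volume (frontier (tunion S)) = 0 := by
  have hsub : frontier (tunion S) ⊆ ⋃ i, frontier (body (S i)) := by
    intro x hx
    have hxT : x ∈ tunion S := isCompact_tunion.isClosed.frontier_subset hx
    obtain ⟨i, hi⟩ := Set.mem_iUnion.1 hxT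
    refine Set.mem_iUnion.2 ⟨i, subset_closure hi, fun hint => ?_⟩
    exact hx.2 (interior_mono (body_subset_tunion i) hint)
  refine measure_mono_null hsub (measure_iUnion_null fun i => ?_)
  exact (convex_body (S i)).addHaar_frontier _

lemma interior_tunion_ae_eq : interior (tunion S) =ᵐ[volume] tunion S :=
  interior_ae_eq_of_null_frontier volume_frontier_tunion

end Triang

end Triangulation

end SFWG

end

noncomputable section

namespace SFWG

/-! ### Jumps across sides -/

section Jump

variable {d : ℕ}

/-- A combination of surface densities that vanishes as a distribution in `U` vanishes almost
everywhere in `U`. -/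
lemma ae_sum_indicator_eq_zero {ι : Type*} [Fintype ι] {F : ι → Set (Space d)}
    (hF : ∀ a, IsCompact (F a)) {g : ι → Space d → ℝ}
    (hg : ∀ a, IntegrableOn (g a) (F a) (surf d)) {U : Set (Space d)} (hU : IsOpen U)
    (h : ∀ φ, IsTest U φ → ∑ a, ∫ x in F a, g a x * φ x ∂(surf d) = 0) :
    ∀ᵐ x ∂(surf d), x ∈ U → ∑ a, (F a).indicator (g a) x = 0 := by
  set W := ⋃ a, F a with hW
  have hWm : MeasurableSet W := MeasurableSet.iUnion fun a => (hF a).measurableSet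
  have hsub : ∀ a, F a ⊆ W := fun a => Set.subset_iUnion F a
  have hind : ∀ a, Integrable ((F a).indicator (g a)) ((surf d).restrict W) := by
    intro a
    rw [integrable_indicator_iff (hF a).measurableSet, IntegrableOn,
      Measure.restrict_restrict (hF a).measurableSet, Set.inter_eq_self_of_subset_left (hsub a)]
    exact hg a
  have hint : Integrable (fun x => ∑ a, (F a).indicator (g a) x) ((surf d).restrict W) :=
    integrable_finsetSum _ fun a _ => hind a
  have h1 := hU.ae_eq_zero_of_integral_contDiff_smul_eq_zero (μ := (surf d).restrict W)
    (hint.locallyIntegrable.locallyIntegrableOn U) (fun φ h1 h2 h3 => by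
      have h4 := h φ ⟨h1, h2, h3⟩
      obtain ⟨B, hB⟩ := h2.exists_bound_of_continuous h1.continuous
      have hm : ∀ a, Integrable (fun x => φ x * (F a).indicator (g a) x)
          ((surf d).restrict W) := fun a =>
        (hind a).bdd_mul h1.continuous.aestronglyMeasurable (Eventually.of_forall hB)
      simp only [smul_eq_mul, Finset.mul_sum]
      rw [integral_finsetSum _ fun a _ => hm a, ← h4]
      refine Finset.sum_congr rfl fun a _ => ?_
      have : (fun x => φ x * (F a).indicator (g a) x) =
          (F a).indicator fun x => g a x * φ x := by
        ext x
        by_cases hx : x ∈ F a <;> simp [hx, mul_comm]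
      rw [this, integral_indicator (hF a).measurableSet,
        Measure.restrict_restrict (hF a).measurableSet, Set.inter_eq_self_of_subset_left (hsub a)])
  rw [ae_restrict_iff' hWm] at h1
  filter_upwards [h1] with x hx hxU
  by_cases hxW : x ∈ W
  · exact hx hxW hxU
  · refine Finset.sum_eq_zero fun a _ => Set.indicator_of_notMem (fun hxa => hxW (hsub a hxa)) _

lemma IsTest.mono {U V : Set (Space d)} {φ : Space d → ℝ} (h : IsTest U φ) (hUV : U ⊆ V) :
    IsTest V φ := ⟨h.1, h.2.1, h.2.2.trans hUV⟩

lemma HasWeakPartial.mono {U V : Set (Space d)} (hV : MeasurableSet V)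
    (hUV : U ⊆ V) {i : Fin d} {w g : Space d → ℝ} (h : HasWeakPartial V i w g) :
    HasWeakPartial U i w g := by
  intro φ hφ
  have h1 := h φ (hφ.mono hUV)
  have hsupp : ∀ x, x ∉ U → φ x = 0 := fun x hx => by
    by_contra hne
    exact hx (hφ.2.2 (subset_closure hne))
  have hsupp' : ∀ x, x ∉ U → partialD i φ x = 0 := fun x hx => by
    by_contra hne
    refine hx (hφ.2.2 (tsupport_fderiv_subset ℝ (f := φ) (subset_closure ?_)))
    intro h0
    exact hne (by simp [partialD, h0])
  rw [← setIntegral_eq_of_subset_of_forall_sdiff_eq_zero hV hUV,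
    ← setIntegral_eq_of_subset_of_forall_sdiff_eq_zero hV hUV]
  · exact h1
  · intro x hx; rw [hsupp x hx.2, mul_zero]
  · intro x hx; rw [hsupp' x hx.2, mul_zero]

variable {n : ℕ} {S : Fin n → Affine.Simplex ℝ (Space d) d}

/-- Traces from both sides of a matched side agree. -/
lemma Triang.trace_eq (hT : Triang S) (hd : 0 < d) {w : Space d → ℝ} {G : Fin d → Space d → ℝ}
    (hw : MemLp w 2 (volume.restrict (interior (tunion S))))
    (hG : ∀ j, MemLp (G j) 2 (volume.restrict (interior (tunion S))))
    (hD : ∀ j, HasWeakPartial (interior (tunion S)) j w (G j))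
    {g : Fin n → Fin (d + 1) → Space d → ℝ} (hg : ∀ i, HasTraces (S i) w G (g i))
    {a b : Fin n × Fin (d + 1)} (hab : SideAdj S a b) :
    ∀ᵐ x ∂((surf d).restrict (side S a)), g a.1 a.2 x = g b.1 b.2 x := by
  have hint : ∀ a : Fin n × Fin (d + 1), IntegrableOn (g a.1 a.2) (side S a) (surf d) := by
    intro a
    have := isFiniteMeasure_facet (S a.1) hd a.2
    exact ((hg a.1).memLp_trace a.2).integrable (by norm_num)
  -- Summing Green's formula over all simplices, the volume terms cancel by the definition of the
  -- weak derivative. What remains is a surface distribution that vanishes in the interior of the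
  -- union.
  have hj : ∀ j : Fin d, ∀ᵐ x ∂(surf d), x ∈ interior (tunion S) →
      ∑ a : Fin n × Fin (d + 1),
        (side S a).indicator (fun x => sideNormal S a j * g a.1 a.2 x) x = 0 := by
    intro j
    refine ae_sum_indicator_eq_zero (F := fun a : Fin n × Fin (d + 1) => side S a)
      (g := fun a x => sideNormal S a j * g a.1 a.2 x) (fun a => isCompact_facet (S a.1) a.2)
      (fun a => Integrable.const_mul (hint a) _) isOpen_interior fun φ hφ => ?_
    have h1 := hD j φ hφ
    have hcont := hφ.1.continuous
    have e1 : ∫ x in interior (tunion S), w x * partialD j φ x =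
        ∑ i, ∫ x in body (S i), w x * partialD j φ x := by
      rw [setIntegral_congr_set interior_tunion_ae_eq, hT.integral_tunion]
      rw [← integrableOn_congr_set_ae interior_tunion_ae_eq]
      exact integrable_mul_of_memLp hw ((memLp_of_continuous_of_isCompact isCompact_tunion
        isCompact_tunion.measure_lt_top.ne (continuous_partialD hφ.1 j)).mono_measure
          (Measure.restrict_mono interior_subset le_rfl))
    have e2 : ∫ x in interior (tunion S), G j x * φ x =
        ∑ i, ∫ x in body (S i), G j x * φ x := by
      rw [setIntegral_congr_set interior_tunion_ae_eq, hT.integral_tunion]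
      rw [← integrableOn_congr_set_ae interior_tunion_ae_eq]
      exact integrable_mul_of_memLp (hG j) ((memLp_of_continuous_of_isCompact isCompact_tunion
        isCompact_tunion.measure_lt_top.ne hcont).mono_measure
          (Measure.restrict_mono interior_subset le_rfl))
    have h2 : ∀ i, _ := fun i => (hg i).green hd hφ.1 j
    rw [Fintype.sum_prod_type]
    calc _ = ∑ i, ∑ l, outwardNormal (S i) l j *
          ∫ z in facet (S i) l, g i l z * φ z ∂(surf d) := by
            refine Finset.sum_congr rfl fun i _ => Finset.sum_congr rfl fun l _ => ?_
            rw [← integral_const_mul]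
            simp only [mul_assoc]
      _ = ∑ i, ((∫ x in body (S i), G j x * φ x) + ∫ x in body (S i), w x * partialD j φ x) :=
            Finset.sum_congr rfl fun i _ => (h2 i).symm
      _ = 0 := by rw [Finset.sum_add_distrib, ← e1, ← e2, h1]; ring
  have hj' := (ae_all_iff (μ := surf d)).2 hj
  rw [ae_restrict_iff' (isCompact_facet (S a.1) a.2).measurableSet]
  filter_upwards [hj', hT.ae_mem_interior_of_sideAdj hd hab, hT.ae_eq_or_eq_of_mem hd hab] with
    x h1 h2 h3 hxa
  have hxb : x ∈ side S b := hab.2 ▸ hxa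
  -- At almost every point only the two matched sides meet, with opposite normals, so each component
  -- of the normal annihilates the jump; some component is nonzero.
  have h4 : ∀ j, sideNormal S a j * (g a.1 a.2 x - g b.1 b.2 x) = 0 := by
    intro j
    have h5 := h1 j (h2 hxa)
    rw [Finset.sum_eq_add a b hab.1, Set.indicator_of_mem hxa, Set.indicator_of_mem hxb,
      hT.neg_sideNormal hd hab] at h5
    · simp only [PiLp.neg_apply] at h5
      linarith
    · rintro c - ⟨hca, hcb⟩
      refine Set.indicator_of_notMem (fun hxc => ?_) _
      rcases h3 hxa c hxc with h | h
      · exact hca h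
      · exact hcb h
    · simp
    · simp
  have hn := norm_outwardNormal (S a.1) hd a.2
  obtain ⟨j, hj0⟩ : ∃ j, sideNormal S a j ≠ 0 := by
    by_contra! hcon
    have : sideNormal S a = 0 := by ext j; simpa using hcon j
    rw [show outwardNormal (S a.1) a.2 = sideNormal S a from rfl, this, norm_zero] at hn
    exact zero_ne_one hn
  exact sub_eq_zero.1 ((mul_eq_zero.1 (h4 j)).resolve_left hj0)

end Jump

end SFWG

end

noncomputable section

namespace SFWG

/-! ### Shape regular families of simplices -/

section Regular

variable {d n : ℕ}

/-- The simplices contain balls of radius `γ h`, and the diameter of their union is at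
most `h`. -/
structure ShapeReg (S : Fin n → Affine.Simplex ℝ (Space d) d) (γ h : ℝ) : Prop where
  pos : 0 < h
  diam_le : ∀ x ∈ tunion S, ∀ y ∈ tunion S, ‖x - y‖ ≤ h
  ball : ∀ i, ∃ c, Metric.closedBall c (γ * h) ⊆ body (S i)

/-- The volume of the smallest admissible simplex, `ω (γ h)^d`. -/
def ballVol (d : ℕ) (ρ : ℝ) : ℝ := ρ ^ d * volume.real (Metric.ball (0 : Space d) 1)

lemma ballVol_pos {ρ : ℝ} (hρ : 0 < ρ) : 0 < ballVol d ρ :=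
  mul_pos (pow_pos hρ d) (ENNReal.toReal_pos (Metric.measure_ball_pos volume 0 one_pos).ne'
    measure_ball_lt_top.ne)

lemma volume_real_closedBall (c : Space d) {ρ : ℝ} (hρ : 0 ≤ ρ) :
    volume.real (Metric.closedBall c ρ) = ballVol d ρ := by
  rw [Measure.addHaar_real_closedBall _ _ hρ, finrank_euclideanSpace_fin, ballVol]

lemma ballVol_mul (γ h : ℝ) : ballVol d (γ * h) = γ ^ d * ballVol d h := by
  unfold ballVol; ring

variable {S : Fin n → Affine.Simplex ℝ (Space d) d} {γ h : ℝ}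

namespace ShapeReg

lemma diam_body (hS : ShapeReg S γ h)
    (i : Fin n) : ∀ x ∈ body (S i), ∀ y ∈ body (S i), ‖x - y‖ ≤ h :=
  fun x hx y hy => hS.diam_le x (body_subset_tunion i hx) y (body_subset_tunion i hy)

lemma le_height (hS : ShapeReg S γ h) (hd : 0 < d) (hγ : 0 < γ) (i : Fin n) (l : Fin (d + 1)) :
    2 * γ * h ≤ height (S i) l := by
  obtain ⟨c, hc⟩ := hS.ball i
  have := two_mul_le_height (S i) hd l (mul_pos hγ hS.pos).le hc
  linarith

lemma ballVol_le (hS : ShapeReg S γ h)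
    (hγ : 0 < γ) (i : Fin n) : ballVol d (γ * h) ≤ volume.real (body (S i)) := by
  obtain ⟨c, hc⟩ := hS.ball i
  rw [← volume_real_closedBall c (mul_pos hγ hS.pos).le]
  exact measureReal_mono hc (isCompact_body (S i)).measure_lt_top.ne

lemma sum_volume_le (hS : ShapeReg S γ h)
    (hT : Triang S) : ∑ i, volume.real (body (S i)) ≤ ballVol d h := by
  have h1 := hT.integral_tunion (f := fun _ => 1)
    (integrableOn_const isCompact_tunion.measure_lt_top.ne)
  simp only [setIntegral_const, smul_eq_mul, mul_one] at h1
  rw [← h1]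
  rcases (tunion S).eq_empty_or_nonempty with h0 | ⟨x, hx⟩
  · rw [h0, measureReal_empty]; exact (ballVol_pos hS.pos).le
  · rw [← volume_real_closedBall x hS.pos.le]
    refine measureReal_mono (fun y hy => ?_) measure_closedBall_lt_top.ne
    rw [Metric.mem_closedBall, dist_eq_norm]
    exact hS.diam_le y hy x hx

/-- The simplices do not overlap, each contains a ball of radius `γ * h`, and all of them lie in a
ball of radius `h`. -/
lemma card_le (hS : ShapeReg S γ h) (hγ : 0 < γ) (hT : Triang S) : n ≤ ⌊(γ ^ d)⁻¹⌋₊ := by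
  refine Nat.le_floor ?_
  have h1 := hS.sum_volume_le hT
  have h2 : (n : ℝ) * ballVol d (γ * h) ≤ ∑ i, volume.real (body (S i)) := by
    have := Finset.sum_le_sum (s := Finset.univ) fun i (_ : i ∈ Finset.univ) =>
      hS.ballVol_le hγ i
    simpa using this
  have h3 := ballVol_pos (d := d) hS.pos
  rw [ballVol_mul] at h2
  have h4 : (n : ℝ) * γ ^ d ≤ 1 := by
    by_contra! hcon
    nlinarith
  rw [← one_div, le_div_iff₀ (pow_pos hγ d)]
  exact h4

end ShapeReg

/-- `w ∈ H¹` in the interior of the union, with gradient `G`. -/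
structure WeakH1 (S : Fin n → Affine.Simplex ℝ (Space d) d) (w : Space d → ℝ)
    (G : Fin d → Space d → ℝ) : Prop where
  mem : MemLp w 2 (volume.restrict (tunion S))
  memG : ∀ j, MemLp (G j) 2 (volume.restrict (tunion S))
  weak : ∀ j, HasWeakPartial (interior (tunion S)) j w (G j)

lemma memLp_body_of_tunion {w : Space d → ℝ} (hw : MemLp w 2 (volume.restrict (tunion S)))
    (i : Fin n) : MemLp w 2 (volume.restrict (body (S i))) :=
  hw.mono_measure (Measure.restrict_mono (body_subset_tunion i) le_rfl)

lemma WeakH1.exists_hasTraces (hd : 0 < d) {w : Space d → ℝ} {G : Fin d → Space d → ℝ}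
    (h : WeakH1 S w G) (i : Fin n) : ∃ g, HasTraces (S i) w G g :=
  SFWG.exists_hasTraces hd (memLp_body_of_tunion h.mem i) (fun j => memLp_body_of_tunion (h.memG j) i)
    fun j => (h.weak j).mono isOpen_interior.measurableSet
      (interior_mono (body_subset_tunion i))

lemma WeakH1.trace_eq (hd : 0 < d) (hT : Triang S) {w : Space d → ℝ} {G : Fin d → Space d → ℝ}
    (h : WeakH1 S w G) {g : Fin n → Fin (d + 1) → Space d → ℝ}
    (hg : ∀ i, HasTraces (S i) w G (g i)) {a b : Fin n × Fin (d + 1)} (hab : SideAdj S a b) :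
    ∀ᵐ x ∂((surf d).restrict (side S a)), g a.1 a.2 x = g b.1 b.2 x :=
  hT.trace_eq hd (h.mem.mono_measure (Measure.restrict_mono interior_subset le_rfl))
    (fun j => (h.memG j).mono_measure (Measure.restrict_mono interior_subset le_rfl)) h.weak hg hab

lemma Triang.integral_sq (hT : Triang S) {w : Space d → ℝ}
    (hw : MemLp w 2 (volume.restrict (tunion S))) :
    ∫ x in tunion S, w x ^ 2 = ∑ i, ∫ x in body (S i), w x ^ 2 :=
  hT.integral_tunion hw.integrable_sq

lemma integrableOn_tunion {w : Space d → ℝ} (hw : MemLp w 2 (volume.restrict (tunion S))) :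
    IntegrableOn w (tunion S) := by
  have : IsFiniteMeasure (volume.restrict (tunion S)) :=
    ⟨by rw [Measure.restrict_apply_univ]; exact isCompact_tunion.measure_lt_top⟩
  exact hw.integrable (by norm_num)

/-- The mean over a simplex and the mean of the trace over one of its faces. -/
lemma HasTraces.mean_sub_sq_le (hd : 0 < d) {T : Affine.Simplex ℝ (Space d) d} {w : Space d → ℝ}
    {G : Fin d → Space d → ℝ} {g : Fin (d + 1) → Space d → ℝ} (hg : HasTraces T w G g)
    (l : Fin (d + 1)) (hh : ∀ x ∈ body T, ∀ y ∈ body T, ‖x - y‖ ≤ h) :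
    ((∫ z in facet T l, g l z ∂(surf d)) / (surf d).real (facet T l) -
      (∫ x in body T, w x) / volume.real (body T)) ^ 2 ≤
      h ^ 2 / volume.real (body T) * ∑ j, ∫ x in body T, G j x ^ 2 := by
  have hV := volume_real_body_pos T
  have hH := height_pos T hd l
  have hvol := volume_real_body T hd l
  have hd' : (0 : ℝ) < d := by exact_mod_cast hd
  have hF : 0 < (surf d).real (facet T l) := by
    by_contra! hcon
    rw [hvol] at hV
    have := mul_nonpos_of_nonneg_of_nonpos (div_pos hH hd').le hcon
    linarith
  set E := ∑ j, ∫ x in body T, G j x * (x j - T.points l j) with hE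
  have hcone := hg.cone hd l
  rw [← hE] at hcone
  -- Since `height * area = d * volume`, the cone identity says exactly that the two means differ by
  -- the gradient term `E`, divided by `d` times the volume.
  have hdiff : (∫ z in facet T l, g l z ∂(surf d)) / (surf d).real (facet T l) -
      (∫ x in body T, w x) / volume.real (body T) = E / (d * volume.real (body T)) := by
    have e1 : (∫ z in facet T l, g l z ∂(surf d)) =
        (d * (∫ x in body T, w x) + E) / height T l := by
      rw [hcone]; field_simp
    rw [e1, hvol]
    field_simp
    ring
  have hE2 : E ^ 2 ≤ d * (volume.real (body T) * h ^ 2 * ∑ j, ∫ x in body T, G j x ^ 2) := by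
    refine sq_sum_le_card_mul_sum_sq.trans ?_
    rw [Finset.card_univ, Fintype.card_fin, Finset.mul_sum (a := volume.real (body T) * h ^ 2)]
    refine mul_le_mul_of_nonneg_left (Finset.sum_le_sum fun j _ => ?_) hd'.le
    have hc : Continuous fun x : Space d => x j - T.points l j := by fun_prop
    refine (sq_integral_mul_le (hg.memLp_grad j) (memLp_body hc)).trans ?_
    rw [mul_comm]
    refine mul_le_mul_of_nonneg_right ?_ (integral_nonneg fun x => sq_nonneg _)
    refine integral_body_sq_le T fun x hx => ?_
    have := PiLp.norm_apply_le (x - T.points l) j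
    simp only [PiLp.sub_apply, Real.norm_eq_abs] at this
    exact this.trans (hh x hx _ (points_mem_body T l))
  rw [hdiff, div_pow, div_le_iff₀ (by positivity)]
  have hd1 : (1 : ℝ) ≤ d := by exact_mod_cast hd
  have hA : 0 ≤ ∑ j, ∫ x in body T, G j x ^ 2 :=
    Finset.sum_nonneg fun j _ => integral_nonneg fun x => sq_nonneg _
  calc E ^ 2 ≤ d * (volume.real (body T) * h ^ 2 * ∑ j, ∫ x in body T, G j x ^ 2) := hE2
    _ ≤ d * (d * (volume.real (body T) * h ^ 2 * ∑ j, ∫ x in body T, G j x ^ 2)) := by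
        refine mul_le_mul_of_nonneg_left (le_mul_of_one_le_left ?_ hd1) hd'.le
        positivity
    _ = _ := by field_simp

/-- The Poincaré inequality, uniformly for shape regular families of simplices. -/
theorem exists_poincare (d : ℕ) (hd : 0 < d) {γ : ℝ} (hγ : 0 < γ) : ∃ C : ℝ, 0 < C ∧
    ∀ (n : ℕ) (S : Fin n → Affine.Simplex ℝ (Space d) d) (h : ℝ), Triang S → ShapeReg S γ h →
      ∀ (w : Space d → ℝ) (G : Fin d → Space d → ℝ), WeakH1 S w G →
        ∫ x in tunion S, w x = 0 →
        ∫ x in tunion S, w x ^ 2 ≤ C * h ^ 2 * ∑ j, ∫ x in tunion S, G j x ^ 2 := by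
  obtain ⟨K, hK, hpot⟩ := exists_potential_bound ⌊(γ ^ d)⁻¹⌋₊
  -- The first summand comes from the convex simplices. The second comes from the means, which are
  -- bounded by `2 * K * δ`; the factor `(γ ^ d)⁻¹` is the ratio of the volumes of balls of radii
  -- `h` and `γ * h`.
  refine ⟨2 ^ d + (K * 2) ^ 2 * (γ ^ d)⁻¹, by positivity,
    fun n S h hT hS w G hwG hmean => ?_⟩
  have hh := hS.pos
  choose g hg using hwG.exists_hasTraces hd
  set c : Fin n → ℝ := fun i => (∫ x in body (S i), w x) / volume.real (body (S i)) with hc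
  set Ai : Fin n → ℝ := fun i => ∑ j, ∫ x in body (S i), G j x ^ 2 with hAi
  have hAi0 : ∀ i, 0 ≤ Ai i := fun i =>
    Finset.sum_nonneg fun j _ => integral_nonneg fun x => sq_nonneg _
  set A : ℝ := ∑ j, ∫ x in tunion S, G j x ^ 2 with hA
  have hAsum : A = ∑ i, Ai i := by
    rw [hA, Finset.sum_congr rfl fun j _ => hT.integral_sq (hwG.memG j), Finset.sum_comm]
  have hA0 : 0 ≤ A := hAsum ▸ Finset.sum_nonneg fun i _ => hAi0 i
  have hAle : ∀ i, Ai i ≤ A := fun i => hAsum ▸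
    Finset.single_le_sum (fun i _ => hAi0 i) (Finset.mem_univ i)
  set vm := ballVol d (γ * h) with hvm
  have hvm0 : 0 < vm := ballVol_pos (mul_pos hγ hh)
  set δ := Real.sqrt (h ^ 2 / vm * A) with hδ
  have hδ0 : 0 ≤ δ := Real.sqrt_nonneg _
  have hδ2 : δ ^ 2 = h ^ 2 / vm * A := Real.sq_sqrt (by positivity)
  have hm : ∀ i l, |(∫ z in facet (S i) l, g i l z ∂(surf d)) / (surf d).real (facet (S i) l) -
      c i| ≤ δ := by
    intro i l
    rw [← abs_of_nonneg hδ0]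
    refine sq_le_sq.1 ?_
    rw [hδ2]
    refine ((hg i).mean_sub_sq_le hd l (hS.diam_body i)).trans ?_
    have := hS.ballVol_le hγ i
    gcongr
    exact hAle i
  -- The traces from both sides of a common face agree, so the two means over simplices are within
  -- `δ` of the same face mean.
  have hstep : ∀ i j, (∃ l m, facet (S i) l = facet (S j) m) → |c i - c j| ≤ 2 * δ := by
    rintro i j ⟨l, m, hlm⟩
    rcases eq_or_ne i j with rfl | hij
    · simp only [sub_self, abs_zero]; positivity
    · have hab : SideAdj S (i, l) (j, m) := ⟨fun h => hij (congrArg Prod.fst h), hlm⟩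
      have h1 := hwG.trace_eq hd hT hg hab
      have h2 : ∫ z in facet (S i) l, g i l z ∂(surf d) =
          ∫ z in facet (S j) m, g j m z ∂(surf d) := by
        rw [← hlm]; exact integral_congr_ae h1
      have h3 := hm i l
      have h4 := hm j m
      rw [h2, hlm] at h3
      rw [abs_sub_comm] at h3
      calc _ ≤ _ := abs_sub_le _ _ _
        _ ≤ δ + δ := add_le_add h3 h4
        _ = _ := by ring
  have hcc : ∀ i j, |c i - c j| ≤ K * (2 * δ) := fun i j =>
    hpot n (hS.card_le hγ hT) _ i j (hT.conn i j) c (2 * δ) (by positivity) hstep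
  have hVi : ∀ i, 0 < volume.real (body (S i)) := fun i => volume_real_body_pos (S i)
  have hsum0 : ∑ i, volume.real (body (S i)) * c i = 0 := by
    rw [← hmean, hT.integral_tunion (integrableOn_tunion hwG.mem)]
    refine Finset.sum_congr rfl fun i _ => ?_
    simp only [hc]
    rw [mul_div_cancel₀ _ (hVi i).ne']
  have hci : ∀ i, |c i| ≤ K * (2 * δ) := by
    intro i
    set V := ∑ j, volume.real (body (S j)) with hV
    have hV0 : 0 < V := Finset.sum_pos (fun j _ => hVi j) ⟨i, Finset.mem_univ i⟩
    -- As the function has mean zero, each mean `c i` is a weighted average of the differences `c i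
    -- - c j`.
    have e1 : V * c i = ∑ j, volume.real (body (S j)) * (c i - c j) := by
      simp only [mul_sub, Finset.sum_sub_distrib, hsum0, sub_zero, hV, Finset.sum_mul]
    have e2 : V * |c i| ≤ V * (K * (2 * δ)) := by
      rw [← abs_of_pos hV0, ← abs_mul, e1, abs_of_pos hV0]
      refine (Finset.abs_sum_le_sum_abs _ _).trans ?_
      rw [hV, Finset.sum_mul]
      refine Finset.sum_le_sum fun j _ => ?_
      rw [abs_mul, abs_of_pos (hVi j)]
      exact mul_le_mul_of_nonneg_left (hcc i j) (hVi j).le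
    exact le_of_mul_le_mul_left e2 hV0
  have hi : ∀ i, ∫ x in body (S i), w x ^ 2 ≤
      2 ^ d * h ^ 2 * Ai i + (K * (2 * δ)) ^ 2 * volume.real (body (S i)) := by
    intro i
    have h1 := (hg i).poincare (hS.diam_body i)
    have h2 : (∫ x in body (S i), w x) ^ 2 / volume.real (body (S i)) =
        c i ^ 2 * volume.real (body (S i)) := by
      simp only [hc]
      have := (hVi i).ne'
      field_simp
    have h3 : c i ^ 2 ≤ (K * (2 * δ)) ^ 2 := by
      rw [← sq_abs (c i)]
      exact pow_le_pow_left₀ (abs_nonneg _) (hci i) 2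
    have h4 := mul_le_mul_of_nonneg_right h3 (hVi i).le
    linarith
  rw [hT.integral_sq hwG.mem]
  calc _ ≤ ∑ i, (2 ^ d * h ^ 2 * Ai i + (K * (2 * δ)) ^ 2 * volume.real (body (S i))) :=
        Finset.sum_le_sum fun i _ => hi i
    _ = 2 ^ d * h ^ 2 * A + (K * (2 * δ)) ^ 2 * ∑ i, volume.real (body (S i)) := by
        rw [Finset.sum_add_distrib, ← Finset.mul_sum, ← Finset.mul_sum, hAsum]
    _ ≤ 2 ^ d * h ^ 2 * A + (K * (2 * δ)) ^ 2 * ballVol d h := by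
        have := hS.sum_volume_le hT
        gcongr
    _ = _ := by
        have hb := ballVol_pos (d := d) hh
        have hg' := pow_pos hγ d
        rw [show (K * (2 * δ)) ^ 2 = (K * 2) ^ 2 * δ ^ 2 by ring, hδ2, hvm, ballVol_mul]
        field_simp

end Regular

end SFWG

end

noncomputable section

namespace SFWG

/-! ### Iterated derivatives of polynomials -/

section PolyDeriv

variable {d : ℕ}

/-- The derivative `∂^α p` of a polynomial. -/
def dpoly (α : Fin d → ℕ) : Poly d →ₗ[ℝ] Poly d :=
  (MvPolynomial.basisMonomials (Fin d) ℝ).constr ℝ fun s =>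
    MvPolynomial.monomial (s - Finsupp.equivFunOnFinite.symm α)
      (∏ i, ((s i).descFactorial (α i) : ℝ))

/-- The truncated subtraction of exponents does no harm: where it truncates, the falling factorial
is zero. -/
lemma dpoly_monomial (α : Fin d → ℕ) (s : Fin d →₀ ℕ) (c : ℝ) :
    dpoly α (MvPolynomial.monomial s c) =
      MvPolynomial.monomial (s - Finsupp.equivFunOnFinite.symm α)
        (c * ∏ i, ((s i).descFactorial (α i) : ℝ)) := by
  have h1 : (MvPolynomial.monomial s c : Poly d) =
      c • MvPolynomial.basisMonomials (Fin d) ℝ s := by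
    simp [MvPolynomial.smul_monomial]
  rw [h1, map_smul, dpoly, Module.Basis.constr_basis, MvPolynomial.smul_monomial, smul_eq_mul]

lemma dpoly_zero (p : Poly d) : dpoly 0 p = p := by
  induction p using MvPolynomial.induction_on' with
  | monomial s c =>
    rw [dpoly_monomial]
    have : Finsupp.equivFunOnFinite.symm (0 : Fin d → ℕ) = 0 := by ext; simp
    simp [this]
  | add p q hp hq => rw [map_add, hp, hq]

lemma pderiv_dpoly (α : Fin d → ℕ) (j : Fin d) (p : Poly d) :
    MvPolynomial.pderiv j (dpoly α p) = dpoly (α + Pi.single j 1) p := by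
  induction p using MvPolynomial.induction_on' with
  | monomial s c =>
    rw [dpoly_monomial, dpoly_monomial, MvPolynomial.pderiv_monomial]
    congr 1
    · congr 1
      ext i
      simp only [Finsupp.tsub_apply, Finsupp.equivFunOnFinite_symm_apply_apply, Pi.add_apply]
      rcases eq_or_ne i j with rfl | h
      · simp; omega
      · simp [h]
    · rw [mul_assoc]
      congr 1
      have e : ∀ f : Fin d → ℝ, ∏ i, f i = (∏ i ∈ Finset.univ.erase j, f i) * f j := fun f =>
        (Finset.prod_erase_mul _ _ (Finset.mem_univ j)).symm
      refine (congrArg (· * _) (e _)).trans (Eq.trans ?_ (e _).symm)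
      simp only [mul_assoc]
      congr 1
      · refine Finset.prod_congr rfl fun i hi => ?_
        simp [Finset.ne_of_mem_erase hi]
      · simp only [Pi.add_apply, Pi.single_eq_same, Nat.descFactorial_succ, Finsupp.tsub_apply,
          Finsupp.equivFunOnFinite_symm_apply_apply]
        push_cast
        ring
  | add p q hp hq => rw [map_add, map_add, map_add, hp, hq]

lemma dpoly_eq_zero {α : Fin d → ℕ} {p : Poly d} (h : p.totalDegree < ∑ i, α i) :
    dpoly α p = 0 := by
  conv_lhs => rw [p.as_sum, map_sum]
  refine Finset.sum_eq_zero fun s hs => ?_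
  have h1 : s.degree ≤ p.totalDegree := MvPolynomial.le_totalDegree hs
  rw [Finsupp.degree_eq_sum] at h1
  obtain ⟨i, hi⟩ : ∃ i, s i < α i := by
    by_contra! hcon
    have := Finset.sum_le_sum fun i (_ : i ∈ Finset.univ) => hcon i
    omega
  rw [dpoly_monomial, Finset.prod_eq_zero (Finset.mem_univ i), mul_zero, map_zero]
  rw [Nat.descFactorial_of_lt hi, Nat.cast_zero]

/-- Polynomials with given values of a functional on all derivatives. -/
lemma exists_poly_moments (I : Poly d →ₗ[ℝ] ℝ) (hI : I 1 ≠ 0) (m : ℕ) (b : (Fin d → ℕ) → ℝ) :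
    ∃ q : Poly d, q.totalDegree ≤ m ∧ ∀ α, ∑ i, α i ≤ m → I (dpoly α q) = b α := by
  -- In the top degree the derivatives of order `m` of a homogeneous polynomial of degree `m` are
  -- constants, so its coefficients are determined directly.
  have key : ∀ (m : ℕ) (b : (Fin d → ℕ) → ℝ), ∃ q : Poly d, q.totalDegree ≤ m ∧
      ∀ α, ∑ i, α i = m → I (dpoly α q) = b α := by
    intro m b
    refine ⟨∑ α ∈ Finset.piAntidiag Finset.univ m,
      MvPolynomial.monomial (Finsupp.equivFunOnFinite.symm α)
        (b α / (I 1 * ∏ i, ((α i).factorial : ℝ))), ?_, fun β hβ => ?_⟩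
    · refine MvPolynomial.totalDegree_finsetSum_le fun α hα => ?_
      refine (MvPolynomial.totalDegree_monomial_le _ _).trans ?_
      change (Finsupp.equivFunOnFinite.symm α).degree ≤ m
      rw [Finsupp.degree_eq_sum]
      simpa using (Finset.mem_piAntidiag.1 hα).1.le
    · rw [map_sum, map_sum, Finset.sum_eq_single β]
      · rw [dpoly_monomial]
        have e1 : ∀ i, ((Finsupp.equivFunOnFinite.symm β) i).descFactorial (β i) =
            (β i).factorial := fun i => by
          simp [Nat.descFactorial_self]
        have hf : (∏ i, ((β i).factorial : ℝ)) ≠ 0 :=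
          Finset.prod_ne_zero_iff.2 fun i _ => by positivity
        simp only [e1, tsub_self]
        have e2 : (MvPolynomial.monomial 0 (b β / (I 1 * ∏ i, ((β i).factorial : ℝ)) *
            ∏ i, ((β i).factorial : ℝ)) : Poly d) = (b β / I 1) • 1 := by
          rw [MvPolynomial.smul_eq_C_mul, mul_one]
          change MvPolynomial.C _ = _
          congr 1
          field_simp
        rw [e2, map_smul, smul_eq_mul, div_mul_cancel₀ _ hI]
      · intro α hα hne
        have hαs : ∑ i, α i = m := (Finset.mem_piAntidiag.1 hα).1
        obtain ⟨i, hi⟩ : ∃ i, α i < β i := by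
          by_contra! hcon
          refine hne (funext fun i => ?_)
          exact ((Finset.sum_eq_sum_iff_of_le fun i _ => hcon i).1 (hβ.trans hαs.symm) i
            (Finset.mem_univ i)).symm
        have h0 : (∏ i, (((Finsupp.equivFunOnFinite.symm α) i).descFactorial (β i) : ℝ)) = 0 :=
          Finset.prod_eq_zero (Finset.mem_univ i) (by
            rw [Finsupp.equivFunOnFinite_symm_apply_apply, Nat.descFactorial_of_lt hi,
              Nat.cast_zero])
        rw [dpoly_monomial, h0, mul_zero, map_zero, map_zero]
      · intro h
        exact absurd (Finset.mem_piAntidiag.2 ⟨hβ, fun _ _ => Finset.mem_univ _⟩) h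
  induction m generalizing b with
  | zero =>
    obtain ⟨q, hq, h⟩ := key 0 b
    exact ⟨q, hq, fun α hα => h α (by omega)⟩
  | succ m ih =>
    obtain ⟨q₁, hq₁, h₁⟩ := key (m + 1) b
    -- The lower-order part makes up for what the top part contributes to lower derivatives; it has
    -- degree at most `m` and does not disturb the derivatives of order `m + 1`.
    obtain ⟨q₀, hq₀, h₀⟩ := ih fun α => b α - I (dpoly α q₁)
    refine ⟨q₀ + q₁, (MvPolynomial.totalDegree_add _ _).trans (max_le (by omega) hq₁),
      fun α hα => ?_⟩
    rw [map_add, map_add]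
    rcases Nat.lt_or_ge (∑ i, α i) (m + 1) with h | h
    · rw [h₀ α (by omega)]; ring
    · rw [dpoly_eq_zero (α := α) (p := q₀) (by omega), map_zero, zero_add, h₁ α (by omega)]

end PolyDeriv

/-! ### Polynomial approximation -/

section BrambleHilbert

variable {d n : ℕ} {S : Fin n → Affine.Simplex ℝ (Space d) d}

lemma hasWeakPartial_of_contDiff (U : Set (Space d)) {p : Space d → ℝ}
    (hp : ContDiff ℝ ∞ p) (j : Fin d) : HasWeakPartial U j p (partialD j p) := by
  intro φ hφ
  have hsupp : ∀ x, x ∉ U → φ x = 0 := fun x hx => by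
    by_contra hne
    exact hx (hφ.2.2 (subset_closure hne))
  have hsupp' : ∀ x, x ∉ U → partialD j φ x = 0 := fun x hx => by
    by_contra hne
    refine hx (hφ.2.2 (tsupport_fderiv_subset ℝ (f := φ) (subset_closure ?_)))
    intro h0
    exact hne (by simp [partialD, h0])
  rw [setIntegral_eq_integral_of_forall_compl_eq_zero (fun x hx => by rw [hsupp' x hx, mul_zero]),
    setIntegral_eq_integral_of_forall_compl_eq_zero (fun x hx => by rw [hsupp x hx, mul_zero])]
  have hcs : HasCompactSupport (partialD j φ) := by
    refine hφ.2.1.mono' fun x hx => tsupport_fderiv_subset ℝ (f := φ) (subset_closure ?_)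
    intro h0
    exact hx (by simp [partialD, h0])
  unfold partialD
  refine integral_mul_fderiv_eq_neg_fderiv_mul_of_integrable ?_ ?_ ?_
    (fun x _ => hp.differentiable (by simp) x) (fun x _ => hφ.1.differentiable (by simp) x)
  · exact ((continuous_partialD hp j).mul hφ.1.continuous).integrable_of_hasCompactSupport
      hφ.2.1.mul_left
  · exact (hp.continuous.mul (continuous_partialD hφ.1 j)).integrable_of_hasCompactSupport
      hcs.mul_left
  · exact (hp.continuous.mul hφ.1.continuous).integrable_of_hasCompactSupport hφ.2.1.mul_left

lemma memLp_tunion {φ : Space d → ℝ} (hφ : Continuous φ) :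
    MemLp φ 2 (volume.restrict (tunion S)) :=
  memLp_of_continuous_of_isCompact isCompact_tunion isCompact_tunion.measure_lt_top.ne hφ

lemma WeakH1.sub_smooth {w : Space d → ℝ} {G : Fin d → Space d → ℝ} (h : WeakH1 S w G)
    {p : Space d → ℝ} (hp : ContDiff ℝ ∞ p) :
    WeakH1 S (fun x => w x - p x) (fun j x => G j x - partialD j p x) := by
  refine ⟨h.mem.sub (memLp_tunion hp.continuous),
    fun j => (h.memG j).sub (memLp_tunion (continuous_partialD hp j)), fun j φ hφ => ?_⟩
  have hm : ∀ {f : Space d → ℝ}, MemLp f 2 (volume.restrict (tunion S)) →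
      MemLp f 2 (volume.restrict (interior (tunion S))) := fun hf =>
    hf.mono_measure (Measure.restrict_mono interior_subset le_rfl)
  have h1 := h.weak j φ hφ
  have h2 := hasWeakPartial_of_contDiff (interior (tunion S)) hp j φ hφ
  simp only [sub_mul]
  rw [integral_sub (integrable_mul_of_memLp (hm h.mem)
      (hm (memLp_tunion (continuous_partialD hφ.1 j))))
    (integrable_mul_of_memLp (hm (memLp_tunion hp.continuous))
      (hm (memLp_tunion (continuous_partialD hφ.1 j)))),
    integral_sub (integrable_mul_of_memLp (hm (h.memG j)) (hm (memLp_tunion hφ.1.continuous)))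
    (integrable_mul_of_memLp (hm (memLp_tunion (continuous_partialD hp j)))
      (hm (memLp_tunion hφ.1.continuous))), h1, h2]
  ring

/-- Approximation of `u ∈ H^m` by a polynomial of degree `< m` together with all derivatives. -/
theorem exists_bramble_hilbert (d : ℕ) (hd : 0 < d) {γ : ℝ} (hγ : 0 < γ) (m : ℕ) :
    ∃ C : ℝ, 0 < C ∧
    ∀ (n : ℕ) (S : Fin n → Affine.Simplex ℝ (Space d) d) (h : ℝ), 0 < n → Triang S →
      ShapeReg S γ h → ∀ D : (Fin d → ℕ) → Space d → ℝ,
      (∀ α, ∑ i, α i < m + 1 → WeakH1 S (D α) (fun i => D (α + Pi.single i 1))) →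
      ∃ q : Poly d, q.totalDegree ≤ m ∧ ∀ r α, ∑ i, α i + r = m + 1 →
        ∫ x in tunion S, (D α x - pval (dpoly α q) x) ^ 2 ≤
          C * h ^ (2 * r) * ∑ β ∈ Finset.piAntidiag Finset.univ (m + 1),
            ∫ x in tunion S, D β x ^ 2 := by
  obtain ⟨C₀, hC₀, hP⟩ := exists_poincare d hd hγ
  refine ⟨(C₀ * d + 1) ^ (m + 1), by positivity, fun n S h hn hT hS D hD => ?_⟩
  have hint : ∀ p : Poly d, IntegrableOn (pval p) (tunion S) := fun p =>
    (continuous_pval p).continuousOn.integrableOn_compact isCompact_tunion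
  let I : Poly d →ₗ[ℝ] ℝ :=
    { toFun := fun p => ∫ x in tunion S, pval p x
      map_add' := fun p q => by
        simp only [pval_add]
        exact integral_add (hint p) (hint q)
      map_smul' := fun c p => by
        simp only [pval_smul, RingHom.id_apply, smul_eq_mul]
        exact integral_const_mul _ _ }
  have hI : I 1 ≠ 0 := by
    change ∫ x in tunion S, pval 1 x ≠ 0
    simp only [pval_one, setIntegral_const, smul_eq_mul, mul_one]
    have h1 := volume_real_body_pos (S ⟨0, hn⟩)
    have h2 := measureReal_mono (μ := volume) (body_subset_tunion (S := S) ⟨0, hn⟩)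
      isCompact_tunion.measure_lt_top.ne
    exact (h1.trans_le h2).ne'
  -- Every derivative of `q` of order at most `m` has the same integral as that of `u`, so the
  -- Poincaré inequality applies to each difference.
  obtain ⟨q, hq, hmom⟩ := exists_poly_moments I hI m fun α => ∫ x in tunion S, D α x
  refine ⟨q, hq, ?_⟩
  set B := ∑ β ∈ Finset.piAntidiag Finset.univ (m + 1), ∫ x in tunion S, D β x ^ 2 with hB
  have hB0 : 0 ≤ B := Finset.sum_nonneg fun β _ => integral_nonneg fun x => sq_nonneg _
  have hX0 : (0 : ℝ) ≤ C₀ * d := by positivity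
  -- Induction on `r`, the number of derivatives that `α` lacks to order `m + 1`. At `r = 0` the
  -- derivative of `q` is zero, and each further step is one application of the Poincaré inequality,
  -- gaining `h ^ 2`.
  have key : ∀ r α, ∑ i, α i + r = m + 1 →
      ∫ x in tunion S, (D α x - pval (dpoly α q) x) ^ 2 ≤ (C₀ * d) ^ r * h ^ (2 * r) * B := by
    intro r
    induction r with
    | zero =>
      intro α hα
      rw [dpoly_eq_zero (by omega)]
      simp only [pval_zero, sub_zero, pow_zero, one_mul, mul_zero]
      exact Finset.single_le_sum (f := fun β => ∫ x in tunion S, D β x ^ 2)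
        (fun β _ => integral_nonneg fun x => sq_nonneg _)
        (Finset.mem_piAntidiag.2 ⟨by simpa using hα, fun _ _ => Finset.mem_univ _⟩)
    | succ r ih =>
      intro α hα
      have hw := hD α (by omega)
      have hw' := hw.sub_smooth (contDiff_pval (dpoly α q))
      simp only [partialD_pval, pderiv_dpoly] at hw'
      have h1 := hP n S h hT hS _ _ hw' (by
        rw [integral_sub (integrableOn_tunion hw.mem) (hint _), sub_eq_zero]
        exact (hmom α (by omega)).symm)
      refine h1.trans ?_
      have h2 : ∀ j : Fin d, ∫ x in tunion S, (D (α + Pi.single j 1) x -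
          pval (dpoly (α + Pi.single j 1) q) x) ^ 2 ≤ (C₀ * d) ^ r * h ^ (2 * r) * B := by
        intro j
        refine ih _ ?_
        simp only [Pi.add_apply, Finset.sum_add_distrib, Finset.sum_pi_single', Finset.mem_univ,
          if_true]
        omega
      calc _ ≤ C₀ * h ^ 2 * ∑ _j : Fin d, (C₀ * d) ^ r * h ^ (2 * r) * B :=
            mul_le_mul_of_nonneg_left (Finset.sum_le_sum fun j _ => h2 j) (by positivity)
        _ = _ := by
          rw [Finset.sum_const, Finset.card_univ, Fintype.card_fin, nsmul_eq_mul]; ring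
  intro r α hα
  refine (key r α hα).trans ?_
  have hh := hS.pos
  gcongr
  calc (C₀ * d) ^ r ≤ (C₀ * d + 1) ^ r := by gcongr; linarith
    _ ≤ _ := pow_le_pow_right₀ (by linarith) (by omega)

end BrambleHilbert

end SFWG

end

noncomputable section

namespace SFWG

/-! ### Lifting of normal traces and divergences on an element -/

section ElementLift

variable {d n : ℕ} {S : Fin n → Affine.Simplex ℝ (Space d) d} {γ h : ℝ}

/-- The side `a` coincides with no other side. -/
def Unmatched (S : Fin n → Affine.Simplex ℝ (Space d) d) (a : Fin n × Fin (d + 1)) : Prop :=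
  ∀ b, ¬SideAdj S a b

lemma SideAdj.not_unmatched {a b : Fin n × Fin (d + 1)} (h : SideAdj S a b) : ¬Unmatched S a :=
  fun ha => ha b h

lemma ShapeReg.volume_le (hS : ShapeReg S γ h) (hT : Triang S) (i : Fin n) :
    volume.real (body (S i)) ≤ ballVol d h :=
  (Finset.single_le_sum (f := fun i => volume.real (body (S i)))
    (fun _ _ => measureReal_nonneg) (Finset.mem_univ i)).trans (hS.sum_volume_le hT)

lemma ShapeReg.surf_side_le (hd : 0 < d) (hγ : 0 < γ) (hS : ShapeReg S γ h) (hT : Triang S)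
    (a : Fin n × Fin (d + 1)) :
    (surf d).real (side S a) ≤ d * ballVol d h / (2 * γ * h) := by
  have h1 := volume_real_body (S a.1) hd a.2
  have h2 := hS.volume_le hT a.1
  have h3 := hS.le_height hd hγ a.1 a.2
  have hh := hS.pos
  have hd' : (0 : ℝ) < d := by exact_mod_cast hd
  rw [le_div_iff₀ (by positivity)]
  have h4 : height (S a.1) a.2 * (surf d).real (side S a) = d * volume.real (body (S a.1)) := by
    rw [h1]; field_simp
  calc (surf d).real (side S a) * (2 * γ * h)
      ≤ (surf d).real (side S a) * height (S a.1) a.2 :=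
        mul_le_mul_of_nonneg_left h3 measureReal_nonneg
    _ = d * volume.real (body (S a.1)) := by rw [← h4]; ring
    _ ≤ _ := by gcongr

lemma ShapeReg.le_surf_side (hd : 0 < d) (hγ : 0 < γ) (hS : ShapeReg S γ h)
    (a : Fin n × Fin (d + 1)) :
    γ ^ d * ballVol d h / h ≤ (surf d).real (side S a) := by
  have h1 := volume_real_body (S a.1) hd a.2
  have h2 := hS.ballVol_le hγ a.1
  have h3 := height_le (S a.1) hd a.2 (hS.diam_body a.1)
  have hh := hS.pos
  have hd' : (1 : ℝ) ≤ d := by exact_mod_cast hd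
  rw [ballVol_mul, h1] at h2
  rw [div_le_iff₀ hh]
  refine h2.trans ?_
  have hH := height_pos (S a.1) hd a.2
  rw [mul_comm]
  refine mul_le_mul_of_nonneg_left ?_ measureReal_nonneg
  exact (div_le_self hH.le hd').trans h3

open scoped Classical in
/-- Lifting of normal traces and divergence on an element. -/
theorem exists_element_lift (d : ℕ) (hd : 0 < d) (k : ℕ) {γ : ℝ} (hγ : 0 < γ) :
    ∃ C : ℝ, 0 < C ∧
    ∀ (n : ℕ) (S : Fin n → Affine.Simplex ℝ (Space d) d) (h : ℝ), 0 < n → Triang S →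
      ShapeReg S γ h → ∀ (g : Fin n × Fin (d + 1) → Poly d) (r : Poly d),
      (∀ a, (g a).totalDegree ≤ k + 1) → r.totalDegree ≤ k →
      ∫ x in tunion S, pval r x =
        ∑ a with Unmatched S a, ∫ z in side S a, pval (g a) z ∂(surf d) →
      ∃ τ : Fin n → Fin d → Poly d, (∀ i j, (τ i j).totalDegree ≤ k + 1) ∧
        (∀ a, Unmatched S a → ∀ x ∈ side S a,
          normalTr (S a.1) a.2 (τ a.1) x = pval (g a) x) ∧
        (∀ a b, SideAdj S a b → ∀ x ∈ side S a,
          normalTr (S a.1) a.2 (τ a.1) x + normalTr (S b.1) b.2 (τ b.1) x = 0) ∧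
        (∀ i x, pval (fdiv (τ i)) x = pval r x) ∧
        ∑ i, ∑ j, ∫ x in body (S i), pval (τ i j) x ^ 2 ≤
          C * (h * ∑ a with Unmatched S a, ∫ z in side S a, pval (g a) z ^ 2 ∂(surf d) +
            h ^ 2 * ∫ x in tunion S, pval r x ^ 2) := by
  set N := ⌊(γ ^ d)⁻¹⌋₊ with hN
  obtain ⟨K, hK, hflow⟩ := exists_unit_flow N (d + 1)
  obtain ⟨C₁, hC₁, hlift⟩ := exists_simplex_lift d hd k (κ := 2 * γ) (by positivity)
  set Q : ℝ := N * (d + 1) * (K ^ 2 * N * (γ ^ d)⁻¹) with hQ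
  have hQ0 : 0 ≤ Q := by positivity
  refine ⟨C₁ * (1 + Q * ((d + 1) * d / γ) + Q * 2), by positivity,
    fun n S h hn hT hS g r hg hr hcomp => ?_⟩
  have hh := hS.pos
  have hnN : n ≤ N := hS.card_le hγ hT
  have hd' : (0 : ℝ) < d := by exact_mod_cast hd
  have hVh := ballVol_pos (d := d) hh
  have hconn : ∀ i j : Fin n, Relation.ReflTransGen
      (fun i j => ∃ l l', SideAdj S (i, l) (j, l') ∨ i = j) i j := by
    intro i j
    refine Relation.ReflTransGen.mono ?_ _ _ (hT.conn i j)
    rintro i j ⟨l, m, hlm⟩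
    refine ⟨l, m, ?_⟩
    by_cases hij : i = j
    · exact Or.inr hij
    · exact Or.inl ⟨fun h => hij (congrArg Prod.fst h), hlm⟩
  -- Unit flows from each simplex to the simplex `0`, through matched sides only.
  choose s₀ hs₀b hs₀a hs₀u hs₀d using fun i => hflow n hnN (SideAdj S) (fun _ _ h => h.symm)
    (fun _ _ _ h h' => hT.sideAdj_unique hd h h') i ⟨0, hn⟩ (hconn i _)
  -- the deficits and the flow that removes them
  set bd : Fin n × Fin (d + 1) → ℝ := fun a =>
    if Unmatched S a then ∫ z in side S a, pval (g a) z ∂(surf d) else 0 with hbd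
  set δ : Fin n → ℝ := fun i => (∫ x in body (S i), pval r x) - ∑ l, bd (i, l) with hδ
  have hint : IntegrableOn (pval r) (tunion S) :=
    (continuous_pval r).continuousOn.integrableOn_compact isCompact_tunion
  have hδ0 : ∑ i, δ i = 0 := by
    simp only [hδ, Finset.sum_sub_distrib]
    rw [← hT.integral_tunion hint, hcomp, Finset.sum_filter, Fintype.sum_prod_type, sub_self]
  set s : Fin n × Fin (d + 1) → ℝ := fun a => ∑ i, δ i * s₀ i a with hs
  have hsa : ∀ a b, SideAdj S a b → s a + s b = 0 := by
    intro a b hab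
    simp only [hs, ← Finset.sum_add_distrib, ← mul_add]
    exact Finset.sum_eq_zero fun i _ => by rw [hs₀a i a b hab hab.1, mul_zero]
  have hsu : ∀ a, Unmatched S a → s a = 0 := by
    intro a ha
    exact Finset.sum_eq_zero fun i _ => by rw [hs₀u i a fun b hb => absurd hb (ha b), mul_zero]
  -- By superposition simplex `i` emits exactly its deficit. Simplex `0` also receives the sum of
  -- all deficits, which is zero by the global compatibility condition.
  have hsd : ∀ i, ∑ l, s (i, l) = δ i := by
    intro i
    simp only [hs]
    rw [Finset.sum_comm]
    simp only [← Finset.mul_sum, hs₀d, mul_sub, Finset.sum_sub_distrib, mul_ite, mul_one, mul_zero]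
    rw [Finset.sum_ite_eq, if_pos (Finset.mem_univ i)]
    split_ifs with h0
    · rw [hδ0, sub_zero]
    · simp
  have hsurf : ∀ a, 0 < (surf d).real (side S a) := fun a =>
    lt_of_lt_of_le (by positivity) (hS.le_surf_side hd hγ a)
  -- On matched sides the prescribed normal component is the constant with total flux `s a`. The
  -- constants on matched sides are opposite, so the simplexwise liftings fit together.
  set g' : Fin n × Fin (d + 1) → Poly d := fun a =>
    if Unmatched S a then g a else MvPolynomial.C (s a / (surf d).real (side S a)) with hg'
  have hg'deg : ∀ a, (g' a).totalDegree ≤ k + 1 := by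
    intro a
    simp only [hg']
    split_ifs
    · exact hg a
    · rw [MvPolynomial.totalDegree_C]; omega
  have hg'int : ∀ a, ∫ z in side S a, pval (g' a) z ∂(surf d) = bd a + s a := by
    intro a
    simp only [hg', hbd]
    by_cases ha : Unmatched S a
    · rw [if_pos ha, if_pos ha, hsu a ha, add_zero]
    · rw [if_neg ha, if_neg ha, zero_add]
      simp only [pval_C, setIntegral_const, smul_eq_mul]
      exact mul_div_cancel₀ _ (hsurf a).ne'
  choose τ hτ1 hτ2 hτ3 hτ4 using fun i => hlift (S i) h hh (hS.diam_body i)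
    (hS.le_height hd hγ i) (fun l => g' (i, l)) r (fun l => hg'deg (i, l)) hr (by
      have : ∀ l, ∫ z in facet (S i) l, pval (g' (i, l)) z ∂(surf d) = bd (i, l) + s (i, l) :=
        fun l => hg'int (i, l)
      simp only [this, Finset.sum_add_distrib, hsd, hδ]
      ring)
  refine ⟨τ, hτ1, fun a ha x hx => ?_, fun a b hab x hx => ?_, hτ3, ?_⟩
  · rw [hτ2 a.1 a.2 x hx]
    simp only [hg', if_pos ha]
  · have hxb : x ∈ side S b := hab.2 ▸ hx
    rw [hτ2 a.1 a.2 x hx, hτ2 b.1 b.2 x hxb]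
    simp only [hg', if_neg hab.not_unmatched, if_neg hab.symm.not_unmatched, pval_C]
    rw [hab.2, ← add_div, hsa a b hab, zero_div]
  -- the bound
  set W : ℝ := ∑ a with Unmatched S a, ∫ z in side S a, pval (g a) z ^ 2 ∂(surf d) with hW
  set J : ℝ := ∫ x in tunion S, pval r x ^ 2 with hJ
  have hJ0 : 0 ≤ J := integral_nonneg fun x => sq_nonneg _
  have hW0 : 0 ≤ W := Finset.sum_nonneg fun a _ => integral_nonneg fun x => sq_nonneg _
  have hJs : J = ∑ i, ∫ x in body (S i), pval r x ^ 2 :=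
    hT.integral_sq (memLp_tunion (continuous_pval r))
  have hcs : ∀ (μ : Measure (Space d)) [IsFiniteMeasure μ] (p : Space d → ℝ), MemLp p 2 μ →
      (∫ x, p x ∂μ) ^ 2 ≤ μ.real Set.univ * ∫ x, p x ^ 2 ∂μ := by
    intro μ _ p hp
    have := sq_integral_mul_le (memLp_const (1 : ℝ) (μ := μ) (p := 2)) hp
    simpa using this
  have hδ2 : ∑ i, δ i ^ 2 ≤ ballVol d h * (2 * J + (d + 1) * d / (γ * h) * W) := by
    have h1 : ∀ i, δ i ^ 2 ≤ 2 * (ballVol d h * ∫ x in body (S i), pval r x ^ 2) +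
        2 * ((d + 1) * (d * ballVol d h / (2 * γ * h) * ∑ l, if Unmatched S (i, l) then
          ∫ z in side S (i, l), pval (g (i, l)) z ^ 2 ∂(surf d) else 0)) := by
      intro i
      have e1 : (∫ x in body (S i), pval r x) ^ 2 ≤
          ballVol d h * ∫ x in body (S i), pval r x ^ 2 := by
        have : IsFiniteMeasure (volume.restrict (body (S i))) :=
          ⟨by rw [Measure.restrict_apply_univ]; exact (isCompact_body _).measure_lt_top⟩
        refine (hcs _ _ (memLp_body (continuous_pval r))).trans ?_
        rw [measureReal_restrict_apply_univ]
        exact mul_le_mul_of_nonneg_right (hS.volume_le hT i)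
          (integral_nonneg fun x => sq_nonneg _)
      have e2 : (∑ l, bd (i, l)) ^ 2 ≤ (d + 1) * (d * ballVol d h / (2 * γ * h) *
          ∑ l, if Unmatched S (i, l) then
            ∫ z in side S (i, l), pval (g (i, l)) z ^ 2 ∂(surf d) else 0) := by
        refine sq_sum_le_card_mul_sum_sq.trans ?_
        rw [Finset.card_univ, Fintype.card_fin, Finset.mul_sum (a := d * ballVol d h / (2 * γ * h))]
        push_cast
        refine mul_le_mul_of_nonneg_left (Finset.sum_le_sum fun l _ => ?_) (by positivity)
        simp only [hbd]
        split_ifs with hu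
        · have := isFiniteMeasure_facet (S i) hd l
          refine (hcs _ _ (memLp_facet hd l (continuous_pval (g (i, l))))).trans ?_
          rw [measureReal_restrict_apply_univ]
          exact mul_le_mul_of_nonneg_right (hS.surf_side_le hd hγ hT (i, l))
            (integral_nonneg fun x => sq_nonneg _)
        · simp
      simp only [hδ]
      nlinarith [sq_nonneg ((∫ x in body (S i), pval r x) + ∑ l, bd (i, l))]
    refine (Finset.sum_le_sum fun i _ => h1 i).trans ?_
    rw [Finset.sum_add_distrib, ← Finset.mul_sum, ← Finset.mul_sum, ← hJs, ← Finset.mul_sum,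
      ← Finset.mul_sum, ← Finset.mul_sum]
    rw [hW, Finset.sum_filter, Fintype.sum_prod_type]
    refine le_of_eq ?_
    field_simp
  have hsq : ∀ a, s a ^ 2 ≤ K ^ 2 * N * ∑ i, δ i ^ 2 := by
    intro a
    have h1 : |s a| ≤ K * ∑ i, |δ i| := by
      refine (Finset.abs_sum_le_sum_abs _ _).trans ?_
      rw [Finset.mul_sum]
      refine Finset.sum_le_sum fun i _ => ?_
      rw [abs_mul, mul_comm]
      exact mul_le_mul_of_nonneg_right (hs₀b i a) (abs_nonneg _)
    have h2 : (∑ i, |δ i|) ^ 2 ≤ N * ∑ i, δ i ^ 2 := by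
      have := sq_sum_le_card_mul_sum_sq (s := Finset.univ) (f := fun i => |δ i|)
      simp only [sq_abs, Finset.card_univ, Fintype.card_fin] at this
      refine this.trans ?_
      have : (n : ℝ) ≤ N := by exact_mod_cast hnN
      have h0 : 0 ≤ ∑ i, δ i ^ 2 := Finset.sum_nonneg fun i _ => sq_nonneg _
      gcongr
    calc s a ^ 2 = |s a| ^ 2 := (sq_abs _).symm
      _ ≤ (K * ∑ i, |δ i|) ^ 2 := pow_le_pow_left₀ (abs_nonneg _) h1 2
      _ = K ^ 2 * (∑ i, |δ i|) ^ 2 := by ring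
      _ ≤ K ^ 2 * (N * ∑ i, δ i ^ 2) := by gcongr
      _ = _ := by ring
  -- The bound for `s a ^ 2` carries the volume of a ball of radius `h`, and the area of a side is
  -- at least a multiple of this volume divided by `h`. The volumes cancel and the powers of `h`
  -- come out as in the statement.
  have hsa2 : ∀ a, h * (s a ^ 2 / (surf d).real (side S a)) ≤
      K ^ 2 * N * (γ ^ d)⁻¹ * (2 * (h ^ 2 * J) + (d + 1) * d / γ * (h * W)) := by
    intro a
    have h1 := hS.le_surf_side hd hγ a
    have h2 := hsq a
    have hg0 := pow_pos hγ d
    calc h * (s a ^ 2 / (surf d).real (side S a))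
        ≤ h * (K ^ 2 * N * (ballVol d h * (2 * J + (d + 1) * d / (γ * h) * W)) /
            (γ ^ d * ballVol d h / h)) := by
          gcongr
          exact h2.trans (by gcongr)
      _ = _ := by field_simp
  have hg'sq : ∀ a, h * ∫ z in side S a, pval (g' a) z ^ 2 ∂(surf d) ≤
      h * (if Unmatched S a then ∫ z in side S a, pval (g a) z ^ 2 ∂(surf d) else 0) +
        K ^ 2 * N * (γ ^ d)⁻¹ * (2 * (h ^ 2 * J) + (d + 1) * d / γ * (h * W)) := by
    intro a
    simp only [hg']
    split_ifs with ha
    · have : 0 ≤ K ^ 2 * N * (γ ^ d)⁻¹ * (2 * (h ^ 2 * J) + (d + 1) * d / γ * (h * W)) := by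
        positivity
      linarith
    · simp only [pval_C, setIntegral_const, smul_eq_mul, mul_zero, zero_add]
      refine le_trans (le_of_eq ?_) (hsa2 a)
      have := (hsurf a).ne'
      field_simp
  have hn' : (n : ℝ) ≤ N := by exact_mod_cast hnN
  have hX : 0 ≤ 2 * (h ^ 2 * J) + (d + 1) * d / γ * (h * W) := by positivity
  calc ∑ i, ∑ j, ∫ x in body (S i), pval (τ i j) x ^ 2
      ≤ ∑ i, C₁ * (h * ∑ l, ∫ z in facet (S i) l, pval (g' (i, l)) z ^ 2 ∂(surf d) +
            h ^ 2 * ∫ x in body (S i), pval r x ^ 2) := Finset.sum_le_sum fun i _ => hτ4 i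
    _ = C₁ * (∑ a, h * ∫ z in side S a, pval (g' a) z ^ 2 ∂(surf d) + h ^ 2 * J) := by
        rw [← Finset.mul_sum, Finset.sum_add_distrib, ← Finset.mul_sum, ← Finset.mul_sum, ← hJs,
          ← Finset.mul_sum, Fintype.sum_prod_type]
    _ ≤ C₁ * (∑ a, (h * (if Unmatched S a then
          ∫ z in side S a, pval (g a) z ^ 2 ∂(surf d) else 0) +
        K ^ 2 * N * (γ ^ d)⁻¹ * (2 * (h ^ 2 * J) + (d + 1) * d / γ * (h * W))) + h ^ 2 * J) :=
        mul_le_mul_of_nonneg_left (add_le_add (Finset.sum_le_sum fun a _ => hg'sq a) le_rfl) hC₁.le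
    _ = C₁ * (h * W + n * (d + 1) * (K ^ 2 * N * (γ ^ d)⁻¹ *
          (2 * (h ^ 2 * J) + (d + 1) * d / γ * (h * W))) + h ^ 2 * J) := by
        rw [Finset.sum_add_distrib, ← Finset.mul_sum, hW, Finset.sum_filter, Finset.sum_const,
          Finset.card_univ, Fintype.card_prod, Fintype.card_fin, Fintype.card_fin, nsmul_eq_mul]
        push_cast
        ring
    _ ≤ C₁ * (h * W + N * (d + 1) * (K ^ 2 * N * (γ ^ d)⁻¹ *
          (2 * (h ^ 2 * J) + (d + 1) * d / γ * (h * W))) + h ^ 2 * J) := by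
        gcongr
    _ = C₁ * ((1 + Q * ((d + 1) * d / γ)) * (h * W) + (1 + Q * 2) * (h ^ 2 * J)) := by
        rw [hQ]; ring
    _ ≤ C₁ * ((1 + Q * ((d + 1) * d / γ) + Q * 2) * (h * W) +
          (1 + Q * ((d + 1) * d / γ) + Q * 2) * (h ^ 2 * J)) := by
        have : 0 ≤ Q * ((d + 1) * d / γ) := by positivity
        refine mul_le_mul_of_nonneg_left (add_le_add (mul_le_mul_of_nonneg_right ?_ (by positivity))
          (mul_le_mul_of_nonneg_right ?_ (by positivity))) hC₁.le <;> linarith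
    _ = _ := by ring

end ElementLift

end SFWG

end

noncomputable section

namespace SFWG

/-! ### Projection onto polynomials -/

section Projection

variable {d : ℕ}

/-- The `L²`-projection onto the polynomials of degree `≤ m` for a finite family of measures. -/
lemma exists_poly_proj {ι : Type*} (A : Finset ι) {μ : ι → Measure (Space d)}
    (hμ : ∀ a ∈ A, ∀ p : Poly d, MemLp (pval p) 2 (μ a)) {w : ι → Space d → ℝ}
    (hw : ∀ a ∈ A, MemLp (w a) 2 (μ a)) (m : ℕ) :
    ∃ p : Poly d, p.totalDegree ≤ m ∧
      (∀ s : Poly d, s.totalDegree ≤ m →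
        ∑ a ∈ A, ∫ x, pval p x * pval s x ∂(μ a) = ∑ a ∈ A, ∫ x, w a x * pval s x ∂(μ a)) ∧
      ∑ a ∈ A, ∫ x, pval p x ^ 2 ∂(μ a) ≤ ∑ a ∈ A, ∫ x, w a x ^ 2 ∂(μ a) := by
  let V := MvPolynomial.restrictTotalDegree (Fin d) ℝ m
  have hint : ∀ a ∈ A, ∀ p q : Poly d, Integrable (fun x => pval p x * pval q x) (μ a) :=
    fun a ha p q => integrable_mul_of_memLp (hμ a ha p) (hμ a ha q)
  have hintw : ∀ a ∈ A, ∀ q : Poly d, Integrable (fun x => w a x * pval q x) (μ a) :=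
    fun a ha q => integrable_mul_of_memLp (hw a ha) (hμ a ha q)
  let ℓ : V →ₗ[ℝ] ℝ :=
    { toFun := fun s => ∑ a ∈ A, ∫ x, w a x * pval s.1 x ∂(μ a)
      map_add' := fun s s' => by
        rw [← Finset.sum_add_distrib]
        refine Finset.sum_congr rfl fun a ha => ?_
        rw [← integral_add (hintw a ha _) (hintw a ha _)]
        simp only [Submodule.coe_add, pval_add, mul_add]
      map_smul' := fun c s => by
        rw [RingHom.id_apply, smul_eq_mul, Finset.mul_sum]
        refine Finset.sum_congr rfl fun a _ => ?_
        rw [← integral_const_mul]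
        simp only [Submodule.coe_smul, pval_smul, mul_left_comm] }
  let B : V →ₗ[ℝ] V →ₗ[ℝ] ℝ := LinearMap.mk₂ ℝ
    (fun p s => ∑ a ∈ A, ∫ x, pval p.1 x * pval s.1 x ∂(μ a))
    (fun p p' s => by
      rw [← Finset.sum_add_distrib]
      refine Finset.sum_congr rfl fun a ha => ?_
      rw [← integral_add (hint a ha _ _) (hint a ha _ _)]
      simp only [Submodule.coe_add, pval_add, add_mul])
    (fun c p s => by
      rw [smul_eq_mul, Finset.mul_sum]
      refine Finset.sum_congr rfl fun a _ => ?_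
      rw [← integral_const_mul]
      simp only [Submodule.coe_smul, pval_smul, mul_assoc])
    (fun p s s' => by
      rw [← Finset.sum_add_distrib]
      refine Finset.sum_congr rfl fun a ha => ?_
      rw [← integral_add (hint a ha _ _) (hint a ha _ _)]
      simp only [Submodule.coe_add, pval_add, mul_add])
    (fun c p s => by
      rw [smul_eq_mul, Finset.mul_sum]
      refine Finset.sum_congr rfl fun a _ => ?_
      rw [← integral_const_mul]
      simp only [Submodule.coe_smul, pval_smul, mul_left_comm])
  -- The form is only semidefinite. A polynomial of zero form vanishes almost everywhere for each of
  -- the measures, so the functional vanishes on it too.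
  obtain ⟨p, hp⟩ := exists_representative B (fun p s => by
      simp only [B, LinearMap.mk₂_apply, mul_comm]) ℓ (fun s hs => by
    have h1 := hs s
    simp only [B, LinearMap.mk₂_apply] at h1
    rw [Finset.sum_eq_zero_iff_of_nonneg
      fun a _ => integral_nonneg fun x => mul_self_nonneg _] at h1
    refine Finset.sum_eq_zero fun a ha => ?_
    have h2 := (integral_eq_zero_iff_of_nonneg (fun x => mul_self_nonneg _)
      (hint a ha _ _)).1 (h1 a ha)
    have h3 : (fun x => w a x * pval s.1 x) =ᵐ[μ a] fun _ => 0 := by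
      filter_upwards [h2] with x hx
      rw [mul_self_eq_zero.1 hx, mul_zero]
    rw [integral_congr_ae h3, integral_zero])
  have hp' : ∀ s : Poly d, s.totalDegree ≤ m →
        ∑ a ∈ A, ∫ x, pval p.1 x * pval s x ∂(μ a) = ∑ a ∈ A, ∫ x, w a x * pval s x ∂(μ a) :=
    fun s hs => hp ⟨s, (MvPolynomial.mem_restrictTotalDegree _ _ _).2 hs⟩
  have hpd := (MvPolynomial.mem_restrictTotalDegree _ _ _).1 p.2
  refine ⟨p.1, hpd, hp', ?_⟩
  have h1 := hp' p.1 hpd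
  have h2 : ∀ a ∈ A, 2 * ∫ x, w a x * pval p.1 x ∂(μ a) ≤
      (∫ x, w a x ^ 2 ∂(μ a)) + ∫ x, pval p.1 x ^ 2 ∂(μ a) := by
    intro a ha
    rw [← integral_const_mul, ← integral_add (hw a ha).integrable_sq (hμ a ha _).integrable_sq]
    refine integral_mono ((hintw a ha _).const_mul 2)
      ((hw a ha).integrable_sq.add (hμ a ha _).integrable_sq) fun x => ?_
    have := sq_nonneg (w a x - pval p.1 x)
    simp only
    nlinarith
  have h3 := Finset.sum_le_sum h2
  rw [← Finset.mul_sum, ← h1, Finset.sum_add_distrib] at h3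
  simp only [← sq] at h3
  linarith

end Projection

/-! ### An approximation of the gradient in the space of fields on an element -/

section Sigma

open scoped Classical in
lemma sum_groups {ι α : Type*} [Fintype ι] [Fintype α] {U : α → Prop} {P : ι → α → Prop}
    (h1 : ∀ e a, P e a → U a) (Y : ι → α → ℝ) :
    ∑ a with U a, ∑ e with P e a, Y e a = ∑ e, ∑ a with P e a, Y e a := by
  simp only [Finset.sum_filter]
  rw [Finset.sum_comm]
  refine Finset.sum_congr rfl fun a _ => ?_
  by_cases ha : U a
  · rw [if_pos ha]
  · rw [if_neg ha]
    exact (Finset.sum_eq_zero fun e _ => if_neg fun he => ha (h1 e a he)).symm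

open scoped Classical in
/-- An approximation of the gradient of `u` on an element whose divergence and normal traces are
the projections of those of the gradient. -/
theorem exists_sigma (d : ℕ) (hd : 0 < d) (k : ℕ) {γ : ℝ} (hγ : 0 < γ) : ∃ C : ℝ, 0 < C ∧
    ∀ (n : ℕ) (S : Fin n → Affine.Simplex ℝ (Space d) d) (h : ℝ), 0 < n → Triang S →
      ShapeReg S γ h → ∀ D : (Fin d → ℕ) → Space d → ℝ,
      (∀ α, ∑ i, α i < k + 3 → WeakH1 S (D α) (fun i => D (α + Pi.single i 1))) →
      ∀ t : Fin d → Fin n → Fin (d + 1) → Space d → ℝ,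
      (∀ j i, HasTraces (S i) (D (Pi.single j 1))
        (fun i' => D (Pi.single j 1 + Pi.single i' 1)) (t j i)) →
      ∀ (nE : ℕ) (P : Fin nE → Fin n × Fin (d + 1) → Prop) (ν : Fin nE → Space d),
      (∀ e a, P e a → Unmatched S a) → (∀ a, Unmatched S a → ∃ e, P e a) →
      (∀ e e' a, P e a → P e' a → e = e') → (∀ e a, P e a → sideNormal S a = ν e) →
      ∃ (σ : Fin n → Fin d → Poly d) (r : Poly d) (ρ : Fin nE → Poly d),
        (∀ i j, (σ i j).totalDegree ≤ k + 1) ∧ r.totalDegree ≤ k ∧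
        (∀ e, (ρ e).totalDegree ≤ k + 1) ∧
        (∀ i x, pval (fdiv (σ i)) x = pval r x) ∧
        (∀ a b, SideAdj S a b → ∀ x ∈ side S a,
          normalTr (S a.1) a.2 (σ a.1) x + normalTr (S b.1) b.2 (σ b.1) x = 0) ∧
        (∀ e a, P e a → ∀ x ∈ side S a, normalTr (S a.1) a.2 (σ a.1) x = pval (ρ e) x) ∧
        (∀ s : Poly d, s.totalDegree ≤ k → ∫ x in tunion S, pval r x * pval s x =
          ∫ x in tunion S, (∑ j, D (Pi.single j 1 + Pi.single j 1) x) * pval s x) ∧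
        (∀ e, ∀ s : Poly d, s.totalDegree ≤ k + 1 →
          ∑ a with P e a, ∫ x in side S a, pval (ρ e) x * pval s x ∂(surf d) =
            ∑ a with P e a, ∫ x in side S a,
              (∑ j, sideNormal S a j * t j a.1 a.2 x) * pval s x ∂(surf d)) ∧
        ∑ i, ∑ j, ∫ x in body (S i), (D (Pi.single j 1) x - pval (σ i j) x) ^ 2 ≤
          C * h ^ (2 * (k + 2)) * ∑ β ∈ Finset.piAntidiag Finset.univ (k + 3),
            ∫ x in tunion S, D β x ^ 2 := by
  obtain ⟨C₁, hC₁, hlift⟩ := exists_element_lift d hd k hγ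
  obtain ⟨C₂, hC₂, hBH⟩ := exists_bramble_hilbert d hd hγ (k + 2)
  set N : ℝ := (⌊(γ ^ d)⁻¹⌋₊ : ℝ) with hN
  have hN0 : 0 ≤ N := Nat.cast_nonneg _
  set X : ℝ := N * (d + 1) * (d * ((2 * γ)⁻¹ * ((2 * d + 1) * C₂))) with hX
  have hX0 : 0 ≤ X := by positivity
  refine ⟨2 * (d * C₂) + 2 * (C₁ * (X + d * (d * C₂))) + 1, by positivity,
    fun n S h hn hT hS D hD t ht nE P ν hP1 hP2 hP3 hν => ?_⟩
  have hh := hS.pos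
  have hd' : (0 : ℝ) < d := by exact_mod_cast hd
  -- `q` has degree at most `k + 2`. First derivatives of `u - q` are of the order `h ^ (k + 2)` and
  -- second ones of the order `h ^ (k + 1)`, so the latter multiplied by `h` have the same size,
  -- measured by `ε`.
  obtain ⟨q, hq, hqb⟩ := hBH n S h hn hT hS D hD
  set B := ∑ β ∈ Finset.piAntidiag Finset.univ (k + 3), ∫ x in tunion S, D β x ^ 2 with hB
  have hB0 : 0 ≤ B := Finset.sum_nonneg fun β _ => integral_nonneg fun x => sq_nonneg _
  set ε := h ^ (2 * (k + 2)) * B with hε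
  have hε0 : 0 ≤ ε := by positivity
  -- derivatives of the polynomial approximation
  have hs1 : ∀ j : Fin d, ∑ i, (Pi.single j 1 : Fin d → ℕ) i = 1 := fun j => by simp
  have hs2 : ∀ j i' : Fin d, ∑ i, (Pi.single j 1 + Pi.single i' 1 : Fin d → ℕ) i = 2 := fun j i' => by
    simp [Finset.sum_add_distrib]
  have hb1 : ∀ j : Fin d, ∫ x in tunion S,
      (D (Pi.single j 1) x - pval (dpoly (Pi.single j 1) q) x) ^ 2 ≤ C₂ * ε := by
    intro j
    have := hqb (k + 2) (Pi.single j 1) (by rw [hs1]; omega)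
    rw [hε, ← mul_assoc]; exact this
  have hb2 : ∀ j i' : Fin d, h ^ 2 * ∫ x in tunion S, (D (Pi.single j 1 + Pi.single i' 1) x -
      pval (dpoly (Pi.single j 1 + Pi.single i' 1) q) x) ^ 2 ≤ C₂ * ε := by
    intro j i'
    have := hqb (k + 1) (Pi.single j 1 + Pi.single i' 1) (by rw [hs2]; omega)
    calc _ ≤ h ^ 2 * (C₂ * h ^ (2 * (k + 1)) * B) := by gcongr
      _ = _ := by rw [hε]; ring
  have hwk : ∀ j, WeakH1 S (D (Pi.single j 1)) (fun i => D (Pi.single j 1 + Pi.single i 1)) :=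
    fun j => hD _ (by rw [hs1]; omega)
  have hwk' : ∀ j, WeakH1 S (fun x => D (Pi.single j 1) x - pval (dpoly (Pi.single j 1) q) x)
      (fun i x => D (Pi.single j 1 + Pi.single i 1) x -
        pval (dpoly (Pi.single j 1 + Pi.single i 1) q) x) := by
    intro j
    have := (hwk j).sub_smooth (contDiff_pval (dpoly (Pi.single j 1) q))
    simpa only [partialD_pval, pderiv_dpoly] using this
  set t' : Fin d → Fin n → Fin (d + 1) → Space d → ℝ := fun j i l x =>
    t j i l x - pval (dpoly (Pi.single j 1) q) x with ht'
  have htr : ∀ j i, HasTraces (S i) (fun x => D (Pi.single j 1) x -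
      pval (dpoly (Pi.single j 1) q) x) (fun i x => D (Pi.single j 1 + Pi.single i 1) x -
        pval (dpoly (Pi.single j 1 + Pi.single i 1) q) x) (t' j i) := by
    intro j i
    have := (ht j i).sub_smooth hd (contDiff_pval (dpoly (Pi.single j 1) q))
    simpa only [partialD_pval, pderiv_dpoly] using this
  -- the flux of the error
  set W : Fin n × Fin (d + 1) → Space d → ℝ := fun a x =>
    ∑ j, sideNormal S a j * t' j a.1 a.2 x with hW
  have ht'L : ∀ (a : Fin n × Fin (d + 1)) j,
      MemLp (t' j a.1 a.2) 2 ((surf d).restrict (side S a)) :=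
    fun a j => (htr j a.1).memLp_trace a.2
  have hWL : ∀ a, MemLp (W a) 2 ((surf d).restrict (side S a)) := fun a =>
    memLp_finsetSum _ fun j _ => (ht'L a j).const_mul _
  have hpL : ∀ (a : Fin n × Fin (d + 1)) (p : Poly d),
      MemLp (pval p) 2 ((surf d).restrict (side S a)) := fun a p =>
    memLp_facet hd a.2 (continuous_pval p)
  -- The projection of the flux of `u - q` is taken on a whole face of the element at once, since
  -- the lifting must have a single polynomial as its normal component there.
  choose ge hge1 hge2 hge3 using fun e => exists_poly_proj (Finset.univ.filter fun a => P e a)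
    (μ := fun a => (surf d).restrict (side S a)) (fun a _ p => hpL a p) (w := W)
    (fun a _ => hWL a) (k + 1)
  set L : Space d → ℝ := fun x => ∑ j, (D (Pi.single j 1 + Pi.single j 1) x -
    pval (dpoly (Pi.single j 1 + Pi.single j 1) q) x) with hL
  have hLL : MemLp L 2 (volume.restrict (tunion S)) :=
    memLp_finsetSum _ fun j _ => (hwk' j).memG j
  obtain ⟨r₀, hr₀1, hr₀2, hr₀3⟩ := exists_poly_proj {()}
    (μ := fun _ => volume.restrict (tunion S)) (fun _ _ p => memLp_tunion (continuous_pval p))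
    (w := fun _ => L) (fun _ _ => hLL) k
  simp only [Finset.sum_singleton] at hr₀2 hr₀3
  -- compatibility
  have hZ : ∑ a, ∫ x in side S a, W a x ∂(surf d) = ∫ x in tunion S, L x := by
    rw [hT.integral_tunion (integrableOn_tunion hLL), Fintype.sum_prod_type]
    refine Finset.sum_congr rfl fun i _ => ?_
    have e1 : ∀ j, ∫ x in body (S i), (D (Pi.single j 1 + Pi.single j 1) x -
        pval (dpoly (Pi.single j 1 + Pi.single j 1) q) x) =
        ∑ l, outwardNormal (S i) l j * ∫ z in facet (S i) l, t' j i l z ∂(surf d) := by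
      intro j
      have := (htr j i).green hd (contDiff_const (c := (1 : ℝ))) j
      simpa only [partialD_const, mul_one, mul_zero, integral_zero, add_zero] using this
    have hfin : ∀ l, IsFiniteMeasure ((surf d).restrict (facet (S i) l)) :=
      fun l => isFiniteMeasure_facet (S i) hd l
    have hfinb : IsFiniteMeasure (volume.restrict (body (S i))) :=
      ⟨by rw [Measure.restrict_apply_univ]; exact (isCompact_body _).measure_lt_top⟩
    simp only [hL, hW]
    rw [integral_finsetSum _ fun j _ => (memLp_body_of_tunion ((hwk' j).memG j) i).integrable
      (by norm_num)]
    simp only [e1]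
    rw [Finset.sum_comm]
    refine Finset.sum_congr rfl fun l _ => ?_
    rw [integral_finsetSum _ fun j _ => ((ht'L (i, l) j).integrable (by norm_num)).const_mul _]
    exact Finset.sum_congr rfl fun j _ => integral_const_mul _ _
  -- The traces of the gradient of `u - q` agree across matched sides, where the normals are
  -- opposite, so only the fluxes through unmatched sides remain.
  have hZu : ∑ a with Unmatched S a, ∫ x in side S a, W a x ∂(surf d) = ∫ x in tunion S, L x := by
    rw [← hZ]
    refine Eq.trans (Finset.sum_congr (by ext; simp [Unmatched]) fun _ _ => rfl)
      (hT.sum_sides_eq hd (fun a => ∫ x in side S a, W a x ∂(surf d)) fun a b hab => ?_).symm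
    have e1 : ∀ᵐ x ∂((surf d).restrict (side S a)), ∀ j, t' j a.1 a.2 x = t' j b.1 b.2 x :=
      (ae_all_iff).2 fun j => (hwk' j).trace_eq hd hT (htr j) hab
    have e2 : ∫ x in side S b, W b x ∂(surf d) = -∫ x in side S a, W a x ∂(surf d) := by
      rw [← hab.2, ← integral_neg]
      refine integral_congr_ae ?_
      filter_upwards [e1] with x hx
      simp only [hW, hT.neg_sideNormal hd hab, ← Finset.sum_neg_distrib]
      exact Finset.sum_congr rfl fun j _ => by rw [hx j, PiLp.neg_apply]; ring
    rw [e2]; ring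
  set g : Fin n × Fin (d + 1) → Poly d := fun a => ∑ e with P e a, ge e with hg
  have hga : ∀ e a, P e a → g a = ge e := by
    intro e a hea
    simp only [hg]
    rw [Finset.sum_eq_single e]
    · intro e' he' hne
      exact absurd (hP3 _ _ _ (Finset.mem_filter.1 he').2 hea) hne
    · intro hne
      exact absurd (by simpa using hea) hne
  have hgrp : ∀ F : Fin n × Fin (d + 1) → ℝ,
      ∑ a with Unmatched S a, F a = ∑ e, ∑ a with P e a, F a := by
    intro F
    rw [← sum_groups hP1 fun _ a => F a]
    refine Finset.sum_congr rfl fun a ha => ?_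
    obtain ⟨e, he⟩ := hP2 a (Finset.mem_filter.1 ha).2
    rw [Finset.sum_eq_single e]
    · intro e' he' hne
      exact absurd (hP3 _ _ _ (Finset.mem_filter.1 he').2 he) hne
    · intro hne
      exact absurd (by simpa using he) hne
  -- The projections preserve integrals, as `1` is an admissible test polynomial; so the divergence
  -- theorem for the error passes to the projected data.
  have hcomp : ∫ x in tunion S, pval r₀ x =
      ∑ a with Unmatched S a, ∫ z in side S a, pval (g a) z ∂(surf d) := by
    have e1 := hr₀2 1 (by simp)
    simp only [pval_one, mul_one] at e1
    rw [e1, ← hZu, hgrp, hgrp]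
    refine Finset.sum_congr rfl fun e _ => ?_
    have e2 := hge2 e 1 (by simp)
    simp only [pval_one, mul_one] at e2
    rw [← e2]
    refine Finset.sum_congr rfl fun a ha => ?_
    rw [hga e a (Finset.mem_filter.1 ha).2]
  obtain ⟨τ, hτ1, hτ2, hτ3, hτ4, hτ5⟩ := hlift n S h hn hT hS g r₀ (fun a =>
    MvPolynomial.totalDegree_finsetSum_le fun e _ => hge1 e) hr₀1 hcomp
  have hdeg1 : ∀ j, (dpoly (Pi.single j 1) q).totalDegree ≤ k + 1 := by
    intro j
    have e1 := pderiv_dpoly 0 j q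
    rw [dpoly_zero, zero_add] at e1
    rw [← e1]
    have := totalDegree_pderiv_le j q
    omega
  have hdeg2 : ∀ j, (dpoly (Pi.single j 1 + Pi.single j 1) q).totalDegree ≤ k := by
    intro j
    rw [← pderiv_dpoly]
    have := totalDegree_pderiv_le j (dpoly (Pi.single j 1) q)
    have := hdeg1 j
    omega
  set gq : Fin d → Poly d := fun j => dpoly (Pi.single j 1) q with hgq
  have hngq : ∀ e a, P e a → ∀ x, normalTr (S a.1) a.2 gq x =
      pval (∑ j, MvPolynomial.C (ν e j) * gq j) x := by
    intro e a hea x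
    simp only [normalTr, pval_sum, pval_mul, pval_C]
    refine Finset.sum_congr rfl fun j _ => ?_
    rw [← hν e a hea, mul_comm]
  -- The gradient of `q` has degree at most `k + 1`, its divergence degree at most `k`, and its
  -- normal component is one polynomial on each face, because the normal is constant there. The
  -- projections reproduce it, and the lifting `τ` supplies the projections of the rest.
  refine ⟨fun i => gq + τ i, r₀ + ∑ j, dpoly (Pi.single j 1 + Pi.single j 1) q,
    fun e => ge e + ∑ j, MvPolynomial.C (ν e j) * gq j, fun i j => ?_, ?_, fun e => ?_,
    fun i x => ?_, fun a b hab x hx => ?_, fun e a hea x hx => ?_, fun s hs => ?_,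
    fun e s hs => ?_, ?_⟩
  · exact (MvPolynomial.totalDegree_add _ _).trans (max_le (hdeg1 j) (hτ1 i j))
  · exact (MvPolynomial.totalDegree_add _ _).trans (max_le hr₀1
      (MvPolynomial.totalDegree_finsetSum_le fun j _ => hdeg2 j))
  · refine (MvPolynomial.totalDegree_add _ _).trans (max_le (hge1 e)
      (MvPolynomial.totalDegree_finsetSum_le fun j _ => ?_))
    refine (MvPolynomial.totalDegree_mul _ _).trans ?_
    rw [MvPolynomial.totalDegree_C, zero_add]
    exact hdeg1 j
  · rw [fdiv_add, pval_add, hτ4, pval_add, add_comm]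
    simp only [fdiv, hgq, pderiv_dpoly]
  · simp only [normalTr_add]
    have e1 := hτ3 a b hab x hx
    have e2 : normalTr (S b.1) b.2 gq x = -normalTr (S a.1) a.2 gq x := by
      have := hT.neg_sideNormal hd hab
      simp only [sideNormal] at this
      simp only [normalTr, this, PiLp.neg_apply, mul_neg, Finset.sum_neg_distrib]
    rw [e2]; linarith
  · rw [normalTr_add, hngq e a hea, pval_add, hτ2 a (hP1 e a hea) x hx, hga e a hea, add_comm]
  · have e1 := hr₀2 s hs
    have i1 : IntegrableOn (fun x => pval r₀ x * pval s x) (tunion S) :=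
      integrable_mul_of_memLp (memLp_tunion (continuous_pval _)) (memLp_tunion (continuous_pval _))
    have i2 : IntegrableOn (fun x => pval (∑ j, dpoly (Pi.single j 1 + Pi.single j 1) q) x *
        pval s x) (tunion S) :=
      integrable_mul_of_memLp (memLp_tunion (continuous_pval _)) (memLp_tunion (continuous_pval _))
    have i3 : IntegrableOn (fun x => L x * pval s x) (tunion S) :=
      integrable_mul_of_memLp hLL (memLp_tunion (continuous_pval _))
    simp only [pval_add, add_mul]
    rw [integral_add i1 i2, e1, ← integral_add i3 i2]
    refine integral_congr_ae (Eventually.of_forall fun x => ?_)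
    simp only [hL, pval_sum, Finset.sum_sub_distrib]
    ring
  · have e1 := hge2 e s hs
    have : ∀ a ∈ Finset.univ.filter (fun a => P e a),
        ∫ x in side S a, pval (ge e + ∑ j, MvPolynomial.C (ν e j) * gq j) x * pval s x ∂(surf d) -
          ∫ x in side S a, (∑ j, sideNormal S a j * t j a.1 a.2 x) * pval s x ∂(surf d) =
        ∫ x in side S a, pval (ge e) x * pval s x ∂(surf d) -
          ∫ x in side S a, W a x * pval s x ∂(surf d) := by
      intro a ha
      have hea := (Finset.mem_filter.1 ha).2
      have i1 : IntegrableOn (fun x => pval (ge e) x * pval s x) (side S a) (surf d) :=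
        integrable_mul_of_memLp (hpL a _) (hpL a _)
      have i2 : IntegrableOn (fun x => pval (∑ j, MvPolynomial.C (ν e j) * gq j) x * pval s x)
        (side S a) (surf d) := integrable_mul_of_memLp (hpL a _) (hpL a _)
      have i3 : IntegrableOn (fun x => W a x * pval s x) (side S a) (surf d) :=
        integrable_mul_of_memLp (hWL a) (hpL a _)
      have e2 : ∫ x in side S a, (∑ j, sideNormal S a j * t j a.1 a.2 x) * pval s x ∂(surf d) =
          ∫ x in side S a, (W a x * pval s x +
            pval (∑ j, MvPolynomial.C (ν e j) * gq j) x * pval s x) ∂(surf d) := by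
        refine integral_congr_ae (Eventually.of_forall fun x => ?_)
        simp only [hW, ht', pval_sum, pval_mul, pval_C, ← add_mul, ← Finset.sum_add_distrib,
          ← hν e a hea]
        congr 1
        exact Finset.sum_congr rfl fun j _ => by simp only [hgq]; ring
      rw [e2, integral_add i3 i2]
      simp only [pval_add, add_mul]
      rw [integral_add i1 i2]
      ring
    have h2 := Finset.sum_congr rfl this
    rw [Finset.sum_sub_distrib, Finset.sum_sub_distrib] at h2
    linarith
  -- the bound
  have hWb : ∀ a, h * ∫ x in side S a, W a x ^ 2 ∂(surf d) ≤
      d * ((2 * γ)⁻¹ * ((2 * d + 1) * C₂)) * ε := by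
    intro a
    have e1 : ∫ x in side S a, W a x ^ 2 ∂(surf d) ≤
        ∑ j, ∫ x in side S a, t' j a.1 a.2 x ^ 2 ∂(surf d) := by
      rw [← integral_finsetSum _ fun j _ => (ht'L a j).integrable_sq]
      refine integral_mono (hWL a).integrable_sq
        (integrable_finsetSum _ fun j _ => (ht'L a j).integrable_sq) fun x => ?_
      have := Finset.sum_mul_sq_le_sq_mul_sq Finset.univ (fun j => sideNormal S a j)
        (fun j => t' j a.1 a.2 x)
      have hn1 : ∑ j, sideNormal S a j ^ 2 = 1 := by
        have := EuclideanSpace.norm_sq_eq (sideNormal S a)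
        rw [norm_outwardNormal (S a.1) hd a.2] at this
        simpa using this.symm
      rw [hn1, one_mul] at this
      exact this
    -- The trace inequality on the simplex, whose heights are at least `2 * γ * h`: one derivative
    -- of the error counts `d + 1` times, the `d` second derivatives once each with weight `h ^ 2`.
    have e2 : ∀ j, h * ∫ x in side S a, t' j a.1 a.2 x ^ 2 ∂(surf d) ≤
        (2 * γ)⁻¹ * ((2 * d + 1) * C₂) * ε := by
      intro j
      have f1 := (htr j a.1).facet_sq_le hd a.2 (hS.diam_body a.1)
      have f2 := hS.le_height hd hγ a.1 a.2
      have mono : ∀ {w : Space d → ℝ}, MemLp w 2 (volume.restrict (tunion S)) →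
          ∫ x in body (S a.1), w x ^ 2 ≤ ∫ x in tunion S, w x ^ 2 := fun hw =>
        setIntegral_mono_set hw.integrable_sq (Eventually.of_forall fun x => sq_nonneg _)
          (body_subset_tunion a.1).eventuallyLE
      have f3 := (mono (hwk' j).mem).trans (hb1 j)
      have f4 : h ^ 2 * ∑ i, ∫ x in body (S a.1), (D (Pi.single j 1 + Pi.single i 1) x -
          pval (dpoly (Pi.single j 1 + Pi.single i 1) q) x) ^ 2 ≤ d * (C₂ * ε) := by
        rw [Finset.mul_sum]
        calc _ ≤ ∑ _i : Fin d, C₂ * ε := Finset.sum_le_sum fun i _ =>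
              (mul_le_mul_of_nonneg_left (mono ((hwk' j).memG i)) (sq_nonneg h)).trans (hb2 j i)
          _ = _ := by rw [Finset.sum_const, Finset.card_univ, Fintype.card_fin, nsmul_eq_mul]
      have hI0 : 0 ≤ ∫ x in side S a, t' j a.1 a.2 x ^ 2 ∂(surf d) :=
        integral_nonneg fun x => sq_nonneg _
      have f5 : 2 * γ * h * ∫ x in side S a, t' j a.1 a.2 x ^ 2 ∂(surf d) ≤
          (2 * d + 1) * C₂ * ε := by
        calc _ ≤ height (S a.1) a.2 * ∫ x in side S a, t' j a.1 a.2 x ^ 2 ∂(surf d) :=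
              mul_le_mul_of_nonneg_right f2 hI0
          _ ≤ _ := f1
          _ ≤ (d + 1) * (C₂ * ε) + d * (C₂ * ε) :=
              add_le_add (mul_le_mul_of_nonneg_left f3 (by positivity)) f4
          _ = _ := by ring
      rw [mul_assoc ((2 * γ)⁻¹), ← div_eq_inv_mul, le_div_iff₀ (by positivity)]
      linarith
    calc _ ≤ h * ∑ j, ∫ x in side S a, t' j a.1 a.2 x ^ 2 ∂(surf d) :=
          mul_le_mul_of_nonneg_left e1 hh.le
      _ = ∑ j, h * ∫ x in side S a, t' j a.1 a.2 x ^ 2 ∂(surf d) := Finset.mul_sum _ _ _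
      _ ≤ ∑ _j : Fin d, (2 * γ)⁻¹ * ((2 * d + 1) * C₂) * ε := Finset.sum_le_sum fun j _ => e2 j
      _ = _ := by
        rw [Finset.sum_const, Finset.card_univ, Fintype.card_fin, nsmul_eq_mul]; ring
  have hgb : h * ∑ a with Unmatched S a, ∫ z in side S a, pval (g a) z ^ 2 ∂(surf d) ≤ X * ε := by
    have e1 : ∑ a with Unmatched S a, ∫ z in side S a, pval (g a) z ^ 2 ∂(surf d) ≤
        ∑ a with Unmatched S a, ∫ z in side S a, W a z ^ 2 ∂(surf d) := by
      rw [hgrp, hgrp]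
      refine Finset.sum_le_sum fun e _ => le_trans (le_of_eq ?_) (hge3 e)
      refine Finset.sum_congr rfl fun a ha => ?_
      rw [hga e a (Finset.mem_filter.1 ha).2]
    have e2 : ∑ a with Unmatched S a, ∫ z in side S a, W a z ^ 2 ∂(surf d) ≤
        ∑ a, ∫ z in side S a, W a z ^ 2 ∂(surf d) :=
      Finset.sum_le_sum_of_subset_of_nonneg (Finset.filter_subset _ _)
        fun a _ _ => integral_nonneg fun x => sq_nonneg _
    have hnN : (n : ℝ) ≤ N := by rw [hN]; exact_mod_cast hS.card_le hγ hT
    calc _ ≤ h * ∑ a, ∫ z in side S a, W a z ^ 2 ∂(surf d) :=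
          mul_le_mul_of_nonneg_left (e1.trans e2) hh.le
      _ = ∑ a, h * ∫ z in side S a, W a z ^ 2 ∂(surf d) := Finset.mul_sum _ _ _
      _ ≤ ∑ _a : Fin n × Fin (d + 1), d * ((2 * γ)⁻¹ * ((2 * d + 1) * C₂)) * ε :=
          Finset.sum_le_sum fun a _ => hWb a
      _ = n * (d + 1) * (d * ((2 * γ)⁻¹ * ((2 * d + 1) * C₂))) * ε := by
          rw [Finset.sum_const, Finset.card_univ, Fintype.card_prod, Fintype.card_fin,
            Fintype.card_fin, nsmul_eq_mul]
          push_cast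
          ring
      _ ≤ _ := by rw [hX]; gcongr
  have hrb : h ^ 2 * ∫ x in tunion S, pval r₀ x ^ 2 ≤ d * (d * C₂) * ε := by
    have e1 : ∫ x in tunion S, L x ^ 2 ≤ d * ∑ j : Fin d, ∫ x in tunion S,
        (D (Pi.single j 1 + Pi.single j 1) x -
          pval (dpoly (Pi.single j 1 + Pi.single j 1) q) x) ^ 2 := by
      have := integral_sq_sum_le (μ := volume.restrict (tunion S)) (Finset.univ : Finset (Fin d))
        (f := fun j x => D (Pi.single j 1 + Pi.single j 1) x -
          pval (dpoly (Pi.single j 1 + Pi.single j 1) q) x) fun j _ => (hwk' j).memG j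
      rwa [Finset.card_univ, Fintype.card_fin] at this
    calc _ ≤ h ^ 2 * (d * ∑ j : Fin d, ∫ x in tunion S, (D (Pi.single j 1 + Pi.single j 1) x -
          pval (dpoly (Pi.single j 1 + Pi.single j 1) q) x) ^ 2) :=
          mul_le_mul_of_nonneg_left (hr₀3.trans e1) (sq_nonneg h)
      _ = d * ∑ j : Fin d, h ^ 2 * ∫ x in tunion S, (D (Pi.single j 1 + Pi.single j 1) x -
          pval (dpoly (Pi.single j 1 + Pi.single j 1) q) x) ^ 2 := by
          rw [← Finset.mul_sum]; ring
      _ ≤ d * ∑ _j : Fin d, C₂ * ε :=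
          mul_le_mul_of_nonneg_left (Finset.sum_le_sum fun j _ => hb2 j j) hd'.le
      _ = _ := by
        rw [Finset.sum_const, Finset.card_univ, Fintype.card_fin, nsmul_eq_mul]; ring
  have hτb : ∑ i, ∑ j, ∫ x in body (S i), pval (τ i j) x ^ 2 ≤ C₁ * (X + d * (d * C₂)) * ε := by
    refine hτ5.trans ?_
    calc _ ≤ C₁ * (X * ε + d * (d * C₂) * ε) :=
          mul_le_mul_of_nonneg_left (add_le_add hgb hrb) hC₁.le
      _ = _ := by ring
  have hub : ∑ i, ∑ j, ∫ x in body (S i),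
      (D (Pi.single j 1) x - pval (dpoly (Pi.single j 1) q) x) ^ 2 ≤ d * C₂ * ε := by
    rw [Finset.sum_comm]
    calc _ = ∑ j : Fin d, ∫ x in tunion S,
          (D (Pi.single j 1) x - pval (dpoly (Pi.single j 1) q) x) ^ 2 :=
          Finset.sum_congr rfl fun j _ => (hT.integral_sq (hwk' j).mem).symm
      _ ≤ ∑ _j : Fin d, C₂ * ε := Finset.sum_le_sum fun j _ => hb1 j
      _ = _ := by
        rw [Finset.sum_const, Finset.card_univ, Fintype.card_fin, nsmul_eq_mul]; ring
  have hfin : ∀ i j, ∫ x in body (S i), (D (Pi.single j 1) x - pval ((gq + τ i) j) x) ^ 2 ≤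
      2 * (∫ x in body (S i), (D (Pi.single j 1) x - pval (dpoly (Pi.single j 1) q) x) ^ 2) +
        2 * ∫ x in body (S i), pval (τ i j) x ^ 2 := by
    intro i j
    have := integral_sub_sq_le (memLp_body_of_tunion (hwk' j).mem i)
      (memLp_body (S := S i) (continuous_pval (τ i j)))
    refine le_trans (le_of_eq ?_) this
    refine integral_congr_ae (Eventually.of_forall fun x => ?_)
    simp only [Pi.add_apply, pval_add, hgq]
    ring
  calc _ ≤ ∑ i, ∑ j, (2 * (∫ x in body (S i),
          (D (Pi.single j 1) x - pval (dpoly (Pi.single j 1) q) x) ^ 2) +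
        2 * ∫ x in body (S i), pval (τ i j) x ^ 2) :=
        Finset.sum_le_sum fun i _ => Finset.sum_le_sum fun j _ => hfin i j
    _ = 2 * (∑ i, ∑ j, ∫ x in body (S i),
          (D (Pi.single j 1) x - pval (dpoly (Pi.single j 1) q) x) ^ 2) +
        2 * ∑ i, ∑ j, ∫ x in body (S i), pval (τ i j) x ^ 2 := by
        simp only [Finset.sum_add_distrib, ← Finset.mul_sum]
    _ ≤ 2 * (d * C₂ * ε) + 2 * (C₁ * (X + d * (d * C₂)) * ε) := by linarith
    _ ≤ (2 * (d * C₂) + 2 * (C₁ * (X + d * (d * C₂))) + 1) * ε := by linarith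
    _ = _ := by rw [hε]; ring

end Sigma

end SFWG

end

noncomputable section

namespace SFWG

/-! ### Piecewise polynomial fields with continuous normal components -/

section Fields

variable {d n : ℕ}

lemma eq_of_pval_eq (S : Affine.Simplex ℝ (Space d) d) {p q : Poly d}
    (h : ∀ x ∈ interior (body S), pval p x = pval q x) : p = q := by
  rw [← sub_eq_zero]
  obtain ⟨c, hc⟩ := exists_bary_coeff S (p - q) le_rfl
  have h1 := bary_coeff_eq_zero S (c := c) fun x hx => by rw [← hc, pval_sub, h x hx, sub_self]
  have h2 : ∀ x, pval (p - q) x = 0 := fun x => by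
    rw [hc]
    exact Finset.sum_eq_zero fun α hα => by rw [h1 α hα, zero_mul]
  refine MvPolynomial.funext fun x => ?_
  have h3 := h2 (WithLp.toLp 2 x)
  simpa [pval] using h3

lemma IsTest.eq_zero {U : Set (Space d)} {φ : Space d → ℝ} (h : IsTest U φ) {x : Space d}
    (hx : x ∉ U) : φ x = 0 := image_eq_zero_of_notMem_tsupport fun h' => hx (h.2.2 h')

lemma IsTest.partialD_eq_zero {U : Set (Space d)} {φ : Space d → ℝ} (h : IsTest U φ) {x : Space d}
    (hx : x ∉ U) (j : Fin d) : partialD j φ x = 0 := by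
  rw [partialD, fderiv_of_notMem_tsupport ℝ fun h' => hx (h.2.2 h')]
  rfl

lemma integrableOn_body_mul (S : Affine.Simplex ℝ (Space d) d) {f g : Space d → ℝ}
    (hf : Continuous f) (hg : Continuous g) : IntegrableOn (fun x => f x * g x) (body S) :=
  (hf.mul hg).continuousOn.integrableOn_compact (isCompact_body S)

lemma integrableOn_tunion_mul (S : Fin n → Affine.Simplex ℝ (Space d) d) {f g : Space d → ℝ}
    (hf : Continuous f) (hg : Continuous g) : IntegrableOn (fun x => f x * g x) (tunion S) :=
  (hf.mul hg).continuousOn.integrableOn_compact isCompact_tunion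

lemma integrableOn_facet_mul (hd : 0 < d) (S : Affine.Simplex ℝ (Space d) d) (l : Fin (d + 1))
    {f g : Space d → ℝ} (hf : Continuous f) (hg : Continuous g) :
    IntegrableOn (fun x => f x * g x) (facet S l) (surf d) :=
  integrable_mul_of_memLp (memLp_facet hd l hf) (memLp_facet hd l hg)

lemma body_green (hd : 0 < d) (S : Affine.Simplex ℝ (Space d) d) (τ : Fin d → Poly d)
    {φ : Space d → ℝ} (hφ : ContDiff ℝ ∞ φ) :
    ∫ x in body S, ∑ j, pval (τ j) x * partialD j φ x =
      -(∫ x in body S, φ x * pval (fdiv τ) x) +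
        ∑ l, ∫ x in facet S l, φ x * normalTr S l τ x ∂(surf d) := by
  have hc := hφ.continuous
  have h1 : ∀ j, (∫ x in body S, pval (τ j) x * partialD j φ x) +
      ∫ x in body S, φ x * pval (MvPolynomial.pderiv j (τ j)) x =
      ∑ l, outwardNormal S l j * ∫ x in facet S l, φ x * pval (τ j) x ∂(surf d) := by
    intro j
    have e1 := integral_partialD_body S hd (hφ.mul (contDiff_pval (τ j))) j
    rw [← e1, ← integral_add (integrableOn_body_mul S (continuous_pval _) (continuous_partialD hφ j))
      (integrableOn_body_mul S hc (continuous_pval _))]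
    refine integral_congr_ae (Eventually.of_forall fun x => ?_)
    have := partialD_mul hφ (contDiff_pval (τ j)) j x
    simp only
    rw [this, partialD_pval]; ring
  have h2 : ∫ x in body S, ∑ j, pval (τ j) x * partialD j φ x =
      ∑ j, ∫ x in body S, pval (τ j) x * partialD j φ x :=
    integral_finsetSum _ fun j _ => integrableOn_body_mul S (continuous_pval _) (continuous_partialD hφ j)
  have h3 : ∫ x in body S, φ x * pval (fdiv τ) x =
      ∑ j, ∫ x in body S, φ x * pval (MvPolynomial.pderiv j (τ j)) x := by
    simp only [fdiv, pval_sum, Finset.mul_sum]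
    exact integral_finsetSum _ fun j _ => integrableOn_body_mul S hc (continuous_pval _)
  have h4 : ∀ l, ∫ x in facet S l, φ x * normalTr S l τ x ∂(surf d) =
      ∑ j, outwardNormal S l j * ∫ x in facet S l, φ x * pval (τ j) x ∂(surf d) := by
    intro l
    simp only [normalTr, Finset.mul_sum]
    rw [integral_finsetSum _ fun j _ => integrableOn_facet_mul hd S l
      (g := fun x => pval (τ j) x * outwardNormal S l j) hc
      ((continuous_pval (τ j)).mul continuous_const)]
    refine Finset.sum_congr rfl fun j _ => ?_
    rw [← integral_const_mul]
    exact integral_congr_ae (Eventually.of_forall fun x => by simp only; ring)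
  rw [h2, h3, Finset.sum_congr rfl fun l _ => h4 l, Finset.sum_comm,
    ← Finset.sum_congr rfl fun j _ => h1 j, Finset.sum_add_distrib]
  ring

variable {S : Fin n → Affine.Simplex ℝ (Space d) d}

/-- The normal components of a piecewise polynomial field are continuous. -/
def DivConf (S : Fin n → Affine.Simplex ℝ (Space d) d) (q : Fin n → Fin d → Poly d) : Prop :=
  ∀ a b, SideAdj S a b → ∀ x ∈ side S a,
    normalTr (S a.1) a.2 (q a.1) x + normalTr (S b.1) b.2 (q b.1) x = 0

open scoped Classical in
-- In the sum of Green's formulas over the simplices the two contributions of a matched pair of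
-- sides cancel.
lemma DivConf.green (hd : 0 < d) (hT : Triang S) {q : Fin n → Fin d → Poly d} (hq : DivConf S q)
    {φ : Space d → ℝ} (hφ : ContDiff ℝ ∞ φ) :
    ∑ i, ∫ x in body (S i), ∑ j, pval (q i j) x * partialD j φ x =
      -(∑ i, ∫ x in body (S i), φ x * pval (fdiv (q i)) x) +
        ∑ a with Unmatched S a, ∫ x in side S a,
          φ x * normalTr (S a.1) a.2 (q a.1) x ∂(surf d) := by
  rw [Finset.sum_congr rfl fun i _ => body_green hd (S i) (q i) hφ, Finset.sum_add_distrib,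
    Finset.sum_neg_distrib, ← Fintype.sum_prod_type', add_right_inj]
  refine (hT.sum_sides_eq hd (fun a => ∫ x in side S a,
    φ x * normalTr (S a.1) a.2 (q a.1) x ∂(surf d)) fun a b hab => ?_).trans
    (Finset.sum_congr (by ext; simp [Unmatched]) fun _ _ => rfl)
  rw [← hab.2, ← integral_add]
  · refine setIntegral_eq_zero_of_forall_eq_zero fun x hx => ?_
    rw [← mul_add, hq a b hab x hx, mul_zero]
  · exact integrableOn_facet_mul hd _ _ hφ.continuous (continuous_normalTr _ _ _)
  · exact integrableOn_facet_mul hd _ _ hφ.continuous (continuous_normalTr _ _ _)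

/-- The divergence in the sense of distributions of a piecewise polynomial field is a
polynomial. -/
def HasPolyDiv (S : Fin n → Affine.Simplex ℝ (Space d) d) (q : Fin n → Fin d → Poly d)
    (p : Poly d) : Prop :=
  ∀ φ, IsTest (interior (tunion S)) φ →
    ∑ i, ∫ x in body (S i), ∑ j, pval (q i j) x * partialD j φ x =
      -∫ x in tunion S, pval p x * φ x

lemma DivConf.hasPolyDiv (hd : 0 < d) (hT : Triang S) {q : Fin n → Fin d → Poly d}
    (hq : DivConf S q) {p : Poly d} (hp : ∀ i x, pval (fdiv (q i)) x = pval p x) :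
    HasPolyDiv S q p := by
  classical
  intro φ hφ
  rw [hq.green hd hT hφ.1, hT.integral_tunion, Finset.sum_eq_zero (s := Finset.univ.filter _),
    add_zero]
  · simp only [hp, mul_comm]
  · intro a ha
    refine setIntegral_eq_zero_of_forall_eq_zero fun x hx => ?_
    rw [hφ.eq_zero, zero_mul]
    exact (hT.side_subset_frontier hd (Finset.mem_filter.1 ha).2 hx).2
  · exact integrableOn_tunion_mul S (continuous_pval p) hφ.1.continuous

lemma Triang.disjoint_interior_body (hT : Triang S) {i j : Fin n} (hij : i ≠ j) :
    Disjoint (interior (body (S i))) (body (S j)) := by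
  have := (hT.disjoint_interior hij).closure_right isOpen_interior
  exact this.mono_right (body_subset_closure_interior (S j))

/-- Tested with functions supported in a single simplex, the distributional divergence is the
classical one there, and polynomials that agree on an open set are equal. -/
lemma HasPolyDiv.pval_fdiv (hd : 0 < d) (hT : Triang S) {q : Fin n → Fin d → Poly d} {p : Poly d}
    (h : HasPolyDiv S q p) (i : Fin n) : fdiv (q i) = p := by
  refine eq_of_pval_eq (S i) ?_
  have hcont : Continuous fun x => pval (fdiv (q i)) x - pval p x :=
    (continuous_pval _).sub (continuous_pval _)
  have key : ∀ᵐ x, x ∈ interior (body (S i)) → pval (fdiv (q i)) x - pval p x = 0 := by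
    refine isOpen_interior.ae_eq_zero_of_integral_contDiff_smul_eq_zero
      (hcont.locallyIntegrable.locallyIntegrableOn _) fun φ hφ hφc hφs => ?_
    have hφi : IsTest (interior (body (S i))) φ := ⟨hφ, hφc, hφs⟩
    have e1 := h φ (hφi.mono (interior_mono (body_subset_tunion i)))
    rw [hT.integral_tunion (integrableOn_tunion_mul S (continuous_pval p) hφ.continuous), Finset.sum_eq_single i, Finset.sum_eq_single i,
      body_green hd (S i) (q i) hφ, Finset.sum_eq_zero (s := Finset.univ), add_zero] at e1
    · have e2 : ∫ x, φ x • (pval (fdiv (q i)) x - pval p x) =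
          ∫ x in body (S i), φ x • (pval (fdiv (q i)) x - pval p x) := by
        refine (setIntegral_eq_integral_of_forall_compl_eq_zero fun x hx => ?_).symm
        rw [hφi.eq_zero fun h' => hx (interior_subset h'), zero_smul]
      rw [e2]
      simp only [smul_eq_mul, mul_sub]
      rw [integral_sub (integrableOn_body_mul _ hφ.continuous (continuous_pval _))
        (integrableOn_body_mul _ hφ.continuous (continuous_pval _))]
      simp only [mul_comm] at e1 ⊢
      linarith
    · intro l _
      refine setIntegral_eq_zero_of_forall_eq_zero fun x hx => ?_
      rw [hφi.eq_zero, zero_mul]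
      exact not_mem_interior_of_lam_eq_zero (S i) ((mem_facet (S i)).1 hx).2
    · intro j _ hj
      refine setIntegral_eq_zero_of_forall_eq_zero fun x hx => ?_
      rw [hφi.eq_zero, mul_zero]
      exact fun h' => Set.disjoint_left.1 (hT.disjoint_interior_body hj.symm) h' hx
    · simp
    · intro j _ hj
      refine setIntegral_eq_zero_of_forall_eq_zero fun x hx => Finset.sum_eq_zero fun m _ => ?_
      rw [hφi.partialD_eq_zero, mul_zero]
      exact fun h' => Set.disjoint_left.1 (hT.disjoint_interior_body hj.symm) h' hx
    · simp
  have h2 := (Measure.eqOn_open_of_ae_eq (μ := volume) (U := interior (body (S i)))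
    (f := fun x => pval (fdiv (q i)) x - pval p x) (g := fun _ => 0)
    ((ae_restrict_iff' isOpen_interior.measurableSet).2 key) isOpen_interior
    hcont.continuousOn continuousOn_const)
  exact fun x hx => sub_eq_zero.1 (h2 hx)

/-- Once the divergences on the simplices are known to be `p`, the volume terms cancel and a surface
distribution remains that vanishes in the interior. On a matched side its density is, almost
everywhere, the sum of the two normal components, and continuity gives all points. -/
lemma HasPolyDiv.divConf (hd : 0 < d) (hT : Triang S) {q : Fin n → Fin d → Poly d} {p : Poly d}
    (h : HasPolyDiv S q p) : DivConf S q := by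
  have hint : ∀ a : Fin n × Fin (d + 1), ∀ {φ : Space d → ℝ}, Continuous φ →
      IntegrableOn φ (side S a) (surf d) := fun a φ hφ => by
    have := isFiniteMeasure_facet (S a.1) hd a.2
    exact (memLp_facet hd a.2 hφ).integrable (by norm_num)
  have h1 := ae_sum_indicator_eq_zero (F := side S)
    (g := fun a x => normalTr (S a.1) a.2 (q a.1) x) (fun a => isCompact_facet _ _)
    (fun a => hint a (continuous_normalTr _ _ _)) (U := interior (tunion S)) isOpen_interior
    (fun φ hφ => by
      have e1 := h φ hφ
      rw [hT.integral_tunion (integrableOn_tunion_mul S (continuous_pval p) hφ.1.continuous),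
        Finset.sum_congr rfl fun i _ => body_green hd (S i) (q i) hφ.1, Finset.sum_add_distrib,
        Finset.sum_neg_distrib, ← Fintype.sum_prod_type'] at e1
      simp only [h.pval_fdiv hd hT, mul_comm] at e1 ⊢
      linarith)
  intro a b hab
  refine eq_zero_of_ae_eq_zero_facet (S a.1) hd a.2
    ((continuous_normalTr _ _ _).add (continuous_normalTr _ _ _)) ?_
  rw [ae_restrict_iff' (isCompact_facet _ _).measurableSet]
  filter_upwards [h1, hT.ae_mem_interior_of_sideAdj hd hab, hT.ae_eq_or_eq_of_mem hd hab]
    with x hx hx1 hx2 hxa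
  have h3 := hx (hx1 hxa)
  rw [← Finset.sum_subset (Finset.subset_univ {a, b}), Finset.sum_pair hab.1,
    Set.indicator_of_mem (show x ∈ side S a from hxa),
    Set.indicator_of_mem (show x ∈ side S b from hab.2 ▸ hxa)] at h3
  · exact h3
  · intro c _ hc
    refine Set.indicator_of_notMem (fun hxc => hc ?_) _
    rcases hx2 hxa c hxc with rfl | rfl <;> simp

end Fields

end SFWG

end

noncomputable section

namespace SFWG

/-! ### Elements and faces of a mesh -/

section MeshFaces

variable {d : ℕ} {M : Mesh d} {Ω : Set (Space d)}

/-- The side `a` of a sub-simplex of `T` is part of the face `e` of `T`. -/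
def OnFace (M : Mesh d) (T : Fin M.nT) (e : Fin M.nE) (a : Fin (M.nS T) × Fin (d + 1)) : Prop :=
  M.IsFaceOf e T ∧ side (M.sub T) a ⊆ M.face e

lemma isCompact_elt (T : Fin M.nT) : IsCompact (M.elt T) := isCompact_tunion (S := M.sub T)

lemma triang (hM : M.IsMeshOf Ω) (T : Fin M.nT) : Triang (M.sub T) :=
  ⟨hM.sub_injective T, hM.sub_conforming T, hM.sub_connected T⟩

lemma diam_elt_pos (hd : 0 < d) (hM : M.IsMeshOf Ω) (T : Fin M.nT) :
    0 < Metric.diam (M.elt T) := by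
  have i : Fin (M.nS T) := ⟨0, hM.nS_pos T⟩
  have hmem : ∀ l, (M.sub T i).points l ∈ M.elt T := fun l =>
    body_subset_tunion (S := M.sub T) i (points_mem_body _ l)
  have hne : (M.sub T i).points 0 ≠ (M.sub T i).points (Fin.last d) := fun h => by
    have := (M.sub T i).independent.injective h
    rw [Fin.ext_iff] at this
    simp at this
    omega
  exact (dist_pos.2 hne).trans_le
    (Metric.dist_le_diam_of_mem (isCompact_elt T).isBounded (hmem _) (hmem _))

lemma shapeReg (hd : 0 < d) (hM : M.IsMeshOf Ω) {γ : ℝ} (hγ : M.ShapeRegular γ) (T : Fin M.nT) :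
    ShapeReg (M.sub T) γ (Metric.diam (M.elt T)) :=
  ⟨diam_elt_pos hd hM T, fun x hx y hy => by
    rw [← dist_eq_norm]
    exact Metric.dist_le_diam_of_mem (isCompact_elt T).isBounded hx hy, hγ T⟩

lemma OnFace.unmatched (hd : 0 < d) (hM : M.IsMeshOf Ω) {T : Fin M.nT} {e : Fin M.nE}
    {a : Fin (M.nS T) × Fin (d + 1)} (h : OnFace M T e a) : Unmatched (M.sub T) a :=
  (triang hM T).forall_not_sideAdj_of_subset_frontier hd (h.2.trans h.1)

lemma exists_onFace (hd : 0 < d) (hM : M.IsMeshOf Ω) {T : Fin M.nT}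
    {a : Fin (M.nS T) × Fin (d + 1)} (h : Unmatched (M.sub T) a) : ∃ e, OnFace M T e a :=
  hM.subface_subset T a.1 a.2 ((triang hM T).side_subset_frontier hd h)

lemma surf_facet_pos (hd : 0 < d) (S : Affine.Simplex ℝ (Space d) d) (l : Fin (d + 1)) :
    0 < surf d (facet S l) := by
  have := surf_inter_facet_pos S hd l isOpen_univ
    (by rw [Set.univ_inter]; exact (relFacet_nonempty S hd l).mono (relFacet_subset S l))
  rwa [Set.univ_inter] at this

/-- Different faces meet in a null set, which cannot contain a side. -/
lemma OnFace.unique (hd : 0 < d) (hM : M.IsMeshOf Ω) {T : Fin M.nT} {e e' : Fin M.nE}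
    {a : Fin (M.nS T) × Fin (d + 1)} (h : OnFace M T e a) (h' : OnFace M T e' a) : e = e' := by
  by_contra hne
  exact (surf_facet_pos hd (M.sub T a.1) a.2).ne'
    (measure_mono_null (Set.subset_inter h.2 h'.2) (hM.face_inter e e' hne))

lemma face_eq_iUnion (hM : M.IsMeshOf Ω) {T : Fin M.nT} {e : Fin M.nE} (h : M.IsFaceOf e T) :
    M.face e = ⋃ a : {a // OnFace M T e a}, side (M.sub T) a.1 := by
  refine Set.Subset.antisymm (fun x hx => ?_) (Set.iUnion_subset fun a => a.2.2)
  rw [hM.face_eq T e h] at hx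
  simp only [Set.mem_iUnion] at hx ⊢
  obtain ⟨i, l, hil, hx⟩ := hx
  exact ⟨⟨(i, l), h, hil⟩, hx⟩

lemma isCompact_face (hM : M.IsMeshOf Ω) (e : Fin M.nE) : IsCompact (M.face e) := by
  obtain ⟨T, hT⟩ := hM.exists_isFaceOf e
  rw [face_eq_iUnion hM hT]
  exact isCompact_iUnion fun a => isCompact_facet _ _

lemma surf_face_lt_top (hd : 0 < d) (hM : M.IsMeshOf Ω) (e : Fin M.nE) :
    surf d (M.face e) < ⊤ := by
  classical
  obtain ⟨T, hT⟩ := hM.exists_isFaceOf e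
  rw [face_eq_iUnion hM hT]
  exact (measure_iUnion_fintype_le _ _).trans_lt
    (ENNReal.sum_lt_top.2 fun a _ => (surf_facet_ne_top _ hd _).lt_top)

lemma Triang.ae_disjoint_side {n : ℕ} {S : Fin n → Affine.Simplex ℝ (Space d) d} (hT : Triang S)
    (hd : 0 < d) {a b : Fin n × Fin (d + 1)} (ha : Unmatched S a) (hab : a ≠ b) :
    AEDisjoint (surf d) (side S a) (side S b) := by
  have h : ∀ᵐ x ∂(surf d), x ∉ side S a ∩ side S b := by
    filter_upwards [ae_mem_relFacet_of_mem hd S] with x hx hxx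
    by_cases h1 : a.1 = b.1
    · obtain ⟨i, l⟩ := a
      obtain ⟨j, m⟩ := b
      obtain rfl : i = j := h1
      have hlm : l ≠ m := fun h => hab (by rw [h])
      have h2 := hx _ hxx.1
      have h3 := ((mem_facet _).1 hxx.2).2
      exact (h2.2 m hlm.symm).ne' h3
    · obtain ⟨m, hm⟩ := hT.exists_sideAdj h1 (hx a hxx.1) (facet_subset_body _ _ hxx.2)
      exact ha _ hm
  have h2 := ae_iff.1 h
  simpa [AEDisjoint] using h2

open scoped Classical in
lemma integral_face (hd : 0 < d) (hM : M.IsMeshOf Ω) {T : Fin M.nT} {e : Fin M.nE}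
    (h : M.IsFaceOf e T) {f : Space d → ℝ} (hf : IntegrableOn f (M.face e) (surf d)) :
    ∫ x in M.face e, f x ∂(surf d) =
      ∑ a with OnFace M T e a, ∫ x in side (M.sub T) a, f x ∂(surf d) := by
  rw [face_eq_iUnion hM h] at hf ⊢
  rw [integral_iUnion_ae (fun a => (isCompact_facet _ _).measurableSet.nullMeasurableSet)
    (fun a b hab => (triang hM T).ae_disjoint_side hd (a.2.unmatched hd hM)
      fun h' => hab (Subtype.ext h')) hf, tsum_fintype]
  exact (Finset.sum_subtype (Finset.univ.filter (OnFace M T e)) (fun a => by simp)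
    fun a => ∫ x in side (M.sub T) a, f x ∂(surf d)).symm

lemma memLp_face (hd : 0 < d) (hM : M.IsMeshOf Ω) (e : Fin M.nE) {φ : Space d → ℝ}
    (hφ : Continuous φ) : MemLp φ 2 ((surf d).restrict (M.face e)) :=
  memLp_of_continuous_of_isCompact (isCompact_face hM e) (surf_face_lt_top hd hM e).ne hφ

/-! ### The spaces of fields on elements -/

/-- The condition on the distributional divergence is replaced by pointwise ones: the divergences on
the simplices are one polynomial, and the normal components cancel across matched sides. Linearity
is then visible, and the liftings can be recognized as admissible fields. -/
lemma memLambda_iff (hd : 0 < d) (hM : M.IsMeshOf Ω) {k : ℕ} {T : Fin M.nT} {q : M.PwField T} :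
    M.MemLambda k T q ↔ (∀ i j, (q i j).totalDegree ≤ k + 1) ∧
      (∃ p : Poly d, p.totalDegree ≤ k ∧ ∀ i, fdiv (q i) = p) ∧ DivConf (M.sub T) q ∧
      ∀ e, ∃ r : Poly d, r.totalDegree ≤ k + 1 ∧ ∀ a, OnFace M T e a → ∀ x ∈ side (M.sub T) a,
        normalTr (M.sub T a.1) a.2 (q a.1) x = pval r x := by
  have hT := triang hM T
  constructor
  · rintro ⟨h1, ⟨p, hp, h2⟩, h3⟩
    have h2' : HasPolyDiv (M.sub T) q p := h2
    refine ⟨h1, ⟨p, hp, h2'.pval_fdiv hd hT⟩, h2'.divConf hd hT, fun e => ?_⟩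
    by_cases he : M.IsFaceOf e T
    · obtain ⟨r, hr, h⟩ := h3 e he
      exact ⟨r, hr, fun a ha => h a.1 a.2 ha.2⟩
    · exact ⟨0, by simp, fun a ha => absurd ha.1 he⟩
  · rintro ⟨h1, ⟨p, hp, h2⟩, h3, h4⟩
    refine ⟨h1, ⟨p, hp, h3.hasPolyDiv hd hT fun i x => by rw [h2 i]⟩, fun e he => ?_⟩
    obtain ⟨r, hr, h⟩ := h4 e
    exact ⟨r, hr, fun i l hil => h (i, l) ⟨he, hil⟩⟩

/-- The space of admissible fields on `T`. -/
def lambdaSpace (hd : 0 < d) (hM : M.IsMeshOf Ω) (k : ℕ) (T : Fin M.nT) :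
    Submodule ℝ (M.PwField T) where
  carrier := {q | M.MemLambda k T q}
  zero_mem' := (memLambda_iff hd hM).2 ⟨fun i j => by simp, ⟨0, by simp, fun i => fdiv_zero⟩,
    fun a b _ x _ => by simp [normalTr], fun e => ⟨0, by simp, fun a _ x _ => by simp [normalTr]⟩⟩
  add_mem' := by
    intro q q' hq hq'
    obtain ⟨h1, ⟨p, hp, h2⟩, h3, h4⟩ := (memLambda_iff hd hM).1 hq
    obtain ⟨h1', ⟨p', hp', h2'⟩, h3', h4'⟩ := (memLambda_iff hd hM).1 hq'
    refine (memLambda_iff hd hM).2 ⟨fun i j => (MvPolynomial.totalDegree_add _ _).trans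
      (max_le (h1 i j) (h1' i j)), ⟨p + p', (MvPolynomial.totalDegree_add _ _).trans
      (max_le hp hp'), fun i => ?_⟩, fun a b hab x hx => ?_, fun e => ?_⟩
    · rw [Pi.add_apply, fdiv_add, h2, h2']
    · have e1 := h3 a b hab x hx
      have e2 := h3' a b hab x hx
      rw [Pi.add_apply, Pi.add_apply, normalTr_add, normalTr_add]
      linarith
    · obtain ⟨r, hr, h⟩ := h4 e
      obtain ⟨r', hr', h'⟩ := h4' e
      refine ⟨r + r', (MvPolynomial.totalDegree_add _ _).trans (max_le hr hr'),
        fun a ha x hx => ?_⟩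
      rw [Pi.add_apply, normalTr_add, pval_add, h a ha x hx, h' a ha x hx]
  smul_mem' := by
    intro c q hq
    obtain ⟨h1, ⟨p, hp, h2⟩, h3, h4⟩ := (memLambda_iff hd hM).1 hq
    refine (memLambda_iff hd hM).2 ⟨fun i j => (MvPolynomial.totalDegree_smul_le _ _).trans
      (h1 i j), ⟨c • p, (MvPolynomial.totalDegree_smul_le _ _).trans hp, fun i => ?_⟩,
      fun a b hab x hx => ?_, fun e => ?_⟩
    · rw [Pi.smul_apply, fdiv_smul, h2]
    · rw [Pi.smul_apply, Pi.smul_apply, normalTr_smul, normalTr_smul, ← mul_add, h3 a b hab x hx,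
        mul_zero]
    · obtain ⟨r, hr, h⟩ := h4 e
      refine ⟨c • r, (MvPolynomial.totalDegree_smul_le _ _).trans hr, fun a ha x hx => ?_⟩
      rw [Pi.smul_apply, normalTr_smul, pval_smul, h a ha x hx]

lemma finiteDimensional_lambdaSpace (hd : 0 < d) (hM : M.IsMeshOf Ω) (k : ℕ) (T : Fin M.nT) :
    FiniteDimensional ℝ (lambdaSpace hd hM k T) := by
  let f : lambdaSpace hd hM k T →ₗ[ℝ]
      (Fin (M.nS T) → Fin d → MvPolynomial.restrictTotalDegree (Fin d) ℝ (k + 1)) :=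
    { toFun := fun q i j => ⟨q.1 i j, (MvPolynomial.mem_restrictTotalDegree _ _ _).2 (q.2.1 i j)⟩
      map_add' := fun _ _ => rfl
      map_smul' := fun _ _ => rfl }
  refine Module.Finite.of_injective f fun q q' h => Subtype.ext ?_
  funext i j
  exact congrArg Subtype.val (congrFun (congrFun h i) j)

lemma innerT_eq {T : Fin M.nT} (p q : M.PwField T) :
    M.innerT p q = ∑ i, ∑ j, ∫ x in body (M.sub T i), pval (p i j) x * pval (q i j) x :=
  Finset.sum_congr rfl fun _ _ => integral_finsetSum _ fun _ _ =>
    integrableOn_body_mul _ (continuous_pval _) (continuous_pval _)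

lemma innerT_comm {T : Fin M.nT} (p q : M.PwField T) : M.innerT p q = M.innerT q p := by
  simp only [innerT_eq, mul_comm]

lemma innerT_add {T : Fin M.nT} (p q q' : M.PwField T) :
    M.innerT p (q + q') = M.innerT p q + M.innerT p q' := by
  simp only [innerT_eq, ← Finset.sum_add_distrib]
  refine Finset.sum_congr rfl fun _ _ => Finset.sum_congr rfl fun _ _ => ?_
  rw [← integral_add (integrableOn_body_mul _ (continuous_pval _) (continuous_pval _))
    (integrableOn_body_mul _ (continuous_pval _) (continuous_pval _))]
  simp only [Pi.add_apply, pval_add, mul_add]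

lemma innerT_smul {T : Fin M.nT} (c : ℝ) (p q : M.PwField T) :
    M.innerT p (c • q) = c * M.innerT p q := by
  simp only [innerT_eq, Finset.mul_sum]
  refine Finset.sum_congr rfl fun i _ => Finset.sum_congr rfl fun j _ => ?_
  rw [← integral_const_mul]
  simp only [Pi.smul_apply, pval_smul, mul_left_comm]

lemma eq_zero_of_innerT_self {T : Fin M.nT} {q : M.PwField T} (h : M.innerT q q = 0) : q = 0 := by
  rw [innerT_eq, Finset.sum_eq_zero_iff_of_nonneg fun i _ => Finset.sum_nonneg fun j _ =>
    integral_nonneg fun x => mul_self_nonneg _] at h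
  funext i j
  have h1 := (Finset.sum_eq_zero_iff_of_nonneg fun j _ =>
    integral_nonneg fun x => mul_self_nonneg _).1 (h i (Finset.mem_univ _)) j (Finset.mem_univ _)
  have h2 := (integral_eq_zero_iff_of_nonneg (fun x => mul_self_nonneg _)
    (integrableOn_body_mul (M.sub T i) (continuous_pval (q i j)) (continuous_pval _))).1 h1
  have hc := continuous_pval (q i j)
  have h3 := Measure.eqOn_open_of_ae_eq (ae_restrict_of_ae_restrict_of_subset
    (interior_subset (s := body (M.sub T i))) h2) isOpen_interior (hc.mul hc).continuousOn
    continuousOn_const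
  refine eq_of_pval_eq (M.sub T i) fun x hx => ?_
  have h4 := h3 hx
  simpa using h4

/-- The right-hand side in the definition of the weak gradient. -/
def weakRhs (M : Mesh d) (v : M.WGFun) {T : Fin M.nT} (q : M.PwField T) : ℝ :=
  -(∑ i, ∫ x in body (M.sub T i), pval (v.1 T) x * pval (fdiv (q i)) x) + M.boundaryT v q

open scoped Classical in
lemma boundaryT_eq (v : M.WGFun) {T : Fin M.nT} (q : M.PwField T) :
    M.boundaryT v q = ∑ e, ∑ a with OnFace M T e a, ∫ x in side (M.sub T) a,
      pval (v.2 e) x * normalTr (M.sub T a.1) a.2 (q a.1) x ∂(surf d) := by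
  rw [Mesh.boundaryT, Finset.sum_filter]
  refine Finset.sum_congr rfl fun e _ => ?_
  split_ifs with h
  · simp only [Finset.sum_filter]
    rw [← Fintype.sum_prod_type']
    refine Finset.sum_congr rfl fun a _ => ?_
    simp only [OnFace, h, true_and]
    rfl
  · rw [Finset.sum_eq_zero]
    exact fun a ha => absurd (Finset.mem_filter.1 ha).2.1 h

lemma weakRhs_add (hd : 0 < d) (v : M.WGFun) {T : Fin M.nT} (q q' : M.PwField T) :
    weakRhs M v (q + q') = weakRhs M v q + weakRhs M v q' := by
  simp only [weakRhs, boundaryT_eq, Pi.add_apply, fdiv_add, pval_add, normalTr_add, mul_add]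
  simp only [integral_add (integrableOn_body_mul _ (continuous_pval _) (continuous_pval _))
    (integrableOn_body_mul _ (continuous_pval _) (continuous_pval _)),
    integral_add (integrableOn_facet_mul hd _ _ (continuous_pval _) (continuous_normalTr _ _ _))
    (integrableOn_facet_mul hd _ _ (continuous_pval _) (continuous_normalTr _ _ _)),
    Finset.sum_add_distrib]
  ring

lemma weakRhs_smul (v : M.WGFun) {T : Fin M.nT} (c : ℝ) (q : M.PwField T) :
    weakRhs M v (c • q) = c * weakRhs M v q := by
  simp only [weakRhs, boundaryT_eq, Pi.smul_apply, fdiv_smul, pval_smul, normalTr_smul,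
    mul_left_comm _ c, integral_const_mul, ← Finset.mul_sum]
  ring

lemma weakRhs_sub (hd : 0 < d) (v v' : M.WGFun) {T : Fin M.nT} (q : M.PwField T) :
    weakRhs M (v - v') q = weakRhs M v q - weakRhs M v' q := by
  simp only [weakRhs, boundaryT_eq, Prod.fst_sub, Prod.snd_sub, Pi.sub_apply, pval_sub, sub_mul]
  simp only [integral_sub (integrableOn_body_mul _ (continuous_pval _) (continuous_pval _))
    (integrableOn_body_mul _ (continuous_pval _) (continuous_pval _)),
    integral_sub (integrableOn_facet_mul hd _ _ (continuous_pval _) (continuous_normalTr _ _ _))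
    (integrableOn_facet_mul hd _ _ (continuous_pval _) (continuous_normalTr _ _ _)),
    Finset.sum_sub_distrib]
  ring

/-- The product of `L²` is definite on the finite-dimensional space of admissible fields, so Riesz
representation yields a weak gradient, and the choice made in the definition is one. -/
theorem isWeakGrad_weakGrad (hd : 0 < d) (hM : M.IsMeshOf Ω) (k : ℕ) (v : M.WGFun)
    (T : Fin M.nT) : M.IsWeakGrad k v T (M.weakGrad k v T) := by
  have := finiteDimensional_lambdaSpace hd hM k T
  let ℓ : lambdaSpace hd hM k T →ₗ[ℝ] ℝ :=
    { toFun := fun q => weakRhs M v q.1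
      map_add' := fun q q' => weakRhs_add hd v _ _
      map_smul' := fun c q => weakRhs_smul v c _ }
  let B : lambdaSpace hd hM k T →ₗ[ℝ] lambdaSpace hd hM k T →ₗ[ℝ] ℝ := LinearMap.mk₂ ℝ
    (fun p q => M.innerT p.1 q.1)
    (fun p p' q => by simp only [innerT_comm _ q.1, Submodule.coe_add, innerT_add])
    (fun c p q => by
      simp only [innerT_comm _ q.1, Submodule.coe_smul, innerT_smul, smul_eq_mul])
    (fun p q q' => innerT_add _ _ _)
    (fun c p q => innerT_smul _ _ _)
  obtain ⟨g, hg⟩ := exists_representative B (fun p q => innerT_comm _ _) ℓ (fun q hq => by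
    have h1 : q = 0 := Subtype.ext (eq_zero_of_innerT_self (hq q))
    rw [h1, map_zero])
  exact Classical.epsilon_spec (p := M.IsWeakGrad k v T)
    ⟨g.1, g.2, fun q hq => hg ⟨q, hq⟩⟩

lemma innerT_weakGrad (hd : 0 < d) (hM : M.IsMeshOf Ω) (k : ℕ) (v : M.WGFun)
    (T : Fin M.nT) {q : M.PwField T} (hq : M.MemLambda k T q) :
    M.innerT (M.weakGrad k v T) q = weakRhs M v q :=
  (isWeakGrad_weakGrad hd hM k v T).2 q hq

end MeshFaces

end SFWG

end

noncomputable section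

namespace SFWG

/-! ### The elements and faces in the domain -/

section MeshDomain

variable {d : ℕ} {M : Mesh d} {Ω : Set (Space d)}

lemma isOpen_domain (hM : M.IsMeshOf Ω) : IsOpen Ω := by
  rw [← hM.domain_eq]; exact isOpen_interior

lemma interior_elt_subset (hM : M.IsMeshOf Ω) (T : Fin M.nT) : interior (M.elt T) ⊆ Ω := by
  rw [← hM.domain_eq]; exact interior_mono (Set.subset_iUnion _ T)

/-- A closed element may touch the boundary of the domain, but its frontier is null. -/
lemma elt_ae_le (hM : M.IsMeshOf Ω) (T : Fin M.nT) : M.elt T ≤ᵐ[volume] Ω :=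
  (Triang.interior_tunion_ae_eq (S := M.sub T)).symm.le.trans (interior_elt_subset hM T).eventuallyLE

lemma domain_ae_eq (hM : M.IsMeshOf Ω) : Ω =ᵐ[volume] ⋃ T, M.elt T := by
  have h1 : ∀ᵐ x, ∀ T, x ∈ M.elt T → x ∈ Ω := ae_all_iff.2 fun T => elt_ae_le hM T
  filter_upwards [h1] with x hx
  refine propext ⟨fun h => ?_, fun h => ?_⟩
  · have h2 : x ∈ interior (⋃ T, M.elt T) := hM.domain_eq.symm ▸ h
    have h3 : x ∈ ⋃ T, M.elt T := interior_subset h2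
    exact h3
  · obtain ⟨T, hT⟩ := Set.mem_iUnion.1 h
    exact hx T hT

lemma ae_disjoint_elt (hM : M.IsMeshOf Ω) {T T' : Fin M.nT} (h : T ≠ T') :
    AEDisjoint volume (M.elt T) (M.elt T') :=
  (hM.disjoint_interior T T' h).aedisjoint.congr (Triang.interior_tunion_ae_eq (S := M.sub T)).symm
    (Triang.interior_tunion_ae_eq (S := M.sub T')).symm

lemma integral_domain (hM : M.IsMeshOf Ω) {f : Space d → ℝ} (hf : IntegrableOn f Ω) :
    ∫ x in Ω, f x = ∑ T, ∫ x in M.elt T, f x := by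
  rw [setIntegral_congr_set (domain_ae_eq hM), integral_iUnion_ae
    (fun T => (isCompact_elt T).measurableSet.nullMeasurableSet)
    (fun _ _ h => ae_disjoint_elt hM h) (hf.congr_set_ae (domain_ae_eq hM).symm), tsum_fintype]

lemma integral_domain_bodies (hM : M.IsMeshOf Ω) {f : Space d → ℝ} (hf : IntegrableOn f Ω) :
    ∫ x in Ω, f x = ∑ T, ∑ i, ∫ x in body (M.sub T i), f x := by
  rw [integral_domain hM hf]
  exact Finset.sum_congr rfl fun T _ => (triang hM T).integral_tunion
    (Integrable.mono_measure hf (Measure.restrict_mono_ae (elt_ae_le hM T)))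

lemma disjoint_interior_elt (hM : M.IsMeshOf Ω) {T T' : Fin M.nT} (h : T ≠ T') :
    Disjoint (interior (M.elt T)) (M.elt T') := by
  refine ((hM.disjoint_interior T T' h).closure_right isOpen_interior).mono_right ?_
  refine Set.iUnion_subset fun i => (body_subset_closure_interior (M.sub T' i)).trans ?_
  exact closure_mono (interior_mono (body_subset_tunion (S := M.sub _) i))

/-- For almost all points of a face, the sides that contain the point are parts of this face. -/
lemma ae_onFace (hd : 0 < d) (hM : M.IsMeshOf Ω) (e : Fin M.nE) :
    ∀ᵐ x ∂(surf d), x ∈ M.face e → ∀ T a, x ∈ side (M.sub T) a → OnFace M T e a := by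
  obtain ⟨T₀, he⟩ := hM.exists_isFaceOf e
  have h1 : ∀ᵐ x ∂(surf d), ∀ e', e ≠ e' → x ∉ M.face e ∩ M.face e' :=
    ae_all_iff.2 fun e' => by
      by_cases h : e = e'
      · simp [h]
      · have := measure_eq_zero_iff_ae_notMem.1 (hM.face_inter e e' h)
        filter_upwards [this] with x hx _ using hx
  have h2 : ∀ᵐ x ∂(surf d), ∀ T, ∀ a, x ∈ side (M.sub T) a →
      x ∈ relFacet (M.sub T a.1) a.2 := ae_all_iff.2 fun T => ae_mem_relFacet_of_mem hd _
  filter_upwards [h1, h2] with x hx1 hx2 hxe T a hxa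
  -- A matched side would put `x` into the interior of its element. If that element is `T₀`, this
  -- contradicts that `x` is on the frontier of `T₀`; otherwise it contradicts that interiors of
  -- other elements do not meet `T₀`.
  have hun : Unmatched (M.sub T) a := fun b hab => by
    have hint := (triang hM T).mem_interior_of_sideAdj hd hab (hx2 T _ hxa)
      (hx2 T b (hab.2 ▸ hxa))
    by_cases hTT : T = T₀
    · subst hTT
      exact (he hxe).2 hint
    · exact Set.disjoint_left.1 (disjoint_interior_elt hM hTT) hint
        ((isCompact_elt T₀).isClosed.frontier_subset (he hxe))
  obtain ⟨e', he'⟩ := exists_onFace hd hM hun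
  by_cases hee : e = e'
  · exact hee ▸ he'
  · exact absurd ⟨hxe, he'.2 hxa⟩ (hx1 _ hee)

/-- For almost all points of a face, an element that contains the point has this face. -/
lemma ae_isFaceOf (hd : 0 < d) (hM : M.IsMeshOf Ω) {e : Fin M.nE} {T : Fin M.nT}
    (he : M.IsFaceOf e T) :
    ∀ᵐ x ∂(surf d), x ∈ M.face e → ∀ T', x ∈ M.elt T' → M.IsFaceOf e T' := by
  filter_upwards [ae_onFace hd hM e] with x hx hxe T' hxT'
  by_cases hTT : T' = T
  · exact hTT ▸ he
  obtain ⟨i, hi⟩ := Set.mem_iUnion.1 hxT'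
  have hnb : x ∉ interior (body (M.sub T' i)) := fun h =>
    Set.disjoint_left.1 (disjoint_interior_elt hM hTT)
      (interior_mono (body_subset_tunion (S := M.sub T') i) h)
      ((isCompact_elt T).isClosed.frontier_subset (he hxe))
  rw [mem_interior_body] at hnb
  push Not at hnb
  obtain ⟨l, hl⟩ := hnb
  have h0 := (mem_body _).1 hi
  exact (hx hxe T' (i, l) ((mem_facet _).2 ⟨h0, le_antisymm hl (h0 l)⟩)).1

/-- At almost every point of a face common to two elements, two non-overlapping simplices have faces
in the same hyperplane. They lie on different sides of it and together cover a neighbourhood. -/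
lemma ae_mem_domain_of_ne (hd : 0 < d) (hM : M.IsMeshOf Ω) {e : Fin M.nE} {T T' : Fin M.nT}
    (hTT : T ≠ T') (he : M.IsFaceOf e T) (he' : M.IsFaceOf e T') :
    ∀ᵐ x ∂(surf d), x ∈ M.face e → x ∈ Ω := by
  obtain ⟨n, c, hn, hc⟩ := hM.face_flat e
  filter_upwards [ae_mem_relFacet_of_mem hd (M.sub T), ae_mem_relFacet_of_mem hd (M.sub T')]
    with x h1 h2 hx
  have hx1 := hx
  have hx2 := hx
  rw [face_eq_iUnion hM he] at hx1
  rw [face_eq_iUnion hM he'] at hx2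
  obtain ⟨a, ha⟩ := Set.mem_iUnion.1 hx1
  obtain ⟨b, hb⟩ := Set.mem_iUnion.1 hx2
  have hdisj : Disjoint (interior (body (M.sub T a.1.1))) (interior (body (M.sub T' b.1.1))) :=
    (hM.disjoint_interior T T' hTT).mono (interior_mono (body_subset_tunion (S := M.sub T) _))
      (interior_mono (body_subset_tunion (S := M.sub T') _))
  have h3 := (opposite_normals hd hdisj hn (fun y hy => hc y (a.2.2 hy))
    (fun y hy => hc y (b.2.2 hy)) (h1 _ ha) (h2 _ hb)).2
  rw [← hM.domain_eq]
  refine interior_mono (Set.union_subset ?_ ?_) h3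
  · exact (body_subset_tunion (S := M.sub T) _).trans (Set.subset_iUnion M.elt T)
  · exact (body_subset_tunion (S := M.sub T') _).trans (Set.subset_iUnion M.elt T')

/-- Almost every point of the face lies in no other element. If such a point were in the open
domain, a neighbourhood of it would lie in `T`, although it is on the frontier of `T`. The
exceptional points are excluded because relatively open parts of a face have positive measure. -/
lemma face_subset_frontier_of_unique (hd : 0 < d) (hM : M.IsMeshOf Ω) {e : Fin M.nE}
    {T : Fin M.nT} (he : M.IsFaceOf e T) (huniq : ∀ T', M.IsFaceOf e T' → T' = T) :
    M.face e ⊆ frontier Ω := by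
  have hae : ∀ᵐ x ∂(surf d), x ∈ M.face e → x ∉ Ω := by
    filter_upwards [ae_isFaceOf hd hM he] with x hx hxe hxΩ
    have h1 : x ∉ ⋃ T' : {T' // T' ≠ T}, M.elt T'.1 := fun h => by
      obtain ⟨T', hT'⟩ := Set.mem_iUnion.1 h
      exact T'.2 (huniq _ (hx hxe _ hT'))
    have hcl : IsClosed (⋃ T' : {T' // T' ≠ T}, M.elt T'.1) :=
      isClosed_iUnion_of_finite fun T' => (isCompact_elt _).isClosed
    have h2 : Ω ∩ (⋃ T' : {T' // T' ≠ T}, M.elt T'.1)ᶜ ⊆ M.elt T := by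
      rintro y ⟨hy, hyn⟩
      rw [← hM.domain_eq] at hy
      obtain ⟨T', hT'⟩ := Set.mem_iUnion.1 (interior_subset hy)
      by_cases h : T' = T
      · exact h ▸ hT'
      · exact absurd (Set.mem_iUnion.2 ⟨⟨T', h⟩, hT'⟩) hyn
    exact (he hxe).2 (interior_maximal h2 ((isOpen_domain hM).inter hcl.isOpen_compl) ⟨hxΩ, h1⟩)
  intro x hxe
  refine ⟨?_, fun hxΩ => ?_⟩
  · have h3 : x ∈ M.elt T := (isCompact_elt T).isClosed.frontier_subset (he hxe)
    obtain ⟨i, hi⟩ := Set.mem_iUnion.1 h3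
    exact closure_mono ((interior_mono (body_subset_tunion (S := M.sub T) i)).trans
      (interior_elt_subset hM T)) (body_subset_closure_interior _ hi)
  · rw [(isOpen_domain hM).interior_eq] at hxΩ
    have hx' := hxe
    rw [face_eq_iUnion hM he] at hx'
    obtain ⟨a, ha⟩ := Set.mem_iUnion.1 hx'
    have hpos := surf_inter_facet_pos (M.sub T a.1.1) hd a.1.2 (isOpen_domain hM) ⟨x, hxΩ, ha⟩
    refine hpos.ne' (measure_eq_zero_iff_ae_notMem.2 ?_)
    filter_upwards [hae] with y hy hyy
    exact hy (a.2.2 hyy.2) hyy.1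

lemma ae_mem_domain (hd : 0 < d) (hM : M.IsMeshOf Ω) {e : Fin M.nE}
    (he : ¬M.face e ⊆ frontier Ω) : ∀ᵐ x ∂(surf d), x ∈ M.face e → x ∈ Ω := by
  obtain ⟨T, hT⟩ := hM.exists_isFaceOf e
  by_cases h : ∀ T', M.IsFaceOf e T' → T' = T
  · exact absurd (face_subset_frontier_of_unique hd hM hT h) he
  · push Not at h
    obtain ⟨T', h1, h2⟩ := h
    exact ae_mem_domain_of_ne hd hM h2 h1 hT

end MeshDomain

end SFWG

end

noncomputable section

namespace SFWG

/-! ### Weak derivatives and traces on the domain -/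

section Domain

variable {d : ℕ}

lemma ae_eq_zero_of_test {U : Set (Space d)} (hU : IsOpen U) {g : Space d → ℝ}
    (hg : IntegrableOn g U) (h : ∀ χ, IsTest U χ → ∫ x in U, g x * χ x = 0) :
    ∀ᵐ x ∂(volume.restrict U), g x = 0 := by
  refine (ae_restrict_iff' hU.measurableSet).2
    (hU.ae_eq_zero_of_integral_contDiff_smul_eq_zero hg.locallyIntegrableOn
      fun χ h1 h2 h3 => ?_)
  rw [← h χ ⟨h1, h2, h3⟩, ← setIntegral_eq_integral_of_forall_compl_eq_zero (s := U)]
  · simp only [smul_eq_mul, mul_comm]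
  · exact fun x hx => by rw [IsTest.eq_zero (U := U) ⟨h1, h2, h3⟩ hx, zero_smul]

lemma memLp_of_ae_eq {U K : Set (Space d)} (hK : IsCompact K) (hUK : U =ᵐ[volume] K)
    {φ : Space d → ℝ} (hφ : Continuous φ) : MemLp φ 2 (volume.restrict U) := by
  rw [Measure.restrict_congr_set hUK]
  exact memLp_of_continuous_of_isCompact hK hK.measure_lt_top.ne hφ

lemma TendstoH1.hasWeakPartial {U K : Set (Space d)} (hK : IsCompact K) (hUK : U =ᵐ[volume] K)
    {φ : ℕ → Space d → ℝ} {w : Space d → ℝ} {G : Fin d → Space d → ℝ}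
    (hφ : ∀ n, ContDiff ℝ ∞ (φ n)) (h : TendstoH1 U φ w G) (j : Fin d) :
    HasWeakPartial U j w (G j) := by
  intro χ hχ
  have hm : ∀ {ψ : Space d → ℝ}, Continuous ψ → MemLp ψ 2 (volume.restrict U) :=
    memLp_of_ae_eq hK hUK
  have h1 := (tendsto_eLpNorm_zero_iff fun n => (hm (hφ n).continuous).sub h.1).1 h.2.2.1
  have h2 := (tendsto_eLpNorm_zero_iff fun n =>
    (hm (continuous_partialD (hφ n) j)).sub (h.2.1 j)).1 (h.2.2.2 j)
  have t1 := tendsto_integral_mul_const (fun n => hm (hφ n).continuous) h.1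
    (hm (continuous_partialD hχ.1 j)) h1
  have t2 := tendsto_integral_mul_const (fun n => hm (continuous_partialD (hφ n) j)) (h.2.1 j)
    (hm hχ.1.continuous) h2
  refine tendsto_nhds_unique t1 (t2.neg.congr fun n => ?_)
  exact (hasWeakPartial_of_contDiff U (hφ n) j χ hχ).symm

lemma IntegrableOn.of_memLp_two {U K : Set (Space d)} (hK : IsCompact K) (hUK : U =ᵐ[volume] K)
    {g : Space d → ℝ} (hg : MemLp g 2 (volume.restrict U)) : IntegrableOn g U := by
  have : IsFiniteMeasure (volume.restrict U) := by
    rw [Measure.restrict_congr_set hUK]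
    exact ⟨by simpa using hK.measure_lt_top⟩
  exact hg.integrable (by norm_num)

/-- Uniqueness of weak derivatives; it identifies gradients that arise as limits with those given by
`HasWeakDerivs`. -/
lemma HasWeakPartial.ae_eq {U K : Set (Space d)} (hU : IsOpen U) (hK : IsCompact K)
    (hUK : U =ᵐ[volume] K) {j : Fin d} {w w' g g' : Space d → ℝ}
    (hw : w =ᵐ[volume.restrict U] w') (hg : MemLp g 2 (volume.restrict U))
    (hg' : MemLp g' 2 (volume.restrict U)) (h : HasWeakPartial U j w g)
    (h' : HasWeakPartial U j w' g') : g =ᵐ[volume.restrict U] g' := by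
  have h1 := ae_eq_zero_of_test hU (IntegrableOn.of_memLp_two hK hUK (hg.sub hg')) fun χ hχ => by
    have hm : MemLp χ 2 (volume.restrict U) := memLp_of_ae_eq hK hUK hχ.1.continuous
    simp only [Pi.sub_apply, sub_mul]
    rw [integral_sub (integrable_mul_of_memLp hg hm) (integrable_mul_of_memLp hg' hm)]
    have e1 := h χ hχ
    have e2 := h' χ hχ
    have e3 : ∫ x in U, w x * partialD j χ x = ∫ x in U, w' x * partialD j χ x :=
      integral_congr_ae (by filter_upwards [hw] with x hx; rw [hx])
    linarith
  filter_upwards [h1] with x hx using sub_eq_zero.1 hx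

lemma TendstoH1.congr_grad {U : Set (Space d)} {φ : ℕ → Space d → ℝ} {w : Space d → ℝ}
    {G G' : Fin d → Space d → ℝ} (h : TendstoH1 U φ w G)
    (hG : ∀ j, G j =ᵐ[volume.restrict U] G' j) : TendstoH1 U φ w G' := by
  refine ⟨h.1, fun j => (memLp_congr_ae (hG j)).1 (h.2.1 j), h.2.2.1, fun j => ?_⟩
  refine (h.2.2.2 j).congr fun n => eLpNorm_congr_ae ?_
  filter_upwards [hG j] with x hx
  rw [hx]

variable {M : Mesh d} {Ω : Set (Space d)}

lemma isCompact_iUnion_elt : IsCompact (⋃ T, M.elt T) := isCompact_iUnion isCompact_elt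

lemma weakH1_of_hasWeakDerivs (hM : M.IsMeshOf Ω) {m : ℕ} {u : Space d → ℝ}
    {D : (Fin d → ℕ) → Space d → ℝ} (hD : HasWeakDerivs Ω m u D) (T : Fin M.nT)
    {α : Fin d → ℕ} (hα : ∑ i, α i < m) :
    WeakH1 (M.sub T) (D α) fun i => D (α + Pi.single i 1) := by
  have hmono : volume.restrict (tunion (M.sub T)) ≤ volume.restrict Ω :=
    Measure.restrict_mono_ae (elt_ae_le hM T)
  refine ⟨(hD.2.1 α hα.le).mono_measure hmono, fun j => (hD.2.1 _ ?_).mono_measure hmono,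
    fun j => (hD.2.2 α hα j).mono (isOpen_domain hM).measurableSet (interior_elt_subset hM T)⟩
  simp only [Pi.add_apply, Finset.sum_add_distrib, Finset.sum_pi_single', Finset.mem_univ, if_true]
  omega

/-- Smooth functions that converge in `H¹(Ω)` converge on the faces. -/
lemma tendsto_face_sub (hd : 0 < d) (hM : M.IsMeshOf Ω) {φ ψ : ℕ → Space d → ℝ}
    {w : Space d → ℝ} {G G' : Fin d → Space d → ℝ} (hφ : ∀ n, ContDiff ℝ ∞ (φ n))
    (hψ : ∀ n, ContDiff ℝ ∞ (ψ n)) (h : TendstoH1 Ω φ w G) (h' : TendstoH1 Ω ψ w G')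
    (e : Fin M.nE) :
    Tendsto (fun p : ℕ × ℕ => ∫ x in M.face e, (φ p.1 x - ψ p.2 x) ^ 2 ∂(surf d))
      atTop (𝓝 0) := by
  classical
  -- The two limit gradients are weak gradients of the same function, hence equal almost everywhere.
  have h'' : TendstoH1 Ω ψ w G := h'.congr_grad fun j =>
    HasWeakPartial.ae_eq (isOpen_domain hM) isCompact_iUnion_elt (domain_ae_eq hM)
      (EventuallyEq.refl _ w) (h'.2.1 j) (h.2.1 j)
      (h'.hasWeakPartial isCompact_iUnion_elt (domain_ae_eq hM) hψ j)
      (h.hasWeakPartial isCompact_iUnion_elt (domain_ae_eq hM) hφ j)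
  obtain ⟨T, hT⟩ := hM.exists_isFaceOf e
  have hb : ∀ i, body (M.sub T i) ≤ᵐ[volume] Ω := fun i =>
    (body_subset_tunion (S := M.sub T) i).eventuallyLE.trans (elt_ae_le hM T)
  have h1 := tendsto_finsetSum (Finset.univ.filter (OnFace M T e)) fun a _ =>
    TendstoH1.tendsto_facet_sub (S := M.sub T a.1) hd hφ hψ (h.mono (hb a.1)) (h''.mono (hb a.1)) a.2
  rw [Finset.sum_const_zero] at h1
  refine h1.congr fun p => ?_
  rw [integral_face hd hM hT]
  exact ((memLp_face hd hM e (hφ p.1).continuous).sub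
    (memLp_face hd hM e (hψ p.2).continuous)).integrable_sq

/-- The trace is chosen with an unspecified approximating sequence. Any two smooth sequences with
the limit `w` in `H¹` are asymptotically equal on the face, so every such sequence converges to the
chosen trace. -/
lemma tendsto_trace (hd : 0 < d) (hM : M.IsMeshOf Ω) {φ : ℕ → Space d → ℝ}
    {w : Space d → ℝ} {G : Fin d → Space d → ℝ} (hφ : ∀ n, ContDiff ℝ ∞ (φ n))
    (h : TendstoH1 Ω φ w G) (e : Fin M.nE) :
    MemLp (trace Ω w (M.face e)) 2 ((surf d).restrict (M.face e)) ∧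
      Tendsto (fun n => ∫ x in M.face e, (φ n x - trace Ω w (M.face e) x) ^ 2 ∂(surf d))
        atTop (𝓝 0) := by
  have hm : ∀ {ψ : Space d → ℝ}, Continuous ψ → MemLp ψ 2 ((surf d).restrict (M.face e)) :=
    memLp_face hd hM e
  obtain ⟨g, hg, hgt⟩ := exists_tendsto_integral_sq (fun n => hm (hφ n).continuous)
    (tendsto_face_sub hd hM hφ hφ h h e)
  have hspec : IsTrace Ω w (M.face e) (trace Ω w (M.face e)) :=
    Classical.epsilon_spec (p := IsTrace Ω w (M.face e)) ⟨g, hg, φ, G, hφ, h,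
      (tendsto_eLpNorm_zero_iff fun n => (hm (hφ n).continuous).sub hg).2 hgt⟩
  obtain ⟨hmem, ψ, G', hψ, hψG, hψt⟩ := hspec
  refine ⟨hmem, ?_⟩
  have h1 := (tendsto_eLpNorm_zero_iff fun n => (hm (hψ n).continuous).sub hmem).1 hψt
  have hdiag : Tendsto (fun n : ℕ => (n, n)) atTop atTop := tendsto_atTop_diagonal
  have h2 := (tendsto_face_sub hd hM hφ hψ h hψG e).comp hdiag
  have h3 := (h2.const_mul 2).add (h1.const_mul 2)
  simp only [mul_zero, add_zero] at h3
  refine squeeze_zero (fun n => integral_nonneg fun x => sq_nonneg _) (fun n => ?_) h3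
  have h4 := integral_add_sq_le ((hm (hφ n).continuous).sub (hm (hψ n).continuous))
    ((hm (hψ n).continuous).sub hmem)
  simpa using h4

lemma isL2Proj_epsilon {μ : Measure (Space d)} {s : Set (Space d)}
    (hμ : ∀ p : Poly d, MemLp (pval p) 2 (μ.restrict s)) {w : Space d → ℝ}
    (hw : MemLp w 2 (μ.restrict s)) (m : ℕ) :
    Mesh.IsL2Proj μ s m w (Classical.epsilon (Mesh.IsL2Proj μ s m w)) := by
  obtain ⟨p, hp, h, -⟩ := exists_poly_proj ({()} : Finset Unit) (μ := fun _ => μ.restrict s)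
    (fun _ _ => hμ) (w := fun _ => w) (fun _ _ => hw) m
  exact Classical.epsilon_spec (p := Mesh.IsL2Proj μ s m w)
    ⟨p, hp, fun r hr => by simpa using h r hr⟩

/-- Test functions vanish on the boundary faces, hence so does the trace of their limit, almost
everywhere. The projection of zero vanishes almost everywhere and, being a polynomial, everywhere on
the face. -/
lemma memVh0_Qh (hd : 0 < d) (hM : M.IsMeshOf Ω) (k : ℕ) {φ : ℕ → Space d → ℝ}
    {u : Space d → ℝ} {G : Fin d → Space d → ℝ} (hφ : ∀ n, IsTest Ω (φ n))
    (h : TendstoH1 Ω φ u G) : M.MemVh0 Ω k (M.Qh Ω k u) := by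
  have hb : ∀ e, Mesh.IsL2Proj (surf d) (M.face e) (k + 1) (trace Ω u (M.face e))
      ((M.Qh Ω k u).2 e) := fun e =>
    isL2Proj_epsilon (fun p => memLp_face hd hM e (continuous_pval p))
      (tendsto_trace hd hM (fun n => (hφ n).1) h e).1 _
  have h0 : ∀ T, Mesh.IsL2Proj volume (M.elt T) k u ((M.Qh Ω k u).1 T) := fun T =>
    isL2Proj_epsilon (fun p => memLp_tunion (S := M.sub T) (continuous_pval p))
      (h.1.mono_measure (Measure.restrict_mono_ae (elt_ae_le hM T))) _
  refine ⟨⟨fun T => (h0 T).1, fun e => (hb e).1⟩, fun e he x hx => ?_⟩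
  set p := (M.Qh Ω k u).2 e with hp
  obtain ⟨hmem, htr⟩ := tendsto_trace hd hM (fun n => (hφ n).1) h e
  have hz : ∀ n, ∀ x ∈ M.face e, φ n x = 0 := fun n x hx => (hφ n).eq_zero fun hxΩ =>
    (he hx).2 ((isOpen_domain hM).interior_eq.symm ▸ hxΩ)
  have hme := (isCompact_face hM e).measurableSet
  have h1 : ∫ x in M.face e, trace Ω u (M.face e) x ^ 2 ∂(surf d) = 0 := by
    refine tendsto_nhds_unique (tendsto_const_nhds (x := ∫ x in M.face e,
      trace Ω u (M.face e) x ^ 2 ∂(surf d)) (f := atTop (α := ℕ))) (htr.congr fun n => ?_)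
    exact setIntegral_congr_fun hme fun x hx => by simp only [hz n x hx, zero_sub, neg_sq]
  have h2 := (integral_eq_zero_iff_of_nonneg (fun x => sq_nonneg _) hmem.integrable_sq).1 h1
  have h3 : ∫ x in M.face e, pval p x * pval p x ∂(surf d) = 0 := by
    rw [(hb e).2 p (hb e).1]
    refine integral_eq_zero_of_ae ?_
    filter_upwards [h2] with x hx
    have : trace Ω u (M.face e) x = 0 := by simpa using hx
    simp only [this, zero_mul, Pi.zero_apply]
  have hpm := memLp_face hd hM e (continuous_pval p)
  have h4 := (integral_eq_zero_iff_of_nonneg (fun x => mul_self_nonneg _)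
    (integrable_mul_of_memLp hpm hpm)).1 h3
  obtain ⟨T, hT⟩ := hM.exists_isFaceOf e
  have hx' := hx
  rw [face_eq_iUnion hM hT] at hx'
  obtain ⟨a, ha⟩ := Set.mem_iUnion.1 hx'
  refine eq_zero_of_ae_eq_zero_facet (M.sub T a.1.1) hd a.1.2 (continuous_pval p) ?_ x ha
  filter_upwards [ae_restrict_of_ae_restrict_of_subset a.2.2 h4] with y hy
  simpa using hy

/-- The weak gradient of the projection of `u` is the projection of its gradient. -/
theorem weakRhs_Qh (hd : 0 < d) (hM : M.IsMeshOf Ω) {k : ℕ} {φ : ℕ → Space d → ℝ}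
    {u : Space d → ℝ} {G : Fin d → Space d → ℝ} (hφ : ∀ n, ContDiff ℝ ∞ (φ n))
    (h : TendstoH1 Ω φ u G) {T : Fin M.nT} {q : M.PwField T} (hq : M.MemLambda k T q) :
    weakRhs M (M.Qh Ω k u) q =
      ∑ i, ∑ j, ∫ x in body (M.sub T i), G j x * pval (q i j) x := by
  classical
  obtain ⟨h1, ⟨p, hp, h2⟩, h3, h4⟩ := (memLambda_iff hd hM).1 hq
  choose r hr hrq using h4
  have hb : ∀ e, Mesh.IsL2Proj (surf d) (M.face e) (k + 1) (trace Ω u (M.face e))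
      ((M.Qh Ω k u).2 e) := fun e =>
    isL2Proj_epsilon (fun p => memLp_face hd hM e (continuous_pval p))
      (tendsto_trace hd hM hφ h e).1 _
  have huT : MemLp u 2 (volume.restrict (tunion (M.sub T))) :=
    h.1.mono_measure (Measure.restrict_mono_ae (elt_ae_le hM T))
  have h0 : Mesh.IsL2Proj volume (M.elt T) k u ((M.Qh Ω k u).1 T) :=
    isL2Proj_epsilon (fun p => memLp_tunion (S := M.sub T) (continuous_pval p)) huT _
  have hT := triang hM T
  have hbd : ∀ i, body (M.sub T i) ≤ᵐ[volume] Ω := fun i =>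
    (body_subset_tunion (S := M.sub T) i).eventuallyLE.trans (elt_ae_le hM T)
  have hsum : ∀ (e : Fin M.nE) (ψ : Space d → ℝ),
      (∀ s : Poly d, IntegrableOn (fun x => ψ x * pval s x) (M.face e) (surf d)) →
      ∑ a with OnFace M T e a, ∫ x in side (M.sub T) a,
        ψ x * normalTr (M.sub T a.1) a.2 (q a.1) x ∂(surf d) =
      if M.IsFaceOf e T then ∫ x in M.face e, ψ x * pval (r e) x ∂(surf d) else 0 := by
    intro e ψ hψ
    split_ifs with he
    · rw [integral_face hd hM he (hψ _)]
      refine Finset.sum_congr rfl fun a ha => ?_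
      refine setIntegral_congr_fun (isCompact_facet _ _).measurableSet fun x hx => ?_
      simp only [hrq e a (Finset.mem_filter.1 ha).2 x hx]
    · exact Finset.sum_eq_zero fun a ha => absurd (Finset.mem_filter.1 ha).2.1 he
  have hfi : ∀ (e : Fin M.nE) {ψ : Space d → ℝ}, MemLp ψ 2 ((surf d).restrict (M.face e)) →
      ∀ s : Poly d, IntegrableOn (fun x => ψ x * pval s x) (M.face e) (surf d) :=
    fun e ψ hψ s => integrable_mul_of_memLp hψ (memLp_face hd hM e (continuous_pval s))
  have hgrp : ∀ F : Fin (M.nS T) × Fin (d + 1) → ℝ,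
      ∑ a with Unmatched (M.sub T) a, F a = ∑ e, ∑ a with OnFace M T e a, F a := by
    intro F
    rw [← sum_groups (U := Unmatched (M.sub T)) (P := OnFace M T)
      (fun e a ha => ha.unmatched hd hM) fun _ a => F a]
    refine Finset.sum_congr rfl fun a ha => ?_
    obtain ⟨e, he⟩ := exists_onFace hd hM (Finset.mem_filter.1 ha).2
    rw [Finset.sum_eq_single e]
    · intro e' he' hne
      exact absurd ((Finset.mem_filter.1 he').2.unique hd hM he) hne
    · intro hne
      exact absurd (by simpa using he) hne
  -- The divergence and the normal components of `q` are polynomials of the degrees onto which `Q_0`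
  -- and `Q_b` project, so the projections may be dropped.
  have e1 : weakRhs M (M.Qh Ω k u) q = -(∑ i, ∫ x in body (M.sub T i), u x * pval p x) +
      ∑ e, if M.IsFaceOf e T then
        ∫ x in M.face e, trace Ω u (M.face e) x * pval (r e) x ∂(surf d) else 0 := by
    rw [weakRhs, boundaryT_eq]
    refine congrArg₂ (· + ·) (congrArg Neg.neg ?_) ?_
    · simp only [h2]
      rw [← hT.integral_tunion (integrableOn_tunion_mul _ (continuous_pval _) (continuous_pval _)),
        ← hT.integral_tunion (integrable_mul_of_memLp huT (memLp_tunion (continuous_pval p)))]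
      exact h0.2 p hp
    · refine Finset.sum_congr rfl fun e _ => ?_
      rw [hsum e _ (hfi e (memLp_face hd hM e (continuous_pval _))), (hb e).2 _ (hr e)]
  -- The same expression for the smooth approximations is an integration by parts; the claim follows
  -- in the limit.
  have e2 : ∀ n, ∑ i, ∑ j, ∫ x in body (M.sub T i), partialD j (φ n) x * pval (q i j) x =
      -(∑ i, ∫ x in body (M.sub T i), φ n x * pval p x) +
      ∑ e, if M.IsFaceOf e T then ∫ x in M.face e, φ n x * pval (r e) x ∂(surf d) else 0 := by
    intro n
    have := h3.green hd hT (hφ n)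
    rw [hgrp] at this
    simp only [h2] at this
    simp only [fun e => hsum e (φ n) (hfi e (memLp_face hd hM e (hφ n).continuous))] at this
    rw [← this]
    refine Finset.sum_congr rfl fun i _ => ?_
    rw [integral_finsetSum _ fun j _ => integrableOn_body_mul _ (continuous_pval _)
      (continuous_partialD (hφ n) j)]
    simp only [mul_comm]
  have t1 : Tendsto (fun n => ∑ i, ∑ j, ∫ x in body (M.sub T i),
      partialD j (φ n) x * pval (q i j) x) atTop
      (𝓝 (∑ i, ∑ j, ∫ x in body (M.sub T i), G j x * pval (q i j) x)) := by
    refine tendsto_finsetSum _ fun i _ => tendsto_finsetSum _ fun j _ => ?_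
    have hi := h.mono (hbd i)
    exact tendsto_integral_mul_const (fun n => memLp_body (continuous_partialD (hφ n) j))
      (hi.2.1 j) (memLp_body (continuous_pval _))
      ((hi.tendsto_sq (isCompact_body _) hφ).2 j)
  have t2 : Tendsto (fun n => -(∑ i, ∫ x in body (M.sub T i), φ n x * pval p x) +
      ∑ e, if M.IsFaceOf e T then ∫ x in M.face e, φ n x * pval (r e) x ∂(surf d) else 0) atTop
      (𝓝 (weakRhs M (M.Qh Ω k u) q)) := by
    rw [e1]
    refine (tendsto_finsetSum _ fun i _ => ?_).neg.add (tendsto_finsetSum _ fun e _ => ?_)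
    · have hi := h.mono (hbd i)
      exact tendsto_integral_mul_const (fun n => memLp_body (hφ n).continuous)
        hi.1 (memLp_body (continuous_pval _)) (hi.tendsto_sq (isCompact_body _) hφ).1
    · split_ifs with he
      · obtain ⟨hm, ht⟩ := tendsto_trace hd hM hφ h e
        exact tendsto_integral_mul_const (fun n => memLp_face hd hM e (hφ n).continuous) hm
          (memLp_face hd hM e (continuous_pval _)) ht
      · exact tendsto_const_nhds
  exact tendsto_nhds_unique t2 (t1.congr e2)

end Domain

end SFWG

end

noncomputable section

namespace SFWG

/-! ### The error estimate -/

section Estimate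

variable {d : ℕ} {M : Mesh d} {Ω : Set (Space d)}

/-- The normal fluxes of a field with weak divergence cancel almost everywhere. -/
lemma ae_sum_flux_eq_zero (hd : 0 < d) (hM : M.IsMeshOf Ω) {v : Fin d → Space d → ℝ}
    {V : Fin d → Fin d → Space d → ℝ} (hv : ∀ j, MemLp (v j) 2 (volume.restrict Ω))
    (hV : ∀ j, MemLp (V j j) 2 (volume.restrict Ω))
    (hw : ∀ j, HasWeakPartial Ω j (v j) (V j j))
    {t : (T : Fin M.nT) → Fin d → Fin (M.nS T) → Fin (d + 1) → Space d → ℝ}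
    (ht : ∀ T j i, HasTraces (M.sub T i) (v j) (V j) (t T j i)) :
    ∀ᵐ x ∂(surf d), x ∈ Ω → ∑ A : (T : Fin M.nT) × (Fin (M.nS T) × Fin (d + 1)),
      (side (M.sub A.1) A.2).indicator
        (fun x => ∑ j, sideNormal (M.sub A.1) A.2 j * t A.1 j A.2.1 A.2.2 x) x = 0 := by
  refine ae_sum_indicator_eq_zero
    (F := fun A : (T : Fin M.nT) × (Fin (M.nS T) × Fin (d + 1)) => side (M.sub A.1) A.2)
    (g := fun A x => ∑ j, sideNormal (M.sub A.1) A.2 j * t A.1 j A.2.1 A.2.2 x)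
    (fun A => isCompact_facet _ _) (fun A => ?_) (isOpen_domain hM) fun φ hφ => ?_
  · have := isFiniteMeasure_facet (M.sub A.1 A.2.1) hd A.2.2
    exact integrable_finsetSum _ fun j _ =>
      (((ht A.1 j A.2.1).memLp_trace A.2.2).integrable (by norm_num)).const_mul _
  have hm : ∀ {ψ : Space d → ℝ}, Continuous ψ → MemLp ψ 2 (volume.restrict Ω) :=
    memLp_of_ae_eq isCompact_iUnion_elt (domain_ae_eq hM)
  have e1 : ∀ j, ∑ T, ∑ i, ∑ l, outwardNormal (M.sub T i) l j *
      ∫ z in facet (M.sub T i) l, t T j i l z * φ z ∂(surf d) = 0 := by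
    intro j
    have i1 : IntegrableOn (fun x => V j j x * φ x) Ω :=
      integrable_mul_of_memLp (hV j) (hm hφ.1.continuous)
    have i2 : IntegrableOn (fun x => v j x * partialD j φ x) Ω :=
      integrable_mul_of_memLp (hv j) (hm (continuous_partialD hφ.1 j))
    simp only [← fun T i => (ht T j i).green hd hφ.1 j, Finset.sum_add_distrib]
    rw [← integral_domain_bodies hM i1, ← integral_domain_bodies hM i2, hw j φ hφ]
    ring
  have e2 : ∀ A : (T : Fin M.nT) × (Fin (M.nS T) × Fin (d + 1)),
      ∫ x in side (M.sub A.1) A.2,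
        (∑ j, sideNormal (M.sub A.1) A.2 j * t A.1 j A.2.1 A.2.2 x) * φ x ∂(surf d) =
      ∑ j, sideNormal (M.sub A.1) A.2 j *
        ∫ x in side (M.sub A.1) A.2, t A.1 j A.2.1 A.2.2 x * φ x ∂(surf d) := by
    intro A
    have i1 : ∀ j, IntegrableOn (fun x => sideNormal (M.sub A.1) A.2 j *
        (t A.1 j A.2.1 A.2.2 x * φ x)) (side (M.sub A.1) A.2) (surf d) := fun j =>
      (integrable_mul_of_memLp ((ht A.1 j A.2.1).memLp_trace A.2.2)
        (memLp_facet hd A.2.2 hφ.1.continuous)).const_mul _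
    simp only [Finset.sum_mul, mul_assoc]
    rw [integral_finsetSum _ fun j _ => i1 j]
    exact Finset.sum_congr rfl fun j _ => integral_const_mul _ _
  rw [Finset.sum_congr rfl fun A _ => e2 A, Finset.sum_comm]
  refine Finset.sum_eq_zero fun j _ => ?_
  rw [← e1 j, Fintype.sum_sigma]
  exact Finset.sum_congr rfl fun T _ => Fintype.sum_prod_type _

open scoped Classical in
/-- The normal fluxes on an inner face cancel. -/
lemma sum_flux_face_eq_zero (hd : 0 < d) (hM : M.IsMeshOf Ω) {v : Fin d → Space d → ℝ}
    {V : Fin d → Fin d → Space d → ℝ} (hv : ∀ j, MemLp (v j) 2 (volume.restrict Ω))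
    (hV : ∀ j, MemLp (V j j) 2 (volume.restrict Ω))
    (hw : ∀ j, HasWeakPartial Ω j (v j) (V j j))
    {t : (T : Fin M.nT) → Fin d → Fin (M.nS T) → Fin (d + 1) → Space d → ℝ}
    (ht : ∀ T j i, HasTraces (M.sub T i) (v j) (V j) (t T j i)) {e : Fin M.nE}
    (he : ¬M.face e ⊆ frontier Ω) (p : Poly d) :
    ∑ T, ∑ a with OnFace M T e a, ∫ x in side (M.sub T) a,
      (∑ j, sideNormal (M.sub T) a j * t T j a.1 a.2 x) * pval p x ∂(surf d) = 0 := by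
  set F : (A : (T : Fin M.nT) × (Fin (M.nS T) × Fin (d + 1))) → Space d → ℝ := fun A x =>
    ∑ j, sideNormal (M.sub A.1) A.2 j * t A.1 j A.2.1 A.2.2 x with hF
  have hFL : ∀ A, MemLp (F A) 2 ((surf d).restrict (side (M.sub A.1) A.2)) := fun A =>
    memLp_finsetSum _ fun j _ => ((ht A.1 j A.2.1).memLp_trace A.2.2).const_mul _
  have hsm : ∀ A : (T : Fin M.nT) × (Fin (M.nS T) × Fin (d + 1)),
      MeasurableSet (side (M.sub A.1) A.2) := fun A => (isCompact_facet _ _).measurableSet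
  have hfm := (isCompact_face hM e).measurableSet
  have honf := (ae_restrict_iff' hfm).2 (ae_onFace hd hM e)
  -- Each integral is written over the whole face. Sides that are not part of the face meet it in a
  -- null set only, so the sum may run over all sides of the mesh, where the fluxes cancel.
  have h1 : ∀ A, (if OnFace M A.1 e A.2 then
      ∫ x in side (M.sub A.1) A.2, F A x * pval p x ∂(surf d) else 0) =
      ∫ x in M.face e, (side (M.sub A.1) A.2).indicator (fun x => F A x * pval p x) x
        ∂(surf d) := by
    intro A
    split_ifs with hA
    · rw [setIntegral_indicator (hsm A), Set.inter_eq_self_of_subset_right hA.2]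
    · refine (integral_eq_zero_of_ae ?_).symm
      filter_upwards [honf] with x hx
      exact Set.indicator_of_notMem (fun h => hA (hx _ _ h)) _
  have h2 : ∀ A, IntegrableOn ((side (M.sub A.1) A.2).indicator fun x => F A x * pval p x)
      (M.face e) (surf d) := fun A => by
    have := integrable_mul_of_memLp (hFL A) (memLp_facet hd A.2.2 (continuous_pval p))
    exact ((integrable_indicator_iff (hsm A)).2 this).integrableOn
  have h3 : ∑ A, (if OnFace M A.1 e A.2 then
      ∫ x in side (M.sub A.1) A.2, F A x * pval p x ∂(surf d) else 0) = 0 := by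
    rw [Finset.sum_congr rfl fun A _ => h1 A, ← integral_finsetSum _ fun A _ => h2 A]
    refine integral_eq_zero_of_ae ?_
    filter_upwards [(ae_restrict_iff' hfm).2 (ae_mem_domain hd hM he),
      ae_restrict_of_ae (ae_sum_flux_eq_zero hd hM hv hV hw ht)] with x hx hx2
    have h4 : ∀ A, (side (M.sub A.1) A.2).indicator (fun x => F A x * pval p x) x =
        (side (M.sub A.1) A.2).indicator (F A) x * pval p x := fun A =>
      Set.indicator_mul_left _ _ _
    rw [Finset.sum_congr rfl fun A _ => h4 A, ← Finset.sum_mul, hx2 hx, zero_mul]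
    rfl
  rw [Fintype.sum_sigma] at h3
  simpa only [Finset.sum_filter] using h3

lemma memVh0_sub {k : ℕ} {v w : M.WGFun} (hv : M.MemVh0 Ω k v) (hw : M.MemVh0 Ω k w) :
    M.MemVh0 Ω k (v - w) :=
  ⟨⟨fun T => (MvPolynomial.totalDegree_sub _ _).trans (max_le (hv.1.1 T) (hw.1.1 T)),
    fun e => (MvPolynomial.totalDegree_sub _ _).trans (max_le (hv.1.2 e) (hw.1.2 e))⟩,
    fun e he x hx => by
      rw [Prod.snd_sub, Pi.sub_apply, pval_sub, hv.2 e he x hx, hw.2 e he x hx, sub_zero]⟩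

lemma sum_single_one (j : Fin d) : ∑ i, (Pi.single j 1 : Fin d → ℕ) i = 1 := by
  rw [Finset.sum_pi_single' j 1 Finset.univ, if_pos (Finset.mem_univ j)]

lemma diam_le_meshSize (T : Fin M.nT) : Metric.diam (M.elt T) ≤ M.meshSize :=
  le_ciSup (f := fun T => Metric.diam (M.elt T)) (Set.finite_range _).bddAbove T

/-- The gradient has a weak divergence in `L²`, so the weak equation can be integrated by parts once
more, and test functions separate. -/
lemma ae_eq_neg_laplacian (hM : M.IsMeshOf Ω) {f : Space d → ℝ}
    (hf : MemLp f 2 (volume.restrict Ω)) {v : Fin d → Space d → ℝ} {V : Fin d → Space d → ℝ}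
    (hv : ∀ j, MemLp (v j) 2 (volume.restrict Ω)) (hV : ∀ j, MemLp (V j) 2 (volume.restrict Ω))
    (hw : ∀ j, HasWeakPartial Ω j (v j) (V j))
    (h : ∀ φ, IsTest Ω φ → ∫ x in Ω, ∑ i, v i x * partialD i φ x = ∫ x in Ω, f x * φ x) :
    ∀ᵐ x ∂(volume.restrict Ω), f x = -∑ j, V j x := by
  have hm : ∀ {ψ : Space d → ℝ}, Continuous ψ → MemLp ψ 2 (volume.restrict Ω) :=
    memLp_of_ae_eq isCompact_iUnion_elt (domain_ae_eq hM)
  have hs : MemLp (fun x => ∑ j, V j x) 2 (volume.restrict Ω) := memLp_finsetSum _ fun j _ => hV j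
  have h1 := ae_eq_zero_of_test (isOpen_domain hM) (g := fun x => f x + ∑ j, V j x)
    (IntegrableOn.of_memLp_two isCompact_iUnion_elt (domain_ae_eq hM) (hf.add hs)) fun χ hχ => by
      have hχm := hm hχ.1.continuous
      have i1 : ∀ j, IntegrableOn (fun x => V j x * χ x) Ω := fun j =>
        integrable_mul_of_memLp (hV j) hχm
      have i2 : ∀ j, IntegrableOn (fun x => v j x * partialD j χ x) Ω := fun j =>
        integrable_mul_of_memLp (hv j) (hm (continuous_partialD hχ.1 j))
      have e1 := h χ hχ
      rw [integral_finsetSum _ fun j _ => i2 j, Finset.sum_congr rfl fun j _ => hw j χ hχ,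
        Finset.sum_neg_distrib, ← integral_finsetSum _ fun j _ => i1 j] at e1
      simp only [add_mul, Finset.sum_mul]
      rw [integral_add (integrable_mul_of_memLp hf hχm)
        (integrable_finsetSum _ fun j _ => i1 j), ← e1]
      ring
  filter_upwards [h1] with x hx
  linarith

/-- The squared estimate, for any family `D` of weak derivatives of `u`. Testing the scheme with the
error itself and writing the load in terms of the fields `σ` turns the squared energy norm into the
sum of `(∇u - σ, ∇_w E)_T`. -/
theorem exists_energy_bound (d : ℕ) (hd : 0 < d) (k : ℕ) {γ : ℝ} (hγ : 0 < γ) :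
    ∃ C : ℝ, 0 < C ∧ ∀ (Ω : Set (Space d)) (M : Mesh d), M.IsMeshOf Ω → M.ShapeRegular γ →
      ∀ (f u : Space d → ℝ), MemLp f 2 (volume.restrict Ω) → IsPoissonSolution Ω f u →
      ∀ D, HasWeakDerivs Ω (k + 3) u D → ∀ uh : M.WGFun, M.IsWGSolution Ω k f uh →
        ∑ T, M.innerT (M.weakGrad k (M.Qh Ω k u - uh) T) (M.weakGrad k (M.Qh Ω k u - uh) T) ≤
          C * M.meshSize ^ (2 * (k + 2)) *
            ∑ β ∈ Finset.piAntidiag Finset.univ (k + 3), ∫ x in Ω, D β x ^ 2 := by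
  classical
  obtain ⟨C, hC, hsig⟩ := exists_sigma d hd k hγ
  refine ⟨C, hC, fun Ω M hM hreg f u hf ⟨G₀, ⟨φ, hφ, hφt⟩, hweak⟩ D hD uh huh => ?_⟩
  set v : Fin d → Space d → ℝ := fun j => D (Pi.single j 1) with hv
  set V : Fin d → Fin d → Space d → ℝ := fun j i => D (Pi.single j 1 + Pi.single i 1) with hV
  have hα : ∀ j, ∑ i, (Pi.single j 1 : Fin d → ℕ) i < k + 3 := fun j => by
    rw [sum_single_one]; omega
  have hvL : ∀ j, MemLp (v j) 2 (volume.restrict Ω) := fun j => hD.2.1 _ (hα j).le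
  have hVL : ∀ j, MemLp (V j j) 2 (volume.restrict Ω) := fun j => hD.2.1 _ (by
    simp only [Pi.add_apply, Finset.sum_add_distrib, sum_single_one]; omega)
  have hVw : ∀ j, HasWeakPartial Ω j (v j) (V j j) := fun j => hD.2.2 _ (hα j) j
  -- The gradient in the definition of the Poisson solution and the first derivatives in `D` are
  -- both weak gradients of `u`.
  have hG : ∀ j, G₀ j =ᵐ[volume.restrict Ω] v j := fun j => by
    have h1 := hD.2.2 0 (by simp) j
    rw [zero_add] at h1
    exact HasWeakPartial.ae_eq (isOpen_domain hM) isCompact_iUnion_elt (domain_ae_eq hM)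
      hD.1.symm (hφt.2.1 j) (hvL j)
      (hφt.hasWeakPartial isCompact_iUnion_elt (domain_ae_eq hM) (fun n => (hφ n).1) j) h1
  have hφv : TendstoH1 Ω φ u v := hφt.congr_grad hG
  have hfV : ∀ᵐ x ∂(volume.restrict Ω), f x = -∑ j, V j j x := by
    refine ae_eq_neg_laplacian hM hf hvL hVL hVw fun χ hχ => ?_
    rw [← hweak χ hχ]
    refine integral_congr_ae ?_
    filter_upwards [ae_all_iff.2 hG] with x hx
    exact Finset.sum_congr rfl fun j _ => by rw [hx j]
  have hDT : ∀ (T : Fin M.nT) α, ∑ i, α i < k + 3 →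
      WeakH1 (M.sub T) (D α) fun i => D (α + Pi.single i 1) := fun T α h =>
    weakH1_of_hasWeakDerivs hM hD T h
  have ht0 : ∀ T j i, ∃ t, HasTraces (M.sub T i) (v j) (V j) t := fun T j i =>
    (hDT T _ (hα j)).exists_hasTraces hd i
  choose t ht using ht0
  have hν0 : ∀ T e, ∃ n, ∀ a, OnFace M T e a → sideNormal (M.sub T) a = n := fun T e => by
    by_cases he : M.IsFaceOf e T
    · obtain ⟨n, hn⟩ := hM.face_normal T e he
      exact ⟨n, fun a ha => hn a.1 a.2 ha.2⟩
    · exact ⟨0, fun a ha => absurd ha.1 he⟩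
  choose ν hν using hν0
  have hσ0 := fun T => hsig (M.nS T) (M.sub T) (Metric.diam (M.elt T)) (hM.nS_pos T)
    (triang hM T) (shapeReg hd hM hreg T) D (hDT T) (t T) (ht T) M.nE (OnFace M T) (ν T)
    (fun e a h => h.unmatched hd hM) (fun a h => exists_onFace hd hM h)
    (fun e e' a h h' => h.unique hd hM h') (hν T)
  choose σ r ρ hσd hrd hρd hσr hσm hσρ hr hρ herr using hσ0
  have hσΛ : ∀ T, M.MemLambda k T (σ T) := fun T => (memLambda_iff hd hM).2
    ⟨hσd T, ⟨r T, hrd T, fun i => eq_of_pval_eq (M.sub T i) fun x _ => hσr T i x⟩, hσm T,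
      fun e => ⟨ρ T e, hρd T e, hσρ T e⟩⟩
  set E : M.WGFun := M.Qh Ω k u - uh with hE
  have hEV : M.MemVh0 Ω k E := memVh0_sub (memVh0_Qh hd hM k hφ hφv) huh.1
  set g : (T : Fin M.nT) → M.PwField T := fun T => M.weakGrad k E T with hg
  have hgΛ : ∀ T, M.MemLambda k T (g T) := fun T => (isWeakGrad_weakGrad hd hM k E T).1
  -- Against the polynomial `E.2 e` of degree at most `k + 1` the normal component of `σ` acts like
  -- the flux of `∇u`. On boundary faces `E` vanishes; on inner faces the fluxes from both sides
  -- cancel.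
  have hbdry : ∑ T, M.boundaryT E (σ T) = 0 := by
    have e1 : ∀ T e, ∑ a with OnFace M T e a, ∫ x in side (M.sub T) a,
        pval (E.2 e) x * normalTr (M.sub T a.1) a.2 (σ T a.1) x ∂(surf d) =
        ∑ a with OnFace M T e a, ∫ x in side (M.sub T) a,
          (∑ j, sideNormal (M.sub T) a j * t T j a.1 a.2 x) * pval (E.2 e) x ∂(surf d) := by
      intro T e
      rw [← hρ T e (E.2 e) (hEV.1.2 e)]
      refine Finset.sum_congr rfl fun a ha => ?_
      refine setIntegral_congr_fun (isCompact_facet _ _).measurableSet fun x hx => ?_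
      simp only [hσρ T e a (Finset.mem_filter.1 ha).2 x hx, mul_comm]
    simp only [boundaryT_eq, e1]
    rw [Finset.sum_comm]
    refine Finset.sum_eq_zero fun e _ => ?_
    by_cases he : M.face e ⊆ frontier Ω
    · refine Finset.sum_eq_zero fun T _ => Finset.sum_eq_zero fun a ha => ?_
      refine setIntegral_eq_zero_of_forall_eq_zero fun x hx => ?_
      rw [hEV.2 e he x ((Finset.mem_filter.1 ha).2.2 hx), mul_zero]
    · exact sum_flux_face_eq_zero hd hM hvL hVL hVw ht he _
  -- `f` is minus the Laplacian, which against `E.1 T` of degree at most `k` may be replaced by the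
  -- divergence of `σ`; the definition of the weak gradient does the rest.
  have hload : ∀ T, ∫ x in M.elt T, f x * pval (E.1 T) x =
      M.innerT (g T) (σ T) - M.boundaryT E (σ T) := by
    intro T
    have e1 : ∫ x in M.elt T, f x * pval (E.1 T) x =
        -∫ x in tunion (M.sub T), (∑ j, V j j x) * pval (E.1 T) x := by
      rw [← integral_neg]
      refine integral_congr_ae ?_
      filter_upwards [ae_mono (Measure.restrict_mono_ae (elt_ae_le hM T)) hfV] with x hx
      rw [hx, neg_mul]
    rw [e1, ← hr T _ (hEV.1.1 T), innerT_weakGrad hd hM k E T (hσΛ T), weakRhs,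
      (triang hM T).integral_tunion
        (integrableOn_tunion_mul _ (continuous_pval _) (continuous_pval _))]
    simp only [hσr, mul_comm]
    ring
  -- The weak gradient of the error is tested with itself; for the part `Q_h u` the weak gradient
  -- acts as `∇u`.
  have henergy : ∀ T, M.innerT (g T) (g T) =
      (∑ i, ∑ j, ∫ x in body (M.sub T i), v j x * pval (g T i j) x) -
        M.innerT (M.weakGrad k uh T) (g T) := by
    intro T
    rw [innerT_weakGrad hd hM k E T (hgΛ T), hE, weakRhs_sub hd,
      weakRhs_Qh hd hM (fun n => (hφ n).1) hφv (hgΛ T), ← innerT_weakGrad hd hM k uh T (hgΛ T)]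
  have hvB : ∀ T i j, MemLp (v j) 2 (volume.restrict (body (M.sub T i))) := fun T i j =>
    (ht T j i).memLp
  -- Young's inequality with weights `1/2`, so that half of the energy can be absorbed into the left
  -- side.
  have hterm : ∀ T, (∑ i, ∑ j, ∫ x in body (M.sub T i), v j x * pval (g T i j) x) -
      M.innerT (g T) (σ T) ≤
      (1 / 2) * (∑ i, ∑ j, ∫ x in body (M.sub T i), (v j x - pval (σ T i j) x) ^ 2) +
        (1 / 2) * M.innerT (g T) (g T) := by
    intro T
    simp only [innerT_eq, Finset.mul_sum, ← Finset.sum_add_distrib, ← Finset.sum_sub_distrib]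
    refine Finset.sum_le_sum fun i _ => Finset.sum_le_sum fun j _ => ?_
    have m1 := memLp_body (S := M.sub T i) (continuous_pval (σ T i j))
    have m2 := memLp_body (S := M.sub T i) (continuous_pval (g T i j))
    have m3 : IntegrableOn (fun x => (v j x - pval (σ T i j) x) ^ 2) (body (M.sub T i)) :=
      ((hvB T i j).sub m1).integrable_sq
    rw [← integral_sub (integrable_mul_of_memLp (hvB T i j) m2) (integrable_mul_of_memLp m2 m1),
      ← integral_const_mul, ← integral_const_mul, ← integral_add (m3.const_mul _)
        ((integrable_mul_of_memLp m2 m2).const_mul _)]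
    refine integral_mono ((integrable_mul_of_memLp (hvB T i j) m2).sub
      (integrable_mul_of_memLp m2 m1)) ((m3.const_mul _).add
        ((integrable_mul_of_memLp m2 m2).const_mul _)) fun x => ?_
    have := sq_nonneg (v j x - pval (σ T i j) x - pval (g T i j) x)
    simp only
    nlinarith
  have htotal : ∑ T, M.innerT (g T) (g T) ≤
      ∑ T, ∑ i, ∑ j, ∫ x in body (M.sub T i), (v j x - pval (σ T i j) x) ^ 2 := by
    have e1 : ∑ T, M.innerT (M.weakGrad k uh T) (g T) = ∑ T, M.innerT (g T) (σ T) := by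
      rw [huh.2 E hEV, Finset.sum_congr rfl fun T _ => hload T, Finset.sum_sub_distrib, hbdry,
        sub_zero]
    have e2 : ∑ T, M.innerT (g T) (g T) =
        ∑ T, ((∑ i, ∑ j, ∫ x in body (M.sub T i), v j x * pval (g T i j) x) -
          M.innerT (g T) (σ T)) := by
      rw [Finset.sum_congr rfl fun T _ => henergy T, Finset.sum_sub_distrib,
        Finset.sum_sub_distrib, e1]
    have e3 := Finset.sum_le_sum fun T (_ : T ∈ Finset.univ) => hterm T
    rw [← e2, Finset.sum_add_distrib, ← Finset.mul_sum, ← Finset.mul_sum] at e3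
    linarith
  have hβ : ∀ β ∈ Finset.piAntidiag (Finset.univ : Finset (Fin d)) (k + 3),
      ∫ x in Ω, D β x ^ 2 = ∑ T, ∫ x in tunion (M.sub T), D β x ^ 2 := fun β hβ =>
    integral_domain hM (hD.2.1 β (Finset.mem_piAntidiag.1 hβ).1.le).integrable_sq
  refine htotal.trans ?_
  rw [Finset.sum_congr rfl hβ, Finset.sum_comm, Finset.mul_sum]
  refine Finset.sum_le_sum fun T _ => (herr T).trans ?_
  refine mul_le_mul_of_nonneg_right (mul_le_mul_of_nonneg_left ?_ hC.le)
    (Finset.sum_nonneg fun β _ => integral_nonneg fun x => sq_nonneg _)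
  exact pow_le_pow_left₀ Metric.diam_nonneg (diam_le_meshSize T) _

end Estimate

end SFWG

end

/-! ### The energy norm estimate -/

theorem mainTheorem2 (d : ℕ) (hd : d = 2 ∨ d = 3) (k : ℕ) (γ : ℝ) (hγ : 0 < γ) :
    ∃ C : ℝ, 0 < C ∧
      ∀ (Ω : Set (SFWG.Space d)) (M : SFWG.Mesh d), M.IsMeshOf Ω → M.ShapeRegular γ →
      ∀ (f u : SFWG.Space d → ℝ), MemLp f 2 (volume.restrict Ω) →
        SFWG.IsPoissonSolution Ω f u → SFWG.MemSobolev Ω (k + 3) u →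
      ∀ uh : M.WGFun, M.IsWGSolution Ω k f uh →
        M.energyNorm k (M.Qh Ω k u - uh) ≤
          C * M.meshSize ^ (k + 2) * SFWG.sobolevSeminorm Ω (k + 3) u := by
  have hd0 : 0 < d := by rcases hd with rfl | rfl <;> norm_num
  obtain ⟨C, hC, hbound⟩ := SFWG.exists_energy_bound d hd0 k hγ
  refine ⟨Real.sqrt C, Real.sqrt_pos.2 hC, fun Ω M hM hreg f u hf hu hs uh huh => ?_⟩
  -- The bound is applied to the very family of derivatives that the definition of the semi-norm
  -- chooses; square roots then give the claim with the constant `√C`.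
  have h1 := hbound Ω M hM hreg f u hf hu _
    (Classical.epsilon_spec (p := SFWG.HasWeakDerivs Ω (k + 3) u) hs) uh huh
  have hm : 0 ≤ M.meshSize := Real.iSup_nonneg fun T => Metric.diam_nonneg
  have h2 := Real.sqrt_le_sqrt h1
  rwa [mul_comm 2, pow_mul, Real.sqrt_mul (by positivity), Real.sqrt_mul hC.le,
    Real.sqrt_sq (by positivity)] at h2
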